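/- Let $U\subset\mathbb R^2$ be a bounded convex domain with piecewise $C^2$-smooth boundary, let $\Pi=U\times\mathbb R\subset\mathbb R^3$, let $\nu$ be the outer unit normal on $\partial\Pi$, $dS$ the surface measure, $\langle a,b\rangle=\sum_j a_j\overline{b_j}$ the Hermitian product on $\mathbb C^3$ and $[a,b]$ the cross product. Let $\varepsilon,\mu$ be real functions on $\Pi$ such that, with constants, $$0<\varepsilon_0\le\varepsilon(x)\le\varepsilon_1,\qquad 0<\mu_0\le\mu(x)\le\mu_1,$$ and such that $\varepsilon,\mu\in\widetilde W^2_{3/2}(\Pi)$, i.e. $\varepsilon(x+e_3)=\varepsilon(x)$, $\mu(x+e_3)=\mu(x)$ and $\varepsilon,\mu\in W^2_{3/2}(\Pi\cap B_R)$ for every ball $B_R$ of radius $R$ about the origin. Let $v,f\in H^1(\Pi,\mathbb C^3)$ with $\operatorname{div}(\mu v)=0$ in $\Pi$ in the weak sense. Then all the integrals below converge absolutely and $$\begin{aligned}\int_\Pi \varepsilon^{-1}\langle\operatorname{rot}v,\operatorname{rot}f\rangle\,dx ={}&\int_\Pi\langle\operatorname{rot}(\mu v),\operatorname{rot}((\varepsilon\mu)^{-1}f)\rangle\,dx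 -\int_\Pi\langle\operatorname{rot}v,\mu[\nabla(\varepsilon\mu)^{-1},f]\rangle\,dx\\ &+\int_\Pi\varepsilon^{-1}\langle W_0(\mu)v,f\rangle\,dx +\sum_{j=1}^3\int_\Pi(\varepsilon\mu)^{-1}\,\partial_j\mu\,\langle\partial_j v,f\rangle\,dx\\ &+\int_{\partial\Pi}(\varepsilon\mu)^{-1}\langle[\nabla\mu,v],[f,\nu]\rangle\,dS,\end{aligned}$$ where $W_0(\mu)$ is the $3\times3$ matrix with entries $$W_0(\mu)_{jk}=\mu^{-1}\Delta\mu\,\delta_{jk}+\mu^{-2}\,\partial_j\mu\,\partial_k\mu-\mu^{-1}\,\partial_j\partial_k\mu ,$$ the derivatives are weak derivatives, and the values of $(\varepsilon\mu)^{-1},\nabla\mu,v,f$ on $\partial\Pi$ are understood in the sense of traces. -/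

import Mathlib

open MeasureTheory Set Filter Topology
open scoped ContDiff ENNReal Matrix

namespace MaxwellCylinder

/-- The plane, Euclidean three-space, and `ℂ³` with its Hermitian norm. -/
abbrev E2 := EuclideanSpace ℝ (Fin 2)
abbrev E3 := EuclideanSpace ℝ (Fin 3)
abbrev C3 := EuclideanSpace ℂ (Fin 3)

/-! ### Geometry of the cylinder -/

/-- The infinite cylinder `U × ℝ`; the axis is the third coordinate. -/
def straightCylinder (U : Set E2) : Set E3 := {x | (!₂[x 0, x 1] : E2) ∈ U}

/-- The unit coordinate vectors of `ℝ³`. -/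
noncomputable def unitVec (j : Fin 3) : E3 := EuclideanSpace.single j 1

/-- The boundary of `U` is a simple closed curve, parametrized by arc length, that is `C²` up to
the end points on each of finitely many consecutive arcs. -/
def HasPiecewiseC2Boundary (U : Set E2) : Prop :=
  ∃ (L : ℝ) (γ : ℝ → E2) (n : ℕ) (t : ℕ → ℝ),
    0 < L ∧ ContinuousOn γ (Icc 0 L) ∧ γ 0 = γ L ∧ InjOn γ (Ico 0 L) ∧
    γ '' Icc 0 L = frontier U ∧
    t 0 = 0 ∧ t n = L ∧
    ∀ i < n, t i < t (i + 1) ∧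
      ContDiffOn ℝ 2 γ (Icc (t i) (t (i + 1))) ∧
      ∀ s ∈ Icc (t i) (t (i + 1)), ‖derivWithin γ (Icc (t i) (t (i + 1))) s‖ = 1

/-- Surface measure on the boundary of `Ω`: two-dimensional Hausdorff measure, normalized so that
it is Lebesgue measure on planes. -/
noncomputable def surfaceMeasure (Ω : Set E3) : Measure E3 :=
  (Measure.euclideanHausdorffMeasure 2 : Measure E3).restrict (frontier Ω)

/-- `w` is an outward unit normal at the boundary point `x` of the convex set `Ω`: it is the
outward unit normal of a supporting half-space. Where the boundary is smooth there is exactly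
one such vector. -/
def IsOuterNormal (Ω : Set E3) (x w : E3) : Prop :=
  ‖w‖ = 1 ∧ ∀ y ∈ Ω, inner ℝ (y - x) w ≤ 0

open Classical in
/-- The unit outer normal field `ν` of a convex set (on the edges, which have surface measure
zero, one of the outward normals is picked). -/
noncomputable def outerNormal (Ω : Set E3) (x : E3) : E3 :=
  if h : ∃ w, IsOuterNormal Ω x w then h.choose else 0

/-! ### Weak derivatives and Sobolev spaces -/

section Weak

variable {F : Type*} [NormedAddCommGroup F] [NormedSpace ℝ F]

/-- Real test functions on `Ω`, the class `C₀^∞(Ω)`. -/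
def IsTest (Ω : Set E3) (φ : E3 → ℝ) : Prop :=
  ContDiff ℝ ∞ φ ∧ HasCompactSupport φ ∧ tsupport φ ⊆ Ω

/-- `h` is the weak partial derivative `∂_j g` in `Ω`. -/
def IsWeakPartial (Ω : Set E3) (j : Fin 3) (g h : E3 → F) : Prop :=
  LocallyIntegrableOn g Ω ∧ LocallyIntegrableOn h Ω ∧
  ∀ φ : E3 → ℝ, IsTest Ω φ →
    ∫ x in Ω, (fderiv ℝ φ x (unitVec j)) • g x = - ∫ x in Ω, φ x • h x

open Classical in
/-- The weak partial derivative `∂_j g` in `Ω`, determined up to a null set. -/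
noncomputable def weakPartial (Ω : Set E3) (j : Fin 3) (g : E3 → F) : E3 → F :=
  if h : ∃ d, IsWeakPartial Ω j g d then h.choose else 0

/-- The Sobolev space `W^l_p(Ω)` (with values in `F`). -/
def MemSobolev (Ω : Set E3) (p : ℝ≥0∞) : ℕ → (E3 → F) → Prop
  | 0, g => MemLp g p (volume.restrict Ω)
  | l + 1, g => MemLp g p (volume.restrict Ω) ∧
      ∀ j, ∃ h, IsWeakPartial Ω j g h ∧ MemSobolev Ω p l h

/-- The space `H¹(Ω) = W¹_2(Ω)`. -/
def MemH1 (Ω : Set E3) (g : E3 → F) : Prop := MemSobolev Ω 2 1 g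

/-- Functions on `Ω` whose weak derivatives up to order `l` belong to `L_p(Ω ∩ B_R)` for every
ball `B_R` of radius `R` about the origin. -/
def MemSobolevBalls (Ω : Set E3) (p : ℝ≥0∞) : ℕ → (E3 → F) → Prop
  | 0, g => ∀ R : ℝ, MemLp g p (volume.restrict (Ω ∩ Metric.ball 0 R))
  | l + 1, g => (∀ R : ℝ, MemLp g p (volume.restrict (Ω ∩ Metric.ball 0 R))) ∧
      ∀ j, ∃ h, IsWeakPartial Ω j g h ∧ MemSobolevBalls Ω p l h

/-- The space of functions `g` on `Ω`, periodic along the axis, `g (x + e₃) = g x`, which are in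
`W^l_p(Ω ∩ B_R)` for every `R`. -/
def MemPeriodicSobolev (Ω : Set E3) (p : ℝ≥0∞) (l : ℕ) (g : E3 → F) : Prop :=
  (∀ᵐ x ∂(volume.restrict Ω), g (x + unitVec 2) = g x) ∧ MemSobolevBalls Ω p l g

/-- `T` is the boundary trace of `g`: some sequence of smooth functions converges to `g` in
`W¹_1(Ω ∩ B_R)`, while its boundary values converge to `T` in `L_1(∂Ω ∩ B_R)`, for every `R`.
For functions in `W¹_p(Ω ∩ B_R)` with `p ≥ 1` this is the usual trace. -/
def HasTrace (Ω : Set E3) (g T : E3 → F) : Prop :=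
  AEStronglyMeasurable T (surfaceMeasure Ω) ∧
  ∃ (D : Fin 3 → E3 → F) (φ : ℕ → E3 → F),
    (∀ j, IsWeakPartial Ω j g (D j)) ∧ (∀ n, ContDiff ℝ ∞ (φ n)) ∧
    ∀ R : ℝ,
      Tendsto (fun n => eLpNorm (fun x => φ n x - g x) 1
        (volume.restrict (Ω ∩ Metric.ball 0 R))) atTop (𝓝 0) ∧
      (∀ j, Tendsto (fun n => eLpNorm (fun x => fderiv ℝ (φ n) x (unitVec j) - D j x) 1
        (volume.restrict (Ω ∩ Metric.ball 0 R))) atTop (𝓝 0)) ∧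
      Tendsto (fun n => eLpNorm (fun x => φ n x - T x) 1
        ((surfaceMeasure Ω).restrict (Metric.ball 0 R))) atTop (𝓝 0)

open Classical in
/-- The boundary trace of `g`, determined up to a set of surface measure zero. -/
noncomputable def trace (Ω : Set E3) (g : E3 → F) : E3 → F :=
  if h : ∃ T, HasTrace Ω g T then h.choose else 0

end Weak

/-! ### Vector analysis in `ℂ³` -/

/-- The Hermitian product `⟨a, b⟩ = ∑ a_j conj(b_j)`, linear in the first argument. -/
noncomputable def herm (a b : C3) : ℂ := inner ℂ b a

/-- The cross product `[a, b]`. -/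
noncomputable def cross (a b : C3) : C3 := WithLp.toLp 2 (crossProduct a.ofLp b.ofLp)

/-- A real vector as a vector of `ℂ³`. -/
noncomputable def toC3 (w : E3) : C3 := WithLp.toLp 2 fun j => (w j : ℂ)

/-- The weak gradient `∇g` of a real function, as a field with values in `ℂ³`. -/
noncomputable def grad (Ω : Set E3) (g : E3 → ℝ) (x : E3) : C3 :=
  WithLp.toLp 2 fun j => ((weakPartial Ω j g x : ℝ) : ℂ)

/-- The weak curl `rot a`. -/
noncomputable def rot (Ω : Set E3) (a : E3 → C3) (x : E3) : C3 :=
  !₂[weakPartial Ω 1 a x 2 - weakPartial Ω 2 a x 1,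
     weakPartial Ω 2 a x 0 - weakPartial Ω 0 a x 2,
     weakPartial Ω 0 a x 1 - weakPartial Ω 1 a x 0]

/-- `div a = 0` in `Ω` in the sense of integral identities. (Complex test functions give the same
condition, as the identity is linear; for `a` in `L_2` so do test functions from `H¹₀(Ω)`.) -/
def DivFree (Ω : Set E3) (a : E3 → C3) : Prop :=
  ∀ φ : E3 → ℝ, IsTest Ω φ →
    ∫ x in Ω, ∑ j, ((fderiv ℝ φ x (unitVec j) : ℝ) : ℂ) * a x j = 0

/-- The matrix `W₀(m)_{jk} = m⁻¹ Δm δ_{jk} + m⁻² ∂_j m ∂_k m - m⁻¹ ∂_j ∂_k m`. -/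
noncomputable def W0 (Ω : Set E3) (m : E3 → ℝ) (x : E3) : Matrix (Fin 3) (Fin 3) ℝ :=
  Matrix.of fun j k =>
    (if j = k then (m x)⁻¹ * ∑ i, weakPartial Ω i (weakPartial Ω i m) x else 0)
    + (m x)⁻¹ ^ 2 * weakPartial Ω j m x * weakPartial Ω k m x
    - (m x)⁻¹ * weakPartial Ω j (weakPartial Ω k m) x

/-- A real matrix acting on `ℂ³`. -/
noncomputable def act (A : Matrix (Fin 3) (Fin 3) ℝ) (a : C3) : C3 :=
  WithLp.toLp 2 ((A.map fun r => (r : ℂ)) *ᵥ a.ofLp)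

end MaxwellCylinder

open MaxwellCylinder

/-! Write `q = (εμ)⁻¹` and `w = q f`. Pointwise, `rot(μv) = μ rot v + [∇μ, v]` and `rot w = q rot f
+ [∇q, f]`, so `⟨rot(μv), rot w⟩ = ε⁻¹⟨rot v, rot f⟩ + ⟨rot v, μ[∇q, f]⟩ + ⟨[∇μ, v], rot w⟩`.
Everything rests on integrating the last term by parts. In components it is the sum over `j, k` of
`(∂_jμ v_k - ∂_kμ v_j) ∂_j w̄_k`, and each summand is a product of a derivative of `μ`, a component
of `v` and a derivative of `w`. Moving `∂_j` off `w` produces second derivatives of `μ`, the terms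
`∂_jμ ∂_j v_k`, a term with `div v`, and a boundary integral. Since `μ div v = -⟨∇μ, v⟩`, the
divergence term becomes the `μ⁻²` part of `W₀(μ)`; the boundary terms combine to `⟨[∇μ, v], [f, ν]⟩`
by the Lagrange identity. The algebra is in `herm_rotOf_smul`, `herm_act` and `herm_cross_cross`,
the assembly in `integral_identity_of_sums`.

The analytic core is `Multiplier.integral_eq`: the Gauss-Green formula for a product `a u w` with `a
= ∂_kμ` only in `W¹_{3/2}` on bounded parts and `u, w` in `H¹`. The exponents just fit: `a` is in
`L₃`, its derivatives in `L_{3/2}`, its trace in `L₂`, while `H¹` functions are in `L₆` with traces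
in `L₄`. Hence `a u` is in `L₂`, and after splitting a weight `t` as `sign t · √|t| · √|t|` the
remaining terms are also pairings of `L₂` functions. As the cylinder is unbounded, local bounds do
not suffice; periodicity makes the norms of the coefficients uniform along the axis, and averaging
local estimates over balls centred on the axis gives global weighted inequalities
(`WeightedBound.of_uniformLp`). The formula then passes to the limit from smooth compactly supported
functions.

The Sobolev and trace inequalities come from convexity. The divergence theorem for `φ (x - c)` in
the horizontal directions, where `(x - c)·ν ≥ ρ` on the boundary, bounds `φ` in `L₁` of the boundary
by its `W¹_1` norm. So the extension of `φ` by zero has a gradient of controlled total variation,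
and the Gagliardo-Nirenberg-Sobolev inequality in `ℝ³` applies to its mollifications; the other
exponents follow by inserting powers of a function. The divergence theorem itself is proved by
slicing the plane domain, after the surface measure is identified with arc length times height
(`surfaceMeasure_eq_map`). Smooth approximation up to the boundary is mollification after
contraction towards an interior point. -/

namespace MaxwellCylinder

/-! ### Surface measure of a cylinder over a curve parametrized by arc length -/

/-- The point of `ℝ³` over `x ∈ ℝ²` at height `z`. -/
noncomputable def lift (x : E2) (z : ℝ) : E3 := !₂[x 0, x 1, z]

@[simp] lemma lift_zero (x : E2) (z : ℝ) : lift x z 0 = x 0 := rfl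
@[simp] lemma lift_one (x : E2) (z : ℝ) : lift x z 1 = x 1 := rfl
@[simp] lemma lift_two (x : E2) (z : ℝ) : lift x z 2 = z := rfl

/-- The projection of `ℝ³` to the first two coordinates. -/
noncomputable def hor (x : E3) : E2 := !₂[x 0, x 1]

@[simp] lemma hor_zero (x : E3) : hor x 0 = x 0 := rfl
@[simp] lemma hor_one (x : E3) : hor x 1 = x 1 := rfl

@[simp] lemma hor_lift (x : E2) (z : ℝ) : hor (lift x z) = x := by
  ext i; fin_cases i <;> rfl

@[simp] lemma lift_hor (x : E3) : lift (hor x) (x 2) = x := by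
  ext i; fin_cases i <;> rfl

lemma mem_straightCylinder {U : Set E2} {x : E3} : x ∈ straightCylinder U ↔ hor x ∈ U := Iff.rfl

lemma norm_sq_E2 (x : E2) : ‖x‖ ^ 2 = x 0 ^ 2 + x 1 ^ 2 := by
  simp [EuclideanSpace.norm_sq_eq, Fin.sum_univ_two]

lemma norm_sq_E3 (x : E3) : ‖x‖ ^ 2 = x 0 ^ 2 + x 1 ^ 2 + x 2 ^ 2 := by
  simp [EuclideanSpace.norm_sq_eq, Fin.sum_univ_three]

lemma dist_sq_lift (x y : E2) (z w : ℝ) :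
    dist (lift x z) (lift y w) ^ 2 = dist x y ^ 2 + (z - w) ^ 2 := by
  rw [dist_eq_norm, dist_eq_norm, norm_sq_E3, norm_sq_E2]; simp

lemma continuous_hor : Continuous hor := by
  unfold hor
  fun_prop

lemma continuous_lift : Continuous fun p : E2 × ℝ => lift p.1 p.2 := by
  unfold lift
  refine (PiLp.continuous_toLp 2 _).comp (continuous_pi fun i => ?_)
  fin_cases i <;> simp <;> fun_prop

/-- The cylinder over a plane curve. -/
noncomputable def sheet (γ : ℝ → E2) (p : E2) : E3 := lift (γ (p 0)) (p 1)

lemma sheet_injOn {γ : ℝ → E2} {S : Set ℝ} (hinj : InjOn γ S) :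
    InjOn (sheet γ) {p | p 0 ∈ S} := by
  intro p hp q hq h
  have h0 : γ (p 0) = γ (q 0) := by
    have := congrArg hor h
    simpa [sheet] using this
  have h1 : p 1 = q 1 := by
    have := congrArg (fun x : E3 => x 2) h
    simpa [sheet] using this
  ext i; fin_cases i
  · exact hinj hp hq h0
  · exact h1

lemma sheet_continuousOn {γ : ℝ → E2} {S : Set ℝ} (hc : ContinuousOn γ S) :
    ContinuousOn (sheet γ) {p | p 0 ∈ S} := by
  have h1 : ContinuousOn (fun p : E2 => ((γ (p 0), p 1) : E2 × ℝ)) {p | p 0 ∈ S} := by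
    refine ContinuousOn.prodMk (hc.comp (by fun_prop) (fun p hp => hp)) (by fun_prop)
  exact continuous_lift.comp_continuousOn h1

/-- The normalizing constant of `euclideanHausdorffMeasure d` depends on `d` and not on the space,
so the Lipschitz estimate for Hausdorff measure carries over unchanged. -/
lemma hausdorff_image_le {X Y : Type*} [MetricSpace X] [MeasurableSpace X]
    [BorelSpace X] [MetricSpace Y] [MeasurableSpace Y] [BorelSpace Y] {f : X → Y} {s : Set X}
    {K : NNReal} (h : LipschitzOnWith K f s) (d : ℕ) :
    (Measure.euclideanHausdorffMeasure d : Measure Y) (f '' s) ≤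
      (K : ℝ≥0∞) ^ d * (Measure.euclideanHausdorffMeasure d : Measure X) s := by
  rw [Measure.euclideanHausdorffMeasure_def, Measure.euclideanHausdorffMeasure_def,
    Measure.smul_apply, Measure.smul_apply, ENNReal.smul_def, ENNReal.smul_def, smul_eq_mul,
    smul_eq_mul, mul_left_comm]
  gcongr
  simpa using h.hausdorffMeasure_image_le (d := (d : ℝ)) (Nat.cast_nonneg d)

/-- The height coordinate is preserved and `K ≥ 1`, so a bi-Lipschitz bound for `γ` on `T` is
inherited by the sheet over `T`. In the plane, two-dimensional Hausdorff measure is Lebesgue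
measure. -/
lemma sheet_compare {γ : ℝ → E2} {T : Set ℝ} {K : NNReal} (hK : 1 ≤ K)
    (h1 : ∀ s ∈ T, ∀ t ∈ T, dist (γ s) (γ t) ≤ K * |s - t|)
    (h2 : ∀ s ∈ T, ∀ t ∈ T, |s - t| ≤ K * dist (γ s) (γ t)) {A : Set E2} (hA : ∀ p ∈ A, p 0 ∈ T) :
    (Measure.euclideanHausdorffMeasure 2 : Measure E3) (sheet γ '' A) ≤ (K : ℝ≥0∞) ^ 2 * volume A ∧
    volume A ≤ (K : ℝ≥0∞) ^ 2 * (Measure.euclideanHausdorffMeasure 2 : Measure E3)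
      (sheet γ '' A) := by
  have hK0 : (1 : ℝ) ≤ K := hK
  have key : ∀ p q : E2, dist p q ^ 2 = (p 0 - q 0) ^ 2 + (p 1 - q 1) ^ 2 := by
    intro p q; rw [dist_eq_norm, norm_sq_E2]; simp
  have keys : ∀ p q : E2, dist (sheet γ p) (sheet γ q) ^ 2
      = dist (γ (p 0)) (γ (q 0)) ^ 2 + (p 1 - q 1) ^ 2 := fun p q => dist_sq_lift _ _ _ _
  rw [← EuclideanSpace.euclideanHausdorffMeasure_eq_volume 2]
  constructor
  · refine hausdorff_image_le (LipschitzOnWith.of_dist_le_mul fun p hp q hq => ?_) 2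
    refine le_of_sq_le_sq ?_ (by positivity)
    rw [mul_pow, keys, key p q]
    have := h1 _ (hA p hp) _ (hA q hq)
    have h3 : dist (γ (p 0)) (γ (q 0)) ^ 2 ≤ (K : ℝ) ^ 2 * (p 0 - q 0) ^ 2 := by
      rw [← sq_abs (p 0 - q 0), ← mul_pow]; gcongr
    nlinarith [mul_nonneg (sub_nonneg.2 (one_le_pow₀ hK0 : (1 : ℝ) ≤ (K : ℝ) ^ 2)) (sq_nonneg (p 1 - q 1))]
  · have hanti : ∀ p ∈ A, ∀ q ∈ A, dist p q ≤ K * dist (sheet γ p) (sheet γ q) := by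
      intro p hp q hq
      refine le_of_sq_le_sq ?_ (by positivity)
      rw [mul_pow, keys, key p q]
      have := h2 _ (hA p hp) _ (hA q hq)
      have h3 : (p 0 - q 0) ^ 2 ≤ (K : ℝ) ^ 2 * dist (γ (p 0)) (γ (q 0)) ^ 2 := by
        rw [← sq_abs (p 0 - q 0), ← mul_pow]; gcongr
      nlinarith [mul_nonneg (sub_nonneg.2 (one_le_pow₀ hK0 : (1 : ℝ) ≤ (K : ℝ) ^ 2)) (sq_nonneg (p 1 - q 1))]
    have hinj : InjOn (sheet γ) A := by
      intro p hp q hq h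
      have := hanti p hp q hq
      rw [h, dist_self, mul_zero] at this
      exact dist_le_zero.mp this
    have hinv : LipschitzOnWith K (Function.invFunOn (sheet γ) A) (sheet γ '' A) := by
      refine LipschitzOnWith.of_dist_le_mul ?_
      rintro _ ⟨p, hp, rfl⟩ _ ⟨q, hq, rfl⟩
      rw [hinj.leftInvOn_invFunOn hp, hinj.leftInvOn_invFunOn hq]
      exact hanti p hp q hq
    have := hausdorff_image_le hinv 2
    rwa [hinj.leftInvOn_invFunOn.image_image] at this

/-- A unit speed curve is almost isometric on small pieces. The parameter set splits into countably
many measurable pieces on each of which `γ` is close to a linear isometry; the pieces are compared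
by `sheet_compare` and summed, injectivity keeping the images disjoint. -/
lemma hausdorff_sheet_compare {γ : ℝ → E2} {γ' : ℝ → E2} {S : Set ℝ}
    (hinj : InjOn γ S) (hd : ∀ s ∈ S, HasDerivAt γ (γ' s) s) (hn : ∀ s ∈ S, ‖γ' s‖ = 1)
    {A : Set E2} (hAm : MeasurableSet A) (hA : ∀ p ∈ A, p 0 ∈ S) {K : NNReal} (hK : 1 < K) :
    (Measure.euclideanHausdorffMeasure 2 : Measure E3) (sheet γ '' A) ≤ (K : ℝ≥0∞) ^ 2 * volume A ∧
    volume A ≤ (K : ℝ≥0∞) ^ 2 * (Measure.euclideanHausdorffMeasure 2 : Measure E3)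
      (sheet γ '' A) := by
  rcases A.eq_empty_or_nonempty with rfl | ⟨p₀, hp₀⟩
  · simp
  have hSne : S.Nonempty := ⟨_, hA _ hp₀⟩
  have hK' : (1 : ℝ) < K := hK
  have hKi : (K : ℝ)⁻¹ < 1 := inv_lt_one_of_one_lt₀ hK'
  -- An error `δ` relative to a linear isometry distorts distances by factors between `1 - δ = K⁻¹`
  -- and `1 + δ = 2 - K⁻¹`, and the latter is at most `K`.
  let δ : NNReal := 1 - K⁻¹
  have hδ : (δ : ℝ) = 1 - (K : ℝ)⁻¹ := by
    rw [NNReal.coe_sub (by exact_mod_cast hKi.le)]; simp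
  have hδ0 : δ ≠ 0 := by
    intro h
    rw [h] at hδ
    simp at hδ
    linarith
  obtain ⟨t, B, tdisj, tmeas, tcov, tapp, tB⟩ :=
    exists_partition_approximatesLinearOn_of_hasFDerivWithinAt γ S
      (fun s => ContinuousLinearMap.toSpanSingleton ℝ (γ' s))
      (fun s hs => (hd s hs).hasFDerivAt.hasFDerivWithinAt) (fun _ => δ) (fun _ => hδ0)
  have hdist : ∀ n, ∀ s ∈ S ∩ t n, ∀ r ∈ S ∩ t n,
      dist (γ s) (γ r) ≤ K * |s - r| ∧ |s - r| ≤ K * dist (γ s) (γ r) := by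
    intro n s hs r hr
    have h := tapp n s hs r hr
    obtain ⟨y, hy, hBy⟩ := tB hSne n
    have hB : ‖B n (s - r)‖ = |s - r| := by
      rw [hBy, ContinuousLinearMap.toSpanSingleton_apply, norm_smul, hn y hy, mul_one,
        Real.norm_eq_abs]
    rw [Real.norm_eq_abs, hδ] at h
    rw [dist_eq_norm]
    have h1 := norm_sub_norm_le (γ s - γ r) (B n (s - r))
    have h2 := norm_sub_norm_le (B n (s - r)) (γ s - γ r)
    rw [norm_sub_rev (B n (s - r))] at h2
    have h0 := abs_nonneg (s - r)
    have hKK : (K : ℝ)⁻¹ * K = 1 := inv_mul_cancel₀ (by positivity)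
    constructor
    · have : 2 - (K : ℝ)⁻¹ ≤ K := by
        have : 0 < (K : ℝ)⁻¹ := by positivity
        nlinarith
      nlinarith
    · have h3 : (K : ℝ)⁻¹ * |s - r| ≤ ‖γ s - γ r‖ := by nlinarith
      calc |s - r| = K * ((K : ℝ)⁻¹ * |s - r|) := by rw [← mul_assoc, mul_comm (K : ℝ), hKK, one_mul]
        _ ≤ _ := by gcongr
  let A' : ℕ → Set E2 := fun n => A ∩ {p | p 0 ∈ t n}
  have hA'm : ∀ n, MeasurableSet (A' n) := fun n => hAm.inter ((tmeas n).preimage (by fun_prop))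
  have hcov : A = ⋃ n, A' n := by
    ext p
    simp only [A', mem_iUnion, mem_inter_iff, mem_ofPred_eq, exists_and_left]
    exact ⟨fun hp => ⟨hp, mem_iUnion.1 (tcov (hA p hp))⟩, fun h => h.1⟩
  have hdisj : Pairwise (Function.onFun Disjoint A') := by
    intro m n hmn
    refine disjoint_left.2 fun p hp hq => ?_
    exact disjoint_left.1 (tdisj hmn) hp.2 hq.2
  have hcont : ContinuousOn γ S := fun s hs => (hd s hs).continuousAt.continuousWithinAt
  have hsub : A ⊆ {p | p 0 ∈ S} := hA
  have himm : ∀ n, MeasurableSet (sheet γ '' A' n) := fun n =>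
    (hA'm n).image_of_continuousOn_injOn
      ((sheet_continuousOn hcont).mono (inter_subset_left.trans hsub))
      ((sheet_injOn hinj).mono (inter_subset_left.trans hsub))
  have himd : Pairwise (Function.onFun Disjoint fun n => sheet γ '' A' n) := by
    intro m n hmn
    rw [Function.onFun, disjoint_left]
    rintro _ ⟨p, hp, rfl⟩ ⟨q, hq, h⟩
    have := sheet_injOn hinj (hsub hq.1) (hsub hp.1) h
    exact disjoint_left.1 (hdisj hmn) hp (this ▸ hq)
  have hvol : volume A = ∑' n, volume (A' n) := by
    rw [← measure_iUnion hdisj hA'm, ← hcov]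
  have hH : (Measure.euclideanHausdorffMeasure 2 : Measure E3) (sheet γ '' A) =
      ∑' n, (Measure.euclideanHausdorffMeasure 2 : Measure E3) (sheet γ '' A' n) := by
    rw [← measure_iUnion himd himm, ← image_iUnion, ← hcov]
  have hcmp := fun n => sheet_compare (γ := γ) (T := S ∩ t n) hK.le
    (fun s hs r hr => (hdist n s hs r hr).1) (fun s hs r hr => (hdist n s hs r hr).2)
    (A := A' n) (fun p hp => ⟨hA p hp.1, hp.2⟩)
  rw [hvol, hH, ← ENNReal.tsum_mul_left, ← ENNReal.tsum_mul_left]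
  exact ⟨ENNReal.tsum_le_tsum fun n => (hcmp n).1, ENNReal.tsum_le_tsum fun n => (hcmp n).2⟩

lemma le_of_forall_one_lt_sq_mul {a b : ℝ≥0∞} (h : ∀ K : NNReal, 1 < K → a ≤ (K : ℝ≥0∞) ^ 2 * b) :
    a ≤ b := by
  have hK : Tendsto (fun K : NNReal => (K : ℝ≥0∞) ^ 2 * b) (𝓝[>] 1) (𝓝 ((1 : ℝ≥0∞) ^ 2 * b)) := by
    refine ENNReal.Tendsto.mul_const ?_ (Or.inl (by simp))
    refine ENNReal.Tendsto.pow ?_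
    have : Tendsto (fun K : NNReal => (K : ℝ≥0∞)) (𝓝 1) (𝓝 ((1 : NNReal) : ℝ≥0∞)) :=
      (ENNReal.continuous_coe.tendsto 1)
    simpa using this.mono_left nhdsWithin_le_nhds
  rw [one_pow, one_mul] at hK
  exact ge_of_tendsto hK (eventually_nhdsWithin_of_forall fun K hK => h K hK)

lemma hausdorff_sheet {γ : ℝ → E2} {γ' : ℝ → E2} {S : Set ℝ}
    (hinj : InjOn γ S) (hd : ∀ s ∈ S, HasDerivAt γ (γ' s) s) (hn : ∀ s ∈ S, ‖γ' s‖ = 1)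
    {A : Set E2} (hAm : MeasurableSet A) (hA : ∀ p ∈ A, p 0 ∈ S) :
    (Measure.euclideanHausdorffMeasure 2 : Measure E3) (sheet γ '' A) = volume A :=
  le_antisymm
    (le_of_forall_one_lt_sq_mul fun _ hK => (hausdorff_sheet_compare hinj hd hn hAm hA hK).1)
    (le_of_forall_one_lt_sq_mul fun _ hK => (hausdorff_sheet_compare hinj hd hn hAm hA hK).2)

end MaxwellCylinder

/-! ### Coordinates, and the boundary parametrized by arc length and height. -/

namespace MaxwellCylinder

/-- `ℝ³` as a product of the plane and the axis. -/
noncomputable def splitE3 : E3 ≃ᵐ E2 × ℝ where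
  toFun x := (hor x, x 2)
  invFun p := lift p.1 p.2
  left_inv x := lift_hor x
  right_inv p := by simp
  measurable_toFun := (continuous_hor.prodMk (by fun_prop)).measurable
  measurable_invFun := continuous_lift.measurable

@[simp] lemma splitE3_apply (x : E3) : splitE3 x = (hor x, x 2) := rfl

@[simp] lemma splitE3_symm_apply (p : E2 × ℝ) : splitE3.symm p = lift p.1 p.2 := rfl

lemma measurePreserving_splitE3 : MeasurePreserving splitE3 := by
  have h1 := PiLp.volume_preserving_ofLp (Fin 3)
  have h2 := volume_preserving_piFinSuccAbove (fun _ : Fin 3 => ℝ) 2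
  have h3 : MeasurePreserving (Prod.swap : ℝ × (Fin 2 → ℝ) → (Fin 2 → ℝ) × ℝ) :=
    Measure.measurePreserving_swap
  have h4 : MeasurePreserving (Prod.map (WithLp.toLp 2 : (Fin 2 → ℝ) → E2) (id : ℝ → ℝ)) :=
    (PiLp.volume_preserving_toLp (Fin 2)).prod (MeasurePreserving.id _)
  have h := h4.comp (h3.comp (h2.comp h1))
  convert h using 1
  funext x
  refine Prod.ext ?_ rfl
  ext i
  fin_cases i <;> rfl

/-- The coordinates of the plane. -/
noncomputable def splitE2 : E2 ≃ᵐ ℝ × ℝ where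
  toFun x := (x 0, x 1)
  invFun p := !₂[p.1, p.2]
  left_inv x := by ext i; fin_cases i <;> rfl
  right_inv p := rfl
  measurable_toFun := by
    change Measurable fun x : E2 => (x 0, x 1)
    fun_prop
  measurable_invFun := by
    refine (PiLp.continuous_toLp 2 _).measurable.comp (measurable_pi_lambda _ fun i => ?_)
    fin_cases i <;> simp <;> fun_prop

@[simp] lemma splitE2_apply (x : E2) : splitE2 x = (x 0, x 1) := rfl

@[simp] lemma splitE2_symm_apply (p : ℝ × ℝ) : splitE2.symm p = !₂[p.1, p.2] := rfl

lemma measurePreserving_splitE2 : MeasurePreserving splitE2 := by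
  exact (volume_preserving_finTwoArrow ℝ).comp (PiLp.volume_preserving_ofLp (Fin 2))

/-- `γ` on `[0, L]` runs once around the boundary of `U`, and has unit speed on the open set
`S`, which exhausts `[0, L)` up to countably many points. -/
structure IsBoundaryCurve (U : Set E2) (L : ℝ) (γ : ℝ → E2) (S : Set ℝ) : Prop where
  pos : 0 < L
  continuous : Continuous γ
  injOn : InjOn γ (Ico 0 L)
  image : γ '' Ico 0 L = frontier U
  isOpen : IsOpen S
  subset : S ⊆ Ioo 0 L
  countable : (Ico 0 L \ S).Countable
  hasDeriv : ∀ s ∈ S, HasDerivAt γ (deriv γ s) s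
  norm_deriv : ∀ s ∈ S, ‖deriv γ s‖ = 1

lemma HasPiecewiseC2Boundary.exists_curve {U : Set E2} (h : HasPiecewiseC2Boundary U) :
    ∃ L γ S, IsBoundaryCurve U L γ S := by
  obtain ⟨L, γ, n, t, hL, hc, h0L, hinj, him, ht0, htn, harc⟩ := h
  -- Nothing is known of `γ` off `[0, L]`. The constant extension is continuous on `ℝ` and agrees
  -- with `γ` near every interior point of an arc, so derivatives there are unaffected.
  let γ₁ : ℝ → E2 := IccExtend hL.le fun s => γ s
  have hγ₁ : ∀ s ∈ Icc 0 L, γ₁ s = γ s := fun s hs => by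
    simp [γ₁, IccExtend_of_mem hL.le _ hs]
  have hmono : ∀ i j, i ≤ j → j ≤ n → t i ≤ t j := by
    intro i j hij
    induction j, hij using Nat.le_induction with
    | base => intro _; exact le_rfl
    | succ j _ ih => intro hj; exact (ih (by omega)).trans (harc j (by omega)).1.le
  have hsub : ∀ i < n, Icc (t i) (t (i + 1)) ⊆ Icc 0 L := by
    intro i hi
    refine Icc_subset_Icc ?_ ?_
    · rw [← ht0]; exact hmono 0 i (Nat.zero_le _) hi.le
    · rw [← htn]; exact hmono (i + 1) n hi le_rfl
  have hsub' : ∀ i < n, Ioo (t i) (t (i + 1)) ⊆ Ioo 0 L := by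
    intro i hi s hs
    have h1 := hsub i hi (left_mem_Icc.2 (harc i hi).1.le)
    have h2 := hsub i hi (right_mem_Icc.2 (harc i hi).1.le)
    exact ⟨h1.1.trans_lt hs.1, hs.2.trans_le h2.2⟩
  have hder : ∀ i < n, ∀ s ∈ Ioo (t i) (t (i + 1)),
      HasDerivAt γ₁ (deriv γ₁ s) s ∧ ‖deriv γ₁ s‖ = 1 := by
    intro i hi s hs
    obtain ⟨_, hC, hnorm⟩ := harc i hi
    have hs' := Ioo_subset_Icc_self hs
    have hnhds : Icc (t i) (t (i + 1)) ∈ 𝓝 s := Icc_mem_nhds hs.1 hs.2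
    have hd : HasDerivAt γ (derivWithin γ (Icc (t i) (t (i + 1))) s) s :=
      ((hC.differentiableOn (by norm_num)) s hs').hasDerivWithinAt.hasDerivAt hnhds
    have heq : γ₁ =ᶠ[𝓝 s] γ := by
      filter_upwards [hnhds] with r hr using hγ₁ r (hsub i hi hr)
    have hd1 := hd.congr_of_eventuallyEq heq
    rw [hd1.deriv]
    exact ⟨hd1, hnorm s hs'⟩
  refine ⟨L, γ₁, ⋃ i : Fin n, Ioo (t i) (t (i + 1)), hL, ?_, ?_, ?_, ?_, ?_, ?_, ?_, ?_⟩
  · exact (continuousOn_iff_continuous_domRestrict.1 hc).Icc_extend'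
  · intro r hr s hs h
    rw [hγ₁ r (Ico_subset_Icc_self hr), hγ₁ s (Ico_subset_Icc_self hs)] at h
    exact hinj hr hs h
  · rw [← him, image_congr fun s hs => hγ₁ s (Ico_subset_Icc_self hs)]
    refine (image_mono Ico_subset_Icc_self).antisymm ?_
    rintro _ ⟨s, hs, rfl⟩
    rcases hs.2.lt_or_eq with h | h
    · exact ⟨s, ⟨hs.1, h⟩, rfl⟩
    · exact ⟨0, ⟨le_rfl, hL⟩, by rw [h0L, h]⟩
  · exact isOpen_iUnion fun _ => isOpen_Ioo
  · exact iUnion_subset fun i => hsub' i i.2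
  · refine ((countable_range t)).mono ?_
    rintro s ⟨hs, hsS⟩
    by_contra hst
    -- A parameter in `[0, L)` that avoids all nodes and all open arcs would lie to the right of
    -- every node, in particular of `t n = L`.
    have key : ∀ j ≤ n, t j ≤ s := by
      intro j
      induction j with
      | zero => intro _; rw [ht0]; exact hs.1
      | succ j ih =>
        intro hj
        by_contra hlt
        refine hsS (mem_iUnion.2 ⟨⟨j, by omega⟩, ?_, not_le.1 hlt⟩)
        exact lt_of_le_of_ne (ih (by omega)) fun h => hst ⟨j, h⟩
    have := key n le_rfl
    rw [htn] at this
    exact absurd hs.2 (not_lt.2 this)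
  · intro s hs
    obtain ⟨i, hi⟩ := mem_iUnion.1 hs
    exact (hder i i.2 s hi).1
  · intro s hs
    obtain ⟨i, hi⟩ := mem_iUnion.1 hs
    exact (hder i i.2 s hi).2

lemma isOpenMap_hor : IsOpenMap hor := by
  intro V hV
  have : hor '' V = ⋃ z : ℝ, (fun x : E2 => lift x z) ⁻¹' V := by
    ext x
    simp only [mem_image, mem_iUnion, mem_preimage]
    constructor
    · rintro ⟨y, hy, rfl⟩; exact ⟨y 2, by simpa using hy⟩
    · rintro ⟨z, hz⟩; exact ⟨_, hz, hor_lift x z⟩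
  rw [this]
  exact isOpen_iUnion fun z => hV.preimage (continuous_lift.comp (Continuous.prodMk_left z))

lemma frontier_straightCylinder (U : Set E2) :
    frontier (straightCylinder U) = hor ⁻¹' frontier U :=
  (isOpenMap_hor.preimage_frontier_eq_frontier_preimage continuous_hor U).symm

/-- The parametrization of the cylinder over a plane curve. -/
noncomputable def sheet' (γ : ℝ → E2) (p : ℝ × ℝ) : E3 := lift (γ p.1) p.2

lemma continuous_sheet' {γ : ℝ → E2} (hγ : Continuous γ) : Continuous (sheet' γ) :=
  continuous_lift.comp ((hγ.comp continuous_fst).prodMk continuous_snd)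

/-- The boundary is the injective image of `S × ℝ` under a measure preserving sheet, up to the lines
over countably many exceptional parameters, which are null. -/
lemma surfaceMeasure_eq_map {U : Set E2} {L : ℝ} {γ : ℝ → E2} {S : Set ℝ}
    (h : IsBoundaryCurve U L γ S) :
    surfaceMeasure (straightCylinder U) =
      Measure.map (sheet' γ) ((volume.restrict S).prod volume) := by
  ext B hB
  have hcont := continuous_sheet' h.continuous
  have hSm := h.isOpen.measurableSet
  rw [surfaceMeasure, Measure.restrict_apply hB, Measure.map_apply hcont.measurable hB,
    frontier_straightCylinder]
  let A : Set E2 := {p | p 0 ∈ S} ∩ sheet γ ⁻¹' B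
  have hsc : Continuous (sheet γ) := by
    have := sheet_continuousOn (γ := γ) (S := univ) h.continuous.continuousOn
    simpa [continuousOn_univ] using this
  have hAm : MeasurableSet A :=
    (hSm.preimage (by fun_prop : Measurable fun p : E2 => p 0)).inter (hB.preimage hsc.measurable)
  have hSI : S ⊆ Ico 0 L := h.subset.trans Ioo_subset_Ico_self
  have h1 := hausdorff_sheet (A := A) (h.injOn.mono hSI) h.hasDeriv h.norm_deriv hAm
    (fun p hp => hp.1)
  have hvol : volume A = ((volume.restrict S).prod volume) (sheet' γ ⁻¹' B) := by
    have hr : (volume.restrict S).prod (volume : Measure ℝ) =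
        (volume : Measure (ℝ × ℝ)).restrict (S ×ˢ univ) := by
      rw [Measure.volume_eq_prod, ← Measure.prod_restrict, Measure.restrict_univ]
    rw [hr, Measure.restrict_apply (hB.preimage hcont.measurable),
      ← measurePreserving_splitE2.measure_preimage_equiv]
    congr 1
    ext p
    simp [A, sheet', sheet, and_comm]
  rw [← hvol, ← h1]
  -- On a single parameter value the curve is trivially bi-Lipschitz with `K = 1`, so the line over
  -- it is compared with a null line of the plane.
  have hnull : ∀ s, (Measure.euclideanHausdorffMeasure 2 : Measure E3)
      (sheet γ '' {p | p 0 = s}) = 0 := by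
    intro s
    have h2 := (sheet_compare (γ := γ) (T := {s}) (K := 1) le_rfl
      (by rintro _ rfl _ rfl; simp) (by rintro _ rfl _ rfl; simp)
      (A := {p | p 0 = s}) (fun p hp => hp)).1
    have h3 : volume {p : E2 | p 0 = s} = 0 := by
      have : {p : E2 | p 0 = s} = splitE2 ⁻¹' ({s} ×ˢ univ) := by ext p; simp
      rw [this, measurePreserving_splitE2.measure_preimage_equiv, Measure.volume_eq_prod,
        Measure.prod_prod]
      simp
    rw [h3, mul_zero] at h2
    exact le_antisymm h2 zero_le
  refine le_antisymm ?_ (measure_mono ?_)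
  · have hsub : B ∩ hor ⁻¹' frontier U ⊆
        sheet γ '' A ∪ ⋃ s ∈ Ico 0 L \ S, sheet γ '' {p | p 0 = s} := by
      rintro x ⟨hxB, hx⟩
      rw [mem_preimage, ← h.image] at hx
      obtain ⟨s, hs, hsx⟩ := hx
      have hx' : sheet γ !₂[s, x 2] = x := by simp [sheet, hsx]
      by_cases hsS : s ∈ S
      · exact Or.inl ⟨!₂[s, x 2], ⟨hsS, by rwa [mem_preimage, hx']⟩, hx'⟩
      · exact Or.inr (mem_biUnion (show s ∈ Ico 0 L \ S from ⟨hs, hsS⟩) ⟨!₂[s, x 2], rfl, hx'⟩)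
    refine (measure_mono hsub).trans ((measure_union_le _ _).trans ?_)
    rw [(measure_biUnion_null_iff h.countable).2 fun s _ => hnull s, add_zero]
  · rintro _ ⟨p, ⟨hp, hpB⟩, rfl⟩
    refine ⟨hpB, ?_⟩
    rw [mem_preimage, ← h.image]
    exact ⟨p 0, hSI hp, by simp [sheet]⟩

end MaxwellCylinder

namespace MaxwellCylinder

/-! ### Outer normals -/

/-- `w` is an outward unit normal of the plane set `U` at `x`. -/
def IsPlaneNormal (U : Set E2) (x w : E2) : Prop :=
  ‖w‖ = 1 ∧ ∀ y ∈ U, inner ℝ (y - x) w ≤ 0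

lemma exists_unit_normal {E : Type*} [NormedAddCommGroup E] [InnerProductSpace ℝ E]
    [CompleteSpace E] {V : Set E} (hV : IsOpen V) (hc : Convex ℝ V) (hne : V.Nonempty) {x : E}
    (hx : x ∈ frontier V) : ∃ w : E, ‖w‖ = 1 ∧ ∀ y ∈ V, inner ℝ (y - x) w ≤ 0 := by
  have hxV : x ∉ V := fun h => by
    rw [frontier, hV.interior_eq] at hx
    exact hx.2 h
  obtain ⟨f, hf⟩ := geometric_hahn_banach_open_point hc hV hxV
  let u := (InnerProductSpace.toDual ℝ E).symm f
  have hu : ∀ y, inner ℝ y u = f y := fun y => by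
    rw [real_inner_comm]; exact InnerProductSpace.toDual_symm_apply
  have hu0 : u ≠ 0 := by
    rintro h0
    obtain ⟨y, hy⟩ := hne
    have h1 := hf y hy
    rw [← hu, ← hu, h0] at h1
    simp at h1
  refine ⟨‖u‖⁻¹ • u, ?_, fun y hy => ?_⟩
  · rw [norm_smul, norm_inv, norm_norm, inv_mul_cancel₀ (norm_ne_zero_iff.2 hu0)]
  · rw [inner_smul_right, hu, map_sub]
    exact mul_nonpos_of_nonneg_of_nonpos (by positivity) (by linarith [hf y hy])

lemma inner_E2 (x y : E2) : inner ℝ x y = x 0 * y 0 + x 1 * y 1 := by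
  simp [PiLp.inner_apply, Fin.sum_univ_two, mul_comm]

lemma inner_E3 (x y : E3) : inner ℝ x y = x 0 * y 0 + x 1 * y 1 + x 2 * y 2 := by
  simp [PiLp.inner_apply, Fin.sum_univ_three, mul_comm]

/-- The points `c + r w` with `0 ≤ r < ρ` lie in the ball, and the supporting inequality at them
reads `r ≤ ⟨x - c, w⟩`. This lower bound is the quantitative form of convexity behind the trace
inequality. -/
lemma inner_normal_le_of_ball {E : Type*} [NormedAddCommGroup E] [InnerProductSpace ℝ E]
    {V : Set E} {c x w : E} {ρ : ℝ} (hρ : 0 < ρ) (hball : Metric.ball c ρ ⊆ V) (hw : ‖w‖ = 1)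
    (h : ∀ y ∈ V, inner ℝ (y - x) w ≤ 0) : ρ ≤ inner ℝ (x - c) w := by
  refine le_of_forall_lt fun r hr => ?_
  rcases lt_or_ge r 0 with hr0 | hr0
  · have := h c (hball (Metric.mem_ball_self hρ))
    rw [← neg_sub, inner_neg_left] at this
    linarith
  · have hm : (r + ρ) / 2 < ρ := by linarith
    have hmem : c + ((r + ρ) / 2) • w ∈ V := hball (by
      rw [Metric.mem_ball, dist_eq_norm, add_sub_cancel_left, norm_smul, hw, mul_one,
        Real.norm_of_nonneg (by linarith)]
      exact hm)
    have := h _ hmem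
    have he : c + ((r + ρ) / 2) • w - x = ((r + ρ) / 2) • w - (x - c) := by abel
    rw [he, inner_sub_left, inner_smul_left, real_inner_self_eq_norm_sq, hw] at this
    simp at this
    linarith

/-- The tangent vector turned by a right angle to the side of the line not containing `c`. -/
noncomputable def planeNormal (c : E2) (γ : ℝ → E2) (s : ℝ) : E2 :=
  if 0 < (c 0 - γ s 0) * (-(deriv γ s 1)) + (c 1 - γ s 1) * deriv γ s 0
  then !₂[deriv γ s 1, -(deriv γ s 0)] else !₂[-(deriv γ s 1), deriv γ s 0]

lemma measurable_planeNormal (c : E2) {γ : ℝ → E2} (hγ : Continuous γ) :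
    Measurable (planeNormal c γ) := by
  have hd : Measurable (deriv γ) := measurable_deriv γ
  have h0 : Measurable fun s => deriv γ s 0 := by fun_prop
  have h1 : Measurable fun s => deriv γ s 1 := by fun_prop
  have hγm := hγ.measurable
  have g0 : Measurable fun s => γ s 0 := by fun_prop
  have g1 : Measurable fun s => γ s 1 := by fun_prop
  refine Measurable.ite (measurableSet_lt measurable_const (by fun_prop)) ?_ ?_
  · exact (splitE2.symm.measurable).comp (h1.prodMk h0.neg)
  · exact (splitE2.symm.measurable).comp (h1.neg.prodMk h0)

lemma inner_normal_le_of_mem_closure {E : Type*} [NormedAddCommGroup E] [InnerProductSpace ℝ E]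
    {V : Set E} {x w : E} (h : ∀ y ∈ V, inner ℝ (y - x) w ≤ 0) {y : E} (hy : y ∈ closure V) :
    inner ℝ (y - x) w ≤ 0 := by
  have hcl : IsClosed {y : E | inner ℝ (y - x) w ≤ 0} :=
    isClosed_le (by fun_prop) continuous_const
  exact closure_minimal h hcl hy

section Curve

variable {U : Set E2} {L : ℝ} {γ : ℝ → E2} {S : Set ℝ}

lemma IsBoundaryCurve.mem_frontier (h : IsBoundaryCurve U L γ S) {s : ℝ} (hs : s ∈ S) :
    γ s ∈ frontier U := by
  rw [← h.image]
  exact mem_image_of_mem _ (Ioo_subset_Ico_self (h.subset hs))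

/-- The curve stays on one side of the supporting line at `γ s`, so its signed distance to that line
has a local maximum at `s`. -/
lemma IsBoundaryCurve.inner_deriv_eq_zero (h : IsBoundaryCurve U L γ S) {s : ℝ} (hs : s ∈ S)
    {w : E2} (hw : IsPlaneNormal U (γ s) w) : inner ℝ (deriv γ s) w = 0 := by
  have hmax : IsLocalMax (fun r => inner ℝ (γ r - γ s) w) s := by
    filter_upwards [h.isOpen.mem_nhds hs] with r hr
    rw [sub_self, inner_zero_left]
    exact inner_normal_le_of_mem_closure hw.2 (frontier_subset_closure (h.mem_frontier hr))
  have hd : HasDerivAt (fun r => inner ℝ (γ r - γ s) w) (inner ℝ (deriv γ s) w) s := by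
    simpa using ((h.hasDeriv s hs).sub_const (γ s)).inner ℝ (hasDerivAt_const s w)
  exact hmax.hasDerivAt_eq_zero hd

/-- A unit vector orthogonal to the unit tangent is one of two quarter turns of it, and the interior
point `c` decides which. Thus over `S` the normal is unique and given by a formula measurable in
`s`. -/
lemma IsBoundaryCurve.eq_planeNormal (h : IsBoundaryCurve U L γ S) {c : E2} {ρ : ℝ} (hρ : 0 < ρ)
    (hball : Metric.ball c ρ ⊆ U) {s : ℝ} (hs : s ∈ S) {w : E2}
    (hw : IsPlaneNormal U (γ s) w) : w = planeNormal c γ s := by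
  have h0 := h.inner_deriv_eq_zero hs hw
  have h1 := inner_normal_le_of_ball hρ hball hw.1 hw.2
  have hn : w 0 ^ 2 + w 1 ^ 2 = 1 := by rw [← norm_sq_E2, hw.1, one_pow]
  have hn' : deriv γ s 0 ^ 2 + deriv γ s 1 ^ 2 = 1 := by
    rw [← norm_sq_E2, h.norm_deriv s hs, one_pow]
  rw [inner_E2] at h0 h1
  simp only [PiLp.sub_apply] at h1
  set a := deriv γ s 0
  set b := deriv γ s 1
  -- `κ` is the coefficient of `w` along the turned tangent `(-b, a)`; unit length forces `κ = ±1`.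
  set κ := w 1 * a - w 0 * b with hκ
  have hw0 : w 0 = -κ * b := by
    have : w 0 = w 0 * (a ^ 2 + b ^ 2) := by rw [hn', mul_one]
    rw [this, hκ]; linear_combination a * h0
  have hw1 : w 1 = κ * a := by
    have : w 1 = w 1 * (a ^ 2 + b ^ 2) := by rw [hn', mul_one]
    rw [this, hκ]; linear_combination b * h0
  have hκ2 : κ ^ 2 = 1 := by
    rw [hw0, hw1] at hn; linear_combination hn - κ ^ 2 * hn'
  have hκ3 : κ = 1 ∨ κ = -1 := by
    rcases mul_eq_zero.1 (show (κ - 1) * (κ + 1) = 0 by linear_combination hκ2) with h | h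
    · exact Or.inl (by linarith)
    · exact Or.inr (by linarith)
  rw [hw0, hw1] at h1
  unfold planeNormal
  rcases hκ3 with h2 | h2
  · rw [if_neg]
    · ext i; fin_cases i
      · simpa [h2] using hw0
      · simpa [h2] using hw1
    · rw [h2] at h1; push Not; linarith
  · rw [if_pos]
    · ext i; fin_cases i
      · simpa [h2] using hw0
      · simpa [h2] using hw1
    · rw [h2] at h1; linarith

lemma isPlaneNormal_planeNormal (h : IsBoundaryCurve U L γ S) (hU : IsOpen U) (hc : Convex ℝ U)
    {c : E2} {ρ : ℝ} (hρ : 0 < ρ) (hball : Metric.ball c ρ ⊆ U) {s : ℝ} (hs : s ∈ S) :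
    IsPlaneNormal U (γ s) (planeNormal c γ s) := by
  obtain ⟨w, hw⟩ := exists_unit_normal hU hc ⟨c, hball (Metric.mem_ball_self hρ)⟩
    (h.mem_frontier hs)
  rw [← h.eq_planeNormal hρ hball hs hw]
  exact hw

end Curve

end MaxwellCylinder

namespace MaxwellCylinder

/-! ### The divergence theorem in a plane convex domain, by slices -/

/-- The point of the plane with `j`-th coordinate `y` and other coordinate `x`. -/
noncomputable def pt (j : Fin 2) (x y : ℝ) : E2 := WithLp.toLp 2 fun i => if i = j then y else x

@[simp] lemma pt_self (j : Fin 2) (x y : ℝ) : pt j x y j = y := by simp [pt]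

@[simp] lemma pt_succ (j : Fin 2) (x y : ℝ) : pt j x y (j + 1) = x := by
  fin_cases j <;> simp [pt]

@[simp] lemma pt_coords (j : Fin 2) (p : E2) : pt j (p (j + 1)) (p j) = p := by
  ext i; fin_cases j <;> fin_cases i <;> simp [pt]

lemma inner_E2_index (j : Fin 2) (x y : E2) :
    inner ℝ x y = x j * y j + x (j + 1) * y (j + 1) := by
  rw [inner_E2]
  fin_cases j
  · rfl
  · exact add_comm _ _

lemma norm_sq_E2_index (j : Fin 2) (x : E2) : ‖x‖ ^ 2 = x j ^ 2 + x (j + 1) ^ 2 := by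
  rw [← real_inner_self_eq_norm_sq, inner_E2_index j]; ring

lemma continuous_pt (j : Fin 2) : Continuous fun p : ℝ × ℝ => pt j p.1 p.2 := by
  unfold pt
  refine (PiLp.continuous_toLp 2 _).comp (continuous_pi fun i => ?_)
  split_ifs <;> fun_prop

/-- Coordinates of the plane in which the `j`-th one comes second. -/
noncomputable def ptEquiv (j : Fin 2) : ℝ × ℝ ≃ᵐ E2 where
  toFun p := pt j p.1 p.2
  invFun p := (p (j + 1), p j)
  left_inv p := by simp
  right_inv p := by simp
  measurable_toFun := (continuous_pt j).measurable
  measurable_invFun := by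
    change Measurable fun p : E2 => (p (j + 1), p j)
    fun_prop

lemma ptEquiv_apply (j : Fin 2) (p : ℝ × ℝ) : ptEquiv j p = pt j p.1 p.2 := rfl

lemma measurePreserving_ptEquiv (j : Fin 2) : MeasurePreserving (ptEquiv j) := by
  have hs := measurePreserving_splitE2.symm
  fin_cases j
  · have hsw : MeasurePreserving (Prod.swap : ℝ × ℝ → ℝ × ℝ) volume volume :=
      Measure.measurePreserving_swap
    have he : (ptEquiv 0 : ℝ × ℝ → E2) = splitE2.symm ∘ Prod.swap := by
      funext p; ext i; fin_cases i <;> simp [ptEquiv_apply, pt]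
    have h := hs.comp hsw
    rw [← he] at h
    exact h
  · have he : (ptEquiv 1 : ℝ × ℝ → E2) = splitE2.symm := by
      funext p; ext i; fin_cases i <;> simp [ptEquiv_apply, pt]
    rw [← he] at hs
    exact hs

lemma pt_add (j : Fin 2) (x y x' y' : ℝ) : pt j x y + pt j x' y' = pt j (x + x') (y + y') := by
  ext i; by_cases h : i = j <;> simp [pt, h]

lemma smul_pt (j : Fin 2) (r x y : ℝ) : r • pt j x y = pt j (r * x) (r * y) := by
  ext i; by_cases h : i = j <;> simp [pt, h]

lemma eq_Ioo_of_isOpen_convex {I : Set ℝ} (ho : IsOpen I) (hc : Convex ℝ I)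
    (hb : Bornology.IsBounded I) (hne : I.Nonempty) : I = Ioo (sInf I) (sSup I) := by
  have hconn : IsConnected I := ⟨hne, hc.isPreconnected⟩
  refine Subset.antisymm (fun y hy => ?_)
    (IsConnected.Ioo_csInf_csSup_subset hconn hb.bddBelow hb.bddAbove)
  obtain ⟨δ, hδ, hsub⟩ := Metric.isOpen_iff.1 ho y hy
  have h1 : y - δ / 2 ∈ I := hsub (by rw [Metric.mem_ball, Real.dist_eq, abs_lt]; constructor <;> linarith)
  have h2 : y + δ / 2 ∈ I := hsub (by rw [Metric.mem_ball, Real.dist_eq, abs_lt]; constructor <;> linarith)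
  exact ⟨(csInf_le hb.bddBelow h1).trans_lt (by linarith),
    lt_of_lt_of_le (by linarith) (le_csSup hb.bddAbove h2)⟩

/-- The slice of `U` along the `j`-th axis, run through in the direction of the sign `σ`. -/
def slice (U : Set E2) (j : Fin 2) (σ x : ℝ) : Set ℝ := {y | pt j x (σ * y) ∈ U}

/-- The end of a slice in the direction of the sign `σ`. -/
noncomputable def sliceEnd (U : Set E2) (j : Fin 2) (σ x : ℝ) : ℝ := σ * sSup (slice U j σ x)

lemma isOpen_slice {U : Set E2} (hU : IsOpen U) (j : Fin 2) (σ x : ℝ) : IsOpen (slice U j σ x) :=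
  hU.preimage ((continuous_pt j).comp (by fun_prop : Continuous fun y : ℝ => (x, σ * y)))

lemma convex_slice {U : Set E2} (hc : Convex ℝ U) (j : Fin 2) (σ x : ℝ) : Convex ℝ
    (slice U j σ x) := by
  intro y hy z hz a b ha hb' hab
  have := hc hy hz ha hb' hab
  rw [smul_pt, smul_pt, pt_add, ← add_mul, hab, one_mul] at this
  change pt j x _ ∈ U
  convert this using 2
  simp only [smul_eq_mul]; ring

lemma isBounded_slice {U : Set E2} (hb : Bornology.IsBounded U) (j : Fin 2) {σ : ℝ}
    (hσ : σ = 1 ∨ σ = -1) (x : ℝ) :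
    Bornology.IsBounded (slice U j σ x) := by
  obtain ⟨R, hR⟩ := hb.exists_norm_le
  rw [isBounded_iff_forall_norm_le]
  refine ⟨R, fun y hy => ?_⟩
  have h1 := hR _ hy
  have h2 := PiLp.norm_apply_le (pt j x (σ * y)) j
  rw [pt_self, norm_mul] at h2
  have h3 : ‖σ‖ = 1 := by rcases hσ with rfl | rfl <;> simp
  rw [h3, one_mul] at h2
  exact h2.trans h1

lemma slice_neg {U : Set E2} (j : Fin 2) (x : ℝ) : slice U j (-1) x = -slice U j 1 x := by
  ext y; simp [slice]

lemma sliceEnd_neg {U : Set E2} (j : Fin 2) (x : ℝ) : sliceEnd U j (-1) x = sInf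
    (slice U j 1 x) := by
  rw [sliceEnd, slice_neg, Real.sInf_def]; ring

lemma mem_slice_iff {U : Set E2} (j : Fin 2) {σ : ℝ} (hσ : σ = 1 ∨ σ = -1) (x y : ℝ) :
    σ * y ∈ slice U j σ x ↔ pt j x y ∈ U := by
  rcases hσ with rfl | rfl <;> simp [slice]

lemma pt_sliceEnd_mem_frontier {U : Set E2} (hU : IsOpen U) (hc : Convex ℝ U)
    (hb : Bornology.IsBounded U) (j : Fin 2) {σ : ℝ} (hσ : σ = 1 ∨ σ = -1) {x : ℝ}
    (hx : (slice U j σ x).Nonempty) : pt j x (sliceEnd U j σ x) ∈ frontier U := by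
  have hbd := isBounded_slice hb j hσ x
  have heq := eq_Ioo_of_isOpen_convex (isOpen_slice hU j σ x) (convex_slice hc j σ x) hbd hx
  have hcont : Continuous fun y : ℝ => pt j x (σ * y) :=
    (continuous_pt j).comp (by fun_prop : Continuous fun y : ℝ => (x, σ * y))
  have hlub := csSup_mem_closure hx hbd.bddAbove
  rw [frontier, hU.interior_eq]
  refine ⟨?_, fun h => ?_⟩
  · exact map_mem_closure (f := fun y : ℝ => pt j x (σ * y)) hcont hlub (fun y hy => hy)
  · have : sSup (slice U j σ x) ∈ slice U j σ x := h
    exact lt_irrefl _ (heq.subset this).2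

/-- The supporting inequality at `p`, whose normal has a positive component in the direction `σ`,
keeps the slice below `p`. Conversely the open segment from a point of the slice to `p` in the
closure stays in `U`, so the slice comes arbitrarily close to `p`. -/
lemma sliceEnd_eq {U : Set E2} (hU : IsOpen U) (hc : Convex ℝ U) (j : Fin 2) {σ : ℝ}
    (hσ : σ = 1 ∨ σ = -1) {p w : E2}
    (hp : p ∈ closure U) (hw : ∀ y ∈ U, inner ℝ (y - p) w ≤ 0) (hwj : 0 < σ * w j)
    (hx : (slice U j σ (p (j + 1))).Nonempty) : sliceEnd U j σ (p (j + 1)) = p j := by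
  have hσσ : σ * σ = 1 := by rcases hσ with rfl | rfl <;> norm_num
  have hlub : IsLUB (slice U j σ (p (j + 1))) (σ * p j) := by
    constructor
    · intro y hy
      have h := hw _ hy
      rw [inner_E2_index j] at h
      simp only [PiLp.sub_apply, pt_self, pt_succ, sub_self, zero_mul, add_zero] at h
      have h2 : (y - σ * p j) * (σ * w j) ≤ 0 := by
        have : (y - σ * p j) * (σ * w j) = (σ * y - σ * σ * p j) * w j := by ring
        rw [this, hσσ, one_mul]; exact h
      by_contra hlt
      push Not at hlt
      nlinarith
    · intro u hu
      obtain ⟨y₀, hy₀⟩ := hx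
      have hy₀' : pt j (p (j + 1)) (σ * y₀) ∈ interior U := by rw [hU.interior_eq]; exact hy₀
      refine le_of_tendsto (f := fun t : ℝ => (1 - t) * y₀ + t * (σ * p j)) (x := 𝓝[<] 1) ?_ ?_
      · have : Continuous fun t : ℝ => (1 - t) * y₀ + t * (σ * p j) := by fun_prop
        have h := this.tendsto 1
        simp only [sub_self, zero_mul, one_mul, zero_add] at h
        exact h.mono_left nhdsWithin_le_nhds
      · have : Ioo (0 : ℝ) 1 ∈ 𝓝[<] (1 : ℝ) := Ioo_mem_nhdsLT one_pos
        filter_upwards [this] with t ht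
        refine hu ?_
        have hseg := hc.openSegment_interior_closure_subset_interior hy₀' hp
        have hmem := hseg ⟨1 - t, t, by linarith [ht.2], ht.1, by ring, rfl⟩
        have hm2 := interior_subset hmem
        have hpe : p = pt j (p (j + 1)) (p j) := (pt_coords j p).symm
        have he : (1 - t) • pt j (p (j + 1)) (σ * y₀) + t • p =
            pt j (p (j + 1)) (σ * ((1 - t) * y₀ + t * (σ * p j))) := by
          conv_lhs => rw [show t • p = t • pt j (p (j + 1)) (p j) by rw [pt_coords]]
          rw [smul_pt, smul_pt, pt_add]
          congr 1
          · ring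
          · linear_combination -t * p j * hσσ
        rw [he] at hm2
        exact hm2
  rw [sliceEnd, hlub.csSup_eq hx, ← mul_assoc, hσσ, one_mul]

/-- The projection of `U` along the `j`-th axis. -/
def shadow (U : Set E2) (j : Fin 2) : Set ℝ := (fun p : E2 => p (j + 1)) '' U

lemma slice_nonempty_iff {U : Set E2} (j : Fin 2) {σ : ℝ} (hσ : σ = 1 ∨ σ = -1) (x : ℝ) :
    (slice U j σ x).Nonempty ↔ x ∈ shadow U j := by
  constructor
  · rintro ⟨y, hy⟩; exact ⟨_, hy, by simp⟩
  · rintro ⟨p, hp, rfl⟩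
    refine ⟨σ * p j, ?_⟩
    rw [mem_slice_iff j hσ]; simpa using hp

lemma ordConnected_shadow {U : Set E2} (hc : Convex ℝ U) (j : Fin 2) :
    (shadow U j).OrdConnected := by
  have : Convex ℝ (shadow U j) := by
    rintro _ ⟨p, hp, rfl⟩ _ ⟨q, hq, rfl⟩ a b ha hb' hab
    exact ⟨a • p + b • q, hc hp hq ha hb' hab, by simp⟩
  exact this.ordConnected

end MaxwellCylinder

namespace MaxwellCylinder

section PlaneDivergence

variable {F : Type*} [NormedAddCommGroup F] [NormedSpace ℝ F]
  {U : Set E2} {L : ℝ} {γ : ℝ → E2} {S : Set ℝ} {N : ℝ → E2}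

/-- The part of the boundary where the normal field `N` points in the direction `σ e_j`. -/
def facing (S : Set ℝ) (N : ℝ → E2) (j : Fin 2) (σ : ℝ) : Set ℝ := S ∩ {s | 0 < σ * N s j}

lemma measurableSet_facing (hS : MeasurableSet S) (hN : Measurable N) (j : Fin 2) (σ : ℝ) :
    MeasurableSet (facing S N j σ) := by
  refine hS.inter (measurableSet_lt measurable_const ?_)
  fun_prop

/-- The shadow is an interval. If the coordinate of `γ s` were outside it, one of `±e_{j+1}` would
be a normal at `γ s`, hence equal to `N s` by uniqueness, against `N s j ≠ 0`. -/
lemma coord_mem_shadow (hc : Convex ℝ U)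
    (hu : ∀ s ∈ S, ∀ w, IsPlaneNormal U (γ s) w → w = N s)
    (j : Fin 2) {s : ℝ} (hs : s ∈ S) (hNj : N s j ≠ 0) : γ s (j + 1) ∈ shadow U j := by
  by_contra hx
  have hord := ordConnected_shadow hc j
  have key : ∀ τ : ℝ, τ = 1 ∨ τ = -1 → (∀ y ∈ U, (y (j + 1) - γ s (j + 1)) * τ ≤ 0) → False := by
    intro τ hτ hy
    have hw : IsPlaneNormal U (γ s) (pt j τ 0) := by
      constructor
      · have : ‖pt j τ 0‖ ^ 2 = 1 ^ 2 := by
          rw [norm_sq_E2_index j]; rcases hτ with rfl | rfl <;> simp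
        exact (sq_eq_sq₀ (norm_nonneg _) zero_le_one).1 this
      · intro y hyU
        rw [inner_E2_index j]
        simpa using hy y hyU
    have := hu s hs _ hw
    rw [← this] at hNj
    simp at hNj
  by_cases hlt : ∀ y ∈ U, y (j + 1) ≤ γ s (j + 1)
  · exact key 1 (Or.inl rfl) fun y hy => by linarith [hlt y hy]
  · refine key (-1) (Or.inr rfl) fun y hy => ?_
    push Not at hlt
    obtain ⟨y', hy', hlt⟩ := hlt
    by_contra hneg
    push Not at hneg
    exact hx (hord.out ⟨y, hy, rfl⟩ ⟨y', hy', rfl⟩ ⟨by linarith, hlt.le⟩)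

lemma IsBoundaryCurve.sliceEnd_coord (h : IsBoundaryCurve U L γ S) (hU : IsOpen U)
    (hc : Convex ℝ U) (hn : ∀ s ∈ S, IsPlaneNormal U (γ s) (N s))
    (hu : ∀ s ∈ S, ∀ w, IsPlaneNormal U (γ s) w → w = N s)
    (j : Fin 2) {σ : ℝ} (hσ : σ = 1 ∨ σ = -1) {s : ℝ} (hs : s ∈ facing S N j σ) :
    pt j (γ s (j + 1)) (sliceEnd U j σ (γ s (j + 1))) = γ s := by
  have hne : N s j ≠ 0 := fun h0 => by simpa [h0] using hs.2
  rw [sliceEnd_eq hU hc j hσ (frontier_subset_closure (h.mem_frontier hs.1)) (hn s hs.1).2 hs.2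
    ((slice_nonempty_iff j hσ _).2 (coord_mem_shadow hc hu j hs.1 hne)), pt_coords]

/-- Unit tangent and unit normal in the plane differ by a quarter turn. So the Jacobian of
projecting the boundary along the `j`-th axis is `|N_j|`. -/
lemma IsBoundaryCurve.abs_deriv_coord (h : IsBoundaryCurve U L γ S)
    (hn : ∀ s ∈ S, IsPlaneNormal U (γ s) (N s)) (j : Fin 2) {s : ℝ} (hs : s ∈ S) :
    |deriv γ s (j + 1)| = |N s j| := by
  have h0 := h.inner_deriv_eq_zero hs (hn s hs)
  have h1 : deriv γ s j ^ 2 + deriv γ s (j + 1) ^ 2 = 1 := by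
    rw [← norm_sq_E2_index j, h.norm_deriv s hs, one_pow]
  have h2 : N s j ^ 2 + N s (j + 1) ^ 2 = 1 := by
    rw [← norm_sq_E2_index j, (hn s hs).1, one_pow]
  rw [inner_E2_index j] at h0
  rw [← sq_eq_sq_iff_abs_eq_abs]
  linear_combination N s j ^ 2 * h1 - deriv γ s (j + 1) ^ 2 * h2 +
    (deriv γ s (j + 1) * N s (j + 1) - deriv γ s j * N s j) * h0

/-- Each slice ends at some boundary point `γ s`. If `s ∈ S`, the slice reaches that point from the
open set `U`, where the supporting inequality is strict, so `σ N_j > 0` there. The remaining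
parameters are countable and project to a null set. -/
lemma IsBoundaryCurve.shadow_ae_eq (h : IsBoundaryCurve U L γ S) (hU : IsOpen U)
    (hc : Convex ℝ U) (hb : Bornology.IsBounded U) (hn : ∀ s ∈ S, IsPlaneNormal U (γ s) (N s))
    (hu : ∀ s ∈ S, ∀ w, IsPlaneNormal U (γ s) w → w = N s)
    (j : Fin 2) {σ : ℝ} (hσ : σ = 1 ∨ σ = -1) :
    (shadow U j : Set ℝ) =ᵐ[volume] (fun s => γ s (j + 1)) '' facing S N j σ := by
  have hσσ : σ * σ = 1 := by rcases hσ with rfl | rfl <;> norm_num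
  rw [ae_eq_set]
  constructor
  · have hcount : ((fun s => γ s (j + 1)) '' (Ico 0 L \ S)).Countable := h.countable.image _
    refine measure_mono_null ?_ (hcount.measure_zero volume)
    rintro x ⟨hx, hnot⟩
    have hxs := (slice_nonempty_iff j hσ x).2 hx
    have hfr := pt_sliceEnd_mem_frontier hU hc hb j hσ hxs
    rw [← h.image] at hfr
    obtain ⟨s, hs, hγs⟩ := hfr
    have hx' : γ s (j + 1) = x := by rw [hγs]; simp
    refine ⟨s, ⟨hs, fun hsS => hnot ⟨s, ⟨hsS, ?_⟩, hx'⟩⟩, hx'⟩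
    have hI := eq_Ioo_of_isOpen_convex (isOpen_slice hU j σ x) (convex_slice hc j σ x)
      (isBounded_slice hb j hσ x) hxs
    obtain ⟨y, hy⟩ := hxs
    have hylt : y < sSup (slice U j σ x) := (hI.subset hy).2
    have hle := (hn s hsS).2 _ hy
    have hm : pt j x (σ * y) ∈ interior U := by rw [hU.interior_eq]; exact hy
    obtain ⟨δ, hδ, hball⟩ := Metric.isOpen_iff.1 hU _ hy
    have hstrict := inner_normal_le_of_ball hδ hball (hn s hsS).1 (hn s hsS).2
    rw [hγs, inner_E2_index j] at hstrict
    simp only [PiLp.sub_apply, pt_self, pt_succ, sub_self, zero_mul, add_zero, sliceEnd] at hstrict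
    have : 0 < (sSup (slice U j σ x) - y) * (σ * N s j) := by
      have e : (sSup (slice U j σ x) - y) * (σ * N s j) =
        (σ * sSup (slice U j σ x) - σ * y) * N s j := by ring
      rw [e]; linarith
    exact (pos_iff_pos_of_mul_pos this).1 (by linarith)
  · refine measure_mono_null (t := ∅) ?_ measure_empty
    rintro _ ⟨⟨s, hs, rfl⟩, hnot⟩
    have hne : N s j ≠ 0 := fun h0 => by simpa [h0] using hs.2
    exact hnot (coord_mem_shadow hc hu j hs.1 hne)

/-- Change of variables `x = γ_{j+1}(s)` on the part of the boundary facing `σ e_j`. It is injective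
because a point of that part is the end of its slice and so is determined by `x`. -/
lemma IsBoundaryCurve.setIntegral_shadow (h : IsBoundaryCurve U L γ S) (hU : IsOpen U)
    (hc : Convex ℝ U) (hb : Bornology.IsBounded U) (hN : Measurable N)
    (hn : ∀ s ∈ S, IsPlaneNormal U (γ s) (N s))
    (hu : ∀ s ∈ S, ∀ w, IsPlaneNormal U (γ s) w → w = N s)
    (j : Fin 2) {σ : ℝ} (hσ : σ = 1 ∨ σ = -1) {Ψ : E2 → F} (hΨ : Continuous Ψ) :
    IntegrableOn (fun x => Ψ (pt j x (sliceEnd U j σ x))) (shadow U j) ∧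
    ∫ x in shadow U j, Ψ (pt j x (sliceEnd U j σ x)) =
      ∫ s in facing S N j σ, (σ * N s j) • Ψ (γ s) := by
  have hmeas := measurableSet_facing h.isOpen.measurableSet hN j σ
  have hd : ∀ s ∈ facing S N j σ, HasDerivWithinAt (fun s => γ s (j + 1)) (deriv γ s (j + 1))
      (facing S N j σ) s := by
    intro s hs
    exact ((EuclideanSpace.proj (𝕜 := ℝ) (j + 1)).hasFDerivAt.comp_hasDerivAt s
      (h.hasDeriv s hs.1)).hasDerivWithinAt
  have hinj : InjOn (fun s => γ s (j + 1)) (facing S N j σ) := by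
    intro s hs r hr hsr
    have h1 := h.sliceEnd_coord hU hc hn hu j hσ hs
    have h2 := h.sliceEnd_coord hU hc hn hu j hσ hr
    simp only at hsr
    rw [hsr, h2] at h1
    exact h.injOn (Ioo_subset_Ico_self (h.subset hs.1)) (Ioo_subset_Ico_self (h.subset hr.1)) h1.symm
  have hae := h.shadow_ae_eq hU hc hb hn hu j hσ
  have hcongr : ∀ s ∈ facing S N j σ, |deriv γ s (j + 1)| •
      Ψ (pt j (γ s (j + 1)) (sliceEnd U j σ (γ s (j + 1)))) = (σ * N s j) • Ψ (γ s) := by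
    intro s hs
    rw [h.sliceEnd_coord hU hc hn hu j hσ hs, h.abs_deriv_coord hn j hs.1]
    congr 1
    have hpos : 0 < σ * N s j := hs.2
    rw [← abs_of_pos hpos, abs_mul]
    rcases hσ with rfl | rfl <;> simp
  constructor
  · rw [integrableOn_congr_set_ae hae, integrableOn_image_iff_integrableOn_abs_deriv_smul hmeas hd
      hinj, integrableOn_congr_fun hcongr hmeas]
    obtain ⟨C, hC⟩ := (isCompact_Icc (a := (0 : ℝ)) (b := L)).exists_bound_of_continuousOn
      (hΨ.comp h.continuous).continuousOn
    have hfin : volume (facing S N j σ) < ⊤ :=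
      (measure_mono ((fun s hs => Ioo_subset_Icc_self (h.subset hs.1)) :
        facing S N j σ ⊆ Icc 0 L)).trans_lt measure_Icc_lt_top
    refine IntegrableOn.of_bound hfin ?_ C ?_
    · refine AEStronglyMeasurable.smul ?_ (hΨ.comp h.continuous).aestronglyMeasurable
      exact (by fun_prop : Measurable fun s => σ * N s j).aestronglyMeasurable
    · filter_upwards [ae_restrict_mem hmeas] with s hs
      rw [norm_smul]
      have h1 : ‖σ * N s j‖ ≤ 1 := by
        rw [norm_mul]
        have := PiLp.norm_apply_le (N s) j
        rw [(hn s hs.1).1] at this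
        rcases hσ with rfl | rfl <;> simpa using this
      calc ‖σ * N s j‖ * ‖Ψ (γ s)‖ ≤ 1 * C :=
            mul_le_mul h1 (hC s (Ioo_subset_Icc_self (h.subset hs.1))) (norm_nonneg _) zero_le_one
        _ = C := one_mul C
  · rw [setIntegral_congr_set hae, integral_image_eq_integral_abs_deriv_smul hmeas hd hinj]
    exact setIntegral_congr_fun hmeas hcongr

lemma intervalIntegral_slice {U : Set E2} (hU : IsOpen U) (hc : Convex ℝ U)
    (hb : Bornology.IsBounded U) [CompleteSpace F] (j : Fin 2) {Ψ : E2 → F} (hΨ : ContDiff ℝ 1 Ψ)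
    {x : ℝ} (hx : x ∈ shadow U j) :
    ∫ y in slice U j 1 x, fderiv ℝ Ψ (pt j x y) (EuclideanSpace.single j 1) =
      Ψ (pt j x (sliceEnd U j 1 x)) - Ψ (pt j x (sliceEnd U j (-1) x)) := by
  have hne := (slice_nonempty_iff j (Or.inl rfl) x).2 hx
  have hI := eq_Ioo_of_isOpen_convex (isOpen_slice hU j 1 x) (convex_slice hc j 1 x)
    (isBounded_slice hb j (Or.inl rfl) x) hne
  have hle : sInf (slice U j 1 x) ≤ sSup (slice U j 1 x) := by
    obtain ⟨y, hy⟩ := hne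
    have := hI.subset hy
    exact (this.1.trans this.2).le
  have hd : ∀ y, HasDerivAt (fun y => pt j x y) (EuclideanSpace.single j (1 : ℝ)) y := by
    intro y
    have he : (fun y => pt j x y) = fun y => pt j x 0 + y • EuclideanSpace.single j (1 : ℝ) := by
      funext y; ext i; by_cases h : i = j <;> simp [pt, h]
    rw [he]
    simpa using ((hasDerivAt_id y).smul_const (EuclideanSpace.single j (1 : ℝ))).const_add (pt j x 0)
  have hd' : ∀ y, HasDerivAt (fun y => Ψ (pt j x y))
      (fderiv ℝ Ψ (pt j x y) (EuclideanSpace.single j 1)) y := fun y =>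
    ((hΨ.differentiable (by norm_num)) _).hasFDerivAt.comp_hasDerivAt y (hd y)
  have hcont : Continuous fun y => fderiv ℝ Ψ (pt j x y) (EuclideanSpace.single j 1) := by
    have h1 : Continuous fun y : ℝ => pt j x y := (continuous_pt j).comp (Continuous.prodMk_right x)
    exact ((hΨ.continuous_fderiv (by norm_num)).comp h1).clm_apply continuous_const
  rw [sliceEnd_neg, sliceEnd, one_mul]
  conv_lhs => rw [hI]
  rw [← integral_Ioc_eq_integral_Ioo, ← intervalIntegral.integral_of_le hle]
  exact intervalIntegral.integral_eq_sub_of_hasDerivAt (fun y _ => hd' y)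
    (hcont.intervalIntegrable _ _)

/-- The divergence theorem in a bounded convex plane domain. -/
lemma IsBoundaryCurve.integral_fderiv (h : IsBoundaryCurve U L γ S) [CompleteSpace F]
    (hU : IsOpen U) (hc : Convex ℝ U) (hb : Bornology.IsBounded U) (hN : Measurable N)
    (hn : ∀ s ∈ S, IsPlaneNormal U (γ s) (N s))
    (hu : ∀ s ∈ S, ∀ w, IsPlaneNormal U (γ s) w → w = N s)
    (j : Fin 2) {Ψ : E2 → F} (hΨ : ContDiff ℝ 1 Ψ) :
    ∫ x in U, fderiv ℝ Ψ x (EuclideanSpace.single j 1) = ∫ s in S, N s j • Ψ (γ s) := by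
  have hcont : Continuous fun x => fderiv ℝ Ψ x (EuclideanSpace.single j 1) :=
    (hΨ.continuous_fderiv (by norm_num)).clm_apply continuous_const
  have hint : IntegrableOn (fun x => fderiv ℝ Ψ x (EuclideanSpace.single j 1)) U :=
    (hcont.continuousOn.integrableOn_compact hb.isCompact_closure).mono_set subset_closure
  obtain ⟨i1, e1⟩ := h.setIntegral_shadow hU hc hb hN hn hu j (Or.inl rfl) hΨ.continuous
  obtain ⟨i2, e2⟩ := h.setIntegral_shadow hU hc hb hN hn hu j (Or.inr rfl) hΨ.continuous
  have hfub : ∫ x in U, fderiv ℝ Ψ x (EuclideanSpace.single j 1) =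
      ∫ x in shadow U j, (Ψ (pt j x (sliceEnd U j 1 x)) - Ψ (pt j x (sliceEnd U j (-1) x))) := by
    rw [← integral_indicator hU.measurableSet,
      ← (measurePreserving_ptEquiv j).integral_comp (ptEquiv j).measurableEmbedding,
      Measure.volume_eq_prod, integral_prod]
    · have hsh : MeasurableSet (shadow U j) := by
        have : IsOpen (shadow U j) := by
          have : shadow U j = ⋃ y : ℝ, (fun x => pt j x y) ⁻¹' U := by
            ext x
            simp only [mem_iUnion, mem_preimage]
            rw [← slice_nonempty_iff j (Or.inl rfl)]
            simp [slice, Set.Nonempty]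
          rw [this]
          exact isOpen_iUnion fun y => hU.preimage
            ((continuous_pt j).comp (Continuous.prodMk_left y))
        exact this.measurableSet
      rw [← integral_indicator hsh]
      congr 1
      funext x
      have hind : (fun y => U.indicator (fun x => fderiv ℝ Ψ x (EuclideanSpace.single j 1))
          (ptEquiv j (x, y))) = (slice U j 1 x).indicator
          (fun y => fderiv ℝ Ψ (pt j x y) (EuclideanSpace.single j 1)) := by
        funext y
        have hiff : pt j x y ∈ U ↔ y ∈ slice U j 1 x := by
          rw [← mem_slice_iff j (Or.inl rfl), one_mul]
        rw [ptEquiv_apply]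
        by_cases hy : pt j x y ∈ U
        · rw [indicator_of_mem hy, indicator_of_mem (hiff.1 hy)]
        · rw [indicator_of_notMem hy, indicator_of_notMem fun h' => hy (hiff.2 h')]
      rw [hind, integral_indicator (isOpen_slice hU j 1 x).measurableSet]
      by_cases hx : x ∈ shadow U j
      · rw [indicator_of_mem hx, intervalIntegral_slice hU hc hb j hΨ hx]
      · rw [indicator_of_notMem hx]
        have : slice U j 1 x = ∅ := by
          rw [← not_nonempty_iff_eq_empty, slice_nonempty_iff j (Or.inl rfl)]; exact hx
        rw [this]; simp
    · have := (integrable_indicator_iff hU.measurableSet).2 hint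
      rw [← Measure.volume_eq_prod]
      exact ((measurePreserving_ptEquiv j).integrable_comp_emb
        (ptEquiv j).measurableEmbedding).2 this
  rw [hfub, integral_sub i1 i2, e1, e2]
  have hSm := h.isOpen.measurableSet
  have hm1 := measurableSet_facing hSm hN j 1
  have hm2 := measurableSet_facing hSm hN j (-1)
  have hdisj : Disjoint (facing S N j 1) (facing S N j (-1)) := by
    rw [disjoint_left]
    rintro s ⟨_, h1⟩ ⟨_, h2⟩
    simp only [mem_ofPred_eq] at h1 h2
    linarith
  have hSint : IntegrableOn (fun s => N s j • Ψ (γ s)) S := by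
    obtain ⟨C, hC⟩ := (isCompact_Icc (a := (0 : ℝ)) (b := L)).exists_bound_of_continuousOn
      (hΨ.continuous.comp h.continuous).continuousOn
    have hSI : S ⊆ Icc 0 L := h.subset.trans Ioo_subset_Icc_self
    refine IntegrableOn.of_bound ((measure_mono hSI).trans_lt measure_Icc_lt_top) ?_ C ?_
    · exact ((by fun_prop : Measurable fun s => N s j).aestronglyMeasurable).smul
        (hΨ.continuous.comp h.continuous).aestronglyMeasurable
    · filter_upwards [ae_restrict_mem hSm] with s hs
      rw [norm_smul]
      have h1 := PiLp.norm_apply_le (N s) j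
      rw [(hn s hs).1] at h1
      calc ‖N s j‖ * ‖Ψ (γ s)‖ ≤ 1 * C :=
            mul_le_mul h1 (hC s (hSI hs)) (norm_nonneg _) zero_le_one
        _ = C := one_mul C
  -- The upper and lower ends of the slices cover the boundary except where `N_j = 0`, which
  -- contributes nothing.
  have hun : ∫ s in S, N s j • Ψ (γ s) =
      ∫ s in facing S N j 1 ∪ facing S N j (-1), N s j • Ψ (γ s) := by
    refine setIntegral_eq_of_subset_of_forall_sdiff_eq_zero hSm
      (union_subset inter_subset_left inter_subset_left) ?_
    rintro s ⟨hs, hnot⟩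
    have : N s j = 0 := by
      by_contra h0
      rcases lt_or_gt_of_ne h0 with h1 | h1
      · exact hnot (Or.inr ⟨hs, by simpa using h1⟩)
      · exact hnot (Or.inl ⟨hs, by simpa using h1⟩)
    rw [this, zero_smul]
  rw [hun, setIntegral_union hdisj hm2 (hSint.mono_set inter_subset_left)
    (hSint.mono_set inter_subset_left), sub_eq_add_neg, ← integral_neg]
  congr 1
  · simp
  · simp

end PlaneDivergence

end MaxwellCylinder

namespace MaxwellCylinder

/-! ### The divergence theorem in the cylinder -/

/-- What is used of the cylinder `P` and of its unit normal field `ν`: `P` is an open convex set,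
contains the ball with centre `c` and radius `ρ`, is bounded in the first two directions and
invariant in the third one, and satisfies the divergence theorem. -/
structure IsGaussCylinder (P : Set E3) (ν : E3 → E3) (c : E3) (ρ D : ℝ) : Prop where
  isOpen : IsOpen P
  convex : Convex ℝ P
  rho_pos : 0 < ρ
  ball_subset : Metric.ball c ρ ⊆ P
  hor_le : ∀ x ∈ closure P, |x 0 - c 0| ≤ D ∧ |x 1 - c 1| ≤ D
  shift : ∀ x ∈ P, ∀ z : ℝ, x + z • unitVec 2 ∈ P
  measurable_normal : AEStronglyMeasurable ν (surfaceMeasure P)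
  norm_normal : ∀ᵐ x ∂surfaceMeasure P, ‖ν x‖ = 1
  le_inner_normal : ∀ᵐ x ∂surfaceMeasure P, ρ ≤ (x 0 - c 0) * ν x 0 + (x 1 - c 1) * ν x 1
  finite_ball : ∀ R, surfaceMeasure P (Metric.ball 0 R) < ⊤
  divergence : ∀ {F : Type} [NormedAddCommGroup F] [NormedSpace ℝ F] [CompleteSpace F]
    (ψ : E3 → F), ContDiff ℝ 1 ψ → HasCompactSupport ψ → ∀ j,
    ∫ x in P, fderiv ℝ ψ x (unitVec j) = ∫ x, ν x j • ψ x ∂surfaceMeasure P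

lemma outerNormal_spec {P : Set E3} (hP : IsOpen P) (hc : Convex ℝ P) (hne : P.Nonempty) {x : E3}
    (hx : x ∈ frontier P) : IsOuterNormal P x (outerNormal P x) := by
  have h : ∃ w, IsOuterNormal P x w := exists_unit_normal hP hc hne hx
  rw [outerNormal, dif_pos h]
  exact h.choose_spec

/-- The supporting inequality holds at all vertical translates of a point of `P`. If `w 2 ≠ 0`, a
suitable height would give the inner product the value `1`. -/
lemma IsOuterNormal.two_eq_zero {P : Set E3} (hs : ∀ x ∈ P, ∀ z : ℝ, x + z • unitVec 2 ∈ P)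
    (hne : P.Nonempty) {x w : E3} (h : IsOuterNormal P x w) : w 2 = 0 := by
  obtain ⟨y, hy⟩ := hne
  by_contra h0
  have h1 := h.2 _ (hs y hy ((1 - inner ℝ (y - x) w) / w 2))
  have he : y + ((1 - inner ℝ (y - x) w) / w 2) • unitVec 2 - x =
    (y - x) + ((1 - inner ℝ (y - x) w) / w 2) • unitVec 2 := by abel
  have h2 : inner ℝ (unitVec 2) w = w 2 := by simp [unitVec, EuclideanSpace.inner_single_left]
  rw [he, inner_add_left, inner_smul_left, h2] at h1
  simp only [conj_trivial] at h1
  rw [div_mul_cancel₀ _ h0] at h1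
  linarith

lemma hor_unitVec_two (x : E3) (z : ℝ) : hor (x + z • unitVec 2) = hor x := by
  ext i; fin_cases i <;> simp [unitVec]

lemma inner_E3_hor (x w : E3) : inner ℝ x w = inner ℝ (hor x) (hor w) + x 2 * w 2 := by
  rw [inner_E3, inner_E2]; simp

lemma hor_sub (x y : E3) : hor (x - y) = hor x - hor y := by
  ext i; fin_cases i <;> simp

section Cyl

variable {U : Set E2} {L : ℝ} {γ : ℝ → E2} {S : Set ℝ}

lemma shift_straightCylinder {x : E3} (hx : x ∈ straightCylinder U) (z : ℝ) :
    x + z • unitVec 2 ∈ straightCylinder U := by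
  rw [mem_straightCylinder, hor_unitVec_two]; exact hx

lemma isOpen_straightCylinder (hU : IsOpen U) : IsOpen (straightCylinder U) :=
  hU.preimage continuous_hor

lemma convex_straightCylinder (hc : Convex ℝ U) : Convex ℝ (straightCylinder U) := by
  intro x hx y hy a b ha hb hab
  have := hc hx hy ha hb hab
  rw [mem_straightCylinder]
  convert this using 1
  ext i; fin_cases i <;> simp

lemma ball_lift_subset {p : E2} {ρ : ℝ} (hball : Metric.ball p ρ ⊆ U) :
    Metric.ball (lift p 0) ρ ⊆ straightCylinder U := by
  intro x hx
  refine hball ?_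
  rw [Metric.mem_ball] at hx ⊢
  refine lt_of_le_of_lt ?_ hx
  have h := dist_sq_lift (hor x) p (x 2) 0
  rw [lift_hor] at h
  exact le_of_sq_le_sq (by change dist (hor x) p ^ 2 ≤ _; nlinarith [sq_nonneg (x 2 - 0)]) dist_nonneg

/-- Any normal is horizontal and projects to a plane normal, which is unique over `S`; so the choice
made in `outerNormal` has no effect there. -/
lemma outerNormal_lift (h : IsBoundaryCurve U L γ S) (hU : IsOpen U) (hc : Convex ℝ U) {p : E2}
    {ρ : ℝ} (hρ : 0 < ρ) (hball : Metric.ball p ρ ⊆ U) {s : ℝ} (hs : s ∈ S) (z : ℝ) :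
    outerNormal (straightCylinder U) (lift (γ s) z) = lift (planeNormal p γ s) 0 := by
  have hne : (straightCylinder U).Nonempty :=
    ⟨lift p 0, by
      rw [mem_straightCylinder, hor_lift]; exact hball (Metric.mem_ball_self hρ)⟩
  have hfr : lift (γ s) z ∈ frontier (straightCylinder U) := by
    rw [frontier_straightCylinder, mem_preimage, hor_lift]; exact h.mem_frontier hs
  have hw := outerNormal_spec (isOpen_straightCylinder hU) (convex_straightCylinder hc) hne hfr
  set w := outerNormal (straightCylinder U) (lift (γ s) z)
  have h2 := hw.two_eq_zero (fun x hx z => shift_straightCylinder hx z) hne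
  have hpn : IsPlaneNormal U (γ s) (hor w) := by
    constructor
    · have h3 : ‖hor w‖ ^ 2 = 1 ^ 2 := by
        rw [norm_sq_E2, ← hw.1, norm_sq_E3, h2]; simp
      exact (sq_eq_sq₀ (norm_nonneg _) zero_le_one).1 h3
    · intro y hy
      have h3 := hw.2 (lift y 0) (by rw [mem_straightCylinder, hor_lift]; exact hy)
      rw [inner_E3_hor, hor_sub, hor_lift, hor_lift, h2, mul_zero, add_zero] at h3
      exact h3
  rw [← h.eq_planeNormal hρ hball hs hpn, ← h2, lift_hor]

lemma ae_param (h : IsBoundaryCurve U L γ S) {p : ℝ × ℝ → Prop}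
    (hp : ∀ s ∈ S, ∀ z, p (s, z)) : ∀ᵐ x ∂((volume.restrict S).prod (volume : Measure ℝ)), p x := by
  have : (volume.restrict S).prod (volume : Measure ℝ) =
      ((volume : Measure ℝ).prod (volume : Measure ℝ)).restrict (S ×ˢ univ) := by
    rw [← Measure.prod_restrict, Measure.restrict_univ]
  rw [this]
  filter_upwards [ae_restrict_mem (h.isOpen.measurableSet.prod MeasurableSet.univ)] with x hx
  exact hp x.1 hx.1 x.2

/-- `outerNormal` is defined by choice, so its measurability has to come from the formula in the
parameter, transported by the measurable embedding `γ` of `[0, L)` into the plane. -/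
lemma exists_measurable_normal (h : IsBoundaryCurve U L γ S) (p : E2) :
    ∃ N' : E2 → E2, Measurable N' ∧ ∀ s ∈ S, N' (γ s) = planeNormal p γ s := by
  have hemb := (h.continuous.continuousOn (s := Ico 0 L)).measurableEmbedding measurableSet_Ico
    h.injOn
  obtain ⟨N', hN', he⟩ := hemb.exists_measurable_extend
    ((measurable_planeNormal p h.continuous).comp measurable_subtype_coe) (fun _ => inferInstance)
  refine ⟨N', hN', fun s hs => ?_⟩
  have := congrFun he ⟨s, Ioo_subset_Ico_self (h.subset hs)⟩
  exact this

lemma lift_zero_measurable {N' : E2 → E2} (hN' : Measurable N') :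
    Measurable fun x : E3 => lift (N' (hor x)) 0 :=
  continuous_lift.measurable.comp
    (((hN'.comp continuous_hor.measurable)).prodMk measurable_const)

lemma IsBoundaryCurve.isGaussCylinder (h : IsBoundaryCurve U L γ S) (hU : IsOpen U)
    (hc : Convex ℝ U) (hb : Bornology.IsBounded U) :
    ∃ c ρ D, IsGaussCylinder (straightCylinder U) (outerNormal (straightCylinder U)) c ρ D := by
  have hUne : U.Nonempty := by
    by_contra hemp
    rw [not_nonempty_iff_eq_empty] at hemp
    have := h.image
    rw [hemp, frontier_empty, image_eq_empty] at this
    exact (this ▸ (⟨le_rfl, h.pos⟩ : (0 : ℝ) ∈ Ico 0 L) : (0 : ℝ) ∈ (∅ : Set ℝ))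
  obtain ⟨p, hp⟩ := hUne
  obtain ⟨ρ, hρ, hball⟩ := Metric.isOpen_iff.1 hU p hp
  obtain ⟨R₀, hR₀⟩ := hb.closure.exists_norm_le
  set P := straightCylinder U with hPdef
  set ν := outerNormal P with hν
  have hPo : IsOpen P := isOpen_straightCylinder hU
  have hPc : Convex ℝ P := convex_straightCylinder hc
  have hball3 := ball_lift_subset hball
  have hne : P.Nonempty := ⟨lift p 0, hball3 (Metric.mem_ball_self hρ)⟩
  have hσ := surfaceMeasure_eq_map h
  have hcont := continuous_sheet' h.continuous
  have hfr : ∀ᵐ x ∂surfaceMeasure P, x ∈ frontier P :=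
    ae_restrict_mem isClosed_frontier.measurableSet
  have hspec : ∀ᵐ x ∂surfaceMeasure P, IsOuterNormal P x (ν x) := by
    filter_upwards [hfr] with x hx using outerNormal_spec hPo hPc hne hx
  have hshift : ∀ x ∈ P, ∀ z : ℝ, x + z • unitVec 2 ∈ P := fun x hx z =>
    shift_straightCylinder hx z
  have htwo : ∀ᵐ x ∂surfaceMeasure P, ν x 2 = 0 := by
    filter_upwards [hspec] with x hx using hx.two_eq_zero hshift hne
  have hνΓ : ∀ s ∈ S, ∀ z, ν (sheet' γ (s, z)) = lift (planeNormal p γ s) 0 := fun s hs z =>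
    outerNormal_lift h hU hc hρ hball hs z
  have hgood : ∀ᵐ x ∂surfaceMeasure P, hor x ∈ γ '' S := by
    have him : MeasurableSet (γ '' S) := h.isOpen.measurableSet.image_of_continuousOn_injOn
      h.continuous.continuousOn (h.injOn.mono (h.subset.trans Ioo_subset_Ico_self))
    rw [hσ, ae_map_iff hcont.measurable.aemeasurable (him.preimage continuous_hor.measurable)]
    refine ae_param h fun s hs z => ?_
    rw [sheet', hor_lift]
    exact mem_image_of_mem _ hs
  obtain ⟨N', hN'm, hN'⟩ := exists_measurable_normal h p
  have hmeas : AEStronglyMeasurable ν (surfaceMeasure P) := by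
    refine ⟨fun x => lift (N' (hor x)) 0, (lift_zero_measurable hN'm).stronglyMeasurable, ?_⟩
    filter_upwards [hgood] with x hx
    obtain ⟨s, hs, hsx⟩ := hx
    rw [← lift_hor x, ← hsx, hν, outerNormal_lift h hU hc hρ hball hs, hor_lift, hN' s hs]
  have hfin : ∀ R, surfaceMeasure P (Metric.ball 0 R) < ⊤ := by
    intro R
    rw [hσ, Measure.map_apply hcont.measurable Metric.isOpen_ball.measurableSet]
    have hsub : sheet' γ ⁻¹' Metric.ball 0 R ⊆ univ ×ˢ Icc (-R) R := by
      intro q hq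
      refine ⟨mem_univ _, ?_⟩
      have h1 := PiLp.norm_apply_le (sheet' γ q) 2
      have h2 : ‖sheet' γ q‖ < R := by simpa using hq
      have h3 : sheet' γ q 2 = q.2 := rfl
      rw [h3, Real.norm_eq_abs] at h1
      exact abs_le.1 (h1.trans h2.le)
    refine (measure_mono hsub).trans_lt ?_
    rw [Measure.prod_prod, Measure.restrict_apply_univ]
    refine ENNReal.mul_lt_top ?_ measure_Icc_lt_top
    exact (measure_mono h.subset).trans_lt measure_Ioo_lt_top
  have hclosure : ∀ x ∈ closure P, hor x ∈ closure U := fun x hx =>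
    map_mem_closure continuous_hor hx fun y hy => hy
  refine ⟨lift p 0, ρ, 2 * R₀, hPo, hPc, hρ, hball3, ?_, hshift, hmeas, ?_, ?_, ?_, ?_⟩
  · intro x hx
    have h1 := hR₀ _ (hclosure x hx)
    have h2 := hR₀ _ (subset_closure hp)
    constructor
    · have h3 := (PiLp.norm_apply_le (hor x) 0).trans h1
      have h4 := (PiLp.norm_apply_le p 0).trans h2
      simp only [hor_zero, Real.norm_eq_abs] at h3 h4
      rw [lift_zero]
      exact (abs_sub _ _).trans (by linarith)
    · have h3 := (PiLp.norm_apply_le (hor x) 1).trans h1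
      have h4 := (PiLp.norm_apply_le p 1).trans h2
      simp only [hor_one, Real.norm_eq_abs] at h3 h4
      rw [lift_one]
      exact (abs_sub _ _).trans (by linarith)
  · filter_upwards [hspec] with x hx using hx.1
  · filter_upwards [hspec, htwo] with x hx h2
    have := inner_normal_le_of_ball hρ hball3 hx.1 hx.2
    rw [inner_E3, h2] at this
    simpa using this
  · exact hfin
  · intro F _ _ _ ψ hψ hψc j
    have hdcont : Continuous fun x => fderiv ℝ ψ x (unitVec j) :=
      (hψ.continuous_fderiv (by norm_num)).clm_apply continuous_const
    have hdsupp : HasCompactSupport fun x => fderiv ℝ ψ x (unitVec j) :=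
      (hψc.fderiv ℝ).comp_left (g := fun A : E3 →L[ℝ] F => A (unitVec j)) rfl
    have hind : Integrable ((U ×ˢ (univ : Set ℝ)).indicator
        fun q : E2 × ℝ => fderiv ℝ ψ (lift q.1 q.2) (unitVec j))
        ((volume : Measure E2).prod (volume : Measure ℝ)) := by
      have h1 : Integrable (P.indicator fun x => fderiv ℝ ψ x (unitVec j)) :=
        (hdcont.integrable_of_hasCompactSupport hdsupp).indicator hPo.measurableSet
      have h2 := (measurePreserving_splitE3.symm.integrable_comp_emb
        splitE3.symm.measurableEmbedding).2 h1
      have he : (U ×ˢ (univ : Set ℝ)).indicator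
          (fun q : E2 × ℝ => fderiv ℝ ψ (lift q.1 q.2) (unitVec j)) =
          (P.indicator fun x => fderiv ℝ ψ x (unitVec j)) ∘ splitE3.symm := by
        funext q
        simp only [Function.comp, splitE3_symm_apply]
        have hmem : lift q.1 q.2 ∈ P ↔ q ∈ U ×ˢ (univ : Set ℝ) := by
          rw [hPdef, mem_straightCylinder, hor_lift]; simp
        by_cases hq : q ∈ U ×ˢ (univ : Set ℝ)
        · rw [indicator_of_mem hq, indicator_of_mem (hmem.2 hq)]
        · rw [indicator_of_notMem hq, indicator_of_notMem fun h' => hq (hmem.1 h')]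
      rw [he, ← Measure.volume_eq_prod]
      exact h2
    have hvol : ∫ x in P, fderiv ℝ ψ x (unitVec j) = ∫ q in U ×ˢ (univ : Set ℝ),
        fderiv ℝ ψ (lift q.1 q.2) (unitVec j) ∂((volume : Measure E2).prod volume) := by
      rw [← measurePreserving_splitE3.symm.setIntegral_preimage_emb
        splitE3.symm.measurableEmbedding]
      congr 2
      ext q
      simp [hPdef, mem_straightCylinder]
    have hprodU : ((volume : Measure E2).prod (volume : Measure ℝ)).restrict (U ×ˢ univ) =
        (volume.restrict U).prod volume := by
      rw [← Measure.prod_restrict, Measure.restrict_univ]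
    have hint : Integrable (fun q : E2 × ℝ => fderiv ℝ ψ (lift q.1 q.2) (unitVec j))
        ((volume.restrict U).prod volume) := by
      rw [← hprodU]
      exact (integrable_indicator_iff (hU.measurableSet.prod MeasurableSet.univ)).1 hind
    have hliftc : ∀ x : E2, Continuous fun z : ℝ => lift x z := fun x =>
      continuous_lift.comp (Continuous.prodMk_right x)
    -- Along the axis the normal vanishes, and so does the integral of a derivative over every
    -- vertical line. In the other directions the plane theorem holds at each height, and Fubini
    -- integrates over the heights.
    by_cases hj : j = 2
    · subst hj
      have hrhs : ∫ x, ν x 2 • ψ x ∂surfaceMeasure P = 0 := by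
        rw [integral_congr_ae (g := fun _ => (0 : F)), integral_zero]
        filter_upwards [htwo] with x hx
        rw [hx, zero_smul]
      rw [hrhs, hvol, hprodU, integral_prod _ hint]
      refine integral_eq_zero_of_ae (Eventually.of_forall fun x => ?_)
      have hemb : IsClosedEmbedding fun z : ℝ => lift x z := by
        refine Isometry.isClosedEmbedding (Isometry.of_dist_eq fun z w => ?_)
        have h1 := dist_sq_lift x x z w
        rw [dist_self, zero_pow two_ne_zero, zero_add, ← sq_abs (z - w), ← Real.dist_eq] at h1
        exact (sq_eq_sq₀ dist_nonneg dist_nonneg).1 h1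
      refine integral_eq_zero_of_hasDerivAt_of_integrable (f := fun z : ℝ => ψ (lift x z))
        (fun z => ?_) ?_ ?_
      · have hd : HasDerivAt (fun z => lift x z) (unitVec 2) z := by
          have he : (fun z => lift x z) = fun z => lift x 0 + z • unitVec 2 := by
            funext z; ext i; fin_cases i <;> simp [unitVec]
          rw [he]
          simpa using ((hasDerivAt_id z).smul_const (unitVec 2)).const_add (lift x 0)
        exact ((hψ.differentiable (by norm_num)) _).hasFDerivAt.comp_hasDerivAt z hd
      · exact (hdcont.comp (hliftc x)).integrable_of_hasCompactSupport
          (hdsupp.comp_isClosedEmbedding hemb)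
      · exact (hψ.continuous.comp (hliftc x)).integrable_of_hasCompactSupport
          (hψc.comp_isClosedEmbedding hemb)
    · obtain ⟨i, hij⟩ : ∃ i : Fin 2, j = i.castSucc := by
        fin_cases j
        · exact ⟨0, rfl⟩
        · exact ⟨1, rfl⟩
        · exact absurd rfl hj
      have hunit : ∀ x : E2, ∀ z : ℝ, fderiv ℝ ψ (lift x z) (unitVec j) =
          fderiv ℝ (fun x => ψ (lift x z)) x (EuclideanSpace.single i 1) := by
        intro x z
        let A : E2 →L[ℝ] E3 := (LinearMap.toContinuousLinearMap
          { toFun := fun x => lift x 0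
            map_add' := fun x y => by ext k; fin_cases k <;> simp
            map_smul' := fun r x => by ext k; fin_cases k <;> simp })
        have hA : HasFDerivAt (fun x => lift x z) A x := by
          have he : (fun x => lift x z) = fun x => A x + lift 0 z := by
            funext x; ext k; fin_cases k <;> simp [A]
          rw [he]
          exact A.hasFDerivAt.add_const _
        have hd := ((hψ.differentiable (by norm_num)) (lift x z)).hasFDerivAt.comp x hA
        rw [show (fun x => ψ (lift x z)) = ψ ∘ fun x => lift x z from rfl, hd.fderiv,
          ContinuousLinearMap.comp_apply]
        congr 1
        rw [hij]
        ext k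
        fin_cases i <;> fin_cases k <;> simp [A, unitVec]
      have hslice : ∀ z : ℝ, ∫ x in U, fderiv ℝ ψ (lift x z) (unitVec j) =
          ∫ s in S, planeNormal p γ s i • ψ (sheet' γ (s, z)) := by
        intro z
        simp_rw [fun x => hunit x z]
        refine h.integral_fderiv hU hc hb (measurable_planeNormal p h.continuous)
          (fun s hs => isPlaneNormal_planeNormal h hU hc hρ hball hs)
          (fun s hs w hw => h.eq_planeNormal hρ hball hs hw) i (hψ.comp ?_)
        have : (fun x : E2 => lift x z) = fun x => WithLp.toLp 2 ![x 0, x 1, z] := rfl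
        rw [this]
        refine (PiLp.contDiff_toLp).comp (contDiff_pi.2 fun k => ?_)
        fin_cases k <;> simp <;> fun_prop
      have hcoord : AEStronglyMeasurable (fun x => ν x j) (surfaceMeasure P) :=
        (by fun_prop : Continuous fun w : E3 => w j).comp_aestronglyMeasurable hmeas
      have hFm : AEStronglyMeasurable (fun x => ν x j • ψ x) (surfaceMeasure P) :=
        hcoord.smul hψ.continuous.aestronglyMeasurable
      have hFint : Integrable (fun x => ν x j • ψ x) (surfaceMeasure P) := by
        have : IsFiniteMeasureOnCompacts (surfaceMeasure P) := ⟨fun K hK => by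
          obtain ⟨R, hR⟩ := hK.isBounded.subset_ball 0
          exact (measure_mono hR).trans_lt (hfin R)⟩
        refine (hψ.continuous.integrable_of_hasCompactSupport hψc).mono hFm ?_
        filter_upwards [hspec] with x hx
        have h1 := PiLp.norm_apply_le (ν x) j
        rw [hx.1] at h1
        rw [norm_smul]
        exact mul_le_of_le_one_left (norm_nonneg _) h1
      rw [hvol, hprodU, integral_prod_symm _ hint]
      simp_rw [hslice]
      have hFm' := hFm
      have hFi := hFint
      rw [hσ] at hFm' hFi ⊢
      rw [integral_map hcont.aemeasurable hFm', integral_prod_symm]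
      · refine integral_congr_ae (Eventually.of_forall fun z => ?_)
        refine setIntegral_congr_fun h.isOpen.measurableSet fun s hs => ?_
        simp only
        rw [hνΓ s hs z, hij]
        fin_cases i <;> rfl
      · exact (integrable_map_measure hFm' hcont.aemeasurable).1 hFi

end Cyl

end MaxwellCylinder

namespace MaxwellCylinder

/-! ### Mollification -/

/-- A smooth nonnegative function with integral `1`, supported in the ball of radius `r`. -/
noncomputable def kernel (r : ℝ) (hr : 0 < r) : E3 → ℝ :=
  (ContDiffBump.mk (c := (0 : E3)) (r / 2) r (by positivity) (by linarith)).normed volume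

section Kernel

variable {r : ℝ} {hr : 0 < r}

lemma contDiff_kernel {n : ℕ∞} : ContDiff ℝ n (kernel r hr) := ContDiffBump.contDiff_normed _

lemma hasCompactSupport_kernel : HasCompactSupport (kernel r hr) :=
  ContDiffBump.hasCompactSupport_normed _

lemma kernel_nonneg (x : E3) : 0 ≤ kernel r hr x := ContDiffBump.nonneg_normed _ x

lemma integral_kernel : ∫ x, kernel r hr x = 1 := ContDiffBump.integral_normed _

lemma continuous_kernel : Continuous (kernel r hr) := (contDiff_kernel (n := 0)).continuous

lemma integrable_kernel : Integrable (kernel r hr) :=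
  continuous_kernel.integrable_of_hasCompactSupport hasCompactSupport_kernel

lemma kernel_eq_zero {x : E3} (hx : r ≤ ‖x‖) : kernel r hr x = 0 := by
  have h : Function.support (kernel r hr) = Metric.ball 0 r := ContDiffBump.support_normed_eq _
  by_contra h0
  have : x ∈ Metric.ball (0 : E3) r := h ▸ h0
  simp at this
  linarith

lemma lintegral_kernel : ∫⁻ x, ‖kernel r hr x‖ₑ = 1 := by
  have h := ofReal_integral_eq_lintegral_ofReal (integrable_kernel (r := r) (hr := hr))
    (Eventually.of_forall kernel_nonneg)
  rw [integral_kernel, ENNReal.ofReal_one] at h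
  rw [h]
  refine lintegral_congr fun x => ?_
  rw [Real.enorm_eq_ofReal (kernel_nonneg x)]

end Kernel

section Mollify

variable {F : Type*} [NormedAddCommGroup F] [NormedSpace ℝ F]

/-- The convolution of `G` with `k`. -/
noncomputable def mollify (k : E3 → ℝ) (G : E3 → F) (x : E3) : F := ∫ y, k (x - y) • G y

lemma mollify_eq_convolution (k : E3 → ℝ) (G : E3 → F) :
    mollify k G = convolution k G (ContinuousLinearMap.lsmul ℝ ℝ) volume := by
  funext x
  rw [convolution_lsmul_swap]
  rfl

variable {k : E3 → ℝ} {G : E3 → F}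

lemma contDiff_mollify (hk : ContDiff ℝ ∞ k) (hkc : HasCompactSupport k)
    (hG : LocallyIntegrable G) : ContDiff ℝ ∞ (mollify k G) := by
  rw [mollify_eq_convolution]
  exact hkc.contDiff_convolution_left _ hk hG

lemma fderiv_mollify [CompleteSpace F] (hk : ContDiff ℝ ∞ k) (hkc : HasCompactSupport k)
    (hG : LocallyIntegrable G) (x e : E3) :
    fderiv ℝ (mollify k G) x e = ∫ y, fderiv ℝ k (x - y) e • G y := by
  rw [mollify_eq_convolution]
  have h := hkc.hasFDerivAt_convolution_left (ContinuousLinearMap.lsmul ℝ ℝ)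
    (hk.of_le (by exact_mod_cast le_top)) hG x
  rw [h.fderiv]
  have hex : ConvolutionExistsAt (fderiv ℝ k) G x
      ((ContinuousLinearMap.lsmul ℝ ℝ).precompL E3) volume :=
    (hkc.fderiv ℝ).convolutionExists_left _
      (hk.continuous_fderiv (by simp)) hG x
  rw [convolution_eq_swap, ContinuousLinearMap.integral_apply hex.integrable_swap]
  rfl

end Mollify

/-- The kernels of radius `r_n → 0` form an approximate identity. -/
lemma ae_tendsto_mollify {F : Type*} [NormedAddCommGroup F] [NormedSpace ℝ F] [CompleteSpace F]
    {G : E3 → F} (hG : LocallyIntegrable G)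
    {r : ℕ → ℝ} (hr : ∀ n, 0 < r n) (hlim : Tendsto r atTop (𝓝 0)) :
    ∀ᵐ x, Tendsto (fun n => mollify (kernel (r n) (hr n)) G x) atTop (𝓝 (G x)) := by
  simp_rw [mollify_eq_convolution]
  exact ContDiffBump.ae_convolution_tendsto_right_of_locallyIntegrable (K := 2)
    (φ := fun n => ContDiffBump.mk (c := (0 : E3)) (r n / 2) (r n)
      (by have := hr n; positivity) (by have := hr n; linarith)) hlim
    (Eventually.of_forall fun n => by simp; linarith) hG

lemma enorm_clm_le_sum {F : Type*} [NormedAddCommGroup F] [NormedSpace ℝ F] (A : E3 →L[ℝ] F) :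
    ‖A‖ₑ ≤ ∑ j, ‖A (unitVec j)‖ₑ := by
  have h : ‖A‖ ≤ ∑ j, ‖A (unitVec j)‖ := by
    refine A.opNorm_le_bound (Finset.sum_nonneg fun _ _ => norm_nonneg _) fun x => ?_
    have hx : x = ∑ j, x j • unitVec j := by
      ext i; fin_cases i <;> simp [unitVec, Fin.sum_univ_three]
    conv_lhs => rw [hx, map_sum]
    rw [Finset.sum_mul]
    refine (norm_sum_le _ _).trans (Finset.sum_le_sum fun j _ => ?_)
    rw [map_smul, norm_smul, mul_comm]
    exact mul_le_mul_of_nonneg_left (PiLp.norm_apply_le x j) (norm_nonneg _)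
  have h2 : ∀ j, ‖A (unitVec j)‖ₑ = ENNReal.ofReal ‖A (unitVec j)‖ := fun j => (ofReal_norm _).symm
  rw [← ofReal_norm, Finset.sum_congr rfl fun j _ => h2 j,
    ← ENNReal.ofReal_sum_of_nonneg fun _ _ => norm_nonneg _]
  exact ENNReal.ofReal_le_ofReal h

lemma norm_unitVec (j : Fin 3) : ‖unitVec j‖ = 1 := by simp [unitVec]

lemma enorm_apply_unitVec_le {F : Type*} [NormedAddCommGroup F] [NormedSpace ℝ F]
    (A : E3 →L[ℝ] F) (j : Fin 3) : ‖A (unitVec j)‖ₑ ≤ ‖A‖ₑ := by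
  rw [← ofReal_norm, ← ofReal_norm]
  exact ENNReal.ofReal_le_ofReal (by simpa [norm_unitVec] using A.le_opNorm (unitVec j))

/-! ### The trace inequality on the boundary of the cylinder. -/

section Trace

variable {P : Set E3} {ν : E3 → E3} {c : E3} {ρ D : ℝ}

lemma IsGaussCylinder.isFiniteMeasureOnCompacts (h : IsGaussCylinder P ν c ρ D) :
    IsFiniteMeasureOnCompacts (surfaceMeasure P) := ⟨fun K hK => by
  obtain ⟨R, hR⟩ := hK.isBounded.subset_ball 0
  exact (measure_mono hR).trans_lt (h.finite_ball R)⟩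

lemma fderiv_mul_coord {φ : E3 → ℝ} (hφ : Differentiable ℝ φ) (c x : E3) (j : Fin 3) :
    fderiv ℝ (fun x => φ x * (x j - c j)) x (unitVec j) =
      φ x + (x j - c j) * fderiv ℝ φ x (unitVec j) := by
  have h1 : HasFDerivAt (fun x : E3 => x j - c j) (EuclideanSpace.proj (𝕜 := ℝ) j) x :=
    (EuclideanSpace.proj (𝕜 := ℝ) j).hasFDerivAt.sub_const _
  have h2 : HasFDerivAt (fun x => φ x * (x j - c j)) _ x := (hφ x).hasFDerivAt.mul h1
  rw [h2.fderiv]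
  simp [unitVec]

/-- The trace inequality in `W¹_1`. -/
lemma IsGaussCylinder.lintegral_surface_le (h : IsGaussCylinder P ν c ρ D) :
    ∃ C : NNReal, ∀ φ : E3 → ℝ, ContDiff ℝ 1 φ → HasCompactSupport φ → (∀ x, 0 ≤ φ x) →
      ∫⁻ x, ‖φ x‖ₑ ∂surfaceMeasure P ≤ C * ∫⁻ x in P, (‖φ x‖ₑ + ‖fderiv ℝ φ x‖ₑ) := by
  have hfc := h.isFiniteMeasureOnCompacts
  have hD : 0 ≤ D := (abs_nonneg _).trans (h.hor_le c (subset_closure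
    (h.ball_subset (Metric.mem_ball_self h.rho_pos)))).1
  -- Two horizontal directions cost `1 + D` each, and `ρ` is the lower bound of the normal component
  -- of `x - c`.
  refine ⟨(ρ⁻¹ * (2 + 2 * D)).toNNReal, fun φ hφ hφc hφ0 => ?_⟩
  have hdiff := hφ.differentiable (by norm_num)
  have hdc : Continuous (fderiv ℝ φ) := hφ.continuous_fderiv (by norm_num)
  have hφi := hφ.continuous.integrable_of_hasCompactSupport hφc (μ := volume.restrict P)
  have hφs := hφ.continuous.integrable_of_hasCompactSupport hφc (μ := surfaceMeasure P)
  have hdi := hdc.integrable_of_hasCompactSupport (hφc.fderiv ℝ) (μ := volume.restrict P)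
  -- The divergence theorem is applied to `φ (x_j - c_j)` for `j = 0, 1` only: the horizontal part
  -- of `x - c` is bounded by `D`, and it alone already has normal component at least `ρ`.
  have hψ : ∀ j, ContDiff ℝ 1 fun x : E3 => φ x * (x j - c j) := fun j =>
    hφ.mul ((EuclideanSpace.proj (𝕜 := ℝ) j).contDiff.sub contDiff_const)
  have hψc : ∀ j, HasCompactSupport fun x : E3 => φ x * (x j - c j) := fun j => hφc.mul_right
  have hψi : ∀ j, Integrable (fun x => ν x j • (φ x * (x j - c j))) (surfaceMeasure P) := by
    intro j
    refine ((hψ j).continuous.integrable_of_hasCompactSupport (hψc j)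
      (μ := surfaceMeasure P)).mono ?_ ?_
    · exact ((by fun_prop : Continuous fun w : E3 => w j).comp_aestronglyMeasurable
        h.measurable_normal).smul (hψ j).continuous.aestronglyMeasurable
    · filter_upwards [h.norm_normal] with x hx
      have h1 := PiLp.norm_apply_le (ν x) j
      rw [hx] at h1
      rw [norm_smul]
      exact mul_le_of_le_one_left (norm_nonneg _) h1
  have hG : ∀ j, ∫ x, ν x j • (φ x * (x j - c j)) ∂surfaceMeasure P =
      ∫ x in P, (φ x + (x j - c j) * fderiv ℝ φ x (unitVec j)) := by
    intro j
    rw [← h.divergence _ (hψ j) (hψc j) j]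
    exact integral_congr_ae (Eventually.of_forall fun x => fderiv_mul_coord hdiff c x j)
  have hb : ∀ j : Fin 3, (∀ x ∈ P, |x j - c j| ≤ D) →
      ∫ x in P, (φ x + (x j - c j) * fderiv ℝ φ x (unitVec j)) ≤
        (1 + D) * ∫ x in P, (‖φ x‖ + ‖fderiv ℝ φ x‖) := by
    intro j hj
    rw [← integral_const_mul]
    have hcont : Continuous fun x : E3 => φ x + (x j - c j) * fderiv ℝ φ x (unitVec j) :=
      hφ.continuous.add (((by fun_prop : Continuous fun x : E3 => x j - c j)).mul
        (hdc.clm_apply continuous_const))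
    have hdom : Integrable (fun x => (1 + D) * (‖φ x‖ + ‖fderiv ℝ φ x‖)) (volume.restrict P) :=
      (hφi.norm.add hdi.norm).const_mul _
    have hpt : ∀ x ∈ P, ‖φ x + (x j - c j) * fderiv ℝ φ x (unitVec j)‖ ≤
        (1 + D) * (‖φ x‖ + ‖fderiv ℝ φ x‖) := by
      intro x hx
      have h1 : ‖fderiv ℝ φ x (unitVec j)‖ ≤ ‖fderiv ℝ φ x‖ := by
        simpa [norm_unitVec] using (fderiv ℝ φ x).le_opNorm (unitVec j)
      have h2 := hj x hx
      calc _ ≤ ‖φ x‖ + |x j - c j| * ‖fderiv ℝ φ x (unitVec j)‖ := by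
            refine (norm_add_le _ _).trans ?_
            rw [norm_mul, Real.norm_eq_abs (x j - c j)]
        _ ≤ ‖φ x‖ + D * ‖fderiv ℝ φ x‖ := by gcongr
        _ ≤ _ := by nlinarith [norm_nonneg (φ x), norm_nonneg (fderiv ℝ φ x)]
    refine integral_mono_ae ?_ hdom ?_
    · refine hdom.mono' hcont.aestronglyMeasurable ?_
      filter_upwards [ae_restrict_mem h.isOpen.measurableSet] with x hx using hpt x hx
    · filter_upwards [ae_restrict_mem h.isOpen.measurableSet] with x hx
      exact (le_abs_self _).trans (hpt x hx)
  have hmain : ρ * ∫ x, ‖φ x‖ ∂surfaceMeasure P ≤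
      (2 + 2 * D) * ∫ x in P, (‖φ x‖ + ‖fderiv ℝ φ x‖) := by
    calc ρ * ∫ x, ‖φ x‖ ∂surfaceMeasure P
        = ∫ x, ρ * ‖φ x‖ ∂surfaceMeasure P := (integral_const_mul _ _).symm
      _ ≤ ∫ x, (ν x 0 • (φ x * (x 0 - c 0)) + ν x 1 • (φ x * (x 1 - c 1))) ∂surfaceMeasure P := by
          refine integral_mono_ae (hφs.norm.const_mul _) ((hψi 0).add (hψi 1)) ?_
          filter_upwards [h.le_inner_normal] with x hx
          simp only [smul_eq_mul]
          rw [Real.norm_of_nonneg (hφ0 x)]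
          nlinarith [mul_le_mul_of_nonneg_right hx (hφ0 x)]
      _ ≤ _ := by
          rw [integral_add (hψi 0) (hψi 1), hG, hG]
          have h1 := hb 0 fun x hx => (h.hor_le x (subset_closure hx)).1
          have h2 := hb 1 fun x hx => (h.hor_le x (subset_closure hx)).2
          linarith
  have hle : ∫ x, ‖φ x‖ ∂surfaceMeasure P ≤
      (ρ⁻¹ * (2 + 2 * D)) * ∫ x in P, (‖φ x‖ + ‖fderiv ℝ φ x‖) := by
    have hρ := h.rho_pos
    rw [mul_assoc, ← div_eq_inv_mul, le_div_iff₀ hρ]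
    linarith
  have e1 := ofReal_integral_norm_eq_lintegral_enorm hφs
  have e2 : ENNReal.ofReal (∫ x in P, (‖φ x‖ + ‖fderiv ℝ φ x‖)) =
      ∫⁻ x in P, (‖φ x‖ₑ + ‖fderiv ℝ φ x‖ₑ) := by
    have hi : Integrable (fun x => ‖φ x‖ + ‖fderiv ℝ φ x‖) (volume.restrict P) :=
      hφi.norm.add hdi.norm
    rw [ofReal_integral_eq_lintegral_ofReal hi
      (Eventually.of_forall fun x => add_nonneg (norm_nonneg _) (norm_nonneg _))]
    refine lintegral_congr fun x => ?_
    rw [ENNReal.ofReal_add (norm_nonneg _) (norm_nonneg _), ofReal_norm, ofReal_norm]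
  rw [← e1, ← e2, ENNReal.ofNNReal_toNNReal, ← ENNReal.ofReal_mul (by
    have := h.rho_pos; positivity)]
  exact ENNReal.ofReal_le_ofReal hle

end Trace

end MaxwellCylinder

namespace MaxwellCylinder

/-! ### Sobolev inequalities in the cylinder -/

section Sobolev

variable {P : Set E3} {ν : E3 → E3} {c : E3} {ρ D : ℝ}

lemma fderiv_kernel_mul {k φ : E3 → ℝ} (hk : ContDiff ℝ 1 k) (hφ : ContDiff ℝ 1 φ) (x y e : E3) :
    fderiv ℝ (fun y => k (x - y) * φ y) y e =
      k (x - y) * fderiv ℝ φ y e - fderiv ℝ k (x - y) e * φ y := by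
  have h1 : HasFDerivAt (fun y => x - y) (-ContinuousLinearMap.id ℝ E3) y := by
    simpa using (hasFDerivAt_id y).const_sub x
  have h2 : HasFDerivAt (fun y => k (x - y)) _ y :=
    ((hk.differentiable (by norm_num)) (x - y)).hasFDerivAt.comp y h1
  have h3 : HasFDerivAt (fun y => k (x - y) * φ y) _ y :=
    h2.mul ((hφ.differentiable (by norm_num)) y).hasFDerivAt
  rw [h3.fderiv]
  simp only [add_apply, smul_apply,
    ContinuousLinearMap.comp_apply, neg_apply, ContinuousLinearMap.id_apply,
    map_neg, smul_eq_mul]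
  ring

/-- The distributional gradient of the extension of `φ` by zero is `∇φ` on `P` minus the surface
layer `φ ν dS`; this is its mollified form. -/
lemma IsGaussCylinder.fderiv_mollify_indicator (h : IsGaussCylinder P ν c ρ D) {k φ : E3 → ℝ}
    (hk : ContDiff ℝ ∞ k) (hkc : HasCompactSupport k) (hφ : ContDiff ℝ 1 φ)
    (hφc : HasCompactSupport φ) (x : E3) (j : Fin 3) :
    fderiv ℝ (mollify k (P.indicator φ)) x (unitVec j) =
      (∫ y in P, k (x - y) * fderiv ℝ φ y (unitVec j)) -
        ∫ y, ν y j * (k (x - y) * φ y) ∂surfaceMeasure P := by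
  have hPm := h.isOpen.measurableSet
  have hk1 : ContDiff ℝ 1 k := hk.of_le (by exact_mod_cast le_top)
  have hφi := hφ.continuous.integrable_of_hasCompactSupport hφc (μ := volume)
  have hsub : Continuous fun y : E3 => x - y := by fun_prop
  rw [fderiv_mollify hk hkc (hφi.indicator hPm).locallyIntegrable]
  have h1 : ∀ y, fderiv ℝ k (x - y) (unitVec j) • P.indicator φ y =
      P.indicator (fun y => fderiv ℝ k (x - y) (unitVec j) * φ y) y := by
    intro y
    by_cases hy : y ∈ P <;> simp [hy]
  simp_rw [h1]
  rw [integral_indicator hPm]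
  have hψ : ContDiff ℝ 1 fun y => k (x - y) * φ y :=
    (hk1.comp (contDiff_const.sub contDiff_id)).mul hφ
  have hdiv := h.divergence _ hψ hφc.mul_left j
  simp_rw [smul_eq_mul] at hdiv
  rw [← hdiv]
  simp_rw [fderiv_kernel_mul hk1 hφ]
  have hc1 : Continuous fun y => k (x - y) * fderiv ℝ φ y (unitVec j) :=
    (hk.continuous.comp hsub).mul ((hφ.continuous_fderiv (by norm_num)).clm_apply continuous_const)
  have hc2 : Continuous fun y => fderiv ℝ k (x - y) (unitVec j) * φ y :=
    (((hk1.continuous_fderiv (by norm_num)).comp hsub).clm_apply continuous_const).mul hφ.continuous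
  have hs1 : HasCompactSupport fun y => k (x - y) * fderiv ℝ φ y (unitVec j) :=
    HasCompactSupport.mul_left
      ((hφc.fderiv ℝ).comp_left (g := fun A : E3 →L[ℝ] ℝ => A (unitVec j)) rfl)
  have hs2 : HasCompactSupport fun y => fderiv ℝ k (x - y) (unitVec j) * φ y := hφc.mul_left
  rw [integral_sub (hc1.integrable_of_hasCompactSupport hs1)
    (hc2.integrable_of_hasCompactSupport hs2)]
  ring

lemma lintegral_enorm_kernel_sub {r : ℝ} {hr : 0 < r} (y : E3) :
    ∫⁻ x, ‖kernel r hr (x - y)‖ₑ = 1 := by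
  rw [lintegral_sub_right_eq_self (fun x => ‖kernel r hr x‖ₑ) y, lintegral_kernel]

/-- Tonelli, with total mass one of the kernel. The measure `m` is general because the lemma is used
for the volume and for the surface layer. -/
lemma lintegral_lintegral_kernel {r : ℝ} {hr : 0 < r} {m : Measure E3} [SFinite m] {g : E3 → ℝ≥0∞}
    (hg : AEMeasurable g m) :
    ∫⁻ x, ∫⁻ y, ‖kernel r hr (x - y)‖ₑ * g y ∂m = ∫⁻ y, g y ∂m := by
  have hc : Continuous fun p : E3 × E3 => kernel r hr (p.1 - p.2) :=
    continuous_kernel.comp (continuous_fst.sub continuous_snd)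
  rw [lintegral_lintegral_swap]
  · refine lintegral_congr fun y => ?_
    rw [lintegral_mul_const'' _ (by
      exact (continuous_kernel.comp (continuous_sub_right y)).measurable.enorm.aemeasurable),
      lintegral_enorm_kernel_sub, one_mul]
  · exact (hc.measurable.enorm.aemeasurable).mul hg.comp_snd

lemma IsGaussCylinder.sigmaFinite (h : IsGaussCylinder P ν c ρ D) :
    SigmaFinite (surfaceMeasure P) := by
  have := h.isFiniteMeasureOnCompacts
  infer_instance

/-- The extension of `φ` by zero is mollified, and the Gagliardo-Nirenberg-Sobolev inequality in
`ℝ³` is applied. The `L₁` norm of the gradient stays bounded, as the surface layer is controlled by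
the trace inequality; letting the radius tend to zero, Fatou gives the bound on `P`. -/
lemma IsGaussCylinder.eLpNorm_three_halves_le (h : IsGaussCylinder P ν c ρ D) :
    ∃ C : NNReal, ∀ φ : E3 → ℝ, ContDiff ℝ 1 φ → HasCompactSupport φ → (∀ x, 0 ≤ φ x) →
      eLpNorm φ (3 / 2) (volume.restrict P) ≤ C * ∫⁻ x in P, (‖φ x‖ₑ + ‖fderiv ℝ φ x‖ₑ) := by
  obtain ⟨C, hC⟩ := h.lintegral_surface_le
  have hfc := h.isFiniteMeasureOnCompacts
  have hsf := h.sigmaFinite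
  have hPm := h.isOpen.measurableSet
  set K := eLpNormLESNormFDerivOneConst (volume : Measure E3) (3 / 2) with hK
  refine ⟨K * (3 * (1 + C)), fun φ hφ hφc hφ0 => ?_⟩
  set W := ∫⁻ x in P, (‖φ x‖ₑ + ‖fderiv ℝ φ x‖ₑ) with hW
  have hφi := hφ.continuous.integrable_of_hasCompactSupport hφc (μ := volume)
  have hGi := hφi.indicator hPm
  have hdc : Continuous (fderiv ℝ φ) := hφ.continuous_fderiv (by norm_num)
  let r : ℕ → ℝ := fun n => 1 / (n + 1)
  have hr : ∀ n, 0 < r n := fun n => by positivity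
  have hlim : Tendsto r atTop (𝓝 0) := tendsto_one_div_add_atTop_nhds_zero_nat
  let u : ℕ → E3 → ℝ := fun n => mollify (kernel (r n) (hr n)) (P.indicator φ)
  have hu : ∀ n, ContDiff ℝ ∞ (u n) := fun n =>
    contDiff_mollify contDiff_kernel hasCompactSupport_kernel hGi.locallyIntegrable
  have huc : ∀ n, HasCompactSupport (u n) := fun n => by
    simp only [u, mollify_eq_convolution]
    refine hasCompactSupport_kernel.convolution _ ?_
    refine hφc.mono' (subset_trans ?_ subset_closure)
    rw [support_indicator]
    exact inter_subset_right
  have hder : ∀ n, eLpNorm (fderiv ℝ (u n)) 1 volume ≤ 3 * (1 + C) * W := by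
    intro n
    rw [eLpNorm_one_eq_lintegral_enorm]
    have hpt : ∀ x, ‖fderiv ℝ (u n) x‖ₑ ≤ 3 * ((∫⁻ y in P, ‖kernel (r n) (hr n) (x - y)‖ₑ *
        ‖fderiv ℝ φ y‖ₑ) + ∫⁻ y, ‖kernel (r n) (hr n) (x - y)‖ₑ * ‖φ y‖ₑ ∂surfaceMeasure P) := by
      intro x
      refine (enorm_clm_le_sum _).trans ?_
      refine (Finset.sum_le_card_nsmul _ _ _ fun j _ => ?_).trans_eq (by
        rw [Finset.card_univ, Fintype.card_fin, nsmul_eq_mul, Nat.cast_ofNat])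
      rw [h.fderiv_mollify_indicator contDiff_kernel hasCompactSupport_kernel hφ hφc]
      refine (enorm_sub_le).trans (add_le_add ?_ ?_)
      · refine (enorm_integral_le_lintegral_enorm _).trans (lintegral_mono fun y => ?_)
        rw [enorm_mul]
        gcongr
        exact enorm_apply_unitVec_le _ j
      · refine (enorm_integral_le_lintegral_enorm _).trans (lintegral_mono_ae ?_)
        filter_upwards [h.norm_normal] with y hy
        rw [enorm_mul, enorm_mul]
        refine mul_le_of_le_one_left zero_le ?_
        rw [← ofReal_norm]
        have := PiLp.norm_apply_le (ν y) j
        rw [hy] at this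
        exact ENNReal.ofReal_le_one.2 this
    refine (lintegral_mono hpt).trans ?_
    have hm1 : Measurable fun x => ∫⁻ y in P, ‖kernel (r n) (hr n) (x - y)‖ₑ *
        ‖fderiv ℝ φ y‖ₑ := by
      refine Measurable.lintegral_prod_right' (f := fun p : E3 × E3 =>
        ‖kernel (r n) (hr n) (p.1 - p.2)‖ₑ * ‖fderiv ℝ φ p.2‖ₑ) ?_
      exact ((continuous_kernel.comp (continuous_fst.sub continuous_snd)).enorm.measurable).mul
        (hdc.comp continuous_snd).enorm.measurable
    rw [lintegral_const_mul' _ _ (by simp), lintegral_add_left hm1,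
      lintegral_lintegral_kernel hdc.enorm.measurable.aemeasurable,
      lintegral_lintegral_kernel hφ.continuous.enorm.measurable.aemeasurable, mul_assoc]
    gcongr
    rw [add_mul, one_mul]
    gcongr
    · exact lintegral_mono fun y => le_add_self
    · exact hC φ hφ hφc hφ0
  have hp : NNReal.HolderConjugate (Module.finrank ℝ E3) (3 / 2 : NNReal) := by
    rw [finrank_euclideanSpace_fin]
    rw [NNReal.holderConjugate_iff]
    refine ⟨by norm_num, ?_⟩
    apply NNReal.eq
    push_cast
    norm_num
  have hcoe : ((3 / 2 : NNReal) : ℝ≥0∞) = 3 / 2 := by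
    rw [ENNReal.coe_div (by norm_num)]; simp
  have hbound : ∀ n, eLpNorm (u n) (3 / 2) (volume.restrict P) ≤ (K * (3 * (1 + C)) : NNReal) * W := by
    intro n
    refine (eLpNorm_mono_measure _ Measure.restrict_le_self).trans ?_
    have := eLpNorm_le_eLpNorm_fderiv_one (volume : Measure E3)
      ((hu n).of_le (by exact_mod_cast le_top)) (huc n) hp
    rw [hcoe] at this
    refine this.trans ?_
    push_cast
    rw [mul_assoc]
    gcongr
    exact hder n
  refine Lp.eLpNorm_le_of_ae_tendsto (f := u) (u := atTop) (Eventually.of_forall hbound)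
    (fun n => (hu n).continuous.aestronglyMeasurable) ?_
  filter_upwards [ae_restrict_of_ae (ae_tendsto_mollify hGi.locallyIntegrable hr hlim),
    ae_restrict_mem hPm] with x hx hxP
  rwa [indicator_of_mem hxP] at hx

end Sobolev

end MaxwellCylinder

/-! ### Sobolev and trace inequalities in `W¹_p` from those in `W¹_1`. -/

namespace MaxwellCylinder

/-- The inequality `‖ψ‖_{L_r(m)} ≤ C ‖ψ‖_{W¹_p(P)}` for smooth functions with compact support. -/
def SobolevBound (P : Set E3) (m : Measure E3) (r p : ℝ≥0∞) : Prop :=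
  ∃ C : NNReal, ∀ ψ : E3 → ℝ, ContDiff ℝ 1 ψ → HasCompactSupport ψ →
    eLpNorm ψ r m ≤
      C * (eLpNorm ψ p (volume.restrict P) + eLpNorm (fderiv ℝ ψ) p (volume.restrict P))

section Powers

variable {P : Set E3}

lemma eLpNorm_pow_even {m : Measure E3} {ψ : E3 → ℝ} {k : ℕ} (hk0 : 0 < k) (s : ℝ≥0∞) :
    eLpNorm (fun x => ‖ψ x‖ ^ k) s m = eLpNorm ψ (s * k) m ^ k := by
  have h := eLpNorm_norm_rpow (μ := m) (p := s) ψ (q := k) (by exact_mod_cast hk0)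
  simpa [Real.rpow_natCast, ENNReal.rpow_natCast] using h

/-- The gradient of `ψ^{k+1}` is `(k+1) ψ^k ∇ψ`; Hölder with exponents `q` and `p` separates `ψ^k`
from `ψ` and `∇ψ`. -/
lemma lintegral_pow_even_le {ψ : E3 → ℝ} {k : ℕ} (hk0 : 0 < k) {p q : ℝ≥0∞}
    (hpq : ENNReal.HolderTriple q p 1) (hψ : ContDiff ℝ 1 ψ) :
    ∫⁻ x in P, (‖ψ x ^ (k + 1)‖ₑ + ‖fderiv ℝ (fun x => ψ x ^ (k + 1)) x‖ₑ) ≤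
      (k + 1 : ℕ) * (eLpNorm ψ (q * k) (volume.restrict P) ^ k *
        (eLpNorm ψ p (volume.restrict P) + eLpNorm (fderiv ℝ ψ) p (volume.restrict P))) := by
  have hd : ∀ x, fderiv ℝ (fun x => ψ x ^ (k + 1)) x = ((k + 1 : ℕ) * ψ x ^ k) • fderiv ℝ ψ x := by
    intro x
    have := ((hψ.differentiable (by norm_num)) x).hasFDerivAt.pow (k + 1)
    rw [this.fderiv]
    simp
  have hc := hψ.continuous
  have hdc : Continuous (fderiv ℝ ψ) := hψ.continuous_fderiv (by norm_num)
  have hpow : AEStronglyMeasurable (fun x => ‖ψ x‖ ^ k) (volume.restrict P) :=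
    (hc.norm.pow k).aestronglyMeasurable
  have hm : Measurable fun x => ‖ψ x‖ₑ ^ k * ‖ψ x‖ₑ := (hc.enorm.measurable.pow_const k).mul hc.enorm.measurable
  have h1 : ∫⁻ x in P, ‖ψ x‖ₑ ^ k * ‖ψ x‖ₑ ≤ eLpNorm ψ (q * k) (volume.restrict P) ^ k *
      eLpNorm ψ p (volume.restrict P) := by
    have := eLpNorm_smul_le_mul_eLpNorm (hc.aestronglyMeasurable (μ := volume.restrict P)) hpow
      (hpqr := hpq)
    rw [eLpNorm_pow_even hk0, eLpNorm_one_eq_lintegral_enorm] at this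
    convert this using 3 with x
    simp [enorm_mul, enorm_pow]
  have h2 : ∫⁻ x in P, ‖ψ x‖ₑ ^ k * ‖fderiv ℝ ψ x‖ₑ ≤ eLpNorm ψ (q * k) (volume.restrict P) ^ k *
      eLpNorm (fderiv ℝ ψ) p (volume.restrict P) := by
    have := eLpNorm_smul_le_mul_eLpNorm (hdc.aestronglyMeasurable (μ := volume.restrict P)) hpow
      (hpqr := hpq)
    rw [eLpNorm_pow_even hk0, eLpNorm_one_eq_lintegral_enorm] at this
    convert this using 3 with x
    simp [enorm_smul, enorm_pow]
  calc ∫⁻ x in P, (‖ψ x ^ (k + 1)‖ₑ + ‖fderiv ℝ (fun x => ψ x ^ (k + 1)) x‖ₑ)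
      ≤ ∫⁻ x in P, (k + 1 : ℕ) * (‖ψ x‖ₑ ^ k * ‖ψ x‖ₑ + ‖ψ x‖ₑ ^ k * ‖fderiv ℝ ψ x‖ₑ) := by
        refine lintegral_mono fun x => ?_
        rw [hd, enorm_smul, enorm_mul, enorm_pow, enorm_pow, pow_succ, mul_add]
        have hn : ‖((k + 1 : ℕ) : ℝ)‖ₑ = ((k + 1 : ℕ) : ℝ≥0∞) := by
          rw [Real.enorm_natCast]
        rw [hn, mul_assoc]
        refine add_le_add ?_ le_rfl
        exact le_mul_of_one_le_left zero_le (by exact_mod_cast Nat.succ_le_succ (Nat.zero_le k))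
    _ = (k + 1 : ℕ) * ((∫⁻ x in P, ‖ψ x‖ₑ ^ k * ‖ψ x‖ₑ) +
          ∫⁻ x in P, ‖ψ x‖ₑ ^ k * ‖fderiv ℝ ψ x‖ₑ) := by
        rw [lintegral_const_mul' _ _ (by simp), lintegral_add_left hm]
    _ ≤ _ := by
        rw [mul_add (eLpNorm ψ (q * k) (volume.restrict P) ^ k)]
        gcongr

lemma le_of_pow_succ_le {X A : ℝ≥0∞} {k : ℕ} (hX : X ≠ ⊤) (h : X ^ (k + 1) ≤ A * X ^ k) :
    X ≤ A := by
  rcases eq_or_ne X 0 with rfl | h0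
  · exact zero_le
  · rw [pow_succ, mul_comm] at h
    exact (ENNReal.mul_le_mul_iff_left (pow_ne_zero k h0) (ENNReal.pow_ne_top hX)).1 h

lemma abs_pow_even {k : ℕ} (hk : Even k) (y : ℝ) : y ^ k = ‖y‖ ^ k := by
  rw [Real.norm_eq_abs, hk.pow_abs]

/-- Sobolev inequalities follow from the one in `W¹_1` applied to powers of a function. -/
lemma sobolevBound_of_pow {k : ℕ} (hk : Even (k + 1)) (hk0 : 0 < k) {p q : ℝ≥0∞}
    (hpq : ENNReal.HolderTriple q p 1) (hq : q * k = 3 / 2 * (k + 1 : ℕ))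
    (h0 : ∃ C : NNReal, ∀ φ : E3 → ℝ, ContDiff ℝ 1 φ → HasCompactSupport φ → (∀ x, 0 ≤ φ x) →
      eLpNorm φ (3 / 2) (volume.restrict P) ≤ C * ∫⁻ x in P, (‖φ x‖ₑ + ‖fderiv ℝ φ x‖ₑ)) :
    SobolevBound P (volume.restrict P) (3 / 2 * (k + 1 : ℕ)) p := by
  obtain ⟨C, hC⟩ := h0
  refine ⟨C * (k + 1 : ℕ), fun ψ hψ hψc => ?_⟩
  have hpow : HasCompactSupport fun x => ψ x ^ (k + 1) := by
    refine hψc.comp_left (g := fun y : ℝ => y ^ (k + 1)) (by simp)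
  -- As `k + 1` is even, the power is smooth and nonnegative without absolute values.
  have h1 := hC (fun x => ψ x ^ (k + 1)) (hψ.pow _) hpow (fun x => hk.pow_nonneg _)
  have h2 := h1.trans (mul_le_mul_right (lintegral_pow_even_le (P := P) hk0 hpq hψ) _)
  have e : (fun x => ψ x ^ (k + 1)) = fun x => ‖ψ x‖ ^ (k + 1) :=
    funext fun x => abs_pow_even hk (ψ x)
  rw [e, eLpNorm_pow_even (Nat.succ_pos k), hq] at h2
  -- By `hq` the same norm of `ψ` stands on both sides, with power `k + 1` on the left and `k` on
  -- the right. It is finite because `ψ` has compact support, so `k` powers cancel.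
  refine le_of_pow_succ_le (k := k) ?_ (h2.trans_eq ?_)
  · exact (hψ.continuous.memLp_of_hasCompactSupport hψc).eLpNorm_ne_top
  · push_cast; ring_nf

/-- The same insertion of powers, now in an `L₁(m)` bound. The norm of `ψ^k` on the right is
controlled by the Sobolev inequality already obtained, and a `(k+1)`-st root is taken. -/
lemma sobolevBound_of_pow' {m : Measure E3} {k : ℕ} (hk : Even (k + 1)) (hk0 : 0 < k) {p q : ℝ≥0∞}
    (hpq : ENNReal.HolderTriple q p 1) (hq : q * k = 3 / 2 * (k + 1 : ℕ))
    (h0 : ∃ C : NNReal, ∀ φ : E3 → ℝ, ContDiff ℝ 1 φ → HasCompactSupport φ → (∀ x, 0 ≤ φ x) →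
      ∫⁻ x, ‖φ x‖ₑ ∂m ≤ C * ∫⁻ x in P, (‖φ x‖ₑ + ‖fderiv ℝ φ x‖ₑ))
    (hS : SobolevBound P (volume.restrict P) (3 / 2 * (k + 1 : ℕ)) p) :
    SobolevBound P m (k + 1 : ℕ) p := by
  obtain ⟨C, hC⟩ := h0
  obtain ⟨C', hC'⟩ := hS
  refine ⟨(C * (k + 1 : ℕ) * C' ^ k) ^ (1 / ((k + 1 : ℕ) : ℝ)), fun ψ hψ hψc => ?_⟩
  have hpow : HasCompactSupport fun x => ψ x ^ (k + 1) := by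
    refine hψc.comp_left (g := fun y : ℝ => y ^ (k + 1)) (by simp)
  have h1 := hC (fun x => ψ x ^ (k + 1)) (hψ.pow _) hpow (fun x => hk.pow_nonneg _)
  have h2 := h1.trans (mul_le_mul_right (lintegral_pow_even_le (P := P) hk0 hpq hψ) _)
  rw [hq] at h2
  set N := eLpNorm ψ p (volume.restrict P) + eLpNorm (fderiv ℝ ψ) p (volume.restrict P)
  have h3 : eLpNorm ψ (k + 1 : ℕ) m ^ (k + 1) ≤
      ((C * (k + 1 : ℕ) * C' ^ k : NNReal) : ℝ≥0∞) * N ^ (k + 1) := by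
    have e := eLpNorm_pow_even (m := m) (ψ := ψ) (Nat.succ_pos k) 1
    rw [one_mul, eLpNorm_one_eq_lintegral_enorm] at e
    rw [← e]
    simp_rw [← abs_pow_even hk]
    refine h2.trans ?_
    calc (C : ℝ≥0∞) * ((k + 1 : ℕ) * (eLpNorm ψ (3 / 2 * (k + 1 : ℕ)) (volume.restrict P) ^ k * N))
        ≤ C * ((k + 1 : ℕ) * ((C' * N) ^ k * N)) := by
          gcongr
          exact hC' ψ hψ hψc
      _ = _ := by push_cast; ring_nf
  have hk1 : (0 : ℝ) < ((k + 1 : ℕ) : ℝ) := by positivity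
  have h4 := ENNReal.rpow_le_rpow h3 (z := 1 / ((k + 1 : ℕ) : ℝ)) (by positivity)
  rw [ENNReal.mul_rpow_of_nonneg _ _ (by positivity), ← ENNReal.rpow_natCast,
    ← ENNReal.rpow_natCast, ← ENNReal.rpow_mul, ← ENNReal.rpow_mul,
    mul_one_div_cancel hk1.ne', ENNReal.rpow_one, ENNReal.rpow_one] at h4
  rwa [ENNReal.coe_rpow_of_nonneg _ (by positivity)]

end Powers

section Instances

variable {P : Set E3} {ν : E3 → E3} {c : E3} {ρ D : ℝ}

lemma holderTriple_three : ENNReal.HolderTriple 3 (3 / 2) 1 := ⟨by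
  rw [ENNReal.inv_div (by simp) (by simp), inv_one, ENNReal.div_eq_inv_mul, mul_comm]
  nth_rewrite 1 [← one_mul (3 : ℝ≥0∞)⁻¹]
  rw [← add_mul, show (1 : ℝ≥0∞) + 2 = 3 by norm_num, ENNReal.mul_inv_cancel (by simp) (by simp)]⟩

/-- For `p = 3/2` the Hölder partner is `q = 3` and `k = 1`; for `p = 2` below it is `q = 2` and `k
= 3`. The exponents become `3(k+1)/2` in the cylinder and `k+1` on the boundary. -/
lemma IsGaussCylinder.sobolevBound_three (h : IsGaussCylinder P ν c ρ D) :
    SobolevBound P (volume.restrict P) 3 (3 / 2) := by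
  have := sobolevBound_of_pow (P := P) (k := 1) (by decide) one_pos holderTriple_three
    (by rw [Nat.cast_one, mul_one]; norm_num; rw [ENNReal.div_mul_cancel (by simp) (by simp)]) h.eLpNorm_three_halves_le
  have e : (3 / 2 * ((1 + 1 : ℕ) : ℝ≥0∞)) = 3 := by
    norm_num; rw [ENNReal.div_mul_cancel (by simp) (by simp)]
  rwa [e] at this

lemma IsGaussCylinder.sobolevBound_six (h : IsGaussCylinder P ν c ρ D) :
    SobolevBound P (volume.restrict P) 6 2 := by
  have e : (3 / 2 * ((3 + 1 : ℕ) : ℝ≥0∞)) = 6 := by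
    rw [show ((3 + 1 : ℕ) : ℝ≥0∞) = 2 * 2 by norm_num, ← mul_assoc,
      ENNReal.div_mul_cancel (by simp) (by simp)]; norm_num
  have := sobolevBound_of_pow (P := P) (k := 3) (q := 2) (p := 2) (by decide) (by norm_num)
    inferInstance (by rw [e]; norm_num) h.eLpNorm_three_halves_le
  rwa [e] at this

lemma IsGaussCylinder.sobolevBound_surface_two (h : IsGaussCylinder P ν c ρ D) :
    SobolevBound P (surfaceMeasure P) 2 (3 / 2) := by
  have e : (3 / 2 * ((1 + 1 : ℕ) : ℝ≥0∞)) = 3 := by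
    norm_num; rw [ENNReal.div_mul_cancel (by simp) (by simp)]
  have := sobolevBound_of_pow' (P := P) (k := 1) (by decide) one_pos holderTriple_three
    (by rw [e]; norm_num) h.lintegral_surface_le (by rw [e]; exact h.sobolevBound_three)
  simpa using this

lemma IsGaussCylinder.sobolevBound_surface_four (h : IsGaussCylinder P ν c ρ D) :
    SobolevBound P (surfaceMeasure P) 4 2 := by
  have e : (3 / 2 * ((3 + 1 : ℕ) : ℝ≥0∞)) = 6 := by
    rw [show ((3 + 1 : ℕ) : ℝ≥0∞) = 2 * 2 by norm_num, ← mul_assoc,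
      ENNReal.div_mul_cancel (by simp) (by simp)]; norm_num
  have := sobolevBound_of_pow' (P := P) (k := 3) (q := 2) (p := 2) (by decide) (by norm_num)
    inferInstance (by rw [e]; norm_num) h.lintegral_surface_le
    (by rw [e]; exact h.sobolevBound_six)
  simpa using this

end Instances

end MaxwellCylinder

namespace MaxwellCylinder

/-! ### Approximation by smooth functions in convex domains -/

section Approx

variable {F : Type*} [NormedAddCommGroup F] [NormedSpace ℝ F]

/-- The contraction towards `c` with factor `t`. -/
def contraction (c : E3) (t : ℝ) (x : E3) : E3 := c + t • (x - c)

/-- A point `y` near the contracted `x` is the convex combination `t x + (1 - t) z` with `z` in the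
ball about `c`. So contraction makes room for mollification inside `P`. -/
lemma closedBall_contraction_subset {P : Set E3} (hP : Convex ℝ P) {c x : E3} {ρ t r : ℝ}
    (hball : Metric.ball c ρ ⊆ P) (ht0 : 0 < t) (ht1 : t < 1) (hr : r < (1 - t) * ρ) (hx : x ∈ P) :
    Metric.closedBall (contraction c t x) r ⊆ P := by
  intro y hy
  have h1 : 0 < 1 - t := by linarith
  have hz : c + (1 - t)⁻¹ • (y - contraction c t x) ∈ P := by
    refine hball ?_
    rw [Metric.mem_ball, dist_eq_norm, add_sub_cancel_left, norm_smul, norm_inv,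
      Real.norm_of_nonneg h1.le, inv_mul_lt_iff₀ h1, ← dist_eq_norm]
    exact (Metric.mem_closedBall.1 hy).trans_lt hr
  have := hP hx hz ht0.le h1.le (by ring)
  convert this using 1
  rw [smul_add, smul_smul, mul_inv_cancel₀ h1.ne', one_smul, contraction, sub_smul, one_smul,
    smul_sub]
  abel

/-- The Jacobian of the inverse contraction is `t⁻³`, at most `8` for `t ≥ 1/2`. -/
lemma lintegral_contraction_le {c : E3} {t : ℝ} (ht : 1 / 2 ≤ t) {f : E3 → ℝ≥0∞}
    (hf : Measurable f) : ∫⁻ x, f (contraction c t x) ≤ 8 * ∫⁻ x, f x := by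
  have ht0 : 0 < t := by linarith
  have h1 : ∫⁻ x, f (contraction c t x) = ∫⁻ x, f (c + t • x) :=
    lintegral_sub_right_eq_self (fun x => f (c + t • x)) c
  have h2 : ∫⁻ x : E3, f (c + t • x) = ∫⁻ y, f (c + y) ∂(Measure.map (fun x : E3 => t • x) volume) := by
    rw [lintegral_map (by fun_prop) (by fun_prop)]
  rw [h1, h2, Measure.map_addHaar_smul _ ht0.ne', lintegral_smul_measure, lintegral_add_left_eq_self]
  refine mul_le_mul_left ?_ _
  rw [finrank_euclideanSpace_fin, abs_of_nonneg (by positivity)]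
  calc ENNReal.ofReal (t ^ 3)⁻¹ ≤ ENNReal.ofReal 8 := by
        refine ENNReal.ofReal_le_ofReal ?_
        rw [inv_le_comm₀ (by positivity) (by norm_num)]
        calc (8 : ℝ)⁻¹ = (1 / 2) ^ 3 := by norm_num
          _ ≤ t ^ 3 := by gcongr
    _ = 8 := by simp

/-- Jensen's inequality: mollification at `x` is an average over the probability measure with
density `kernel (x - ·)`. -/
lemma enorm_mollify_rpow_le {r : ℝ} {hr : 0 < r} {p : ℝ} (hp : 1 ≤ p) {G : E3 → F}
    (hG : AEStronglyMeasurable G volume) (x : E3) :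
    ‖mollify (kernel r hr) G x‖ₑ ^ p ≤ ∫⁻ y, ‖kernel r hr (x - y)‖ₑ * ‖G y‖ₑ ^ p := by
  have hp0 : 0 < p := by linarith
  have hkc : Continuous fun y : E3 => kernel r hr (x - y) :=
    continuous_kernel.comp (continuous_const.sub continuous_id)
  have hkm : Measurable fun y => ‖kernel r hr (x - y)‖ₑ := hkc.measurable.enorm
  let m := (volume : Measure E3).withDensity fun y => ‖kernel r hr (x - y)‖ₑ
  have hmass : m univ = 1 := by
    rw [withDensity_apply _ MeasurableSet.univ, Measure.restrict_univ,
      lintegral_sub_left_eq_self (fun y => ‖kernel r hr y‖ₑ) x, lintegral_kernel]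
  have hprob : IsProbabilityMeasure m := ⟨hmass⟩
  have hac : m ≪ volume := withDensity_absolutelyContinuous _ _
  have hint : ∀ q : ℝ, 0 ≤ q → ∫⁻ y, ‖kernel r hr (x - y)‖ₑ * ‖G y‖ₑ ^ q = ∫⁻ y, ‖G y‖ₑ ^ q ∂m := by
    intro q hq
    rw [lintegral_withDensity_eq_lintegral_mul₀ hkm.aemeasurable (hG.enorm.pow_const q)]
    rfl
  have h1 : ‖mollify (kernel r hr) G x‖ₑ ≤ eLpNorm G 1 m := by
    rw [eLpNorm_one_eq_lintegral_enorm]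
    refine (enorm_integral_le_lintegral_enorm _).trans_eq ?_
    have := hint 1 zero_le_one
    simp only [ENNReal.rpow_one] at this
    rw [← this]
    exact lintegral_congr fun y => enorm_smul _ _
  have hpp : (1 : ℝ≥0∞) ≤ ENNReal.ofReal p := by rwa [ENNReal.one_le_ofReal]
  have h2 := eLpNorm_le_eLpNorm_of_exponent_le hpp (hG.mono_ac hac)
  have h3 := ENNReal.rpow_le_rpow (h1.trans h2) hp0.le
  rw [hint p hp0.le]
  refine h3.trans_eq ?_
  rw [eLpNorm_eq_lintegral_rpow_enorm_toReal (by simpa using hp0) ENNReal.ofReal_ne_top,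
    ENNReal.toReal_ofReal hp0.le, ← ENNReal.rpow_mul, one_div_mul_cancel hp0.ne', ENNReal.rpow_one]

/-- The approximation operators are bounded in `L_p` uniformly in the radius and in the factor,
which is what the density argument for their convergence needs. -/
lemma eLpNorm_mollify_contraction_le {r : ℝ} {hr : 0 < r} {c : E3} {t : ℝ} (ht : 1 / 2 ≤ t)
    {p : ℝ≥0∞} (hp : 1 ≤ p) (hp' : p ≠ ⊤) {G : E3 → F} (hG : MemLp G p) :
    eLpNorm (fun x => mollify (kernel r hr) G (contraction c t x)) p volume ≤
      8 * eLpNorm G p volume := by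
  have hp1 : 1 ≤ p.toReal := by
    rw [← ENNReal.toReal_one]; exact (ENNReal.toReal_le_toReal (by simp) hp').2 hp
  have hp0 : 0 < p.toReal := by linarith
  have hpne : p ≠ 0 := fun h => by simp [h] at hp0
  rw [eLpNorm_eq_lintegral_rpow_enorm_toReal hpne hp', eLpNorm_eq_lintegral_rpow_enorm_toReal hpne hp']
  have hloc : LocallyIntegrable G := hG.locallyIntegrable hp
  have hcm : Continuous (mollify (kernel r hr) G) :=
    (contDiff_mollify contDiff_kernel hasCompactSupport_kernel hloc).continuous
  have h1 : ∫⁻ x, ‖mollify (kernel r hr) G (contraction c t x)‖ₑ ^ p.toReal ≤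
      8 * ∫⁻ x, ‖G x‖ₑ ^ p.toReal := by
    refine (lintegral_contraction_le (c := c) ht
      (f := fun x => ‖mollify (kernel r hr) G x‖ₑ ^ p.toReal) (hcm.enorm.measurable.pow_const _)).trans ?_
    gcongr 8 * ?_
    refine (lintegral_mono fun x => enorm_mollify_rpow_le hp1 hG.1 x).trans_eq ?_
    exact lintegral_lintegral_kernel (hG.1.enorm.pow_const _)
  calc (∫⁻ x, ‖mollify (kernel r hr) G (contraction c t x)‖ₑ ^ p.toReal) ^ (1 / p.toReal)
      ≤ (8 * ∫⁻ x, ‖G x‖ₑ ^ p.toReal) ^ (1 / p.toReal) := by gcongr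
    _ = 8 ^ (1 / p.toReal) * (∫⁻ x, ‖G x‖ₑ ^ p.toReal) ^ (1 / p.toReal) :=
        ENNReal.mul_rpow_of_nonneg _ _ (by positivity)
    _ ≤ 8 * (∫⁻ x, ‖G x‖ₑ ^ p.toReal) ^ (1 / p.toReal) := by
        gcongr
        calc (8 : ℝ≥0∞) ^ (1 / p.toReal) ≤ 8 ^ (1 : ℝ) := by
              refine ENNReal.rpow_le_rpow_of_exponent_le (by norm_num) ?_
              rw [div_le_one hp0]; exact hp1
          _ = 8 := ENNReal.rpow_one _

end Approx

end MaxwellCylinder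

namespace MaxwellCylinder

/-! ### Local convergence, and the approximating sequence. -/

section LocalLp

variable {F : Type*} [NormedAddCommGroup F]

/-- Convergence in `L_p` on every ball about the origin. -/
def TendstoLpLoc (m : Measure E3) (p : ℝ≥0∞) (φ : ℕ → E3 → F) (g : E3 → F) : Prop :=
  ∀ R : ℝ, Tendsto (fun n => eLpNorm (fun x => φ n x - g x) p (m.restrict (Metric.ball 0 R)))
    atTop (𝓝 0)

/-- Local `L_p` integrability, on every ball about the origin. -/
def MemLpLoc (m : Measure E3) (p : ℝ≥0∞) (g : E3 → F) : Prop :=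
  ∀ R : ℝ, MemLp g p (m.restrict (Metric.ball 0 R))

lemma MemLpLoc.aestronglyMeasurable {m : Measure E3} {p : ℝ≥0∞} {g : E3 → F}
    (h : MemLpLoc m p g) : AEStronglyMeasurable g m := by
  have hu : (⋃ n : ℕ, Metric.ball (0 : E3) n) = univ := Metric.iUnion_ball_nat 0
  rw [← Measure.restrict_univ (μ := m), ← hu]
  exact AEStronglyMeasurable.iUnion fun n => (h n).1

lemma MemLpLoc.locallyIntegrable {m : Measure E3} [IsFiniteMeasureOnCompacts m] {p : ℝ≥0∞}
    (hp : 1 ≤ p) {g : E3 → F} (h : MemLpLoc m p g) : LocallyIntegrable g m := by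
  intro x
  refine ⟨Metric.ball 0 (‖x‖ + 1), Metric.isOpen_ball.mem_nhds (by simp), ?_⟩
  have : IsFiniteMeasure (m.restrict (Metric.ball 0 (‖x‖ + 1))) :=
    ⟨by rw [Measure.restrict_apply_univ]; exact measure_ball_lt_top⟩
  exact (h _).integrable hp

lemma TendstoLpLoc.congr {m : Measure E3} {p : ℝ≥0∞} {φ φ' : ℕ → E3 → F} {g g' : E3 → F}
    (h : TendstoLpLoc m p φ g) (hφ : ∀ n, φ n =ᵐ[m] φ' n) (hg : g =ᵐ[m] g') :
    TendstoLpLoc m p φ' g' := by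
  intro R
  refine (h R).congr fun n => eLpNorm_congr_ae ?_
  filter_upwards [ae_restrict_of_ae (hφ n), ae_restrict_of_ae hg] with x h1 h2
  rw [h1, h2]

lemma TendstoLpLoc.mono_measure {m m' : Measure E3} {p : ℝ≥0∞} {φ : ℕ → E3 → F} {g : E3 → F}
    (h : TendstoLpLoc m p φ g) (hm : m' ≤ m) : TendstoLpLoc m' p φ g := fun R =>
  tendsto_of_tendsto_of_tendsto_of_le_of_le tendsto_const_nhds (h R) (fun _ => zero_le)
    fun _ => eLpNorm_mono_measure _ (Measure.restrict_mono_measure hm _)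

lemma memLpLoc_indicator {P : Set E3} (hP : MeasurableSet P) {p : ℝ≥0∞} {g : E3 → F}
    (hg : MemLpLoc (volume.restrict P) p g) : MemLpLoc volume p (P.indicator g) := by
  intro R
  rw [memLp_indicator_iff_restrict hP, Measure.restrict_comm hP]
  exact hg R

end LocalLp

section Approx

variable {F : Type*} [NormedAddCommGroup F] [NormedSpace ℝ F]

/-- Smooth approximations of `G`: mollifications at scale `ρ / (2 (n + 2))`, composed with the
contraction with factor `1 - 1 / (n + 2)` towards `c`. -/
noncomputable def approx (c : E3) {ρ : ℝ} (hρ : 0 < ρ) (G : E3 → F) (n : ℕ) (x : E3) : F :=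
  mollify (kernel (ρ / (2 * (n + 2))) (by positivity)) G (contraction c (1 - 1 / (n + 2)) x)

variable {c : E3} {ρ : ℝ} {hρ : 0 < ρ} {G : E3 → F}

lemma half_le_factor (n : ℕ) : (1 : ℝ) / 2 ≤ 1 - 1 / (n + 2) := by
  have : (1 : ℝ) / (n + 2) ≤ 1 / 2 := by gcongr; linarith [Nat.cast_nonneg (α := ℝ) n]
  linarith

lemma contDiff_contraction (c : E3) (t : ℝ) : ContDiff ℝ ∞ (contraction c t) := by
  unfold contraction; fun_prop

lemma contDiff_approx (hG : LocallyIntegrable G) (n : ℕ) : ContDiff ℝ ∞ (approx c hρ G n) :=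
  (contDiff_mollify contDiff_kernel hasCompactSupport_kernel hG).comp (contDiff_contraction c _)

lemma dist_contraction (c x : E3) {t : ℝ} (ht : t ≤ 1) :
    dist (contraction c t x) x = (1 - t) * dist x c := by
  rw [dist_eq_norm, contraction, show c + t • (x - c) - x = -((1 - t) • (x - c)) by module,
    norm_neg, norm_smul, Real.norm_of_nonneg (by linarith), dist_eq_norm]

lemma norm_contraction_le (c x : E3) {t : ℝ} (ht : t ≤ 1) (ht0 : 0 ≤ t) :
    ‖contraction c t x‖ ≤ ‖x‖ + ‖c‖ := by
  rw [contraction, show c + t • (x - c) = t • x + (1 - t) • c by module]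
  refine (norm_add_le _ _).trans ?_
  rw [norm_smul, norm_smul, Real.norm_of_nonneg ht0, Real.norm_of_nonneg (by linarith)]
  nlinarith [norm_nonneg x, norm_nonneg c]

/-- Contraction increases the norm by at most `‖c‖`, and the kernel reaches no further than `ρ`.
This locality permits truncating `G` to a ball. -/
lemma approx_congr {G' : E3 → F} {n : ℕ} {x : E3} {R : ℝ} (hx : ‖x‖ < R)
    (h : ∀ y, ‖y‖ < R + ‖c‖ + ρ → G y = G' y) : approx c hρ G n x = approx c hρ G' n x := by
  refine integral_congr_ae (Eventually.of_forall fun y => ?_)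
  dsimp only
  by_cases hy : ‖y‖ < R + ‖c‖ + ρ
  · rw [h y hy]
  · rw [kernel_eq_zero, zero_smul, zero_smul]
    have h1 := norm_contraction_le c x (t := 1 - 1 / ((n : ℝ) + 2))
      (by linarith [show (0 : ℝ) ≤ 1 / (n + 2) by positivity]) (by linarith [half_le_factor n])
    have h2 : ρ / (2 * (n + 2)) ≤ ρ := by
      refine div_le_self hρ.le ?_
      linarith [Nat.cast_nonneg (α := ℝ) n]
    have h3 := norm_sub_norm_le y (contraction c (1 - 1 / ((n : ℝ) + 2)) x)
    rw [norm_sub_rev] at h3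
    linarith

lemma approx_sub {H : E3 → F} (hG : LocallyIntegrable G) (hH : LocallyIntegrable H) (n : ℕ)
    (x : E3) : approx c hρ (fun y => G y - H y) n x = approx c hρ G n x - approx c hρ H n x := by
  have hi : ∀ {K : E3 → F}, LocallyIntegrable K → ∀ z, Integrable fun y =>
      kernel (ρ / (2 * (n + 2))) (by positivity) (z - y) • K y := by
    intro K hK z
    have hs : HasCompactSupport fun y : E3 => kernel (ρ / (2 * (n + 2))) (by positivity) (z - y) :=
      hasCompactSupport_kernel.comp_homeomorph (Homeomorph.subLeft z)
    exact hK.integrable_smul_left_of_hasCompactSupport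
      (continuous_kernel.comp (continuous_const.sub continuous_id)) hs
  unfold approx mollify
  rw [← integral_sub (hi hG _) (hi hH _)]
  simp_rw [smul_sub]

lemma tendsto_factor : Tendsto (fun n : ℕ => (1 : ℝ) / (n + 2)) atTop (𝓝 0) := by
  have := (tendsto_add_atTop_iff_nat 1).2 (tendsto_one_div_add_atTop_nhds_zero_nat (𝕜 := ℝ))
  refine this.congr fun n => ?_
  push_cast; ring

/-- Uniform convergence of the approximations on balls. -/
lemma eventually_dist_approx_le [CompleteSpace F] {H : E3 → F} (hH : Continuous H)
    (hHc : HasCompactSupport H) {δ : ℝ} (hδ : 0 < δ) (R : ℝ) :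
    ∀ᶠ n in atTop, ∀ x ∈ Metric.ball (0 : E3) R, dist (approx c hρ H n x) (H x) ≤ δ := by
  have hu := hHc.uniformContinuous_of_continuous hH
  obtain ⟨η, hη, hd⟩ := Metric.uniformContinuous_iff.1 hu (δ / 2) (by positivity)
  have h1 : Tendsto (fun n : ℕ => (1 : ℝ) / (n + 2) * (ρ + |R| + ‖c‖)) atTop (𝓝 0) := by
    simpa using tendsto_factor.mul_const (ρ + |R| + ‖c‖)
  filter_upwards [h1.eventually (gt_mem_nhds hη)] with n hn x hx
  have hn0 : (0 : ℝ) < 1 / (n + 2) := by positivity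
  have hk : dist (approx c hρ H n x) (H (contraction c (1 - 1 / (n + 2)) x)) ≤ δ / 2 := by
    rw [approx, mollify_eq_convolution]
    refine ContDiffBump.dist_normed_convolution_le hH.aestronglyMeasurable fun y hy => ?_
    refine (hd (lt_of_lt_of_le (Metric.mem_ball.1 hy) ?_)).le
    change ρ / (2 * (n + 2)) ≤ η
    refine le_trans ?_ hn.le
    rw [show ρ / (2 * ((n : ℝ) + 2)) = 1 / (n + 2) * (ρ / 2) by field_simp]
    gcongr
    linarith [abs_nonneg R, norm_nonneg c]
  have hx' : dist (H (contraction c (1 - 1 / (n + 2)) x)) (H x) ≤ δ / 2 := by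
    refine (hd ?_).le
    rw [dist_contraction c x (by linarith)]
    refine lt_of_le_of_lt ?_ hn
    rw [sub_sub_cancel]
    gcongr
    have := dist_triangle x 0 c
    rw [dist_zero_right, dist_zero_left] at this
    have h3 : ‖x‖ < R := by simpa using hx
    linarith [le_abs_self R]
  linarith [dist_triangle (approx c hρ H n x) (H (contraction c (1 - 1 / (n + 2)) x)) (H x)]

lemma tendsto_approx_of_continuous [CompleteSpace F] {H : E3 → F} (hH : Continuous H)
    (hHc : HasCompactSupport H) {p : ℝ≥0∞} :
    TendstoLpLoc volume p (approx c hρ H) H := by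
  intro R
  have hfin : (volume.restrict (Metric.ball (0 : E3) R)) univ ^ p.toReal⁻¹ ≠ ⊤ :=
    ENNReal.rpow_ne_top_of_nonneg (by positivity)
      (by rw [Measure.restrict_apply_univ]; exact measure_ball_lt_top.ne)
  rw [ENNReal.tendsto_nhds_zero]
  intro ε hε
  obtain ⟨δ, hδ, hδε⟩ : ∃ δ : ℝ, 0 < δ ∧
      (volume.restrict (Metric.ball (0 : E3) R)) univ ^ p.toReal⁻¹ * ENNReal.ofReal δ ≤ ε := by
    have ht : Tendsto (fun δ : ℝ => (volume.restrict (Metric.ball (0 : E3) R)) univ ^ p.toReal⁻¹ *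
        ENNReal.ofReal δ) (𝓝[>] 0) (𝓝 0) := by
      have h0 : Tendsto (fun δ : ℝ => ENNReal.ofReal δ) (𝓝[>] 0) (𝓝 0) := by
        have := (ENNReal.continuous_ofReal.tendsto 0).mono_left (nhdsWithin_le_nhds (s := Ioi 0))
        simpa using this
      simpa using ENNReal.Tendsto.const_mul h0 (Or.inr hfin)
    obtain ⟨δ, h1, h2⟩ := ((ENNReal.tendsto_nhds_zero.1 ht ε hε).and self_mem_nhdsWithin).exists
    exact ⟨δ, h2, h1⟩
  filter_upwards [eventually_dist_approx_le (c := c) (hρ := hρ) hH hHc hδ R] with n hn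
  refine (eLpNorm_le_of_ae_bound (C := δ) ?_).trans hδε
  filter_upwards [ae_restrict_mem Metric.isOpen_ball.measurableSet] with x hx
  rw [← dist_eq_norm]
  exact hn x hx

/-- Convergence holds for continuous functions with compact support, such functions are dense in
`L_p`, and the operators are uniformly bounded. -/
lemma tendsto_approx [CompleteSpace F] {p : ℝ≥0∞} (hp : 1 ≤ p) (hp' : p ≠ ⊤)
    (hG : MemLpLoc volume p G) : TendstoLpLoc volume p (approx c hρ G) G := by
  intro R
  set B := Metric.ball (0 : E3) (R + ‖c‖ + ρ) with hB
  have hBm : MeasurableSet B := Metric.isOpen_ball.measurableSet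
  have hG1 : MemLp (B.indicator G) p := (memLp_indicator_iff_restrict hBm).2 (hG _)
  have hG1l := hG1.locallyIntegrable hp
  rw [ENNReal.tendsto_nhds_zero]
  intro ε hε
  -- `10 = 8 + 1 + 1`: the operator bound applied to `G - H`, the error for `H`, and `H - G` itself.
  obtain ⟨δ, hδ, hδε⟩ : ∃ δ : ℝ≥0∞, 0 < δ ∧ 10 * δ ≤ ε := by
    refine ⟨ε / 10, ENNReal.div_pos hε.ne' (by simp), ?_⟩
    rw [ENNReal.mul_div_cancel (by simp) (by simp)]
  obtain ⟨H, hHc, hH1, hH, hHL⟩ := hG1.exists_hasCompactSupport_eLpNorm_sub_le hp' hδ.ne'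
  have hHl : LocallyIntegrable H := hHL.locallyIntegrable hp
  have hdiff : MemLp (fun y => B.indicator G y - H y) p := hG1.sub hHL
  filter_upwards [ENNReal.tendsto_nhds_zero.1
    (tendsto_approx_of_continuous (c := c) (hρ := hρ) (p := p) hH hHc R) δ hδ] with n hn
  have hcA : Continuous (approx c hρ (fun y => B.indicator G y - H y) n) :=
    (contDiff_approx (hG1l.sub hHl) n).continuous
  have hcH : Continuous (approx c hρ H n) := (contDiff_approx hHl n).continuous
  have e1 : eLpNorm (fun x => approx c hρ G n x - G x) p (volume.restrict (Metric.ball 0 R)) =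
      eLpNorm ((approx c hρ (fun y => B.indicator G y - H y) n +
        fun x => approx c hρ H n x - H x) + fun x => H x - B.indicator G x) p
        (volume.restrict (Metric.ball 0 R)) := by
    refine eLpNorm_congr_ae ?_
    filter_upwards [ae_restrict_mem Metric.isOpen_ball.measurableSet] with x hx
    have hxR : ‖x‖ < R := by simpa using hx
    have hxB : x ∈ B := by
      rw [hB, mem_ball_zero_iff]; linarith [norm_nonneg c]
    have h1 : approx c hρ G n x = approx c hρ (B.indicator G) n x := by
      refine approx_congr hxR fun y hy => ?_
      rw [indicator_of_mem]
      simpa [hB] using hy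
    simp only [Pi.add_apply]
    rw [approx_sub hG1l hHl, h1, indicator_of_mem hxB]
    abel
  rw [e1]
  refine (eLpNorm_add_le ?_ ?_ hp).trans ?_
  · exact hcA.aestronglyMeasurable.add
      (hcH.aestronglyMeasurable.sub hH.aestronglyMeasurable)
  · exact (hH.aestronglyMeasurable.sub hG1.1).restrict
  have b1 : eLpNorm (approx c hρ (fun y => B.indicator G y - H y) n) p
      (volume.restrict (Metric.ball 0 R)) ≤ 8 * δ := by
    refine (eLpNorm_mono_measure _ Measure.restrict_le_self).trans ?_
    refine (eLpNorm_mollify_contraction_le (half_le_factor n) hp hp' hdiff).trans ?_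
    gcongr
    exact hH1
  have b3 : eLpNorm (fun x => H x - B.indicator G x) p (volume.restrict (Metric.ball 0 R)) ≤ δ := by
    refine (eLpNorm_mono_measure _ Measure.restrict_le_self).trans ?_
    rw [← eLpNorm_neg]
    refine le_trans (le_of_eq ?_) hH1
    congr 1
    ext x; simp
  calc _ ≤ (8 * δ + δ) + δ := by
        gcongr
        exact (eLpNorm_add_le hcA.aestronglyMeasurable
          (hcH.aestronglyMeasurable.sub hH.aestronglyMeasurable) hp).trans (add_le_add b1 hn)
    _ = 10 * δ := by ring
    _ ≤ ε := hδε

lemma isTest_kernel_sub {P : Set E3} {r : ℝ} {hr : 0 < r} {z : E3}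
    (hz : Metric.closedBall z r ⊆ P) : IsTest P fun y => kernel r hr (z - y) := by
  refine ⟨contDiff_kernel.comp (contDiff_const.sub contDiff_id),
    hasCompactSupport_kernel.comp_homeomorph (Homeomorph.subLeft z), ?_⟩
  refine Subset.trans ?_ hz
  refine closure_minimal (fun y hy => ?_) Metric.isClosed_closedBall
  by_contra hc
  refine hy (kernel_eq_zero ?_)
  rw [Metric.mem_closedBall, dist_comm, dist_eq_norm] at hc
  linarith

/-- The kernel radius is half of `(1 - t) ρ`, so for `x ∈ P` the kernel about the contracted point
is a test function in `P`, and the derivative passes to the weak derivative. The factor `t` is the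
chain rule for the contraction. -/
lemma fderiv_approx [CompleteSpace F] {P : Set E3} (hPm : IsOpen P) (hP : Convex ℝ P)
    (hball : Metric.ball c ρ ⊆ P) {g D : E3 → F} {j : Fin 3} (hw : IsWeakPartial P j g D)
    (hG : LocallyIntegrable G) (hGg : G =ᵐ[volume.restrict P] g) (n : ℕ) {x : E3} (hx : x ∈ P) :
    fderiv ℝ (approx c hρ G n) x (unitVec j) =
      (1 - 1 / ((n : ℝ) + 2)) • approx c hρ (P.indicator D) n x := by
  have hr : 0 < ρ / (2 * ((n : ℝ) + 2)) := by positivity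
  set t : ℝ := 1 - 1 / (n + 2) with ht
  have htl := half_le_factor n
  have hsub : Metric.closedBall (contraction c t x) (ρ / (2 * ((n : ℝ) + 2))) ⊆ P := by
    refine closedBall_contraction_subset hP hball (by linarith)
      (by linarith [show (0 : ℝ) < 1 / (n + 2) by positivity]) ?_ hx
    rw [ht, sub_sub_cancel, show ρ / (2 * ((n : ℝ) + 2)) = 1 / (n + 2) * (ρ / 2) by field_simp]
    gcongr
    linarith
  have hsm := contDiff_mollify (k := kernel _ hr) contDiff_kernel hasCompactSupport_kernel hG
  have hT : HasFDerivAt (contraction c t) (t • ContinuousLinearMap.id ℝ E3) x := by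
    unfold contraction
    exact (((hasFDerivAt_id x).sub_const c).const_smul t).const_add c
  have h1 : HasFDerivAt (approx c hρ G n) _ x :=
    ((hsm.differentiable (by simp)) (contraction c t x)).hasFDerivAt.comp x hT
  rw [h1.fderiv]
  simp only [ContinuousLinearMap.comp_smul, ContinuousLinearMap.comp_id, FunLike.coe_smul,
    Pi.smul_apply]
  congr 1
  rw [fderiv_mollify contDiff_kernel hasCompactSupport_kernel hG]
  have htest := isTest_kernel_sub (hr := hr) hsub
  have hd : ∀ y, fderiv ℝ (fun y => kernel _ hr (contraction c t x - y)) y (unitVec j) =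
      - fderiv ℝ (kernel _ hr) (contraction c t x - y) (unitVec j) := by
    intro y
    have h2 : HasFDerivAt (fun y => contraction c t x - y) (-ContinuousLinearMap.id ℝ E3) y := by
      simpa using (hasFDerivAt_id y).const_sub (contraction c t x)
    have h3 : HasFDerivAt (fun y => kernel _ hr (contraction c t x - y)) _ y :=
      (((contDiff_kernel (n := 1)).differentiable (by simp)) _).hasFDerivAt.comp y h2
    rw [h3.fderiv]
    simp
  have h4 := hw.2.2 _ htest
  simp_rw [hd, neg_smul, integral_neg, neg_inj] at h4
  have e1 : ∫ y, fderiv ℝ (kernel _ hr) (contraction c t x - y) (unitVec j) • G y =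
      ∫ y in P, fderiv ℝ (kernel _ hr) (contraction c t x - y) (unitVec j) • G y := by
    refine (setIntegral_eq_integral_of_forall_compl_eq_zero fun y hy => ?_).symm
    have : y ∉ tsupport fun y => kernel _ hr (contraction c t x - y) := fun h => hy (htest.2.2 h)
    have h5 := fderiv_of_notMem_tsupport (𝕜 := ℝ) this
    have h6 := hd y
    rw [h5] at h6
    rw [neg_eq_zero.1 h6.symm, zero_smul]
  rw [e1, integral_congr_ae (g := fun y => fderiv ℝ (kernel _ hr) (contraction c t x - y)
    (unitVec j) • g y) (by filter_upwards [hGg] with y hy; rw [hy]), h4, approx, mollify,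
    ← integral_indicator hPm.measurableSet]
  refine integral_congr_ae (Eventually.of_forall fun y => ?_)
  by_cases hy : y ∈ P <;> simp [hy, ht]

/-- `φ` is a sequence of smooth functions converging to `g`, along with its derivatives to `D`,
in `L_p` on the bounded parts of `P`. -/
structure SmoothApprox (P : Set E3) (p : ℝ≥0∞) (g : E3 → F) (D : Fin 3 → E3 → F)
    (φ : ℕ → E3 → F) : Prop where
  contDiff : ∀ n, ContDiff ℝ ∞ (φ n)
  tendsto : TendstoLpLoc (volume.restrict P) p φ g
  tendsto_fderiv : ∀ j, TendstoLpLoc (volume.restrict P) p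
    (fun n x => fderiv ℝ (φ n) x (unitVec j)) (D j)

/-- The mollified function `G` lives on all of `ℝ³` and need only agree with `g` on `P`. This leaves
the choice of its values outside: zero in general, or values in a prescribed interval when bounds
must be kept. -/
theorem smoothApprox_approx [CompleteSpace F] {P : Set E3} (hPo : IsOpen P) (hP : Convex ℝ P)
    (hball : Metric.ball c ρ ⊆ P) {p : ℝ≥0∞} (hp : 1 ≤ p) (hp' : p ≠ ⊤) {g : E3 → F}
    {D : Fin 3 → E3 → F} (hw : ∀ j, IsWeakPartial P j g (D j))
    (hD : ∀ j, MemLpLoc (volume.restrict P) p (D j)) (hG : MemLpLoc volume p G)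
    (hGg : G =ᵐ[volume.restrict P] g) : SmoothApprox P p g D (approx c hρ G) := by
  have hGl := hG.locallyIntegrable hp
  refine ⟨contDiff_approx hGl, ?_, fun j => ?_⟩
  · exact ((tendsto_approx hp hp' hG).mono_measure Measure.restrict_le_self).congr
      (fun _ => EventuallyEq.rfl) hGg
  · have hDi := memLpLoc_indicator hPo.measurableSet (hD j)
    -- The factor `1 - 1/(n+2)` tends to one, so it adds only a vanishing multiple of the norm of `D
    -- j`.
    have h1 : TendstoLpLoc (volume.restrict P) p
        (fun n x => (1 - 1 / ((n : ℝ) + 2)) • approx c hρ (P.indicator (D j)) n x) (D j) := by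
      have h2 := ((tendsto_approx (c := c) (hρ := hρ) hp hp' hDi).mono_measure
        (Measure.restrict_le_self (s := P)))
      intro R
      have hDR : MemLp (P.indicator (D j)) p ((volume.restrict P).restrict (Metric.ball 0 R)) :=
        (hDi R).mono_measure (Measure.restrict_mono_measure Measure.restrict_le_self _)
      have h3 : Tendsto (fun n : ℕ => ‖(1 : ℝ) / (n + 2)‖ₑ *
          eLpNorm (P.indicator (D j)) p ((volume.restrict P).restrict (Metric.ball 0 R)))
          atTop (𝓝 0) := by
        have h0 : Tendsto (fun n : ℕ => ‖(1 : ℝ) / (n + 2)‖ₑ) atTop (𝓝 0) := by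
          have := (continuous_enorm.tendsto (0 : ℝ)).comp tendsto_factor
          rwa [enorm_zero] at this
        simpa using ENNReal.Tendsto.mul_const h0 (Or.inr hDR.2.ne)
      have h4 := (h2 R).add h3
      rw [add_zero] at h4
      refine tendsto_of_tendsto_of_tendsto_of_le_of_le tendsto_const_nhds h4
        (fun _ => zero_le) fun n => ?_
      have hcA : Continuous (approx c hρ (P.indicator (D j)) n) :=
        (contDiff_approx (hDi.locallyIntegrable hp) n).continuous
      have e1 : eLpNorm (fun x => (1 - 1 / ((n : ℝ) + 2)) • approx c hρ (P.indicator (D j)) n x -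
          D j x) p ((volume.restrict P).restrict (Metric.ball 0 R)) =
          eLpNorm ((1 - 1 / ((n : ℝ) + 2)) •
            (fun x => approx c hρ (P.indicator (D j)) n x - P.indicator (D j) x) -
            ((1 : ℝ) / (n + 2)) • P.indicator (D j)) p
            ((volume.restrict P).restrict (Metric.ball 0 R)) := by
        refine eLpNorm_congr_ae ?_
        filter_upwards [ae_restrict_of_ae (ae_restrict_mem hPo.measurableSet)] with x hx
        simp only [Pi.sub_apply, Pi.smul_apply, indicator_of_mem hx]
        module
      dsimp only
      rw [e1]
      refine (eLpNorm_sub_le ?_ (hDR.1.const_smul _) hp).trans ?_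
      · exact (hcA.aestronglyMeasurable.sub hDR.1).const_smul _
      rw [eLpNorm_const_smul, eLpNorm_const_smul]
      gcongr
      refine (mul_le_mul_left ?_ _).trans_eq (one_mul _)
      rw [Real.enorm_eq_ofReal (by linarith [half_le_factor n])]
      refine ENNReal.ofReal_le_one.2 ?_
      linarith [show (0 : ℝ) ≤ 1 / (n + 2) by positivity]
    refine h1.congr (fun n => ?_) EventuallyEq.rfl
    filter_upwards [ae_restrict_mem hPo.measurableSet] with x hx
    rw [fderiv_approx hPo hP hball (hw j) hGl hGg n hx]

/-- Averages against a probability kernel stay in the interval. Lower bounds kept in this way allow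
taking reciprocals of the approximations. -/
lemma approx_mem_Icc {G : E3 → ℝ} {a b : ℝ} (hG : LocallyIntegrable G) (hab : ∀ x, G x ∈ Icc a b)
    (n : ℕ) (x : E3) : approx c hρ G n x ∈ Icc a b := by
  have hr : 0 < ρ / (2 * ((n : ℝ) + 2)) := by positivity
  have hs : ∀ z, HasCompactSupport fun y : E3 => kernel _ hr (z - y) := fun z =>
    hasCompactSupport_kernel.comp_homeomorph (Homeomorph.subLeft z)
  have hc : ∀ z, Continuous fun y : E3 => kernel _ hr (z - y) := fun z =>
    continuous_kernel.comp (continuous_const.sub continuous_id)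
  have hi : ∀ z, Integrable fun y => kernel _ hr (z - y) • G y := fun z =>
    hG.integrable_smul_left_of_hasCompactSupport (hc z) (hs z)
  have h1 : ∀ z (s : ℝ), ∫ y, kernel _ hr (z - y) • s = s := by
    intro z s
    rw [integral_smul_const, integral_sub_left_eq_self (fun y => kernel _ hr y) volume z,
      integral_kernel, one_smul]
  have hi' : ∀ z (s : ℝ), Integrable fun y => kernel _ hr (z - y) • s := fun z s =>
    ((hc z).integrable_of_hasCompactSupport (hs z)).smul_const s
  set z := contraction c (1 - 1 / ((n : ℝ) + 2)) x
  constructor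
  · rw [← h1 z a]
    exact integral_mono (hi' z a) (hi z) fun y =>
      mul_le_mul_of_nonneg_left (hab y).1 (kernel_nonneg _)
  · refine le_of_le_of_eq (integral_mono (hi z) (hi' z b) fun y =>
      mul_le_mul_of_nonneg_left (hab y).2 (kernel_nonneg _)) (h1 z b)

end Approx

end MaxwellCylinder

namespace MaxwellCylinder

/-! ### Weighted Sobolev inequalities for vector functions -/

section Weighted

variable {F G : Type*} [NormedAddCommGroup F] [NormedSpace ℝ F]
  [NormedAddCommGroup G] [NormedSpace ℝ G]

/-- The `W¹_p` norm of a differentiable function. -/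
noncomputable def sobNorm (m : Measure E3) (p : ℝ≥0∞) (ψ : E3 → F) : ℝ≥0∞ :=
  eLpNorm ψ p m + ∑ j, eLpNorm (fun x => fderiv ℝ ψ x (unitVec j)) p m

lemma eLpNorm_clm_comp_le (L : F →L[ℝ] G) (m : Measure E3) (p : ℝ≥0∞) (ψ : E3 → F) :
    eLpNorm (fun x => L (ψ x)) p m ≤ ‖L‖ₑ * eLpNorm ψ p m := by
  have := eLpNorm_le_nnreal_smul_eLpNorm_of_ae_le_mul (f := fun x => L (ψ x)) (g := ψ) (c := ‖L‖₊)
    (μ := m) (Eventually.of_forall fun x => L.le_opNNNorm (ψ x)) p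
  simpa [ENNReal.smul_def, enorm_eq_nnnorm] using this

lemma fderiv_clm_comp (L : F →L[ℝ] G) {ψ : E3 → F} (hψ : Differentiable ℝ ψ) (x e : E3) :
    fderiv ℝ (fun x => L (ψ x)) x e = L (fderiv ℝ ψ x e) := by
  have h : HasFDerivAt (fun x => L (ψ x)) _ x := L.hasFDerivAt.comp x (hψ x).hasFDerivAt
  rw [h.fderiv]; rfl

lemma sobNorm_clm_comp_le (L : F →L[ℝ] G) (m : Measure E3) (p : ℝ≥0∞) {ψ : E3 → F}
    (hψ : Differentiable ℝ ψ) : sobNorm m p (fun x => L (ψ x)) ≤ ‖L‖ₑ * sobNorm m p ψ := by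
  rw [sobNorm, sobNorm, mul_add, Finset.mul_sum]
  simp_rw [fderiv_clm_comp L hψ]
  gcongr
  · exact eLpNorm_clm_comp_le L m p ψ
  · exact eLpNorm_clm_comp_le L m p _

/-- The inequality `‖b ψ‖_{L_r(m)} ≤ C ‖ψ‖_{W¹_p(P)}` for a weight `b`. -/
def WeightedBound (P : Set E3) (m : Measure E3) (b : E3 → ℝ) (r p : ℝ≥0∞) : Prop :=
  ∃ C : NNReal, ∀ ψ : E3 → ℝ, ContDiff ℝ 1 ψ → HasCompactSupport ψ →
    eLpNorm (fun x => b x * ψ x) r m ≤ C * sobNorm (volume.restrict P) p ψ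

variable {P : Set E3} {m : Measure E3} {b : E3 → ℝ} {r p : ℝ≥0∞}

lemma eLpNorm_fderiv_le {ψ : E3 → F} (hψ : ContDiff ℝ 1 ψ) (hp : 1 ≤ p) (m : Measure E3) :
    eLpNorm (fderiv ℝ ψ) p m ≤ ∑ j, eLpNorm (fun x => fderiv ℝ ψ x (unitVec j)) p m := by
  have hc : ∀ j, Continuous fun x => fderiv ℝ ψ x (unitVec j) := fun j =>
    (hψ.continuous_fderiv (by simp)).clm_apply continuous_const
  have h1 : eLpNorm (fderiv ℝ ψ) p m ≤
      eLpNorm (∑ j, fun x => ‖fderiv ℝ ψ x (unitVec j)‖) p m := by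
    refine eLpNorm_mono_enorm fun x => (enorm_clm_le_sum _).trans_eq ?_
    rw [Finset.sum_apply, Real.enorm_eq_ofReal (Finset.sum_nonneg fun _ _ => norm_nonneg _),
      ENNReal.ofReal_sum_of_nonneg fun _ _ => norm_nonneg _]
    simp_rw [ofReal_norm]
  refine h1.trans ((eLpNorm_sum_le (fun j _ => (hc j).norm.aestronglyMeasurable) hp).trans_eq ?_)
  simp_rw [eLpNorm_norm]

lemma SobolevBound.weightedBound (h : SobolevBound P m r p) (hp : 1 ≤ p) :
    WeightedBound P m 1 r p := by
  obtain ⟨C, hC⟩ := h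
  refine ⟨C, fun ψ hψ hc => ?_⟩
  simp only [Pi.one_apply, one_mul]
  refine (hC ψ hψ hc).trans ?_
  rw [sobNorm]
  gcongr
  exact eLpNorm_fderiv_le hψ hp _

/-- Expansion in a basis reduces vector functions to their scalar coordinates. -/
lemma WeightedBound.vector [FiniteDimensional ℝ F] (h : WeightedBound P m b r p) (hr : 1 ≤ r)
    (hb : AEStronglyMeasurable b m) :
    ∃ C : NNReal, ∀ ψ : E3 → F, ContDiff ℝ 1 ψ → HasCompactSupport ψ →
      eLpNorm (fun x => b x • ψ x) r m ≤ C * sobNorm (volume.restrict P) p ψ := by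
  obtain ⟨C, hC⟩ := h
  let B := Module.finBasis ℝ F
  let l : ∀ i, F →L[ℝ] ℝ := fun i => LinearMap.toContinuousLinearMap (B.coord i)
  refine ⟨∑ i, ‖B i‖₊ * (C * ‖l i‖₊), fun ψ hψ hc => ?_⟩
  have hl : ∀ i, Continuous fun x => l i (ψ x) := fun i => (l i).continuous.comp hψ.continuous
  have e : (fun x => b x • ψ x) = ∑ i, fun x => (b x * l i (ψ x)) • B i := by
    funext x
    rw [Finset.sum_apply]
    conv_lhs => rw [← B.sum_repr (ψ x), Finset.smul_sum]
    refine Finset.sum_congr rfl fun i _ => ?_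
    rw [smul_smul]; rfl
  rw [e]
  refine (eLpNorm_sum_le (fun i _ =>
    (hb.mul (hl i).aestronglyMeasurable).smul_const (B i)) hr).trans ?_
  push_cast
  rw [Finset.sum_mul]
  refine Finset.sum_le_sum fun i _ => ?_
  have h1 : eLpNorm (fun x => (b x * l i (ψ x)) • B i) r m ≤
      ‖B i‖ₑ * eLpNorm (fun x => b x * l i (ψ x)) r m := by
    have := eLpNorm_le_nnreal_smul_eLpNorm_of_ae_le_mul (f := fun x => (b x * l i (ψ x)) • B i)
      (g := fun x => b x * l i (ψ x)) (c := ‖B i‖₊) (μ := m)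
      (Eventually.of_forall fun x => by rw [nnnorm_smul, mul_comm]) r
    simpa [ENNReal.smul_def, enorm_eq_nnnorm] using this
  refine h1.trans ?_
  rw [mul_assoc, mul_assoc]
  refine mul_le_mul' le_rfl ((hC _ ((l i).contDiff.comp hψ) (hc.comp_left (map_zero _))).trans ?_)
  refine mul_le_mul' le_rfl ?_
  exact sobNorm_clm_comp_le (l i) _ _ (hψ.differentiable (by simp))

end Weighted

/-! ### Cutoff functions -/

section Cutoff

/-- A smooth function equal to `1` on the ball of radius `n + 1` and to `0` off the ball of radius
`2 (n + 1)`. -/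
noncomputable def cutoff (n : ℕ) (x : E3) : ℝ :=
  (ContDiffBump.mk (c := (0 : E3)) 1 2 one_pos one_lt_two) (((n : ℝ) + 1)⁻¹ • x)

lemma contDiff_cutoff (n : ℕ) {k : ℕ∞} : ContDiff ℝ k (cutoff n) :=
  (ContDiffBump.contDiff _).comp (contDiff_const_smul _)

lemma norm_inv_smul (n : ℕ) (x : E3) : ‖((n : ℝ) + 1)⁻¹ • x‖ = ‖x‖ / (n + 1) := by
  rw [norm_smul, norm_inv, Real.norm_of_nonneg (by positivity), div_eq_inv_mul]

lemma cutoff_eq_one {n : ℕ} {x : E3} (hx : ‖x‖ ≤ n + 1) : cutoff n x = 1 := by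
  refine ContDiffBump.one_of_mem_closedBall _ ?_
  rw [mem_closedBall_zero_iff, norm_inv_smul]
  exact (div_le_one (by positivity)).2 hx

lemma cutoff_eq_zero {n : ℕ} {x : E3} (hx : 2 * ((n : ℝ) + 1) ≤ ‖x‖) : cutoff n x = 0 := by
  refine ContDiffBump.zero_of_le_dist _ ?_
  rw [dist_zero_right, norm_inv_smul, le_div_iff₀ (by positivity)]
  exact hx

lemma norm_cutoff_le (n : ℕ) (x : E3) : ‖cutoff n x‖ ≤ 1 := by
  rw [cutoff, Real.norm_of_nonneg (ContDiffBump.nonneg _)]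
  exact ContDiffBump.le_one _

lemma tsupport_cutoff_subset (n : ℕ) : tsupport (cutoff n) ⊆ Metric.closedBall 0 (2 * (n + 1)) := by
  refine closure_minimal (fun x hx => ?_) Metric.isClosed_closedBall
  rw [mem_closedBall_zero_iff]
  by_contra h
  exact hx (cutoff_eq_zero (not_le.1 h).le)

lemma hasCompactSupport_cutoff (n : ℕ) : HasCompactSupport (cutoff n) :=
  (isCompact_closedBall 0 _).of_isClosed_subset (isClosed_tsupport _) (tsupport_cutoff_subset n)

/-- All cutoffs are dilations of one bump by factors `n + 1 ≥ 1`, which only flatten it; the bound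
is uniform in `n`. -/
lemma exists_norm_fderiv_cutoff_le : ∃ K : NNReal, ∀ n x, ‖fderiv ℝ (cutoff n) x‖ ≤ K := by
  let χ : ContDiffBump (0 : E3) := ContDiffBump.mk 1 2 one_pos one_lt_two
  have hχ : ContDiff ℝ 1 (χ : E3 → ℝ) := χ.contDiff
  obtain ⟨K, hK⟩ := (χ.hasCompactSupport.fderiv (𝕜 := ℝ)).exists_bound_of_continuous
    (hχ.continuous_fderiv (by simp))
  refine ⟨K.toNNReal, fun n x => ?_⟩
  have h1 : HasFDerivAt (fun x : E3 => ((n : ℝ) + 1)⁻¹ • x)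
      (((n : ℝ) + 1)⁻¹ • ContinuousLinearMap.id ℝ E3) x :=
    (hasFDerivAt_id x).fun_const_smul _
  have h2 : HasFDerivAt (cutoff n) _ x :=
    ((hχ.differentiable (by simp)) _).hasFDerivAt.comp x h1
  rw [h2.fderiv, ContinuousLinearMap.comp_smul, ContinuousLinearMap.comp_id, norm_smul, norm_inv,
    Real.norm_of_nonneg (by positivity)]
  refine le_trans ?_ ((hK (((n : ℝ) + 1)⁻¹ • x)).trans (Real.le_coe_toNNReal K))
  refine mul_le_of_le_one_left (norm_nonneg _) (inv_le_one_of_one_le₀ ?_)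
  linarith [Nat.cast_nonneg (α := ℝ) n]

variable {F : Type*} [NormedAddCommGroup F] [NormedSpace ℝ F]

lemma fderiv_smul_apply {χ : E3 → ℝ} {ψ : E3 → F} (hχ : ContDiff ℝ 1 χ) (hψ : ContDiff ℝ 1 ψ)
    (x e : E3) : fderiv ℝ (fun x => χ x • ψ x) x e =
      χ x • fderiv ℝ ψ x e + fderiv ℝ χ x e • ψ x := by
  rw [fderiv_fun_smul (hχ.differentiable (by simp) x) (hψ.differentiable (by simp) x)]
  simp

lemma eLpNorm_smul_le_of_support {χ : E3 → ℝ} {K : NNReal} (hK : ∀ x, ‖χ x‖ ≤ K) {s : Set E3}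
    (hs : MeasurableSet s) (h0 : ∀ x ∉ s, χ x = 0) (m : Measure E3) (p : ℝ≥0∞) (ψ : E3 → F) :
    eLpNorm (fun x => χ x • ψ x) p m ≤ K * eLpNorm ψ p (m.restrict s) := by
  rw [← eLpNorm_indicator_eq_eLpNorm_restrict hs]
  have := eLpNorm_le_nnreal_smul_eLpNorm_of_ae_le_mul (f := fun x => χ x • ψ x)
    (g := s.indicator ψ) (c := K) (μ := m) (Eventually.of_forall fun x => ?_) p
  · simpa [ENNReal.smul_def] using this
  · by_cases hx : x ∈ s
    · rw [indicator_of_mem hx, nnnorm_smul]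
      gcongr
      exact hK x
    · simp [h0 x hx]

/-- The product rule puts a derivative on `χ` once in each of the three directions, whence `3 K`.
The support of `χ` localizes the right side to `s`. -/
lemma sobNorm_smul_le {χ : E3 → ℝ} (hχ : ContDiff ℝ 1 χ) {K : NNReal} (h1 : ∀ x, ‖χ x‖ ≤ 1)
    (hK : ∀ x, ‖fderiv ℝ χ x‖ ≤ K) {s : Set E3} (hs : MeasurableSet s) (h0 : tsupport χ ⊆ s)
    (m : Measure E3) {p : ℝ≥0∞} (hp : 1 ≤ p) {ψ : E3 → F} (hψ : ContDiff ℝ 1 ψ) :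
    sobNorm m p (fun x => χ x • ψ x) ≤ (1 + 3 * K) * sobNorm (m.restrict s) p ψ := by
  have hχ0 : ∀ x ∉ s, χ x = 0 := fun x hx => image_eq_zero_of_notMem_tsupport fun h => hx (h0 h)
  have hdχ0 : ∀ j, ∀ x ∉ s, fderiv ℝ χ x (unitVec j) = 0 := fun j x hx => by
    rw [fderiv_of_notMem_tsupport (𝕜 := ℝ) fun h => hx (h0 h)]; rfl
  have hdK : ∀ j x, ‖fderiv ℝ χ x (unitVec j)‖ ≤ K := fun j x => by
    refine ((fderiv ℝ χ x).le_opNorm _).trans ?_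
    rw [norm_unitVec, mul_one]; exact hK x
  have hc : ∀ j, Continuous fun x => fderiv ℝ ψ x (unitVec j) := fun j =>
    (hψ.continuous_fderiv (by simp)).clm_apply continuous_const
  have hcχ : ∀ j, Continuous fun x => fderiv ℝ χ x (unitVec j) := fun j =>
    (hχ.continuous_fderiv (by simp)).clm_apply continuous_const
  have h2 : ∀ j, eLpNorm (fun x => fderiv ℝ (fun x => χ x • ψ x) x (unitVec j)) p m ≤
      eLpNorm (fun x => fderiv ℝ ψ x (unitVec j)) p (m.restrict s) +
        K * eLpNorm ψ p (m.restrict s) := by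
    intro j
    simp_rw [fderiv_smul_apply hχ hψ]
    refine (eLpNorm_add_le (hχ.continuous.smul (hc j)).aestronglyMeasurable
      ((hcχ j).smul hψ.continuous).aestronglyMeasurable hp).trans ?_
    gcongr
    · refine (eLpNorm_smul_le_of_support (K := 1) (by simpa using h1) hs hχ0 m p
        fun x => fderiv ℝ ψ x (unitVec j)).trans_eq ?_
      simp
    · exact eLpNorm_smul_le_of_support (hdK j) hs (hdχ0 j) m p ψ
  have h3 : eLpNorm (fun x => χ x • ψ x) p m ≤ eLpNorm ψ p (m.restrict s) := by
    simpa using eLpNorm_smul_le_of_support (K := 1) (by simpa using h1) hs hχ0 m p ψ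
  calc sobNorm m p (fun x => χ x • ψ x)
      ≤ eLpNorm ψ p (m.restrict s) + ∑ j, (eLpNorm (fun x => fderiv ℝ ψ x (unitVec j)) p
          (m.restrict s) + K * eLpNorm ψ p (m.restrict s)) := by
        rw [sobNorm]
        gcongr with j
        exact h2 j
    _ = sobNorm (m.restrict s) p ψ + 3 * K * eLpNorm ψ p (m.restrict s) := by
        rw [Finset.sum_add_distrib, sobNorm]
        simp only [Finset.sum_const, Finset.card_univ, Fintype.card_fin, nsmul_eq_mul]
        push_cast; ring
    _ ≤ sobNorm (m.restrict s) p ψ + 3 * K * sobNorm (m.restrict s) p ψ := by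
        gcongr; exact le_self_add
    _ = _ := by ring

end Cutoff

/-! ### Calculus of local convergence -/

section Calculus

variable {F G H : Type*} [NormedAddCommGroup F] [NormedAddCommGroup G] [NormedAddCommGroup H]
  {m : Measure E3} {p : ℝ≥0∞} {φ : ℕ → E3 → F} {g : E3 → F}

lemma isFiniteMeasure_restrict_ball [IsFiniteMeasureOnCompacts m] (R : ℝ) :
    IsFiniteMeasure (m.restrict (Metric.ball 0 R)) :=
  ⟨by rw [Measure.restrict_apply_univ]; exact measure_ball_lt_top⟩

lemma memLpLoc_of_continuous [IsFiniteMeasureOnCompacts m] (hg : Continuous g) :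
    MemLpLoc m p g := by
  intro R
  have := isFiniteMeasure_restrict_ball (m := m) R
  obtain ⟨C, hC⟩ := (isCompact_closedBall (0 : E3) R).exists_bound_of_continuousOn hg.continuousOn
  refine MemLp.of_bound hg.aestronglyMeasurable C ?_
  filter_upwards [ae_restrict_mem Metric.isOpen_ball.measurableSet] with x hx
  exact hC x (Metric.ball_subset_closedBall hx)

lemma MemLpLoc.mono_exponent [IsFiniteMeasureOnCompacts m] {q : ℝ≥0∞} (h : MemLpLoc m q g)
    (hpq : p ≤ q) : MemLpLoc m p g := fun R =>
  have := isFiniteMeasure_restrict_ball (m := m) R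
  (h R).mono_exponent hpq

lemma TendstoLpLoc.memLpLoc [IsFiniteMeasureOnCompacts m] (h : TendstoLpLoc m p φ g)
    (hφ : ∀ n, MemLpLoc m p (φ n)) (hg : AEStronglyMeasurable g m) : MemLpLoc m p g := by
  intro R
  obtain ⟨n, hn⟩ := ((ENNReal.tendsto_nhds_zero.1 (h R)) 1 one_pos).exists
  have h1 : MemLp (fun x => φ n x - g x) p (m.restrict (Metric.ball 0 R)) :=
    ⟨(hφ n R).1.sub hg.restrict, hn.trans_lt ENNReal.one_lt_top⟩
  have h2 := (hφ n R).sub h1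
  refine h2.ae_eq (Eventually.of_forall fun x => ?_)
  simp

lemma TendstoLpLoc.mono_exponent [IsFiniteMeasureOnCompacts m] {q : ℝ≥0∞}
    (h : TendstoLpLoc m q φ g) (hpq : p ≤ q) (hφ : ∀ n, AEStronglyMeasurable (φ n) m)
    (hg : AEStronglyMeasurable g m) : TendstoLpLoc m p φ g := by
  intro R
  have := isFiniteMeasure_restrict_ball (m := m) R
  rcases eq_or_ne p 0 with rfl | hp0
  · simp
  have hfin : (m.restrict (Metric.ball 0 R)) univ ^ (1 / p.toReal - 1 / q.toReal) ≠ ⊤ := by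
    have : 0 ≤ 1 / p.toReal - 1 / q.toReal := by
      rcases eq_or_ne q ⊤ with rfl | hq
      · simp
      · rw [sub_nonneg]
        have hp' : p ≠ ⊤ := (hpq.trans_lt hq.lt_top).ne
        exact one_div_le_one_div_of_le (ENNReal.toReal_pos hp0 hp')
          ((ENNReal.toReal_le_toReal hp' hq).2 hpq)
    exact ENNReal.rpow_ne_top_of_nonneg this (measure_ne_top _ _)
  have h1 := ENNReal.Tendsto.mul_const (h R) (Or.inr hfin)
  rw [zero_mul] at h1
  exact tendsto_of_tendsto_of_tendsto_of_le_of_le tendsto_const_nhds h1 (fun _ => zero_le)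
    fun n => eLpNorm_le_eLpNorm_mul_rpow_measure_univ hpq ((hφ n).sub hg).restrict

lemma TendstoLpLoc.add {φ' : ℕ → E3 → F} {g' : E3 → F} (hp : 1 ≤ p) (h : TendstoLpLoc m p φ g)
    (h' : TendstoLpLoc m p φ' g') (hφ : ∀ n, AEStronglyMeasurable (φ n) m)
    (hg : AEStronglyMeasurable g m) (hφ' : ∀ n, AEStronglyMeasurable (φ' n) m)
    (hg' : AEStronglyMeasurable g' m) :
    TendstoLpLoc m p (fun n x => φ n x + φ' n x) (fun x => g x + g' x) := by
  intro R
  have h1 := (h R).add (h' R)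
  rw [add_zero] at h1
  refine tendsto_of_tendsto_of_tendsto_of_le_of_le tendsto_const_nhds h1 (fun _ => zero_le)
    fun n => ?_
  refine le_trans (le_of_eq ?_) (eLpNorm_add_le ((hφ n).sub hg).restrict
    ((hφ' n).sub hg').restrict hp)
  congr 1; funext x; simp only [Pi.add_apply]; abel

variable [NormedSpace ℝ F] [NormedSpace ℝ G] [NormedSpace ℝ H]

lemma TendstoLpLoc.clm (h : TendstoLpLoc m p φ g) (L : F →L[ℝ] G) :
    TendstoLpLoc m p (fun n x => L (φ n x)) (fun x => L (g x)) := by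
  intro R
  have h1 := ENNReal.Tendsto.const_mul (h R) (Or.inr (enorm_ne_top (x := L)))
  rw [mul_zero] at h1
  refine tendsto_of_tendsto_of_tendsto_of_le_of_le tendsto_const_nhds h1 (fun _ => zero_le)
    fun n => ?_
  simp_rw [← map_sub]
  exact eLpNorm_clm_comp_le L _ p _

lemma enorm_bilin_le (B : F →L[ℝ] G →L[ℝ] H) (x : F) (y : G) :
    ‖B x y‖ₑ ≤ ‖B‖ₑ * ‖x‖ₑ * ‖y‖ₑ :=
  ((B x).le_opENorm y).trans (mul_le_mul' (B.le_opENorm x) le_rfl)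

lemma eLpNorm_bilin_le (B : F →L[ℝ] G →L[ℝ] H) {p q r : ℝ≥0∞} [ENNReal.HolderTriple p q r]
    {f : E3 → F} {g : E3 → G} (hf : AEStronglyMeasurable f m) (hg : AEStronglyMeasurable g m) :
    eLpNorm (fun x => B (f x) (g x)) r m ≤ ‖B‖ₑ * eLpNorm f p m * eLpNorm g q m := by
  have := eLpNorm_le_eLpNorm_mul_eLpNorm_of_nnnorm hf hg (fun x y => B x y) ‖B‖₊
    (Eventually.of_forall fun x => B.le_opNorm₂ _ _) (p := p) (q := q) (r := r)
  simpa [enorm_eq_nnnorm] using this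

/-- Products of convergent sequences converge. -/
lemma tendsto_eLpNorm_bilin (B : F →L[ℝ] G →L[ℝ] H) {p q r : ℝ≥0∞} [ENNReal.HolderTriple p q r]
    (hr : 1 ≤ r) {γ : ℕ → E3 → G} {f : E3 → G}
    (h : Tendsto (fun n => eLpNorm (fun x => φ n x - g x) p m) atTop (𝓝 0))
    (h' : Tendsto (fun n => eLpNorm (fun x => γ n x - f x) q m) atTop (𝓝 0))
    (hφ : ∀ n, AEStronglyMeasurable (φ n) m) (hg : MemLp g p m)
    (hγ : ∀ n, AEStronglyMeasurable (γ n) m) (hf : MemLp f q m) :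
    Tendsto (fun n => eLpNorm (fun x => B (φ n x) (γ n x) - B (g x) (f x)) r m) atTop (𝓝 0) := by
  -- Expanding about the limits, each of the three terms contains a small difference, and norms are
  -- otherwise taken of the limits only.
  have key : ∀ n, eLpNorm (fun x => B (φ n x) (γ n x) - B (g x) (f x)) r m ≤
      ‖B‖ₑ * eLpNorm (fun x => φ n x - g x) p m * eLpNorm (fun x => γ n x - f x) q m +
      ‖B‖ₑ * eLpNorm (fun x => φ n x - g x) p m * eLpNorm f q m +
      ‖B‖ₑ * eLpNorm g p m * eLpNorm (fun x => γ n x - f x) q m := by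
    intro n
    have m1 : AEStronglyMeasurable (fun x => φ n x - g x) m := (hφ n).sub hg.1
    have m2 : AEStronglyMeasurable (fun x => γ n x - f x) m := (hγ n).sub hf.1
    have hBm : ∀ {u : E3 → F} {w : E3 → G}, AEStronglyMeasurable u m → AEStronglyMeasurable w m →
        AEStronglyMeasurable (fun x => B (u x) (w x)) m := fun hu hw =>
      B.aestronglyMeasurable_comp₂ hu hw
    have e : (fun x => B (φ n x) (γ n x) - B (g x) (f x)) =
        ((fun x => B (φ n x - g x) (γ n x - f x)) + fun x => B (φ n x - g x) (f x)) +
          fun x => B (g x) (γ n x - f x) := by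
      funext x
      simp only [Pi.add_apply, map_sub, _root_.sub_apply]
      abel
    rw [e]
    refine (eLpNorm_add_le ((hBm m1 m2).add (hBm m1 hf.1)) (hBm hg.1 m2) hr).trans ?_
    gcongr
    · refine (eLpNorm_add_le (hBm m1 m2) (hBm m1 hf.1) hr).trans ?_
      gcongr
      · exact eLpNorm_bilin_le B m1 m2
      · exact eLpNorm_bilin_le B m1 hf.1
    · exact eLpNorm_bilin_le B hg.1 m2
  have hB : ‖B‖ₑ ≠ ⊤ := enorm_ne_top
  have t1 := ENNReal.Tendsto.const_mul h (Or.inr hB)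
  rw [mul_zero] at t1
  have t2 := ENNReal.Tendsto.mul t1 (Or.inr ENNReal.zero_ne_top) h' (Or.inr ENNReal.zero_ne_top)
  have t3 := ENNReal.Tendsto.mul_const t1 (Or.inr hf.2.ne)
  have t4 := ENNReal.Tendsto.const_mul h' (Or.inr (ENNReal.mul_ne_top hB hg.2.ne))
  have t5 := (t2.add t3).add t4
  simp only [mul_zero, zero_mul, add_zero] at t5
  exact tendsto_of_tendsto_of_tendsto_of_le_of_le tendsto_const_nhds t5 (fun _ => zero_le) key

lemma TendstoLpLoc.bilin (B : F →L[ℝ] G →L[ℝ] H) {p q r : ℝ≥0∞} [ENNReal.HolderTriple p q r]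
    (hr : 1 ≤ r) {γ : ℕ → E3 → G} {f : E3 → G} (h : TendstoLpLoc m p φ g)
    (h' : TendstoLpLoc m q γ f) (hφ : ∀ n, AEStronglyMeasurable (φ n) m) (hg : MemLpLoc m p g)
    (hγ : ∀ n, AEStronglyMeasurable (γ n) m) (hf : MemLpLoc m q f) :
    TendstoLpLoc m r (fun n x => B (φ n x) (γ n x)) (fun x => B (g x) (f x)) := fun R =>
  tendsto_eLpNorm_bilin B hr (h R) (h' R) (fun n => (hφ n).restrict) (hg R)
    (fun n => (hγ n).restrict) (hf R)

lemma integrable_bilin_of_hasCompactSupport [IsFiniteMeasureOnCompacts m]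
    (B : F →L[ℝ] G →L[ℝ] H) (hg : MemLpLoc m 1 g) {ψ : E3 → G} (hψ : Continuous ψ)
    (hψc : HasCompactSupport ψ) : Integrable (fun x => B (g x) (ψ x)) m := by
  obtain ⟨R, hR⟩ := hψc.isBounded.subset_ball 0
  obtain ⟨C, hC⟩ := hψc.exists_bound_of_continuous hψ
  have h1 : Integrable g (m.restrict (Metric.ball 0 R)) := memLp_one_iff_integrable.1 (hg R)
  have h2 : IntegrableOn (fun x => B (g x) (ψ x)) (Metric.ball 0 R) m := by
    refine Integrable.mono' (h1.norm.const_mul (‖B‖ * C))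
      (B.aestronglyMeasurable_comp₂ h1.1 hψ.aestronglyMeasurable)
      (Eventually.of_forall fun x => ?_)
    calc ‖B (g x) (ψ x)‖ ≤ ‖B‖ * ‖g x‖ * ‖ψ x‖ := B.le_opNorm₂ _ _
      _ ≤ ‖B‖ * ‖g x‖ * C := by gcongr; exact hC x
      _ = ‖B‖ * C * ‖g x‖ := by ring
  refine (integrableOn_iff_integrable_of_support_subset fun x hx => hR ?_).1 h2
  by_contra h
  exact hx (by simp [image_eq_zero_of_notMem_tsupport h])

lemma TendstoLpLoc.integral [IsFiniteMeasureOnCompacts m] (B : F →L[ℝ] G →L[ℝ] H)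
    (h : TendstoLpLoc m 1 φ g) (hφ : ∀ n, MemLpLoc m 1 (φ n)) (hg : MemLpLoc m 1 g) {ψ : E3 → G}
    (hψ : Continuous ψ) (hψc : HasCompactSupport ψ) :
    Tendsto (fun n => ∫ x, B (φ n x) (ψ x) ∂m) atTop (𝓝 (∫ x, B (g x) (ψ x) ∂m)) := by
  obtain ⟨R, hR⟩ := hψc.isBounded.subset_ball 0
  obtain ⟨C, hC⟩ := hψc.exists_bound_of_continuous hψ
  refine tendsto_integral_of_L1' _ (integrable_bilin_of_hasCompactSupport B hg hψ hψc).1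
    (Eventually.of_forall fun n => integrable_bilin_of_hasCompactSupport B (hφ n) hψ hψc) ?_
  have h1 := ENNReal.Tendsto.const_mul (h R) (Or.inr (show ‖B‖ₑ * ENNReal.ofReal C ≠ ⊤ from
    ENNReal.mul_ne_top enorm_ne_top ENNReal.ofReal_ne_top))
  rw [mul_zero] at h1
  refine tendsto_of_tendsto_of_tendsto_of_le_of_le tendsto_const_nhds h1 (fun _ => zero_le)
    fun n => ?_
  rw [eLpNorm_one_eq_lintegral_enorm, eLpNorm_one_eq_lintegral_enorm,
    ← lintegral_const_mul' _ _ (ENNReal.mul_ne_top enorm_ne_top ENNReal.ofReal_ne_top),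
    ← lintegral_indicator Metric.isOpen_ball.measurableSet]
  refine lintegral_mono fun x => ?_
  dsimp only
  rw [Pi.sub_apply, ← _root_.sub_apply, ← map_sub]
  by_cases hx : x ∈ Metric.ball (0 : E3) R
  · rw [indicator_of_mem hx]
    calc ‖B (φ n x - g x) (ψ x)‖ₑ ≤ ‖B‖ₑ * ‖φ n x - g x‖ₑ * ‖ψ x‖ₑ := enorm_bilin_le B _ _
      _ ≤ ‖B‖ₑ * ‖φ n x - g x‖ₑ * ENNReal.ofReal C := by
          gcongr
          rw [← ofReal_norm]
          exact ENNReal.ofReal_le_ofReal (hC x)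
      _ = _ := by ring
  · rw [image_eq_zero_of_notMem_tsupport fun h => hx (hR h)]
    simp

end Calculus

end MaxwellCylinder

namespace MaxwellCylinder

/-! ### Weak derivatives as limits, and their uniqueness -/

section Weak

variable {F G H : Type} [NormedAddCommGroup F] [NormedSpace ℝ F]
  [NormedAddCommGroup G] [NormedSpace ℝ G] [NormedAddCommGroup H] [NormedSpace ℝ H]
  {P : Set E3} {ν : E3 → E3} {c : E3} {ρ D : ℝ}

lemma fderiv_bilin_apply (B : F →L[ℝ] G →L[ℝ] H) {φ : E3 → F} {ψ : E3 → G}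
    (hφ : ContDiff ℝ 1 φ) (hψ : ContDiff ℝ 1 ψ) (x e : E3) :
    fderiv ℝ (fun x => B (φ x) (ψ x)) x e =
      B (φ x) (fderiv ℝ ψ x e) + B (fderiv ℝ φ x e) (ψ x) := by
  rw [B.fderiv_of_bilinear (hφ.differentiable (by simp) x) (hψ.differentiable (by simp) x)]
  simp

lemma contDiff_bilin (B : F →L[ℝ] G →L[ℝ] H) {φ : E3 → F} {ψ : E3 → G} {n : ℕ∞}
    (hφ : ContDiff ℝ n φ) (hψ : ContDiff ℝ n ψ) : ContDiff ℝ n (fun x => B (φ x) (ψ x)) :=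
  (B.contDiff.comp hφ).clm_apply hψ

lemma continuous_fderiv_apply {φ : E3 → F} (hφ : ContDiff ℝ 1 φ) (e : E3) :
    Continuous fun x => fderiv ℝ φ x e :=
  (hφ.continuous_fderiv (by simp)).clm_apply continuous_const

lemma hasCompactSupport_fderiv_apply {φ : E3 → F} (hφ : HasCompactSupport φ) (e : E3) :
    HasCompactSupport fun x => fderiv ℝ φ x e :=
  (hφ.fderiv (𝕜 := ℝ)).comp_left (g := fun L : E3 →L[ℝ] F => L e) rfl

/-- Compact support is needed of one factor only, so approximating functions without decay may stand
in the other. -/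
lemma IsGaussCylinder.integral_bilin [CompleteSpace H] (h : IsGaussCylinder P ν c ρ D)
    (B : F →L[ℝ] G →L[ℝ] H) {φ : E3 → F} {ψ : E3 → G} (hφ : ContDiff ℝ 1 φ) (hψ : ContDiff ℝ 1 ψ)
    (hψc : HasCompactSupport ψ) (j : Fin 3) :
    (∫ x in P, B (φ x) (fderiv ℝ ψ x (unitVec j))) + ∫ x in P, B (fderiv ℝ φ x (unitVec j)) (ψ x) =
      ∫ x, ν x j • B (φ x) (ψ x) ∂surfaceMeasure P := by
  have hc : HasCompactSupport fun x => B (φ x) (ψ x) := hψc.mono fun x hx hx0 => hx (by simp [hx0])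
  rw [← h.divergence _ (contDiff_bilin B hφ hψ) hc j]
  simp_rw [fderiv_bilin_apply B hφ hψ]
  rw [integral_add]
  · exact integrable_bilin_of_hasCompactSupport B (memLpLoc_of_continuous hφ.continuous)
      (continuous_fderiv_apply hψ _) (hasCompactSupport_fderiv_apply hψc _)
  · exact integrable_bilin_of_hasCompactSupport B
      (memLpLoc_of_continuous (continuous_fderiv_apply hφ _)) hψ.continuous hψc

lemma SmoothApprox.contDiff_one {p : ℝ≥0∞} {g : E3 → F} {d : Fin 3 → E3 → F} {φ : ℕ → E3 → F}
    (h : SmoothApprox P p g d φ) (n : ℕ) : ContDiff ℝ 1 (φ n) :=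
  (h.contDiff n).of_le (by exact_mod_cast le_top)

lemma SmoothApprox.tendsto_integral [CompleteSpace H] {g : E3 → F} {d : Fin 3 → E3 → F}
    {φ : ℕ → E3 → F} (hs : SmoothApprox P 1 g d φ)
    (hg : MemLpLoc (volume.restrict P) 1 g) (hd : ∀ j, MemLpLoc (volume.restrict P) 1 (d j))
    (B : F →L[ℝ] G →L[ℝ] H) {ψ : E3 → G} (hψ : ContDiff ℝ 1 ψ) (hψc : HasCompactSupport ψ)
    (j : Fin 3) :
    Tendsto (fun n => (∫ x in P, B (φ n x) (fderiv ℝ ψ x (unitVec j))) +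
      ∫ x in P, B (fderiv ℝ (φ n) x (unitVec j)) (ψ x)) atTop
      (𝓝 ((∫ x in P, B (g x) (fderiv ℝ ψ x (unitVec j))) + ∫ x in P, B (d j x) (ψ x))) := by
  refine Tendsto.add ?_ ?_
  · exact hs.tendsto.integral B (fun n => memLpLoc_of_continuous (hs.contDiff n).continuous) hg
      (continuous_fderiv_apply hψ _) (hasCompactSupport_fderiv_apply hψc _)
  · exact (hs.tendsto_fderiv j).integral B (fun n => memLpLoc_of_continuous
      (continuous_fderiv_apply (hs.contDiff_one n) _)) (hd j) hψ.continuous hψc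

/-- Integration by parts for the smooth functions passes to the limit; test functions vanish on the
boundary of the open set `P`. The product and quotient rules are obtained in this way. -/
lemma SmoothApprox.isWeakPartial [CompleteSpace F] (h : IsGaussCylinder P ν c ρ D) {g : E3 → F}
    {d : Fin 3 → E3 → F} {φ : ℕ → E3 → F} (hs : SmoothApprox P 1 g d φ)
    (hg : MemLpLoc (volume.restrict P) 1 g) (hd : ∀ j, MemLpLoc (volume.restrict P) 1 (d j))
    (j : Fin 3) : IsWeakPartial P j g (d j) := by
  refine ⟨locallyIntegrableOn_of_locallyIntegrable_restrict (hg.locallyIntegrable le_rfl),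
    locallyIntegrableOn_of_locallyIntegrable_restrict ((hd j).locallyIntegrable le_rfl),
    fun ψ hψ => ?_⟩
  have hψ1 : ContDiff ℝ 1 ψ := hψ.1.of_le (by exact_mod_cast le_top)
  have h1 := hs.tendsto_integral hg hd (ContinuousLinearMap.lsmul ℝ ℝ).flip hψ1 hψ.2.1 j
  have h2 : ∀ n, (∫ x in P, (ContinuousLinearMap.lsmul ℝ ℝ).flip (φ n x)
      (fderiv ℝ ψ x (unitVec j))) + ∫ x in P, (ContinuousLinearMap.lsmul ℝ ℝ).flip
        (fderiv ℝ (φ n) x (unitVec j)) (ψ x) = 0 := by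
    intro n
    rw [h.integral_bilin _ (hs.contDiff_one n) hψ1 hψ.2.1]
    refine setIntegral_eq_zero_of_forall_eq_zero fun x hx => ?_
    have : x ∉ tsupport ψ := fun hxs =>
      (h.isOpen.frontier_eq ▸ hx : x ∈ closure P \ P).2 (hψ.2.2 hxs)
    simp [image_eq_zero_of_notMem_tsupport this]
  simp_rw [h2] at h1
  exact eq_neg_of_add_eq_zero_left (tendsto_nhds_unique h1 tendsto_const_nhds)

lemma integrable_test_smul {φ : E3 → ℝ} (hφ : IsTest P φ) {g : E3 → F}
    (hg : LocallyIntegrableOn g P) : Integrable (fun x => φ x • g x) (volume.restrict P) := by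
  have h1 : IntegrableOn g (tsupport φ) := hg.integrableOn_compact_subset hφ.2.2 hφ.2.1
  have h2 : IntegrableOn (fun x => φ x • g x) (tsupport φ) :=
    h1.continuousOn_smul hφ.1.continuous.continuousOn hφ.2.1
  have h3 : Integrable fun x => φ x • g x := by
    refine (integrableOn_iff_integrable_of_support_subset fun x hx => ?_).1 h2
    by_contra hc
    exact hx (by simp [image_eq_zero_of_notMem_tsupport hc])
  exact h3.restrict

lemma IsWeakPartial.ae_eq [CompleteSpace F] (hP : IsOpen P) {j : Fin 3} {g d d' : E3 → F}
    (h : IsWeakPartial P j g d) (h' : IsWeakPartial P j g d') : d =ᵐ[volume.restrict P] d' := by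
  have key := hP.ae_eq_zero_of_integral_contDiff_smul_eq_zero (μ := volume)
    (f := fun x => d x - d' x) (h.2.1.sub h'.2.1) fun φ hφ hφc hφP => by
      have ht : IsTest P φ := ⟨hφ, hφc, hφP⟩
      have e1 : ∫ x, φ x • (d x - d' x) = ∫ x in P, φ x • (d x - d' x) := by
        refine (setIntegral_eq_integral_of_forall_compl_eq_zero fun x hx => ?_).symm
        rw [image_eq_zero_of_notMem_tsupport fun hc => hx (hφP hc), zero_smul]
      rw [e1]
      simp_rw [smul_sub]
      rw [integral_sub (integrable_test_smul ht h.2.1) (integrable_test_smul ht h'.2.1), sub_eq_zero,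
        ← neg_inj, ← h.2.2 φ ht, ← h'.2.2 φ ht]
  rw [EventuallyEq, ae_restrict_iff' hP.measurableSet]
  filter_upwards [key] with x hx hxP
  exact sub_eq_zero.1 (hx hxP)

lemma IsWeakPartial.isWeakPartial_weakPartial {j : Fin 3} {g d : E3 → F}
    (h : IsWeakPartial P j g d) : IsWeakPartial P j g (weakPartial P j g) := by
  have h' : ∃ d, IsWeakPartial P j g d := ⟨d, h⟩
  rw [weakPartial, dif_pos h']
  exact h'.choose_spec

lemma IsWeakPartial.weakPartial_ae_eq [CompleteSpace F] (hP : IsOpen P) {j : Fin 3} {g d : E3 → F}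
    (h : IsWeakPartial P j g d) : weakPartial P j g =ᵐ[volume.restrict P] d :=
  h.isWeakPartial_weakPartial.ae_eq hP h

lemma IsWeakPartial.congr {j : Fin 3} {g g' d d' : E3 → F}
    (h : IsWeakPartial P j g d)
    (hg : g =ᵐ[volume.restrict P] g') (hd : d =ᵐ[volume.restrict P] d') :
    IsWeakPartial P j g' d' := by
  have hl : ∀ {u w : E3 → F}, u =ᵐ[volume.restrict P] w → LocallyIntegrableOn u P →
      LocallyIntegrableOn w P := by
    intro u w huw hu x hx
    obtain ⟨s, hs, hi⟩ := hu x hx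
    refine ⟨s ∩ P, inter_mem hs self_mem_nhdsWithin, ?_⟩
    refine (hi.mono_set inter_subset_left).congr_fun_ae ?_
    exact ae_restrict_of_ae_restrict_of_subset inter_subset_right huw
  refine ⟨hl hg h.1, hl hd h.2.1, fun φ hφ => ?_⟩
  have e1 : ∫ x in P, fderiv ℝ φ x (unitVec j) • g' x = ∫ x in P, fderiv ℝ φ x (unitVec j) • g x :=
    integral_congr_ae (by filter_upwards [hg] with x hx; rw [hx])
  have e2 : ∫ x in P, φ x • d' x = ∫ x in P, φ x • d x :=
    integral_congr_ae (by filter_upwards [hd] with x hx; rw [hx])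
  rw [e1, e2, h.2.2 φ hφ]

end Weak

/-! ### Traces -/

section Trace

variable {F G H : Type} [NormedAddCommGroup F] [NormedSpace ℝ F]
  [NormedAddCommGroup G] [NormedSpace ℝ G] [NormedAddCommGroup H] [NormedSpace ℝ H]
  {P : Set E3} {ν : E3 → E3} {c : E3} {ρ D : ℝ}

lemma IsGaussCylinder.norm_normal_apply_le (h : IsGaussCylinder P ν c ρ D) (j : Fin 3) :
    ∀ᵐ x ∂surfaceMeasure P, ‖ν x j‖ ≤ 1 := by
  filter_upwards [h.norm_normal] with x hx
  rw [← hx]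
  exact PiLp.norm_apply_le (ν x) j

lemma IsGaussCylinder.aestronglyMeasurable_normal_apply (h : IsGaussCylinder P ν c ρ D)
    (j : Fin 3) : AEStronglyMeasurable (fun x => ν x j) (surfaceMeasure P) :=
  (EuclideanSpace.proj (𝕜 := ℝ) j).continuous.comp_aestronglyMeasurable h.measurable_normal

lemma eLpNorm_smul_le_of_bound {m : Measure E3} {b : E3 → ℝ} (hb : ∀ᵐ x ∂m, ‖b x‖ ≤ 1)
    (p : ℝ≥0∞) (g : E3 → F) : eLpNorm (fun x => b x • g x) p m ≤ eLpNorm g p m := by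
  refine eLpNorm_mono_ae ?_
  filter_upwards [hb] with x hx
  rw [norm_smul]
  exact mul_le_of_le_one_left (norm_nonneg _) hx

/-- The Gauss-Green formula for a function with a trace. -/
theorem IsGaussCylinder.integral_bilin_of_trace [CompleteSpace H] (h : IsGaussCylinder P ν c ρ D)
    {g T : E3 → F} {d : Fin 3 → E3 → F} {φ : ℕ → E3 → F} (hs : SmoothApprox P 1 g d φ)
    (hT : TendstoLpLoc (surfaceMeasure P) 1 φ T)
    (hg : MemLpLoc (volume.restrict P) 1 g) (hd : ∀ j, MemLpLoc (volume.restrict P) 1 (d j))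
    (hTm : MemLpLoc (surfaceMeasure P) 1 T)
    (B : F →L[ℝ] G →L[ℝ] H) {ψ : E3 → G} (hψ : ContDiff ℝ 1 ψ) (hψc : HasCompactSupport ψ)
    (j : Fin 3) :
    (∫ x in P, B (g x) (fderiv ℝ ψ x (unitVec j))) + ∫ x in P, B (d j x) (ψ x) =
      ∫ x, ν x j • B (T x) (ψ x) ∂surfaceMeasure P := by
  have hfc := h.isFiniteMeasureOnCompacts
  have hνm := h.aestronglyMeasurable_normal_apply j
  have h1 := hs.tendsto_integral hg hd B hψ hψc j
  simp_rw [fun n => h.integral_bilin B (hs.contDiff_one n) hψ hψc j] at h1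
  refine tendsto_nhds_unique h1 ?_
  have hmem : ∀ {u : E3 → F}, MemLpLoc (surfaceMeasure P) 1 u →
      MemLpLoc (surfaceMeasure P) 1 fun x => ν x j • u x := fun hu R =>
    ⟨hνm.restrict.smul (hu R).1, (eLpNorm_smul_le_of_bound
      (ae_restrict_of_ae (h.norm_normal_apply_le j)) 1 _).trans_lt (hu R).2⟩
  have h2 : TendstoLpLoc (surfaceMeasure P) 1 (fun n x => ν x j • φ n x) fun x => ν x j • T x := by
    intro R
    refine tendsto_of_tendsto_of_tendsto_of_le_of_le tendsto_const_nhds (hT R) (fun _ => zero_le)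
      fun n => ?_
    simp_rw [← smul_sub]
    exact eLpNorm_smul_le_of_bound (ae_restrict_of_ae (h.norm_normal_apply_le j)) 1 _
  have h3 := h2.integral B (fun n => hmem (memLpLoc_of_continuous (hs.contDiff n).continuous))
    (hmem hTm) hψ.continuous hψc
  simpa using h3

/-- `HasTrace` in terms of smooth approximations. -/
lemma hasTrace_iff {g T : E3 → F} : HasTrace P g T ↔ AEStronglyMeasurable T (surfaceMeasure P) ∧
    ∃ d φ, (∀ j, IsWeakPartial P j g (d j)) ∧ SmoothApprox P 1 g d φ ∧
      TendstoLpLoc (surfaceMeasure P) 1 φ T := by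
  have hR : ∀ R : ℝ, (volume.restrict P).restrict (Metric.ball (0 : E3) R) =
      volume.restrict (P ∩ Metric.ball 0 R) := fun R => by
    rw [Measure.restrict_restrict Metric.isOpen_ball.measurableSet, inter_comm]
  constructor
  · rintro ⟨h0, d, φ, h1, h2, h3⟩
    exact ⟨h0, d, φ, h1, ⟨h2, fun R => by rw [hR]; exact (h3 R).1,
      fun j R => by rw [hR]; exact (h3 R).2.1 j⟩, fun R => (h3 R).2.2⟩
  · rintro ⟨h0, d, φ, h1, h2, h3⟩
    refine ⟨h0, d, φ, h1, h2.contDiff, fun R => ⟨?_, fun j => ?_, h3 R⟩⟩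
    · rw [← hR]; exact h2.tendsto R
    · rw [← hR]; exact h2.tendsto_fderiv j R

lemma SmoothApprox.memLpLoc {p : ℝ≥0∞} {g : E3 → F} {d : Fin 3 → E3 → F} {φ : ℕ → E3 → F}
    (hs : SmoothApprox P p g d φ) (hg : AEStronglyMeasurable g (volume.restrict P)) :
    MemLpLoc (volume.restrict P) p g :=
  hs.tendsto.memLpLoc (fun n => memLpLoc_of_continuous (hs.contDiff n).continuous) hg

lemma SmoothApprox.memLpLoc_partial {p : ℝ≥0∞} {g : E3 → F} {d : Fin 3 → E3 → F} {φ : ℕ → E3 → F}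
    (hs : SmoothApprox P p g d φ) {j : Fin 3} (hd : AEStronglyMeasurable (d j) (volume.restrict P)) :
    MemLpLoc (volume.restrict P) p (d j) :=
  (hs.tendsto_fderiv j).memLpLoc (fun n => memLpLoc_of_continuous
    (continuous_fderiv_apply (hs.contDiff_one n) _)) hd

/-- By the Gauss-Green formula the integrals of `ν_j T ψ` are determined by `g` and its weak
derivatives. So `ν_j (T - T') = 0` for every `j`, and `ν` has length one. -/
theorem HasTrace.ae_eq [CompleteSpace F] (h : IsGaussCylinder P ν c ρ D) {g T T' : E3 → F}
    (hT : HasTrace P g T) (hT' : HasTrace P g T') : T =ᵐ[surfaceMeasure P] T' := by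
  have hfc := h.isFiniteMeasureOnCompacts
  obtain ⟨m, d, φ, hw, hs, ht⟩ := hasTrace_iff.1 hT
  obtain ⟨m', d', φ', hw', hs', ht'⟩ := hasTrace_iff.1 hT'
  have hTl := ht.memLpLoc (fun n => memLpLoc_of_continuous (hs.contDiff n).continuous) m
  have hTl' := ht'.memLpLoc (fun n => memLpLoc_of_continuous (hs'.contDiff n).continuous) m'
  have hdiff : LocallyIntegrable (fun x => T x - T' x) (surfaceMeasure P) :=
    (hTl.locallyIntegrable le_rfl).sub (hTl'.locallyIntegrable le_rfl)
  have key : ∀ j, ∀ᵐ x ∂surfaceMeasure P, ν x j • (T x - T' x) = 0 := by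
    intro j
    have hνm := h.aestronglyMeasurable_normal_apply j
    have hli : LocallyIntegrable (fun x => ν x j • (T x - T' x)) (surfaceMeasure P) := by
      refine hdiff.mono (hνm.smul (m.sub m')) ?_
      filter_upwards [h.norm_normal_apply_le j] with x hx
      rw [norm_smul]
      exact mul_le_of_le_one_left (norm_nonneg _) hx
    refine ae_eq_zero_of_integral_contDiff_smul_eq_zero hli fun ψ hψ hψc => ?_
    have hψ1 : ContDiff ℝ 1 ψ := hψ.of_le (by exact_mod_cast le_top)
    have e1 := h.integral_bilin_of_trace hs ht (hs.memLpLoc (hw 0).1.aestronglyMeasurable)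
      (fun j => hs.memLpLoc_partial (hw j).2.1.aestronglyMeasurable) hTl
      (ContinuousLinearMap.lsmul ℝ ℝ).flip hψ1 hψc j
    have e2 := h.integral_bilin_of_trace hs' ht' (hs'.memLpLoc (hw' 0).1.aestronglyMeasurable)
      (fun j => hs'.memLpLoc_partial (hw' j).2.1.aestronglyMeasurable) hTl'
      (ContinuousLinearMap.lsmul ℝ ℝ).flip hψ1 hψc j
    simp only [ContinuousLinearMap.flip_apply, ContinuousLinearMap.lsmul_apply] at e1 e2
    have e3 : ∫ x in P, ψ x • d j x = ∫ x in P, ψ x • d' j x := integral_congr_ae (by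
      filter_upwards [(hw j).ae_eq h.isOpen (hw' j)] with x hx
      rw [hx])
    rw [e3, e2] at e1
    have hi : ∀ {u : E3 → F}, MemLpLoc (surfaceMeasure P) 1 u →
        Integrable (fun x => ν x j • ψ x • u x) (surfaceMeasure P) := by
      intro u hu
      have := integrable_bilin_of_hasCompactSupport (ContinuousLinearMap.lsmul ℝ ℝ).flip hu
        hψ.continuous hψc
      refine this.mono (hνm.smul this.1) ?_
      filter_upwards [h.norm_normal_apply_le j] with x hx
      rw [norm_smul]
      exact mul_le_of_le_one_left (norm_nonneg _) hx
    have e4 : ∀ x, ψ x • ν x j • (T x - T' x) = ν x j • ψ x • T x - ν x j • ψ x • T' x := by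
      intro x
      module
    simp_rw [e4]
    rw [integral_sub (hi hTl) (hi hTl'), e1, sub_self]
  filter_upwards [key 0, key 1, key 2, h.norm_normal] with x h0 h1 h2 hn
  by_contra hne
  have hne' : T x - T' x ≠ 0 := sub_ne_zero.2 hne
  have h0' := (smul_eq_zero.1 h0).resolve_right hne'
  have h1' := (smul_eq_zero.1 h1).resolve_right hne'
  have h2' := (smul_eq_zero.1 h2).resolve_right hne'
  have : ν x = 0 := by ext i; fin_cases i <;> simpa
  rw [this, norm_zero] at hn
  exact zero_ne_one hn

lemma HasTrace.trace_ae_eq [CompleteSpace F] (h : IsGaussCylinder P ν c ρ D) {g T : E3 → F}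
    (hT : HasTrace P g T) : trace P g =ᵐ[surfaceMeasure P] T := by
  have h' : ∃ T, HasTrace P g T := ⟨T, hT⟩
  rw [trace, dif_pos h']
  exact h'.choose_spec.ae_eq h hT

/-- Sequences that are Cauchy in `L_p` on all balls converge. -/
lemma exists_tendstoLpLoc {F : Type} [NormedAddCommGroup F] [CompleteSpace F] {m : Measure E3}
    {p : ℝ≥0∞} (hp : 1 ≤ p)
    {φ : ℕ → E3 → F} (hφ : ∀ n, MemLpLoc m p (φ n))
    (hc : ∀ N : ℕ, ∀ ε > 0, ∃ K, ∀ n ≥ K, ∀ k ≥ K,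
      eLpNorm (fun x => φ n x - φ k x) p (m.restrict (Metric.ball 0 N)) < ε) :
    ∃ T, AEStronglyMeasurable T m ∧ TendstoLpLoc m p φ T := by
  have hfact : Fact (1 ≤ p) := ⟨hp⟩
  have hp0 : p ≠ 0 := (zero_lt_one.trans_le hp).ne'
  have h1 : ∀ N : ℕ, ∃ T : E3 → F, StronglyMeasurable T ∧
      Tendsto (fun n => eLpNorm (φ n - T) p (m.restrict (Metric.ball 0 N))) atTop (𝓝 0) := by
    intro N
    have hcs : CauchySeq fun n => (hφ n N).toLp (φ n) := by
      refine EMetric.cauchySeq_iff.2 fun ε hε => ?_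
      obtain ⟨K, hK⟩ := hc N ε hε
      refine ⟨K, fun n hn k hk => ?_⟩
      rw [Lp.edist_toLp_toLp]
      exact hK n hn k hk
    obtain ⟨T, hT⟩ := cauchySeq_tendsto_of_complete hcs
    refine ⟨T, Lp.stronglyMeasurable T, ?_⟩
    have := (Lp.tendsto_Lp_iff_tendsto_eLpNorm'' _ (fun n => hφ n N) T (Lp.memLp T)).1
      (by rwa [Lp.toLp_coeFn])
    exact this
  choose T hTm hT using h1
  have hae : ∀ N M : ℕ, N ≤ M → T N =ᵐ[m.restrict (Metric.ball 0 N)] T M := by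
    intro N M hNM
    have hle : m.restrict (Metric.ball (0 : E3) N) ≤ m.restrict (Metric.ball 0 M) :=
      Measure.restrict_mono (Metric.ball_subset_ball (by exact_mod_cast hNM)) le_rfl
    have h2 : Tendsto (fun n => eLpNorm (φ n - T M) p (m.restrict (Metric.ball 0 N))) atTop (𝓝 0) :=
      tendsto_of_tendsto_of_tendsto_of_le_of_le tendsto_const_nhds (hT M) (fun _ => zero_le)
        fun n => eLpNorm_mono_measure _ hle
    exact tendstoInMeasure_ae_unique
      (tendstoInMeasure_of_tendsto_eLpNorm hp0 (fun n => (hφ n N).1)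
        (hTm N).aestronglyMeasurable (hT N))
      (tendstoInMeasure_of_tendsto_eLpNorm hp0 (fun n => (hφ n N).1)
        (hTm M).aestronglyMeasurable h2)
  -- The limits on the balls agree almost everywhere on overlaps and are glued. `⌊‖x‖⌋₊ + 1` is the
  -- least natural radius whose open ball contains `x`.
  let S : E3 → F := fun x => T (⌊‖x‖⌋₊ + 1) x
  have hS : ∀ N : ℕ, S =ᵐ[m.restrict (Metric.ball 0 N)] T N := by
    intro N
    have h3 : ∀ᵐ x ∂m.restrict (Metric.ball (0 : E3) N), ∀ k : ℕ, k ≤ N → x ∈ Metric.ball (0 : E3) k →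
        T k x = T N x := by
      refine ae_all_iff.2 fun k => ?_
      by_cases hk : k ≤ N
      · have h4 := (ae_restrict_iff' Metric.isOpen_ball.measurableSet).1 (hae k N hk)
        filter_upwards [ae_restrict_of_ae h4] with x hx _ hxk
        exact hx hxk
      · exact Eventually.of_forall fun x h => absurd h hk
    filter_upwards [h3, ae_restrict_mem Metric.isOpen_ball.measurableSet] with x hx hxN
    rw [mem_ball_zero_iff] at hxN
    refine hx _ ?_ ?_
    · have := (Nat.floor_lt (norm_nonneg x)).2 hxN
      lia
    · rw [mem_ball_zero_iff]
      push_cast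
      exact Nat.lt_floor_add_one _
  have hSm : AEStronglyMeasurable S m := by
    have hu : (⋃ n : ℕ, Metric.ball (0 : E3) n) = univ := Metric.iUnion_ball_nat 0
    rw [← Measure.restrict_univ (μ := m), ← hu]
    exact AEStronglyMeasurable.iUnion fun n => (hTm n).aestronglyMeasurable.congr (hS n).symm
  refine ⟨S, hSm, fun R => ?_⟩
  obtain ⟨N, hN⟩ := exists_nat_ge R
  have hle : m.restrict (Metric.ball (0 : E3) R) ≤ m.restrict (Metric.ball 0 N) :=
    Measure.restrict_mono (Metric.ball_subset_ball hN) le_rfl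
  refine tendsto_of_tendsto_of_tendsto_of_le_of_le tendsto_const_nhds (hT N) (fun _ => zero_le)
    fun n => ?_
  refine (eLpNorm_mono_measure _ hle).trans_eq (eLpNorm_congr_ae ?_)
  filter_upwards [hS N] with x hx
  simp [hx]

lemma eLpNorm_sub_le_add {F : Type} [NormedAddCommGroup F] {p : ℝ≥0∞} (hp : 1 ≤ p) {g : E3 → F}
    {φ : ℕ → E3 → F}
    {m : Measure E3} (hm : ∀ n, AEStronglyMeasurable (φ n) m) (hg : AEStronglyMeasurable g m)
    (n k : ℕ) : eLpNorm (fun x => φ n x - φ k x) p m ≤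
      eLpNorm (fun x => φ n x - g x) p m + eLpNorm (fun x => φ k x - g x) p m := by
  refine le_trans (le_of_eq ?_) (eLpNorm_sub_le ((hm n).sub hg) ((hm k).sub hg) hp)
  congr 1; funext x; simp

lemma fderiv_sub_apply {φ ψ : E3 → F} (hφ : ContDiff ℝ 1 φ) (hψ : ContDiff ℝ 1 ψ) (x e : E3) :
    fderiv ℝ (fun x => φ x - ψ x) x e = fderiv ℝ φ x e - fderiv ℝ ψ x e := by
  rw [fderiv_fun_sub (hφ.differentiable (by simp) x) (hψ.differentiable (by simp) x)]
  rfl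

/-- Sequences converging in `W¹_p` are Cauchy. -/
lemma eventually_sobNorm_sub_lt {p : ℝ≥0∞} (hp : 1 ≤ p) {g : E3 → F} {d : Fin 3 → E3 → F}
    {φ : ℕ → E3 → F} {m : Measure E3} (hφ : ∀ n, ContDiff ℝ 1 (φ n))
    (hg : AEStronglyMeasurable g m) (hd : ∀ j, AEStronglyMeasurable (d j) m)
    (h0 : Tendsto (fun n => eLpNorm (fun x => φ n x - g x) p m) atTop (𝓝 0))
    (h1 : ∀ j, Tendsto (fun n => eLpNorm (fun x => fderiv ℝ (φ n) x (unitVec j) - d j x) p m)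
      atTop (𝓝 0)) {ε : ℝ≥0∞} (hε : 0 < ε) :
    ∃ K, ∀ n ≥ K, ∀ k ≥ K, sobNorm m p (fun x => φ n x - φ k x) < ε := by
  have h2 : Tendsto (fun n => eLpNorm (fun x => φ n x - g x) p m +
      ∑ j, eLpNorm (fun x => fderiv ℝ (φ n) x (unitVec j) - d j x) p m) atTop (𝓝 0) := by
    have := h0.add (tendsto_finsetSum Finset.univ fun j _ => h1 j)
    simpa using this
  obtain ⟨K, hK⟩ := eventually_atTop.1 (h2.eventually (gt_mem_nhds (ENNReal.half_pos hε.ne')))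
  refine ⟨K, fun n hn k hk => ?_⟩
  refine lt_of_le_of_lt ?_ ((ENNReal.add_lt_add (hK n hn) (hK k hk)).trans_eq (ENNReal.add_halves ε))
  rw [sobNorm, add_add_add_comm, ← Finset.sum_add_distrib]
  gcongr with j
  · exact eLpNorm_sub_le_add hp (fun n => (hφ n).continuous.aestronglyMeasurable) hg n k
  · simp_rw [fderiv_sub_apply (hφ n) (hφ k)]
    exact eLpNorm_sub_le_add (φ := fun n x => fderiv ℝ (φ n) x (unitVec j)) hp
      (fun n => (continuous_fderiv_apply (hφ n) _).aestronglyMeasurable) (hd j) n k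

/-- The inequality applied to differences multiplied by a cutoff shows that `φ` is Cauchy in
`L_r(m)` on every ball. With `m` the surface measure the limit is the trace; with `m` the volume it
yields higher integrability of `g`. -/
theorem SmoothApprox.exists_trace [FiniteDimensional ℝ F] {m : Measure E3}
    [IsFiniteMeasureOnCompacts m] {r p : ℝ≥0∞} (hr : 1 ≤ r) (hp : 1 ≤ p)
    (hW : WeightedBound P m 1 r p) {g : E3 → F} {d : Fin 3 → E3 → F} {φ : ℕ → E3 → F}
    (hs : SmoothApprox P p g d φ) (hg : AEStronglyMeasurable g (volume.restrict P))
    (hd : ∀ j, AEStronglyMeasurable (d j) (volume.restrict P)) :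
    ∃ T, AEStronglyMeasurable T m ∧ TendstoLpLoc m r φ T := by
  have : CompleteSpace F := FiniteDimensional.complete ℝ F
  refine exists_tendstoLpLoc hr (fun n => memLpLoc_of_continuous (hs.contDiff n).continuous)
    fun N ε hε => ?_
  obtain ⟨C, hC⟩ := hW.vector (F := F) hr aestronglyMeasurable_one
  obtain ⟨M, hM⟩ := exists_norm_fderiv_cutoff_le
  set R : ℝ := 2 * ((N : ℝ) + 1) + 1
  -- The added `1` makes `A` nonzero, so that `ε / A` can serve as the tolerance.
  set A : ℝ≥0∞ := C * (1 + 3 * M) + 1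
  have hA0 : A ≠ 0 := by simp [A]
  have hAt : A ≠ ⊤ := by finiteness
  obtain ⟨K, hK⟩ := eventually_sobNorm_sub_lt hp hs.contDiff_one hg.restrict
    (fun j => (hd j).restrict) (hs.tendsto R) (fun j => hs.tendsto_fderiv j R)
    (ENNReal.div_pos hε.ne' hAt)
  refine ⟨K, fun n hn k hk => ?_⟩
  have hd1 : ContDiff ℝ 1 fun x => φ n x - φ k x := (hs.contDiff_one n).sub (hs.contDiff_one k)
  have hball : tsupport (cutoff N) ⊆ Metric.ball 0 R :=
    (tsupport_cutoff_subset N).trans (Metric.closedBall_subset_ball (by simp [R]))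
  calc eLpNorm (fun x => φ n x - φ k x) r (m.restrict (Metric.ball 0 N))
      = eLpNorm (fun x => (1 : E3 → ℝ) x • cutoff N x • (φ n x - φ k x)) r
          (m.restrict (Metric.ball 0 N)) := by
        refine eLpNorm_congr_ae ?_
        filter_upwards [ae_restrict_mem Metric.isOpen_ball.measurableSet] with x hx
        rw [mem_ball_zero_iff] at hx
        rw [cutoff_eq_one (by linarith), Pi.one_apply, one_smul, one_smul]
    _ ≤ eLpNorm (fun x => (1 : E3 → ℝ) x • cutoff N x • (φ n x - φ k x)) r m :=
        eLpNorm_mono_measure _ Measure.restrict_le_self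
    _ ≤ C * sobNorm (volume.restrict P) p (fun x => cutoff N x • (φ n x - φ k x)) :=
        hC _ ((contDiff_cutoff N (k := 1)).smul hd1) (hasCompactSupport_cutoff N).smul_right
    _ ≤ C * ((1 + 3 * M) * sobNorm ((volume.restrict P).restrict (Metric.ball 0 R)) p
          fun x => φ n x - φ k x) := by
        gcongr
        exact sobNorm_smul_le (contDiff_cutoff N (k := 1)) (norm_cutoff_le N) (hM N)
          Metric.isOpen_ball.measurableSet hball _ hp hd1
    _ ≤ A * sobNorm ((volume.restrict P).restrict (Metric.ball 0 R)) p
          fun x => φ n x - φ k x := by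
        rw [← mul_assoc]
        gcongr
        exact le_self_add
    _ < A * (ε / A) := ENNReal.mul_lt_mul_right hA0 hAt (hK n hn k hk)
    _ = ε := ENNReal.mul_div_cancel hA0 hAt

end Trace

end MaxwellCylinder

namespace MaxwellCylinder

/-! ### Uniform local integrability along the axis -/

section Uniform

variable {F : Type} [NormedAddCommGroup F] {P : Set E3} {m : Measure E3}

/-- `L_s` norms over balls of a given radius centred on the axis are bounded. -/
def UniformLp (m : Measure E3) (s : ℝ≥0∞) (w : E3 → F) : Prop :=
  ∀ R : ℝ, ∃ K : NNReal, ∀ z : ℝ,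
    eLpNorm w s (m.restrict (Metric.ball (z • unitVec 2) R)) ≤ K

lemma ae_shift_nat {F : Type} (hs : ∀ x ∈ P, ∀ z : ℝ, x + z • unitVec 2 ∈ P) (hP : MeasurableSet P)
    {g : E3 → F} (hper : ∀ᵐ x ∂(volume.restrict P), g (x + unitVec 2) = g x) (n : ℕ) :
    ∀ᵐ x ∂(volume.restrict P), g (x + (n : ℝ) • unitVec 2) = g x := by
  induction n with
  | zero => simp
  | succ n ih =>
    have h1 : ∀ᵐ x ∂(volume.restrict P), g (x + (n : ℝ) • unitVec 2 + unitVec 2) =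
        g (x + (n : ℝ) • unitVec 2) := by
      rw [ae_restrict_iff' hP] at hper ⊢
      have := (measurePreserving_add_right (volume : Measure E3)
        ((n : ℝ) • unitVec 2)).quasiMeasurePreserving.ae hper
      filter_upwards [this] with x hx hxP
      exact hx (hs x hxP n)
    filter_upwards [ih, h1] with x h2 h3
    rw [← h2, ← h3]
    congr 1
    push_cast
    module

lemma ae_shift_int {F : Type} (hs : ∀ x ∈ P, ∀ z : ℝ, x + z • unitVec 2 ∈ P) (hP : MeasurableSet P)
    {g : E3 → F} (hper : ∀ᵐ x ∂(volume.restrict P), g (x + unitVec 2) = g x) (n : ℤ) :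
    ∀ᵐ x ∂(volume.restrict P), g (x + (n : ℝ) • unitVec 2) = g x := by
  rcases n.eq_nat_or_neg with ⟨k, rfl | rfl⟩
  · simpa using ae_shift_nat hs hP hper k
  · have h1 := ae_shift_nat hs hP hper k
    rw [ae_restrict_iff' hP] at h1 ⊢
    have := (measurePreserving_add_right (volume : Measure E3)
      (-(k : ℝ) • unitVec 2)).quasiMeasurePreserving.ae h1
    filter_upwards [this] with x hx hxP
    have h2 := hx (hs x hxP _)
    rw [neg_smul, neg_add_cancel_right] at h2
    push_cast
    rw [neg_smul, h2]

lemma measurePreserving_shift (hs : ∀ x ∈ P, ∀ z : ℝ, x + z • unitVec 2 ∈ P)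
    (hP : MeasurableSet P) (z : ℝ) :
    MeasurePreserving (fun x => x + z • unitVec 2) (volume.restrict P) (volume.restrict P) := by
  have h := (measurePreserving_add_right (volume : Measure E3) (z • unitVec 2)).restrict_preimage hP
  have : (fun x => x + z • unitVec 2) ⁻¹' P = P := by
    ext x
    refine ⟨fun hx => ?_, fun hx => hs x hx z⟩
    have := hs _ hx (-z)
    simpa using this
  rwa [this] at h

/-- Locally integrable functions that are periodic along the axis are uniformly locally
integrable. -/
lemma MemLpLoc.uniformLp (hs : ∀ x ∈ P, ∀ z : ℝ, x + z • unitVec 2 ∈ P) (hP : MeasurableSet P)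
    {s : ℝ≥0∞} {g : E3 → F} (hg : MemLpLoc (volume.restrict P) s g)
    (hper : ∀ᵐ x ∂(volume.restrict P), g (x + unitVec 2) = g x) :
    UniformLp (volume.restrict P) s g := by
  intro R
  refine ⟨(eLpNorm g s ((volume.restrict P).restrict (Metric.ball 0 (R + 1)))).toNNReal,
    fun z => ?_⟩
  rw [ENNReal.coe_toNNReal (hg _).2.ne]
  -- Shifting by the integer part of `z` brings the centre to a height in `[0, 1)`, and the shifted
  -- ball lies in the ball of radius `R + 1` about the origin.
  have hmp := (measurePreserving_shift hs hP (⌊z⌋ : ℝ)).restrict_preimage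
    (Metric.isOpen_ball (x := z • unitVec 2) (ε := R)).measurableSet
  have hpre : (fun x => x + (⌊z⌋ : ℝ) • unitVec 2) ⁻¹' Metric.ball (z • unitVec 2) R =
      Metric.ball (Int.fract z • unitVec 2) R := by
    ext x
    rw [mem_preimage, Metric.mem_ball, Metric.mem_ball, dist_eq_norm, dist_eq_norm]
    have : x + (⌊z⌋ : ℝ) • unitVec 2 - z • unitVec 2 = x - Int.fract z • unitVec 2 := by
      rw [Int.fract]; module
    rw [this]
  rw [hpre] at hmp
  rw [← eLpNorm_comp_measurePreserving _ hmp]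
  · refine (eLpNorm_congr_ae (g := g)
      (ae_restrict_of_ae (ae_shift_int hs hP hper ⌊z⌋))).trans_le ?_
    refine eLpNorm_mono_measure _ (Measure.restrict_mono (Metric.ball_subset_ball' ?_) le_rfl)
    rw [dist_zero_right, norm_smul, norm_unitVec, mul_one, Real.norm_of_nonneg (Int.fract_nonneg z)]
    linarith [Int.fract_lt_one z]
  · exact hg.aestronglyMeasurable.restrict

/-- A cutoff function near the point `z` of the axis. -/
lemma exists_axis_cutoff : ∃ K : NNReal, ∀ (N : ℕ) (z : ℝ), ∃ χ : E3 → ℝ, ContDiff ℝ 1 χ ∧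
    HasCompactSupport χ ∧ (∀ x, ‖χ x‖ ≤ 1) ∧ (∀ x, ‖fderiv ℝ χ x‖ ≤ K) ∧
    (∀ x ∈ Metric.ball (z • unitVec 2) ((N : ℝ) + 1), χ x = 1) ∧
    tsupport χ ⊆ Metric.ball (z • unitVec 2) (2 * ((N : ℝ) + 1) + 1) := by
  obtain ⟨K, hK⟩ := exists_norm_fderiv_cutoff_le
  refine ⟨K, fun N z => ⟨fun x => cutoff N (x - z • unitVec 2),
    (contDiff_cutoff N (k := 1)).comp (contDiff_id.sub contDiff_const),
    (hasCompactSupport_cutoff N).comp_homeomorph (Homeomorph.subRight _),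
    fun x => norm_cutoff_le N _, fun x => ?_, fun x hx => ?_, ?_⟩⟩
  · rw [fderiv_comp_sub (f := cutoff N)]
    exact hK N _
  · rw [Metric.mem_ball, dist_eq_norm] at hx
    exact cutoff_eq_one hx.le
  · refine (closure_minimal (fun x hx => ?_) Metric.isClosed_closedBall).trans
      (Metric.closedBall_subset_ball (by linarith : 2 * ((N : ℝ) + 1) < _))
    rw [Metric.mem_closedBall, dist_eq_norm]
    by_contra h
    exact hx (cutoff_eq_zero (not_le.1 h).le)

variable [NormedSpace ℝ F]

/-- Sobolev inequality for uniformly local norms. -/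
lemma SmoothApprox.uniformLp [FiniteDimensional ℝ F] {r p : ℝ≥0∞} (hr : 1 ≤ r) (hp : 1 ≤ p)
    (hW : WeightedBound P m 1 r p) {g T : E3 → F} {d : Fin 3 → E3 → F} {φ : ℕ → E3 → F}
    (hs : SmoothApprox P p g d φ) (hgm : AEStronglyMeasurable g (volume.restrict P))
    (hdm : ∀ j, AEStronglyMeasurable (d j) (volume.restrict P))
    (hT : TendstoLpLoc m r φ T) (hTm : AEStronglyMeasurable T m)
    (hg : UniformLp (volume.restrict P) p g) (hd : ∀ j, UniformLp (volume.restrict P) p (d j)) :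
    UniformLp m r T := by
  intro R
  obtain ⟨C, hC⟩ := hW.vector (F := F) hr aestronglyMeasurable_one
  obtain ⟨M, hM⟩ := exists_axis_cutoff
  obtain ⟨N, hN⟩ := exists_nat_ge R
  set R' : ℝ := 2 * ((N : ℝ) + 1) + 1
  obtain ⟨Kg, hKg⟩ := hg R'
  choose Kd hKd using fun j => hd j R'
  refine ⟨C * (1 + 3 * M) * (Kg + ∑ j, Kd j), fun z => ?_⟩
  obtain ⟨χ, hχ, hχc, hχ1, hχd, hχe, hχs⟩ := hM N z
  set mB := (volume.restrict P).restrict (Metric.ball (z • unitVec 2) R')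
  have hle : ∀ ρ : ℝ, Metric.ball (z • unitVec 2 : E3) ρ ⊆ Metric.ball 0 (ρ + ‖(z • unitVec 2 : E3)‖) :=
    fun ρ => Metric.ball_subset_ball' (by rw [dist_zero_right])
  have t0 : Tendsto (fun n => eLpNorm (fun x => φ n x - T x) r
      (m.restrict (Metric.ball (z • unitVec 2) R))) atTop (𝓝 0) :=
    tendsto_of_tendsto_of_tendsto_of_le_of_le tendsto_const_nhds (hT _) (fun _ => zero_le)
      fun n => eLpNorm_mono_measure _ (Measure.restrict_mono (hle R) le_rfl)
  have t1 : Tendsto (fun n => eLpNorm (fun x => φ n x - g x) p mB) atTop (𝓝 0) :=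
    tendsto_of_tendsto_of_tendsto_of_le_of_le tendsto_const_nhds (hs.tendsto _) (fun _ => zero_le)
      fun n => eLpNorm_mono_measure _ (Measure.restrict_mono (hle R') le_rfl)
  have t2 : ∀ j, Tendsto (fun n => eLpNorm (fun x => fderiv ℝ (φ n) x (unitVec j) - d j x) p mB)
      atTop (𝓝 0) := fun j =>
    tendsto_of_tendsto_of_tendsto_of_le_of_le tendsto_const_nhds (hs.tendsto_fderiv j _)
      (fun _ => zero_le) fun n => eLpNorm_mono_measure _ (Measure.restrict_mono (hle R') le_rfl)
  have hsplit : ∀ {u : ℕ → E3 → F} {w : E3 → F} {q : ℝ≥0∞} {μ : Measure E3}, 1 ≤ q →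
      (∀ n, AEStronglyMeasurable (u n) μ) → AEStronglyMeasurable w μ → ∀ n,
      eLpNorm (u n) q μ ≤ eLpNorm (fun x => u n x - w x) q μ + eLpNorm w q μ := by
    intro u w q μ hq hu hw n
    refine le_trans (le_of_eq ?_) (eLpNorm_add_le ((hu n).sub hw) hw hq)
    congr 1; funext x; simp
  -- The cutoffs near height `z` are translates of each other, so no constant depends on `z`; the
  -- error terms do, but they vanish as `n` grows with `z` fixed.
  have hφT : ∀ n, eLpNorm T r (m.restrict (Metric.ball (z • unitVec 2) R)) ≤
      eLpNorm (fun x => φ n x - T x) r (m.restrict (Metric.ball (z • unitVec 2) R)) +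
      C * ((1 + 3 * M) * ((eLpNorm (fun x => φ n x - g x) p mB + Kg) +
        ∑ j, (eLpNorm (fun x => fderiv ℝ (φ n) x (unitVec j) - d j x) p mB + Kd j))) := by
    intro n
    have h1 : eLpNorm T r (m.restrict (Metric.ball (z • unitVec 2) R)) ≤
        eLpNorm (fun x => φ n x - T x) r (m.restrict (Metric.ball (z • unitVec 2) R)) +
        eLpNorm (φ n) r (m.restrict (Metric.ball (z • unitVec 2) R)) := by
      rw [add_comm]
      refine le_trans (le_of_eq ?_) (eLpNorm_sub_le (f := φ n) (g := fun x => φ n x - T x)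
        (hs.contDiff n).continuous.aestronglyMeasurable
        ((hs.contDiff n).continuous.aestronglyMeasurable.sub hTm.restrict) hr)
      congr 1; funext x; simp
    refine h1.trans ?_
    gcongr
    calc eLpNorm (φ n) r (m.restrict (Metric.ball (z • unitVec 2) R))
        = eLpNorm (fun x => (1 : E3 → ℝ) x • χ x • φ n x) r
            (m.restrict (Metric.ball (z • unitVec 2) R)) := by
          refine eLpNorm_congr_ae ?_
          filter_upwards [ae_restrict_mem Metric.isOpen_ball.measurableSet] with x hx
          rw [hχe x (Metric.ball_subset_ball (by linarith) hx), Pi.one_apply, one_smul, one_smul]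
      _ ≤ eLpNorm (fun x => (1 : E3 → ℝ) x • χ x • φ n x) r m :=
          eLpNorm_mono_measure _ Measure.restrict_le_self
      _ ≤ C * sobNorm (volume.restrict P) p (fun x => χ x • φ n x) :=
          hC _ (hχ.smul (hs.contDiff_one n)) hχc.smul_right
      _ ≤ C * ((1 + 3 * M) * sobNorm mB p (φ n)) := by
          gcongr
          exact sobNorm_smul_le hχ hχ1 hχd Metric.isOpen_ball.measurableSet hχs _ hp
            (hs.contDiff_one n)
      _ ≤ _ := by
          rw [sobNorm]
          gcongr with j
          · refine (hsplit hp (fun n => (hs.contDiff n).continuous.aestronglyMeasurable)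
              hgm.restrict n).trans ?_
            gcongr
            exact hKg z
          · refine (hsplit (u := fun n x => fderiv ℝ (φ n) x (unitVec j)) hp
              (fun n => (continuous_fderiv_apply (hs.contDiff_one n) _).aestronglyMeasurable)
              (hdm j).restrict n).trans ?_
            gcongr
            exact hKd j z
  have hlim : Tendsto (fun n => eLpNorm (fun x => φ n x - T x) r
        (m.restrict (Metric.ball (z • unitVec 2) R)) +
      C * ((1 + 3 * M) * ((eLpNorm (fun x => φ n x - g x) p mB + Kg) +
        ∑ j, (eLpNorm (fun x => fderiv ℝ (φ n) x (unitVec j) - d j x) p mB + Kd j)))) atTop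
      (𝓝 (0 + C * ((1 + 3 * M) * ((0 + Kg) + ∑ j, (0 + (Kd j : ℝ≥0∞)))))) := by
    refine t0.add (ENNReal.Tendsto.const_mul (ENNReal.Tendsto.const_mul ?_ (Or.inr (by finiteness)))
      (Or.inr (by finiteness)))
    exact (t1.add tendsto_const_nhds).add
      (tendsto_finsetSum _ fun j _ => (t2 j).add tendsto_const_nhds)
  refine (ge_of_tendsto' hlim hφT).trans_eq ?_
  push_cast
  simp only [zero_add]
  ring

end Uniform

/-! ### Weights -/

section Weights

variable {P : Set E3} {ν : E3 → E3} {c : E3} {ρ D : ℝ} {m : Measure E3}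

lemma eLpNorm_two_sq {F : Type} [NormedAddCommGroup F] (f : E3 → F) (m : Measure E3) :
    eLpNorm f 2 m ^ 2 = ∫⁻ x, ‖f x‖ₑ ^ 2 ∂m := by
  have := eLpNorm_nnreal_pow_eq_lintegral (f := f) (μ := m) (p := 2) two_ne_zero
  simp only [NNReal.coe_ofNat, ENNReal.coe_ofNat, ENNReal.rpow_ofNat] at this
  exact this

lemma dist_axis_sq (x : E3) (z : ℝ) :
    dist x (z • unitVec 2) ^ 2 = x 0 ^ 2 + x 1 ^ 2 + (x 2 - z) ^ 2 := by
  rw [dist_eq_norm, norm_sq_E3]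
  simp [unitVec]

/-- By Tonelli a point `x` is counted with the length of the set of heights whose ball contains it.
-/
lemma lintegral_axis_balls [SFinite m] {h : E3 → ℝ≥0∞} (hh : AEMeasurable h m) (R : ℝ) :
    ∫⁻ z : ℝ, ∫⁻ x in Metric.ball (z • unitVec 2) R, h x ∂m =
      ∫⁻ x, volume {z : ℝ | dist x (z • unitVec 2) < R} * h x ∂m := by
  have hS : MeasurableSet {q : ℝ × E3 | dist q.2 (q.1 • unitVec 2) < R} :=
    (isOpen_lt (by fun_prop) continuous_const).measurableSet
  have h1 : ∀ z : ℝ, ∫⁻ x in Metric.ball (z • unitVec 2) R, h x ∂m =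
      ∫⁻ x, {q : ℝ × E3 | dist q.2 (q.1 • unitVec 2) < R}.indicator (fun q => h q.2) (z, x) ∂m := by
    intro z
    rw [← lintegral_indicator Metric.isOpen_ball.measurableSet]
    rfl
  simp_rw [h1]
  rw [lintegral_lintegral_swap (f := fun z x =>
    {q : ℝ × E3 | dist q.2 (q.1 • unitVec 2) < R}.indicator (fun q => h q.2) (z, x))]
  · refine lintegral_congr fun x => ?_
    have hSx : MeasurableSet {z : ℝ | dist x (z • unitVec 2) < R} :=
      (isOpen_lt (by fun_prop) continuous_const).measurableSet
    rw [mul_comm, ← setLIntegral_const, ← lintegral_indicator hSx]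
    rfl
  · exact (hh.comp_snd.indicator hS)

lemma volume_axis_le (x : E3) (R : ℝ) :
    volume {z : ℝ | dist x (z • unitVec 2) < R} ≤ ENNReal.ofReal (2 * R) := by
  have : {z : ℝ | dist x (z • unitVec 2) < R} ⊆ Ioo (x 2 - R) (x 2 + R) := by
    intro z hz
    have h1 := dist_axis_sq x z
    have h2 : |x 2 - z| < R := by
      refine lt_of_le_of_lt ?_ hz
      refine abs_le_of_sq_le_sq ?_ dist_nonneg
      rw [h1]; nlinarith [sq_nonneg (x 0), sq_nonneg (x 1)]
    rw [abs_lt] at h2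
    constructor <;> linarith
  refine (measure_mono this).trans_eq ?_
  rw [Real.volume_Ioo]
  congr 1; ring

/-- All heights within `1/2` of `x 2` qualify: the squared distance is at most `2 D² + 1`, hence
less than `R²`. -/
lemma le_volume_axis {x : E3} {D R : ℝ} (h0 : |x 0| ≤ D) (h1 : |x 1| ≤ D) (hR : 2 * D + 1 < R) :
    1 ≤ volume {z : ℝ | dist x (z • unitVec 2) < R} := by
  have hD : 0 ≤ D := (abs_nonneg _).trans h0
  have : Ioo (x 2 - 1 / 2) (x 2 + 1 / 2) ⊆ {z : ℝ | dist x (z • unitVec 2) < R} := by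
    intro z hz
    have h2 := dist_axis_sq x z
    have hR0 : 0 ≤ R := by linarith
    change dist x (z • unitVec 2) < R
    refine lt_of_pow_lt_pow_left₀ 2 hR0 ?_
    rw [h2]
    have e0 := sq_le_sq' (abs_le.1 h0).1 (abs_le.1 h0).2
    have e1 := sq_le_sq' (abs_le.1 h1).1 (abs_le.1 h1).2
    have e2 : (x 2 - z) ^ 2 ≤ 1 := (sq_le_one_iff_abs_le_one _).2
      (abs_le.2 ⟨by linarith [hz.2], by linarith [hz.1]⟩)
    have e3 : (2 * D + 1) ^ 2 < R ^ 2 := by gcongr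
    nlinarith
  refine le_trans (le_of_eq ?_) (measure_mono this)
  rw [Real.volume_Ioo, ← ENNReal.ofReal_one]
  congr 1; ring

/-- The sum of the absolute values of a function and its derivatives. -/
noncomputable def jet {F : Type} [NormedAddCommGroup F] [NormedSpace ℝ F] (ψ : E3 → F) (x : E3) : ℝ :=
  ‖ψ x‖ + ∑ j, ‖fderiv ℝ ψ x (unitVec j)‖

lemma sobNorm_le_jet {F : Type} [NormedAddCommGroup F] [NormedSpace ℝ F] (m : Measure E3)
    (p : ℝ≥0∞) (ψ : E3 → F) : sobNorm m p ψ ≤ 4 * eLpNorm (jet ψ) p m := by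
  have h0 : eLpNorm ψ p m ≤ eLpNorm (jet ψ) p m := eLpNorm_mono_real fun x =>
    le_add_of_nonneg_right (Finset.sum_nonneg fun _ _ => norm_nonneg _)
  have h1 : ∀ j, eLpNorm (fun x => fderiv ℝ ψ x (unitVec j)) p m ≤ eLpNorm (jet ψ) p m := fun j =>
    eLpNorm_mono_real fun x => (Finset.single_le_sum (f := fun j => ‖fderiv ℝ ψ x (unitVec j)‖)
      (fun _ _ => norm_nonneg _) (Finset.mem_univ j)).trans (le_add_of_nonneg_left (norm_nonneg _))
  calc sobNorm m p ψ ≤ eLpNorm (jet ψ) p m + ∑ _j : Fin 3, eLpNorm (jet ψ) p m := by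
        rw [sobNorm]; gcongr with j; exact h1 j
    _ = _ := by
        simp only [Finset.sum_const, Finset.card_univ, Fintype.card_fin, nsmul_eq_mul]
        push_cast; ring

lemma continuous_jet {F : Type} [NormedAddCommGroup F] [NormedSpace ℝ F] {ψ : E3 → F}
    (hψ : ContDiff ℝ 1 ψ) : Continuous (jet ψ) :=
  hψ.continuous.norm.add (continuous_finsetSum _ fun _ _ => (continuous_fderiv_apply hψ _).norm)

lemma eLpNorm_jet_le {F : Type} [NormedAddCommGroup F] [NormedSpace ℝ F] (m : Measure E3)
    {p : ℝ≥0∞} (hp : 1 ≤ p) {ψ : E3 → F} (hψ : ContDiff ℝ 1 ψ) :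
    eLpNorm (jet ψ) p m ≤ sobNorm m p ψ := by
  have hc : ∀ j, AEStronglyMeasurable (fun x => ‖fderiv ℝ ψ x (unitVec j)‖) m := fun j =>
    (continuous_fderiv_apply hψ _).norm.aestronglyMeasurable
  have e : jet ψ = (fun x => ‖ψ x‖) + ∑ j, fun x => ‖fderiv ℝ ψ x (unitVec j)‖ := by
    funext x; simp [jet]
  rw [e, sobNorm]
  refine (eLpNorm_add_le hψ.continuous.norm.aestronglyMeasurable
    (Finset.aestronglyMeasurable_sum _ fun j _ => hc j) hp).trans ?_
  rw [eLpNorm_norm]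
  gcongr
  refine (eLpNorm_sum_le (fun j _ => hc j) hp).trans_eq ?_
  simp_rw [eLpNorm_norm]

/-- Uniformly locally integrable weights satisfy a weighted inequality. -/
theorem WeightedBound.of_uniformLp [SFinite m] {D : ℝ}
    (hm : ∀ᵐ x ∂m, |x 0| ≤ D ∧ |x 1| ≤ D) {r s : ℝ≥0∞} [ENNReal.HolderTriple s r 2]
    (hW : WeightedBound P m 1 r 2) {w : E3 → ℝ} (hwm : AEStronglyMeasurable w m)
    (hw : UniformLp m s w) : WeightedBound P m w 2 2 := by
  obtain ⟨C, hC⟩ := hW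
  obtain ⟨M, hM⟩ := exists_axis_cutoff
  obtain ⟨N, hN⟩ := exists_nat_gt (2 * D)
  obtain ⟨K, hK⟩ := hw ((N : ℝ) + 1)
  set R : ℝ := 2 * ((N : ℝ) + 1) + 1
  set A : NNReal := K * (C * ((1 + 3 * M) * 4)) with hA
  -- The overlap of the larger balls is at most `2 R ≤ (2 R + 1)²`, a form that fits under the
  -- square.
  refine ⟨A * (2 * R + 1).toNNReal, fun ψ hψ hψc => ?_⟩
  have hh : AEMeasurable (fun x => ‖w x * ψ x‖ₑ ^ 2) m :=
    ((hwm.mul hψ.continuous.aestronglyMeasurable).enorm.pow_const _)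
  -- On one ball: Hölder with `1/s + 1/r = 1/2`, then the unweighted inequality for `ψ` times a
  -- cutoff, at the price of a larger ball. Squares are used because they are additive over the
  -- cylinder.
  have hcell : ∀ z : ℝ, ∫⁻ x in Metric.ball (z • unitVec 2) ((N : ℝ) + 1), ‖w x * ψ x‖ₑ ^ 2 ∂m ≤
      (A : ℝ≥0∞) ^ 2 * ∫⁻ x in Metric.ball (z • unitVec 2) R, ‖jet ψ x‖ₑ ^ 2 ∂(volume.restrict P) := by
    intro z
    obtain ⟨χ, hχ, hχc, hχ1, hχd, hχe, hχs⟩ := hM N z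
    rw [← eLpNorm_two_sq, ← eLpNorm_two_sq, ← mul_pow]
    gcongr
    set B := Metric.ball (z • unitVec 2 : E3) ((N : ℝ) + 1)
    calc eLpNorm (fun x => w x * ψ x) 2 (m.restrict B)
        = eLpNorm (fun x => w x • (χ x * ψ x)) 2 (m.restrict B) := by
          refine eLpNorm_congr_ae ?_
          filter_upwards [ae_restrict_mem Metric.isOpen_ball.measurableSet] with x hx
          rw [hχe x hx, one_mul, smul_eq_mul]
      _ ≤ eLpNorm w s (m.restrict B) * eLpNorm (fun x => χ x * ψ x) r (m.restrict B) :=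
          eLpNorm_smul_le_mul_eLpNorm (φ := w) (f := fun x => χ x * ψ x) (p := s) (q := r)
            (hχ.continuous.mul hψ.continuous).aestronglyMeasurable
            hwm.restrict
      _ ≤ K * eLpNorm (fun x => (1 : E3 → ℝ) x * (χ x * ψ x)) r m := by
          gcongr
          · exact hK z
          · simp only [Pi.one_apply, one_mul]
            exact eLpNorm_mono_measure _ Measure.restrict_le_self
      _ ≤ K * (C * sobNorm (volume.restrict P) 2 (fun x => χ x • ψ x)) := by
          gcongr
          exact hC _ (hχ.mul hψ) hχc.mul_right
      _ ≤ K * (C * ((1 + 3 * M) * (4 * eLpNorm (jet ψ) 2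
            ((volume.restrict P).restrict (Metric.ball (z • unitVec 2) R))))) := by
          gcongr
          refine (sobNorm_smul_le hχ hχ1 hχd Metric.isOpen_ball.measurableSet hχs _ (by simp)
            hψ).trans ?_
          gcongr
          exact sobNorm_le_jet _ _ _
      _ = _ := by rw [hA]; push_cast; ring
  -- Integration over the height `z` takes the place of a sum over a cover: on the left every point
  -- is counted at least once, on the right with bounded multiplicity.
  have hsq : eLpNorm (fun x => w x * ψ x) 2 m ^ 2 ≤
      ((A * (2 * R + 1).toNNReal : NNReal) * eLpNorm (jet ψ) 2 (volume.restrict P)) ^ 2 := by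
    rw [eLpNorm_two_sq, mul_pow, eLpNorm_two_sq]
    calc ∫⁻ x, ‖w x * ψ x‖ₑ ^ 2 ∂m
        ≤ ∫⁻ x, volume {z : ℝ | dist x (z • unitVec 2) < (N : ℝ) + 1} * ‖w x * ψ x‖ₑ ^ 2 ∂m := by
          refine lintegral_mono_ae ?_
          filter_upwards [hm] with x hx
          exact le_mul_of_one_le_left zero_le (le_volume_axis hx.1 hx.2 (by linarith))
      _ = ∫⁻ z : ℝ, ∫⁻ x in Metric.ball (z • unitVec 2) ((N : ℝ) + 1), ‖w x * ψ x‖ₑ ^ 2 ∂m :=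
          (lintegral_axis_balls hh _).symm
      _ ≤ ∫⁻ z : ℝ, (A : ℝ≥0∞) ^ 2 * ∫⁻ x in Metric.ball (z • unitVec 2) R,
            ‖jet ψ x‖ₑ ^ 2 ∂(volume.restrict P) := lintegral_mono hcell
      _ = (A : ℝ≥0∞) ^ 2 * ∫⁻ x in P, volume {z : ℝ | dist x (z • unitVec 2) < R} *
            ‖jet ψ x‖ₑ ^ 2 := by
          rw [lintegral_const_mul' _ _ (by finiteness), lintegral_axis_balls]
          exact ((continuous_jet hψ).enorm.measurable.pow_const _).aemeasurable
      _ ≤ (A : ℝ≥0∞) ^ 2 * ∫⁻ x in P, ((2 * R + 1).toNNReal : ℝ≥0∞) ^ 2 * ‖jet ψ x‖ₑ ^ 2 := by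
          gcongr with x
          refine (volume_axis_le x R).trans ?_
          rw [← ENNReal.coe_pow, ← Real.toNNReal_pow (by positivity)]
          exact ENNReal.ofReal_le_ofReal (by nlinarith [show 0 ≤ R by positivity])
      _ = _ := by
          rw [lintegral_const_mul' _ _ (by finiteness)]
          push_cast; ring
  have h2 := (ENNReal.pow_le_pow_left_iff (two_ne_zero)).1 hsq
  refine h2.trans ?_
  gcongr
  exact eLpNorm_jet_le _ (by simp) hψ

end Weights

end MaxwellCylinder

namespace MaxwellCylinder

/-! ### Functions in `H¹` and their compactly supported approximations -/

section HOne

variable {F G : Type} [NormedAddCommGroup F] [NormedSpace ℝ F] [NormedAddCommGroup G]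
  [NormedSpace ℝ G] {P : Set E3} {ν : E3 → E3} {c : E3} {ρ D : ℝ} {m : Measure E3}

lemma tendsto_zero_of_sq {f : ℕ → ℝ≥0∞} (h : Tendsto (fun n => f n ^ 2) atTop (𝓝 0)) :
    Tendsto f atTop (𝓝 0) := by
  rw [ENNReal.tendsto_nhds_zero] at h ⊢
  intro ε hε
  filter_upwards [h (ε ^ 2) (ENNReal.pow_pos hε 2)] with n hn
  exact (ENNReal.pow_le_pow_left_iff two_ne_zero).1 hn

lemma tendsto_eLpNorm_smul_zero {b : ℕ → E3 → ℝ} (hb : ∀ n, Continuous (b n)) {K : NNReal}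
    (hK : ∀ n x, ‖b n x‖ ≤ K) (h0 : ∀ x, ∀ᶠ n in atTop, b n x = 0) {g : E3 → F}
    (hg : MemLp g 2 m) : Tendsto (fun n => eLpNorm (fun x => b n x • g x) 2 m) atTop (𝓝 0) := by
  refine tendsto_zero_of_sq ?_
  simp_rw [eLpNorm_two_sq]
  have h1 := tendsto_lintegral_of_dominated_convergence' (μ := m)
    (F := fun n x => ‖b n x • g x‖ₑ ^ 2) (f := fun _ => 0) (fun x => ((K : ℝ≥0∞) * ‖g x‖ₑ) ^ 2)
    (fun n => ((hb n).aestronglyMeasurable.smul hg.1).enorm.pow_const _) (fun n => ?_) ?_ ?_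
  · simpa using h1
  · refine Eventually.of_forall fun x => ?_
    dsimp only
    rw [enorm_smul]
    gcongr
    rw [← ofReal_norm]
    exact (ENNReal.ofReal_le_ofReal (hK n x)).trans_eq ENNReal.ofReal_coe_nnreal
  · simp_rw [mul_pow]
    rw [lintegral_const_mul' _ _ (by finiteness), ← eLpNorm_two_sq]
    exact ENNReal.mul_ne_top (by finiteness) (ENNReal.pow_ne_top hg.2.ne)
  · refine Eventually.of_forall fun x => tendsto_const_nhds.congr' ?_
    filter_upwards [h0 x] with n hn
    simp [hn]

/-- `φ` is a sequence of smooth compactly supported functions converging to `u`, along with its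
derivatives to `d`, in `L₂(P)`, and to `T` in `L₂` on the bounded parts of the boundary. -/
structure H1Approx (P : Set E3) (u : E3 → F) (d : Fin 3 → E3 → F) (T : E3 → F)
    (φ : ℕ → E3 → F) : Prop where
  contDiff : ∀ n, ContDiff ℝ ∞ (φ n)
  hasCompactSupport : ∀ n, HasCompactSupport (φ n)
  memLp : MemLp u 2 (volume.restrict P)
  memLp_partial : ∀ j, MemLp (d j) 2 (volume.restrict P)
  aestronglyMeasurable_trace : AEStronglyMeasurable T (surfaceMeasure P)
  tendsto : Tendsto (fun n => eLpNorm (fun x => φ n x - u x) 2 (volume.restrict P)) atTop (𝓝 0)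
  tendsto_fderiv : ∀ j, Tendsto (fun n => eLpNorm (fun x => fderiv ℝ (φ n) x (unitVec j) - d j x) 2
    (volume.restrict P)) atTop (𝓝 0)
  tendsto_trace : TendstoLpLoc (surfaceMeasure P) 2 φ T

lemma tendstoLpLoc_of_tendsto {F : Type} [NormedAddCommGroup F] {p : ℝ≥0∞} {φ : ℕ → E3 → F}
    {g : E3 → F}
    (h : Tendsto (fun n => eLpNorm (fun x => φ n x - g x) p m) atTop (𝓝 0)) :
    TendstoLpLoc m p φ g := fun _ =>
  tendsto_of_tendsto_of_tendsto_of_le_of_le tendsto_const_nhds h (fun _ => zero_le)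
    fun _ => eLpNorm_mono_measure _ Measure.restrict_le_self

lemma memLpLoc_of_memLp {F : Type} [NormedAddCommGroup F] {p : ℝ≥0∞} {g : E3 → F}
    (h : MemLp g p m) : MemLpLoc m p g :=
  fun _ => h.restrict _

lemma H1Approx.contDiff_one {u : E3 → F} {d : Fin 3 → E3 → F} {T : E3 → F} {φ : ℕ → E3 → F}
    (h : H1Approx P u d T φ) (n : ℕ) : ContDiff ℝ 1 (φ n) :=
  (h.contDiff n).of_le (by exact_mod_cast le_top)

lemma H1Approx.smoothApprox {u : E3 → F} {d : Fin 3 → E3 → F} {T : E3 → F} {φ : ℕ → E3 → F}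
    (h : H1Approx P u d T φ) : SmoothApprox P 2 u d φ :=
  ⟨h.contDiff, tendstoLpLoc_of_tendsto h.tendsto, fun j => tendstoLpLoc_of_tendsto
    (φ := fun n x => fderiv ℝ (φ n) x (unitVec j)) (h.tendsto_fderiv j)⟩

lemma tendsto_eLpNorm_clm {p : ℝ≥0∞} {φ : ℕ → E3 → F} {g : E3 → F} (L : F →L[ℝ] G)
    (h : Tendsto (fun n => eLpNorm (fun x => φ n x - g x) p m) atTop (𝓝 0)) :
    Tendsto (fun n => eLpNorm (fun x => L (φ n x) - L (g x)) p m) atTop (𝓝 0) := by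
  have h1 := ENNReal.Tendsto.const_mul h (Or.inr (enorm_ne_top (x := L)))
  rw [mul_zero] at h1
  refine tendsto_of_tendsto_of_tendsto_of_le_of_le tendsto_const_nhds h1 (fun _ => zero_le)
    fun n => ?_
  simp_rw [← map_sub]
  exact eLpNorm_clm_comp_le L _ p _

/-- Images under linear maps. -/
lemma H1Approx.clm {u : E3 → F} {d : Fin 3 → E3 → F} {T : E3 → F} {φ : ℕ → E3 → F}
    (h : H1Approx P u d T φ) (L : F →L[ℝ] G) :
    H1Approx P (fun x => L (u x)) (fun j x => L (d j x)) (fun x => L (T x))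
      (fun n x => L (φ n x)) where
  contDiff n := L.contDiff.comp (h.contDiff n)
  hasCompactSupport n := (h.hasCompactSupport n).comp_left (map_zero L)
  memLp := L.comp_memLp' h.memLp
  memLp_partial j := L.comp_memLp' (h.memLp_partial j)
  aestronglyMeasurable_trace := L.continuous.comp_aestronglyMeasurable h.aestronglyMeasurable_trace
  tendsto := tendsto_eLpNorm_clm L h.tendsto
  tendsto_fderiv j := by
    simp_rw [fun n x => fderiv_clm_comp L ((h.contDiff_one n).differentiable (by simp)) x]
    exact tendsto_eLpNorm_clm L (h.tendsto_fderiv j)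
  tendsto_trace := h.tendsto_trace.clm L

/-- The `n`-th cutoff multiplies an approximation chosen so late that its error on the support is at
most `1/(n+1)`. What remains, `(χ_n - 1) u`, `(χ_n - 1) d_j` and `∂_jχ_n u`, tends to zero in `L₂`
by dominated convergence. -/
lemma exists_tendsto_of_smoothApprox {u : E3 → F} {d : Fin 3 → E3 → F} {φ : ℕ → E3 → F}
    (hs : SmoothApprox P 2 u d φ) (hu : MemLp u 2 (volume.restrict P))
    (hd : ∀ j, MemLp (d j) 2 (volume.restrict P)) :
    ∃ γ : ℕ → E3 → F, (∀ n, ContDiff ℝ ∞ (γ n)) ∧ (∀ n, HasCompactSupport (γ n)) ∧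
      Tendsto (fun n => eLpNorm (fun x => γ n x - u x) 2 (volume.restrict P)) atTop (𝓝 0) ∧
      ∀ j, Tendsto (fun n => eLpNorm (fun x => fderiv ℝ (γ n) x (unitVec j) - d j x) 2
        (volume.restrict P)) atTop (𝓝 0) := by
  obtain ⟨K, hK⟩ := exists_norm_fderiv_cutoff_le
  let R : ℕ → ℝ := fun n => 2 * ((n : ℝ) + 1) + 1
  let mB : ℕ → Measure E3 := fun n => (volume.restrict P).restrict (Metric.ball 0 (R n))
  have hk : ∀ n : ℕ, ∃ k, eLpNorm (fun x => φ k x - u x) 2 (mB n) +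
      ∑ j, eLpNorm (fun x => fderiv ℝ (φ k) x (unitVec j) - d j x) 2 (mB n) ≤
        ENNReal.ofReal (1 / ((n : ℝ) + 1)) := by
    intro n
    have h2 := (hs.tendsto (R n)).add (tendsto_finsetSum Finset.univ fun j _ =>
      hs.tendsto_fderiv j (R n))
    simp only [Finset.sum_const_zero, add_zero] at h2
    exact (ENNReal.tendsto_nhds_zero.1 h2 _ (by simp; positivity)).exists
  choose k hk using hk
  have hlim : Tendsto (fun n : ℕ => ENNReal.ofReal (1 / ((n : ℝ) + 1))) atTop (𝓝 0) := by
    have := (ENNReal.continuous_ofReal.tendsto 0).comp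
      (tendsto_one_div_add_atTop_nhds_zero_nat (𝕜 := ℝ))
    rwa [ENNReal.ofReal_zero] at this
  have hsupp : ∀ n, tsupport (cutoff n) ⊆ Metric.ball 0 (R n) := fun n =>
    (tsupport_cutoff_subset n).trans (Metric.closedBall_subset_ball (by simp [R]))
  have hc1 : ∀ n, ContDiff ℝ 1 (cutoff n) := fun n => contDiff_cutoff n (k := 1)
  have hdc : ∀ n j, Continuous fun x => fderiv ℝ (cutoff n) x (unitVec j) := fun n j =>
    continuous_fderiv_apply (hc1 n) _
  have hdK : ∀ n j x, ‖fderiv ℝ (cutoff n) x (unitVec j)‖ ≤ K := fun n j x => by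
    refine ((fderiv ℝ (cutoff n) x).le_opNorm _).trans ?_
    rw [norm_unitVec, mul_one]; exact hK n x
  -- The cutoffs are eventually one in a whole neighbourhood of each point, so their gradients
  -- vanish there as well.
  have hev : ∀ x : E3, ∀ᶠ n : ℕ in atTop, ∀ᶠ y in 𝓝 x, cutoff n y = 1 := by
    intro x
    obtain ⟨N, hN⟩ := exists_nat_gt ‖x‖
    filter_upwards [eventually_ge_atTop N] with n hn
    have hnx : ‖x‖ < n := hN.trans_le (by exact_mod_cast hn)
    filter_upwards [(isOpen_lt continuous_norm continuous_const).mem_nhds hnx] with y hy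
    have hy' : ‖y‖ < n := hy
    exact cutoff_eq_one (by linarith)
  have hcut : ∀ {w : ℕ → E3 → F} {g : E3 → F}, (∀ k, Continuous (w k)) →
      MemLp g 2 (volume.restrict P) → ∀ n l,
      eLpNorm (fun x => cutoff n x • w l x - g x) 2 (volume.restrict P) ≤
      eLpNorm (fun x => w l x - g x) 2 (mB n) +
        eLpNorm (fun x => (cutoff n x - 1) • g x) 2 (volume.restrict P) := by
    intro w g hw hg n l
    have e : (fun x => cutoff n x • w l x - g x) =
        (fun x => cutoff n x • (w l x - g x)) + fun x => (cutoff n x - 1) • g x := by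
      funext x; simp only [Pi.add_apply]; module
    rw [e]
    refine (eLpNorm_add_le ((hc1 n).continuous.aestronglyMeasurable.smul
      ((hw l).aestronglyMeasurable.sub hg.1))
      (((hc1 n).continuous.sub continuous_const).aestronglyMeasurable.smul hg.1) (by simp)).trans (add_le_add ?_ le_rfl)
    refine (eLpNorm_smul_le_of_support (K := 1) (by simpa using norm_cutoff_le n)
      Metric.isOpen_ball.measurableSet (fun x hx => image_eq_zero_of_notMem_tsupport
        fun h => hx (hsupp n h)) _ 2 _).trans_eq ?_
    rw [ENNReal.coe_one, one_mul]
    rfl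
  have hz : ∀ {g : E3 → F}, MemLp g 2 (volume.restrict P) →
      Tendsto (fun n => eLpNorm (fun x => (cutoff n x - 1) • g x) 2 (volume.restrict P))
        atTop (𝓝 0) := fun hg =>
    tendsto_eLpNorm_smul_zero (b := fun n x => cutoff n x - 1) (K := 2)
      (fun n => (hc1 n).continuous.sub continuous_const)
      (fun n x => by
        refine (norm_sub_le _ _).trans ?_
        have := norm_cutoff_le n x
        simp only [norm_one, NNReal.coe_ofNat]; linarith)
      (fun x => by
        filter_upwards [hev x] with n hn
        rw [hn.self_of_nhds, sub_self]) hg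
  have hk0 : ∀ n, eLpNorm (fun x => φ (k n) x - u x) 2 (mB n) ≤ ENNReal.ofReal (1 / ((n : ℝ) + 1)) :=
    fun n => le_self_add.trans (hk n)
  have hkj : ∀ j n, eLpNorm (fun x => fderiv ℝ (φ (k n)) x (unitVec j) - d j x) 2 (mB n) ≤
      ENNReal.ofReal (1 / ((n : ℝ) + 1)) := fun j n =>
    ((Finset.single_le_sum (f := fun j =>
      eLpNorm (fun x => fderiv ℝ (φ (k n)) x (unitVec j) - d j x) 2 (mB n))
      (fun _ _ => zero_le) (Finset.mem_univ j)).trans le_add_self).trans (hk n)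
  refine ⟨fun n x => cutoff n x • φ (k n) x, fun n => (contDiff_cutoff n).smul (hs.contDiff _),
    fun n => (hasCompactSupport_cutoff n).smul_right, ?_, fun j => ?_⟩
  · have h1 := hlim.add (hz hu)
    rw [add_zero] at h1
    refine tendsto_of_tendsto_of_tendsto_of_le_of_le tendsto_const_nhds h1 (fun _ => zero_le)
      fun n => ?_
    refine (hcut (fun k => (hs.contDiff k).continuous) hu n (k n)).trans ?_
    gcongr
    exact hk0 n
  · have hz' : Tendsto (fun n => eLpNorm (fun x => fderiv ℝ (cutoff n) x (unitVec j) • u x) 2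
        (volume.restrict P)) atTop (𝓝 0) :=
      tendsto_eLpNorm_smul_zero (b := fun n x => fderiv ℝ (cutoff n) x (unitVec j)) (K := K)
        (fun n => hdc n j) (fun n x => hdK n j x) (fun x => by
          filter_upwards [hev x] with n hn
          have : cutoff n =ᶠ[𝓝 x] fun _ => 1 := hn
          rw [this.fderiv_eq]
          simp) hu
    have h1 := (hlim.add (hz (hd j))).add
      ((ENNReal.Tendsto.const_mul hlim (Or.inr (ENNReal.coe_ne_top (r := K)))).add hz')
    simp only [add_zero, mul_zero] at h1
    refine tendsto_of_tendsto_of_tendsto_of_le_of_le tendsto_const_nhds h1 (fun _ => zero_le)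
      fun n => ?_
    have hcφ : Continuous fun x => fderiv ℝ (φ (k n)) x (unitVec j) :=
      continuous_fderiv_apply (hs.contDiff_one _) _
    have e : (fun x => fderiv ℝ (fun x => cutoff n x • φ (k n) x) x (unitVec j) - d j x) =
        (fun x => cutoff n x • fderiv ℝ (φ (k n)) x (unitVec j) - d j x) +
        ((fun x => fderiv ℝ (cutoff n) x (unitVec j) • (φ (k n) x - u x)) +
          fun x => fderiv ℝ (cutoff n) x (unitVec j) • u x) := by
      funext x
      simp only [Pi.add_apply]
      rw [fderiv_smul_apply (hc1 n) (hs.contDiff_one _)]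
      module
    have m1 : AEStronglyMeasurable (fun x => fderiv ℝ (cutoff n) x (unitVec j) • (φ (k n) x - u x))
        (volume.restrict P) := (hdc n j).aestronglyMeasurable.smul
      ((hs.contDiff _).continuous.aestronglyMeasurable.sub hu.1)
    have m2 : AEStronglyMeasurable (fun x => fderiv ℝ (cutoff n) x (unitVec j) • u x)
        (volume.restrict P) := (hdc n j).aestronglyMeasurable.smul hu.1
    rw [e]
    refine (eLpNorm_add_le (((hc1 n).continuous.smul hcφ).aestronglyMeasurable.sub (hd j).1)
      (m1.add m2) (by simp)).trans (add_le_add ?_ ?_)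
    · refine (hcut (w := fun k x => fderiv ℝ (φ k) x (unitVec j))
        (fun k => continuous_fderiv_apply (hs.contDiff_one k) _) (hd j) n (k n)).trans ?_
      gcongr
      exact hkj j n
    · refine (eLpNorm_add_le m1 m2 (by simp)).trans ?_
      gcongr
      refine (eLpNorm_smul_le_of_support (hdK n j) Metric.isOpen_ball.measurableSet
        (fun x hx => ?_) _ 2 _).trans (mul_le_mul' le_rfl (hk0 n))
      rw [fderiv_of_notMem_tsupport (𝕜 := ℝ) fun h => hx (hsupp n h)]; rfl

lemma eLpNorm_le_of_forall_ball {F : Type} [NormedAddCommGroup F] {f : E3 → F}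
    (hf : AEStronglyMeasurable f m) {p : ℝ≥0∞} {C : ℝ≥0∞}
    (h : ∀ N : ℕ, eLpNorm f p (m.restrict (Metric.ball 0 N)) ≤ C) : eLpNorm f p m ≤ C := by
  refine Lp.eLpNorm_le_of_ae_tendsto (u := atTop)
    (f := fun N : ℕ => (Metric.ball (0 : E3) N).indicator f) (Eventually.of_forall fun N => ?_)
    (fun N => hf.indicator Metric.isOpen_ball.measurableSet) (Eventually.of_forall fun x => ?_)
  · rw [eLpNorm_indicator_eq_eLpNorm_restrict Metric.isOpen_ball.measurableSet]
    exact h N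
  · refine tendsto_const_nhds.congr' ?_
    obtain ⟨N, hN⟩ := exists_nat_gt ‖x‖
    filter_upwards [eventually_ge_atTop N] with n hn
    rw [indicator_of_mem]
    rw [mem_ball_zero_iff]
    exact hN.trans_le (by exact_mod_cast hn)

lemma sobNorm_ne_top [IsFiniteMeasureOnCompacts m] {p : ℝ≥0∞} {ψ : E3 → F} (hψ : ContDiff ℝ 1 ψ)
    (hψc : HasCompactSupport ψ) : sobNorm m p ψ ≠ ⊤ := by
  rw [sobNorm]
  refine ENNReal.add_ne_top.2 ⟨(hψ.continuous.memLp_of_hasCompactSupport hψc).2.ne,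
    ENNReal.sum_ne_top.2 fun j _ => ?_⟩
  exact ((continuous_fderiv_apply hψ _).memLp_of_hasCompactSupport
    (hasCompactSupport_fderiv_apply hψc _)).2.ne

/-- Convergence in `H¹` implies convergence in weighted spaces. -/
theorem WeightedBound.tendsto [FiniteDimensional ℝ F] {b : E3 → ℝ} (hW : WeightedBound P m b 2 2)
    (hb : AEStronglyMeasurable b m) {u : E3 → F} {d : Fin 3 → E3 → F} {T : E3 → F}
    {φ : ℕ → E3 → F} (h : H1Approx P u d T φ) {S : E3 → F} (hS : TendstoLpLoc m 2 φ S)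
    (hSm : AEStronglyMeasurable S m) :
    MemLp (fun x => b x • S x) 2 m ∧ (∀ n, MemLp (fun x => b x • φ n x) 2 m) ∧
      Tendsto (fun n => eLpNorm (fun x => b x • φ n x - b x • S x) 2 m) atTop (𝓝 0) := by
  obtain ⟨C, hC⟩ := hW.vector (F := F) (by simp) hb
  have hφm : ∀ n, MemLp (fun x => b x • φ n x) 2 m := fun n =>
    ⟨hb.smul (h.contDiff n).continuous.aestronglyMeasurable,
      (hC _ (h.contDiff_one n) (h.hasCompactSupport n)).trans_lt
        (ENNReal.mul_lt_top ENNReal.coe_lt_top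
          (sobNorm_ne_top (h.contDiff_one n) (h.hasCompactSupport n)).lt_top)⟩
  have hSbm : AEStronglyMeasurable (fun x => b x • S x) m := hb.smul hSm
  have hlim : Tendsto (fun n => eLpNorm (fun x => b x • φ n x - b x • S x) 2 m) atTop (𝓝 0) := by
    rw [ENNReal.tendsto_atTop_zero]
    intro ε hε
    obtain ⟨K, hK⟩ := eventually_sobNorm_sub_lt (by simp) h.contDiff_one h.memLp.1
      (fun j => (h.memLp_partial j).1) h.tendsto h.tendsto_fderiv
      (ε := ε / (C + 1)) (ENNReal.div_pos hε.ne' (by finiteness))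
    refine ⟨K, fun n hn => eLpNorm_le_of_forall_ball ((hφm n).1.sub hSbm) fun N => ?_⟩
    -- `S` is so far only a local limit. On each ball a subsequence converges to it almost
    -- everywhere, and Fatou turns the global Cauchy estimate into a bound independent of the ball.
    obtain ⟨ns, hns, hae⟩ := (tendstoInMeasure_of_tendsto_eLpNorm two_ne_zero
      (fun n => (h.contDiff n).continuous.aestronglyMeasurable) hSm.restrict
      (hS N)).exists_seq_tendsto_ae
    refine Lp.eLpNorm_le_of_ae_tendsto (u := atTop)
      (f := fun i x => b x • φ n x - b x • φ (ns i) x) ?_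
      (fun i => ((hφm n).1.sub (hφm _).1).restrict) ?_
    · filter_upwards [hns.tendsto_atTop.eventually_ge_atTop K] with i hi
      refine (eLpNorm_mono_measure _ Measure.restrict_le_self).trans ?_
      simp_rw [← smul_sub]
      refine (hC _ ((h.contDiff_one n).sub (h.contDiff_one _))
        ((h.hasCompactSupport n).sub (h.hasCompactSupport _))).trans ?_
      calc (C : ℝ≥0∞) * sobNorm (volume.restrict P) 2 (fun x => φ n x - φ (ns i) x)
          ≤ (C + 1) * (ε / (C + 1)) := mul_le_mul' le_self_add (hK n hn _ hi).le
        _ = ε := ENNReal.mul_div_cancel (by simp) (by finiteness)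
    · filter_upwards [hae] with x hx
      exact tendsto_const_nhds.sub (hx.const_smul _)
  refine ⟨⟨hSbm, ?_⟩, hφm, hlim⟩
  obtain ⟨n, hn⟩ := (ENNReal.tendsto_nhds_zero.1 hlim 1 one_pos).exists
  have e : (fun x => b x • S x) =
      (fun x => b x • φ n x) - fun x => b x • φ n x - b x • S x := by
    funext x; simp
  rw [e]
  exact (eLpNorm_sub_le (hφm n).1 ((hφm n).1.sub hSbm) (by simp)).trans_lt
    (ENNReal.add_lt_top.2 ⟨(hφm n).2, hn.trans_lt ENNReal.one_lt_top⟩)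

end HOne

/-! ### Triple products -/

section Triple

variable {P : Set E3} {ν : E3 → E3} {c : E3} {ρ D : ℝ} {m : Measure E3}

lemma integrable_smul_mul {s : E3 → ℝ} (hs : AEStronglyMeasurable s m) (hs1 : ∀ᵐ x ∂m, ‖s x‖ ≤ 1)
    {f h : E3 → ℂ} (hf : MemLp f 2 m) (hh : MemLp h 2 m) :
    Integrable (fun x => s x • (f x * h x)) m := by
  refine (hf.integrable_mul hh).mono (hs.smul (hf.1.mul hh.1)) ?_
  filter_upwards [hs1] with x hx
  rw [norm_smul]
  exact mul_le_of_le_one_left (norm_nonneg _) hx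

lemma tendsto_integral_smul_mul {s : E3 → ℝ} (hs : AEStronglyMeasurable s m)
    (hs1 : ∀ᵐ x ∂m, ‖s x‖ ≤ 1) {f h : E3 → ℂ} {φ γ : ℕ → E3 → ℂ} (hf : MemLp f 2 m)
    (hh : MemLp h 2 m) (hφ : ∀ n, MemLp (φ n) 2 m) (hγ : ∀ n, MemLp (γ n) 2 m)
    (h1 : Tendsto (fun n => eLpNorm (fun x => φ n x - f x) 2 m) atTop (𝓝 0))
    (h2 : Tendsto (fun n => eLpNorm (fun x => γ n x - h x) 2 m) atTop (𝓝 0)) :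
    Tendsto (fun n => ∫ x, s x • (φ n x * γ n x) ∂m) atTop (𝓝 (∫ x, s x • (f x * h x) ∂m)) := by
  have h3 := tendsto_eLpNorm_bilin (ContinuousLinearMap.mul ℝ ℂ) (r := 1) le_rfl h1 h2
    (fun n => (hφ n).1) hf (fun n => (hγ n).1) hh
  refine tendsto_integral_of_L1' _ (integrable_smul_mul hs hs1 hf hh).1
    (Eventually.of_forall fun n => integrable_smul_mul hs hs1 (hφ n) (hγ n)) ?_
  refine tendsto_of_tendsto_of_tendsto_of_le_of_le tendsto_const_nhds h3 (fun _ => zero_le)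
    fun n => ?_
  refine le_trans (le_of_eq ?_) (eLpNorm_smul_le_of_bound hs1 1 _)
  congr 1
  funext x
  simp [smul_sub]

/-- A coefficient `a`, with derivatives `d` and trace `T`, that can be multiplied with two
functions in `H¹`. -/
structure Multiplier (P : Set E3) (a : E3 → ℝ) (d : Fin 3 → E3 → ℝ) (T : E3 → ℝ) : Prop where
  exists_approx : ∃ φ, SmoothApprox P 1 a d φ ∧ TendstoLpLoc (surfaceMeasure P) 1 φ T
  memLpLoc : MemLpLoc (volume.restrict P) 1 a
  memLpLoc_partial : ∀ j, MemLpLoc (volume.restrict P) 1 (d j)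
  memLpLoc_trace : MemLpLoc (surfaceMeasure P) 1 T
  bound : WeightedBound P (volume.restrict P) a 2 2
  bound_partial : ∀ j, WeightedBound P (volume.restrict P) (fun x => √|d j x|) 2 2
  bound_trace : WeightedBound P (surfaceMeasure P) (fun x => √|T x|) 2 2

/-- Half of the weight goes to each factor, so that a product with a weight in `L_{3/2}` becomes a
pairing of two `L₂` functions. At `t = 0` the quotient is `0` and both sides vanish. -/
lemma smul_mul_eq_sign (t : ℝ) (y z : ℂ) :
    t • (y * z) = (t / |t|) • ((√|t| • y) * (√|t| • z)) := by
  have h : t / |t| * (√|t| * √|t|) = t := by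
    rw [Real.mul_self_sqrt (abs_nonneg t)]
    rcases eq_or_ne t 0 with rfl | ht
    · simp
    · exact div_mul_cancel₀ _ (abs_ne_zero.2 ht)
  rw [smul_mul_smul_comm, smul_smul, h]

lemma norm_div_abs_le (t : ℝ) : ‖t / |t|‖ ≤ 1 := by
  rw [norm_div, Real.norm_eq_abs, Real.norm_eq_abs, abs_abs]
  exact div_self_le_one _

variable {a : E3 → ℝ} {d : Fin 3 → E3 → ℝ} {Ta : E3 → ℝ} {u w Tu Tw : E3 → ℂ}
  {du dw : Fin 3 → E3 → ℂ} {φ γ : ℕ → E3 → ℂ}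

lemma aestronglyMeasurable_sqrt_abs {t : E3 → ℝ} (ht : AEStronglyMeasurable t m) :
    AEStronglyMeasurable (fun x => √|t x|) m :=
  (Real.continuous_sqrt.comp continuous_abs).comp_aestronglyMeasurable ht

lemma aestronglyMeasurable_div_abs {t : E3 → ℝ} (ht : AEStronglyMeasurable t m) :
    AEStronglyMeasurable (fun x => t x / |t x|) m :=
  (ht.aemeasurable.div (continuous_abs.measurable.comp_aemeasurable ht.aemeasurable)).aestronglyMeasurable

/-- The limit of a triple product with a weight `t`, in one of the factors of which a bounded
factor `s` may be inserted. -/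
lemma tendsto_integral_weight {s t : E3 → ℝ} (hs : AEStronglyMeasurable s m)
    (hs1 : ∀ᵐ x ∂m, ‖s x‖ ≤ 1) (ht : AEStronglyMeasurable t m)
    (hW : WeightedBound P m (fun x => √|t x|) 2 2) (hu : H1Approx P u du Tu φ)
    (hw : H1Approx P w dw Tw γ) {S S' : E3 → ℂ} (hS : TendstoLpLoc m 2 φ S)
    (hSm : AEStronglyMeasurable S m) (hS' : TendstoLpLoc m 2 γ S')
    (hSm' : AEStronglyMeasurable S' m) :
    Integrable (fun x => s x • t x • (S x * S' x)) m ∧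
      Tendsto (fun n => ∫ x, s x • t x • (φ n x * γ n x) ∂m) atTop
        (𝓝 (∫ x, s x • t x • (S x * S' x) ∂m)) := by
  obtain ⟨h1, h2, h3⟩ := hW.tendsto (aestronglyMeasurable_sqrt_abs ht) hu hS hSm
  obtain ⟨h1', h2', h3'⟩ := hW.tendsto (aestronglyMeasurable_sqrt_abs ht) hw hS' hSm'
  have hsm : AEStronglyMeasurable (fun x => s x * (t x / |t x|)) m :=
    hs.mul (aestronglyMeasurable_div_abs ht)
  have hsb : ∀ᵐ x ∂m, ‖s x * (t x / |t x|)‖ ≤ 1 := by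
    filter_upwards [hs1] with x hx
    rw [norm_mul]
    exact mul_le_one₀ hx (norm_nonneg _) (norm_div_abs_le _)
  simp_rw [smul_mul_eq_sign (t _), smul_smul (s _)]
  exact ⟨integrable_smul_mul hsm hsb h1 h1', tendsto_integral_smul_mul hsm hsb h1 h1' h2 h2' h3 h3'⟩

/-- The Gauss-Green formula for the product of a multiplier and two functions in `H¹`. -/
theorem Multiplier.integral_eq (h : IsGaussCylinder P ν c ρ D) (ha : Multiplier P a d Ta)
    (hu : H1Approx P u du Tu φ) (hw : H1Approx P w dw Tw γ) (j : Fin 3) :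
    Integrable (fun x => a x • (du j x * w x)) (volume.restrict P) ∧
    Integrable (fun x => a x • (u x * dw j x)) (volume.restrict P) ∧
    Integrable (fun x => d j x • (u x * w x)) (volume.restrict P) ∧
    Integrable (fun x => ν x j • Ta x • (Tu x * Tw x)) (surfaceMeasure P) ∧
    (∫ x in P, a x • (du j x * w x)) + (∫ x in P, a x • (u x * dw j x)) +
      ∫ x in P, d j x • (u x * w x) = ∫ x, ν x j • Ta x • (Tu x * Tw x) ∂surfaceMeasure P := by
  have ham := ha.memLpLoc.aestronglyMeasurable
  have hone : ∀ {m : Measure E3}, ∀ᵐ x ∂m, ‖(1 : E3 → ℝ) x‖ ≤ 1 := by simp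
  obtain ⟨hau, hau', hau''⟩ := ha.bound.tendsto ham hu (tendstoLpLoc_of_tendsto hu.tendsto) hu.memLp.1
  obtain ⟨haw, haw', haw''⟩ := ha.bound.tendsto ham hw (tendstoLpLoc_of_tendsto hw.tendsto) hw.memLp.1
  have hfd : ∀ {f : ℕ → E3 → ℂ} {g Tg : E3 → ℂ} {dg : Fin 3 → E3 → ℂ}, H1Approx P g dg Tg f → ∀ n,
      MemLp (fun x => fderiv ℝ (f n) x (unitVec j)) 2 (volume.restrict P) := fun hg n =>
    (continuous_fderiv_apply (hg.contDiff_one n) _).memLp_of_hasCompactSupport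
      (hasCompactSupport_fderiv_apply (hg.hasCompactSupport n) _)
  have e1 : ∀ x (y z : ℂ), a x • (y * z) = (1 : E3 → ℝ) x • (y * (a x • z)) := fun x y z => by
    rw [Pi.one_apply, one_smul, mul_smul_comm]
  have e2 : ∀ x (y z : ℂ), a x • (y * z) = (1 : E3 → ℝ) x • ((a x • y) * z) := fun x y z => by
    rw [Pi.one_apply, one_smul, smul_mul_assoc]
  have i1 : Integrable (fun x => a x • (du j x * w x)) (volume.restrict P) := by
    simp_rw [e1]
    exact integrable_smul_mul aestronglyMeasurable_one hone (hu.memLp_partial j) haw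
  have t1 : Tendsto (fun n => ∫ x in P, a x • (fderiv ℝ (φ n) x (unitVec j) * γ n x)) atTop
      (𝓝 (∫ x in P, a x • (du j x * w x))) := by
    simp_rw [e1]
    exact tendsto_integral_smul_mul aestronglyMeasurable_one hone (hu.memLp_partial j) haw (hfd hu)
      haw' (hu.tendsto_fderiv j) haw''
  have i2 : Integrable (fun x => a x • (u x * dw j x)) (volume.restrict P) := by
    simp_rw [e2]
    exact integrable_smul_mul aestronglyMeasurable_one hone hau (hw.memLp_partial j)
  have t2 : Tendsto (fun n => ∫ x in P, a x • (φ n x * fderiv ℝ (γ n) x (unitVec j))) atTop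
      (𝓝 (∫ x in P, a x • (u x * dw j x))) := by
    simp_rw [e2]
    exact tendsto_integral_smul_mul aestronglyMeasurable_one hone hau (hw.memLp_partial j) hau'
      (hfd hw) hau'' (hw.tendsto_fderiv j)
  obtain ⟨i3, t3⟩ := tendsto_integral_weight (aestronglyMeasurable_one (β := ℝ)) hone
    (ha.memLpLoc_partial j).aestronglyMeasurable (ha.bound_partial j) hu hw
    (tendstoLpLoc_of_tendsto hu.tendsto) hu.memLp.1 (tendstoLpLoc_of_tendsto hw.tendsto) hw.memLp.1
  simp only [Pi.one_apply, one_smul] at i3 t3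
  obtain ⟨i4, t4⟩ := tendsto_integral_weight (h.aestronglyMeasurable_normal_apply j)
    (h.norm_normal_apply_le j) ha.memLpLoc_trace.aestronglyMeasurable ha.bound_trace hu hw
    hu.tendsto_trace hu.aestronglyMeasurable_trace hw.tendsto_trace hw.aestronglyMeasurable_trace
  refine ⟨i1, i2, i3, i4, tendsto_nhds_unique ((t1.add t2).add t3) (t4.congr fun n => ?_)⟩
  obtain ⟨η, hη, hηT⟩ := ha.exists_approx
  have hψ : ContDiff ℝ 1 fun x => φ n x * γ n x := (hu.contDiff_one n).mul (hw.contDiff_one n)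
  have hψc : HasCompactSupport fun x => φ n x * γ n x := (hu.hasCompactSupport n).mul_right
  -- For fixed `n` the product `φ_n γ_n` is smooth with compact support, so only the coefficient
  -- needs approximation. Its approximations are unrelated to `n`.
  have key := h.integral_bilin_of_trace hη hηT ha.memLpLoc ha.memLpLoc_partial ha.memLpLoc_trace
    (ContinuousLinearMap.lsmul ℝ ℝ) hψ hψc j
  have hd : ∀ x, fderiv ℝ (fun x => φ n x * γ n x) x (unitVec j) =
      φ n x * fderiv ℝ (γ n) x (unitVec j) + fderiv ℝ (φ n) x (unitVec j) * γ n x := fun x =>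
    fderiv_bilin_apply (ContinuousLinearMap.mul ℝ ℂ) (hu.contDiff_one n) (hw.contDiff_one n) x _
  simp only [ContinuousLinearMap.lsmul_apply, hd, smul_add] at key
  rw [← key, integral_add]
  · ring
  · simp_rw [e2]
    exact integrable_smul_mul aestronglyMeasurable_one hone (hau' n) (hfd hw n)
  · simp_rw [e1]
    exact integrable_smul_mul aestronglyMeasurable_one hone (hfd hu n) (haw' n)

end Triple

end MaxwellCylinder

namespace MaxwellCylinder

/-! ### Existence of approximations, products and inverses -/

section WeakCalculus

variable {F G H : Type} [NormedAddCommGroup F] [NormedSpace ℝ F]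
  [NormedAddCommGroup G] [NormedSpace ℝ G] [NormedAddCommGroup H] [NormedSpace ℝ H]
  {P : Set E3} {ν : E3 → E3} {c : E3} {ρ D : ℝ}

theorem IsGaussCylinder.exists_smoothApprox [CompleteSpace F] (h : IsGaussCylinder P ν c ρ D)
    {p : ℝ≥0∞} (hp : 1 ≤ p) (hp' : p ≠ ⊤) {g : E3 → F} {d : Fin 3 → E3 → F}
    (hw : ∀ j, IsWeakPartial P j g (d j)) (hg : MemLpLoc (volume.restrict P) p g)
    (hd : ∀ j, MemLpLoc (volume.restrict P) p (d j)) : ∃ φ, SmoothApprox P p g d φ := by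
  refine ⟨_, smoothApprox_approx (hρ := h.rho_pos) h.isOpen h.convex h.ball_subset hp hp' hw hd
    (memLpLoc_indicator h.isOpen.measurableSet hg) ?_⟩
  filter_upwards [ae_restrict_mem h.isOpen.measurableSet] with x hx
  rw [indicator_of_mem hx]

lemma memLpLoc_of_bound {F : Type} [NormedAddCommGroup F] {m : Measure E3}
    [IsFiniteMeasureOnCompacts m] {p : ℝ≥0∞} {g : E3 → F}
    (hg : AEStronglyMeasurable g m) {K : ℝ} (hK : ∀ᵐ x ∂m, ‖g x‖ ≤ K) : MemLpLoc m p g := fun R =>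
  have := isFiniteMeasure_restrict_ball (m := m) R
  MemLp.of_bound hg.restrict K (ae_restrict_of_ae hK)

lemma norm_le_of_mem_Icc {s t y : ℝ} (hy : y ∈ Icc s t) : ‖y‖ ≤ |s| + |t| := by
  rw [Real.norm_eq_abs, abs_le]
  constructor <;> linarith [hy.1, hy.2, neg_abs_le s, le_abs_self t, abs_nonneg s, abs_nonneg t]

/-- The extension by zero may leave the interval, so it is first truncated to `[s, t]`. This does
not change `g` on `P` up to a null set, and averages then stay in the interval. -/
theorem IsGaussCylinder.exists_smoothApprox_Icc (h : IsGaussCylinder P ν c ρ D)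
    {p : ℝ≥0∞} (hp : 1 ≤ p) (hp' : p ≠ ⊤) {g : E3 → ℝ} {d : Fin 3 → E3 → ℝ}
    (hw : ∀ j, IsWeakPartial P j g (d j)) {s t : ℝ} (hst : s ≤ t)
    (hg : ∀ᵐ x ∂(volume.restrict P), g x ∈ Icc s t)
    (hd : ∀ j, MemLpLoc (volume.restrict P) p (d j)) :
    ∃ φ, SmoothApprox P p g d φ ∧ ∀ n x, φ n x ∈ Icc s t := by
  have hPm := h.isOpen.measurableSet
  let K : E3 → ℝ := fun x => max s (min t (P.indicator g x))
  have hK : ∀ x, K x ∈ Icc s t := fun x =>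
    ⟨le_max_left _ _, max_le hst (min_le_left _ _)⟩
  have hgm : AEStronglyMeasurable g (volume.restrict P) := (hw 0).1.aestronglyMeasurable
  have hind : AEStronglyMeasurable (P.indicator g) volume :=
    (aestronglyMeasurable_indicator_iff hPm).2 hgm
  have hKm : AEStronglyMeasurable K volume :=
    (continuous_const.max (continuous_const.min continuous_id)).comp_aestronglyMeasurable hind
  have hKp : MemLpLoc volume p K := memLpLoc_of_bound hKm
    (Eventually.of_forall fun x => norm_le_of_mem_Icc (hK x))
  refine ⟨approx c h.rho_pos K, smoothApprox_approx h.isOpen h.convex h.ball_subset hp hp' hw hd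
    hKp ?_, approx_mem_Icc (hKp.locallyIntegrable hp) hK⟩
  filter_upwards [ae_restrict_mem hPm, hg] with x hx hgx
  simp only [K, indicator_of_mem hx]
  rw [min_eq_right hgx.2, max_eq_right hgx.1]

lemma SmoothApprox.mono_exponent {p q : ℝ≥0∞} (hqp : q ≤ p) {g : E3 → F} {d : Fin 3 → E3 → F}
    {φ : ℕ → E3 → F} (hs : SmoothApprox P p g d φ)
    (hg : AEStronglyMeasurable g (volume.restrict P))
    (hd : ∀ j, AEStronglyMeasurable (d j) (volume.restrict P)) : SmoothApprox P q g d φ :=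
  ⟨hs.contDiff, hs.tendsto.mono_exponent hqp (fun n => (hs.contDiff n).continuous.aestronglyMeasurable)
    hg, fun j => (hs.tendsto_fderiv j).mono_exponent hqp (fun n =>
      (continuous_fderiv_apply (hs.contDiff_one n) _).aestronglyMeasurable) (hd j)⟩

lemma MemLpLoc.bilin (B : F →L[ℝ] G →L[ℝ] H) {m : Measure E3} {p q r : ℝ≥0∞}
    [ENNReal.HolderTriple p q r] {f : E3 → F} {g : E3 → G} (hf : MemLpLoc m p f)
    (hg : MemLpLoc m q g) : MemLpLoc m r fun x => B (f x) (g x) := fun R =>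
  ⟨B.aestronglyMeasurable_comp₂ (hf R).1 (hg R).1, (eLpNorm_bilin_le B (hf R).1 (hg R).1).trans_lt
    (ENNReal.mul_lt_top (ENNReal.mul_lt_top enorm_lt_top (hf R).2) (hg R).2)⟩

/-- The product rule. -/
theorem SmoothApprox.bilin (B : F →L[ℝ] G →L[ℝ] H) {f : E3 → F} {g : E3 → G} {df : Fin 3 → E3 → F}
    {dg : Fin 3 → E3 → G} {φ : ℕ → E3 → F} {γ : ℕ → E3 → G} (hf : SmoothApprox P 2 f df φ)
    (hg : SmoothApprox P 2 g dg γ) (mf : MemLpLoc (volume.restrict P) 2 f)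
    (mdf : ∀ j, MemLpLoc (volume.restrict P) 2 (df j)) (mg : MemLpLoc (volume.restrict P) 2 g)
    (mdg : ∀ j, MemLpLoc (volume.restrict P) 2 (dg j)) :
    SmoothApprox P 1 (fun x => B (f x) (g x)) (fun j x => B (f x) (dg j x) + B (df j x) (g x))
      (fun n x => B (φ n x) (γ n x)) := by
  have cφ : ∀ n, AEStronglyMeasurable (φ n) (volume.restrict P) := fun n =>
    (hf.contDiff n).continuous.aestronglyMeasurable
  have cγ : ∀ n, AEStronglyMeasurable (γ n) (volume.restrict P) := fun n =>
    (hg.contDiff n).continuous.aestronglyMeasurable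
  refine ⟨fun n => contDiff_bilin B (hf.contDiff n) (hg.contDiff n),
    hf.tendsto.bilin B le_rfl hg.tendsto cφ mf cγ mg, fun j => ?_⟩
  simp_rw [fun n x => fderiv_bilin_apply B (hf.contDiff_one n) (hg.contDiff_one n) x (unitVec j)]
  have cdφ : ∀ n, AEStronglyMeasurable (fun x => fderiv ℝ (φ n) x (unitVec j))
      (volume.restrict P) := fun n =>
    (continuous_fderiv_apply (hf.contDiff_one n) _).aestronglyMeasurable
  have cdγ : ∀ n, AEStronglyMeasurable (fun x => fderiv ℝ (γ n) x (unitVec j))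
      (volume.restrict P) := fun n =>
    (continuous_fderiv_apply (hg.contDiff_one n) _).aestronglyMeasurable
  refine TendstoLpLoc.add le_rfl
    (hf.tendsto.bilin B le_rfl (hg.tendsto_fderiv j) cφ mf cdγ (mdg j))
    ((hf.tendsto_fderiv j).bilin B le_rfl hg.tendsto cdφ (mdf j) cγ mg)
    (fun n => B.aestronglyMeasurable_comp₂ (cφ n) (cdγ n))
    (B.aestronglyMeasurable_comp₂ mf.aestronglyMeasurable (mdg j).aestronglyMeasurable)
    (fun n => B.aestronglyMeasurable_comp₂ (cdφ n) (cγ n))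
    (B.aestronglyMeasurable_comp₂ (mdf j).aestronglyMeasurable mg.aestronglyMeasurable)

lemma MemLpLoc.add {F : Type} [NormedAddCommGroup F] {m : Measure E3} {p : ℝ≥0∞} {f g : E3 → F}
    (hf : MemLpLoc m p f)
    (hg : MemLpLoc m p g) : MemLpLoc m p fun x => f x + g x := fun R => (hf R).add (hg R)

lemma MemLpLoc.bilin_partial (B : F →L[ℝ] G →L[ℝ] H) {m : Measure E3} {f : E3 → F} {g : E3 → G}
    {df : Fin 3 → E3 → F} {dg : Fin 3 → E3 → G} (mf : MemLpLoc m 2 f)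
    (mdf : ∀ j, MemLpLoc m 2 (df j)) (mg : MemLpLoc m 2 g) (mdg : ∀ j, MemLpLoc m 2 (dg j))
    (j : Fin 3) : MemLpLoc m 1 fun x => B (f x) (dg j x) + B (df j x) (g x) :=
  (mf.bilin B (mdg j)).add ((mdf j).bilin B mg)

theorem IsGaussCylinder.isWeakPartial_bilin [CompleteSpace F] [CompleteSpace G] [CompleteSpace H]
    (h : IsGaussCylinder P ν c ρ D) (B : F →L[ℝ] G →L[ℝ] H) {f : E3 → F} {g : E3 → G}
    {df : Fin 3 → E3 → F} {dg : Fin 3 → E3 → G} (wf : ∀ j, IsWeakPartial P j f (df j))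
    (wg : ∀ j, IsWeakPartial P j g (dg j)) (mf : MemLpLoc (volume.restrict P) 2 f)
    (mdf : ∀ j, MemLpLoc (volume.restrict P) 2 (df j)) (mg : MemLpLoc (volume.restrict P) 2 g)
    (mdg : ∀ j, MemLpLoc (volume.restrict P) 2 (dg j)) (j : Fin 3) :
    IsWeakPartial P j (fun x => B (f x) (g x)) (fun x => B (f x) (dg j x) + B (df j x) (g x)) := by
  obtain ⟨φ, hφ⟩ := h.exists_smoothApprox (by simp) (by simp) wf mf mdf
  obtain ⟨γ, hγ⟩ := h.exists_smoothApprox (by simp) (by simp) wg mg mdg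
  exact (hφ.bilin B hγ mf mdf mg mdg).isWeakPartial h (mf.bilin B mg)
    (fun j => MemLpLoc.bilin_partial B mf mdf mg mdg j) j

lemma TendstoLpLoc.of_le {F G : Type} [NormedAddCommGroup F] [NormedAddCommGroup G]
    {m : Measure E3} {p : ℝ≥0∞} {φ : ℕ → E3 → F} {g : E3 → F}
    {φ' : ℕ → E3 → G} {g' : E3 → G} (h : TendstoLpLoc m p φ g) {K : NNReal}
    (hK : ∀ n, ∀ᵐ x ∂m, ‖φ' n x - g' x‖ ≤ K * ‖φ n x - g x‖) : TendstoLpLoc m p φ' g' := by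
  intro R
  have h1 := ENNReal.Tendsto.const_mul (h R) (Or.inr (ENNReal.coe_ne_top (r := K)))
  rw [mul_zero] at h1
  refine tendsto_of_tendsto_of_tendsto_of_le_of_le tendsto_const_nhds h1 (fun _ => zero_le)
    fun n => ?_
  have := eLpNorm_le_nnreal_smul_eLpNorm_of_ae_le_mul (f := fun x => φ' n x - g' x)
    (g := fun x => φ n x - g x) (c := K) (μ := m.restrict (Metric.ball 0 R))
    (ae_restrict_of_ae (hK n)) p
  simpa [ENNReal.smul_def] using this

lemma abs_inv_sub_inv_le {s y z : ℝ} (hs : 0 < s) (hy : s ≤ y) (hz : s ≤ z) :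
    |y⁻¹ - z⁻¹| ≤ s⁻¹ ^ 2 * |y - z| := by
  have hy0 : 0 < y := hs.trans_le hy
  have hz0 : 0 < z := hs.trans_le hz
  rw [inv_sub_inv hy0.ne' hz0.ne', abs_div, abs_mul, abs_of_pos hy0, abs_of_pos hz0, abs_sub_comm,
    div_eq_inv_mul, mul_inv, sq]
  gcongr

lemma abs_inv_sq_sub_inv_sq_le {s y z : ℝ} (hs : 0 < s) (hy : s ≤ y) (hz : s ≤ z) :
    |y⁻¹ ^ 2 - z⁻¹ ^ 2| ≤ 2 * s⁻¹ ^ 3 * |y - z| := by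
  have hy0 : 0 < y := hs.trans_le hy
  have hz0 : 0 < z := hs.trans_le hz
  rw [sq_sub_sq, abs_mul]
  have h1 : |y⁻¹ + z⁻¹| ≤ s⁻¹ + s⁻¹ := by
    rw [abs_of_pos (by positivity)]
    gcongr
  calc |y⁻¹ + z⁻¹| * |y⁻¹ - z⁻¹| ≤ (s⁻¹ + s⁻¹) * (s⁻¹ ^ 2 * |y - z|) := by
        gcongr
        exact abs_inv_sub_inv_le hs hy hz
    _ = _ := by ring

/-- The derivative of the reciprocal of a function that is bounded below. -/
theorem IsGaussCylinder.isWeakPartial_inv (h : IsGaussCylinder P ν c ρ D) {g : E3 → ℝ}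
    {d : Fin 3 → E3 → ℝ} (hw : ∀ j, IsWeakPartial P j g (d j)) {s t : ℝ} (hs : 0 < s) (hst : s ≤ t)
    (hg : ∀ᵐ x ∂(volume.restrict P), g x ∈ Icc s t)
    (hd : ∀ j, MemLpLoc (volume.restrict P) 2 (d j)) (j : Fin 3) :
    IsWeakPartial P j (fun x => (g x)⁻¹) (fun x => -(g x)⁻¹ ^ 2 * d j x) := by
  obtain ⟨φ, hφ, hφI⟩ := h.exists_smoothApprox_Icc (by simp) (by simp) hw hst hg hd
  have hgm : AEStronglyMeasurable g (volume.restrict P) := (hw 0).1.aestronglyMeasurable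
  have hφ0 : ∀ n x, φ n x ≠ 0 := fun n x => (hs.trans_le (hφI n x).1).ne'
  have hginv : AEStronglyMeasurable (fun x => (g x)⁻¹) (volume.restrict P) :=
    hgm.aemeasurable.inv.aestronglyMeasurable
  have hb : ∀ᵐ x ∂(volume.restrict P), ‖(g x)⁻¹‖ ≤ s⁻¹ := by
    filter_upwards [hg] with x hx
    rw [norm_inv, Real.norm_of_nonneg (hs.le.trans hx.1)]
    exact inv_anti₀ hs hx.1
  have hb2 : ∀ᵐ x ∂(volume.restrict P), ‖-(g x)⁻¹ ^ 2‖ ≤ s⁻¹ ^ 2 := by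
    filter_upwards [hb] with x hx
    rw [norm_neg, norm_pow]
    gcongr
  have m0 : MemLpLoc (volume.restrict P) 1 fun x => (g x)⁻¹ := memLpLoc_of_bound hginv hb
  have m2 : MemLpLoc (volume.restrict P) 2 fun x => -(g x)⁻¹ ^ 2 :=
    memLpLoc_of_bound (hginv.pow 2).neg hb2
  have md : ∀ j, MemLpLoc (volume.restrict P) 1 fun x => -(g x)⁻¹ ^ 2 * d j x := fun j =>
    m2.bilin (ContinuousLinearMap.mul ℝ ℝ) (hd j)
  refine SmoothApprox.isWeakPartial (φ := fun n x => (φ n x)⁻¹)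
    (d := fun j x => -(g x)⁻¹ ^ 2 * d j x) h ?_ m0 md j
  -- On `[s, ∞)` the functions `1/y` and `1/y²` are Lipschitz with constants `s⁻²` and `2 s⁻³`, so
  -- convergence of `φ_n` is inherited by the factors of the chain rule.
  refine ⟨fun n => (hφ.contDiff n).inv (hφ0 n), ?_, fun j => ?_⟩
  · refine TendstoLpLoc.of_le (K := ⟨s⁻¹ ^ 2, by positivity⟩) (hφ.tendsto.mono_exponent (p := 1)
      (by simp) (fun n => (hφ.contDiff n).continuous.aestronglyMeasurable) hgm) fun n => ?_
    filter_upwards [hg] with x hx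
    exact abs_inv_sub_inv_le hs (hφI n x).1 hx.1
  · have hfd : ∀ n x, fderiv ℝ (fun x => (φ n x)⁻¹) x (unitVec j) =
        -(φ n x)⁻¹ ^ 2 * fderiv ℝ (φ n) x (unitVec j) := by
      intro n x
      have h1 : HasFDerivAt (fun x => (φ n x)⁻¹) _ x :=
        (hasDerivAt_inv (hφ0 n x)).comp_hasFDerivAt x
          (((hφ.contDiff_one n).differentiable (by simp)) x).hasFDerivAt
      rw [h1.fderiv]
      simp [inv_pow]
    simp_rw [hfd]
    have hc : ∀ n, Continuous fun x => -(φ n x)⁻¹ ^ 2 := fun n =>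
      (((hφ.contDiff n).continuous.inv₀ (hφ0 n)).pow 2).neg
    refine TendstoLpLoc.bilin (ContinuousLinearMap.mul ℝ ℝ) (p := 2) (q := 2) le_rfl
      (φ := fun n x => -(φ n x)⁻¹ ^ 2) (g := fun x => -(g x)⁻¹ ^ 2) ?_ (hφ.tendsto_fderiv j)
      (fun n => (hc n).aestronglyMeasurable) m2
      (fun n => (continuous_fderiv_apply (hφ.contDiff_one n) _).aestronglyMeasurable) (hd j)
    refine TendstoLpLoc.of_le (K := ⟨2 * s⁻¹ ^ 3, by positivity⟩) hφ.tendsto fun n => ?_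
    filter_upwards [hg] with x hx
    rw [neg_sub_neg, norm_sub_rev]
    exact abs_inv_sq_sub_inv_sq_le hs (hφI n x).1 hx.1

/-- Limits of functions with values in a closed set. -/
lemma TendstoLpLoc.ae_mem {F : Type} [NormedAddCommGroup F] {m : Measure E3} {p : ℝ≥0∞}
    (hp : p ≠ 0) {φ : ℕ → E3 → F} {T : E3 → F}
    (h : TendstoLpLoc m p φ T) (hφ : ∀ n, AEStronglyMeasurable (φ n) m)
    (hT : AEStronglyMeasurable T m) {S : Set F} (hS : IsClosed S) (hφS : ∀ n x, φ n x ∈ S) :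
    ∀ᵐ x ∂m, T x ∈ S := by
  have hu : (⋃ n : ℕ, Metric.ball (0 : E3) n) = univ := Metric.iUnion_ball_nat 0
  rw [← Measure.restrict_univ (μ := m), ← hu, ae_restrict_iUnion_iff]
  intro N
  obtain ⟨ns, -, hae⟩ := (tendstoInMeasure_of_tendsto_eLpNorm hp (fun n => (hφ n).restrict)
    hT.restrict (h N)).exists_seq_tendsto_ae
  filter_upwards [hae] with x hx
  exact hS.mem_of_tendsto hx (Eventually.of_forall fun i => hφS _ x)

/-- Both convergences imply convergence in measure. This identifies limits of one sequence taken
with different exponents. -/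
lemma TendstoLpLoc.ae_eq {F : Type} [NormedAddCommGroup F] {m : Measure E3} {p q : ℝ≥0∞}
    (hp : p ≠ 0) (hq : q ≠ 0) {φ : ℕ → E3 → F}
    {T S : E3 → F} (h : TendstoLpLoc m p φ T) (h' : TendstoLpLoc m q φ S)
    (hφ : ∀ n, AEStronglyMeasurable (φ n) m) (hT : AEStronglyMeasurable T m)
    (hS : AEStronglyMeasurable S m) : T =ᵐ[m] S := by
  have hu : (⋃ n : ℕ, Metric.ball (0 : E3) n) = univ := Metric.iUnion_ball_nat 0
  rw [EventuallyEq, ← Measure.restrict_univ (μ := m), ← hu, ae_restrict_iUnion_iff]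
  intro N
  exact tendstoInMeasure_ae_unique
    (tendstoInMeasure_of_tendsto_eLpNorm hp (fun n => (hφ n).restrict) hT.restrict (h N))
    (tendstoInMeasure_of_tendsto_eLpNorm hq (fun n => (hφ n).restrict) hS.restrict (h' N))

/-! ### Translations -/

lemma isTest_shift (hs : ∀ x ∈ P, ∀ z : ℝ, x + z • unitVec 2 ∈ P) {φ : E3 → ℝ} (hφ : IsTest P φ)
    (z : ℝ) : IsTest P fun x => φ (x + z • unitVec 2) := by
  refine ⟨hφ.1.comp (contDiff_id.add contDiff_const),
    hφ.2.1.comp_homeomorph (Homeomorph.addRight _), ?_⟩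
  have := tsupport_comp_eq_preimage φ (Homeomorph.addRight (z • unitVec 2 : E3))
  intro x hx
  have h1 : x + z • unitVec 2 ∈ tsupport φ := by
    have h2 : x ∈ (Homeomorph.addRight (z • unitVec 2 : E3)) ⁻¹' tsupport φ := by
      rw [← this]; exact hx
    exact h2
  have := hs _ (hφ.2.2 h1) (-z)
  simpa using this

lemma IsWeakPartial.shift (hs : ∀ x ∈ P, ∀ z : ℝ, x + z • unitVec 2 ∈ P) (hP : MeasurableSet P)
    {j : Fin 3} {g d : E3 → F} (h : IsWeakPartial P j g d) (z : ℝ) :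
    IsWeakPartial P j (fun x => g (x + z • unitVec 2)) (fun x => d (x + z • unitVec 2)) := by
  have hemb : MeasurableEmbedding fun x : E3 => x + z • unitVec 2 :=
    (Homeomorph.addRight (z • unitVec 2 : E3)).measurableEmbedding
  have hmp := measurePreserving_shift hs hP z
  have hloc : ∀ {u : E3 → F}, LocallyIntegrableOn u P →
      LocallyIntegrableOn (fun x => u (x + z • unitVec 2)) P := by
    intro u hu x hx
    obtain ⟨s, hsn, hsi⟩ := hu _ (hs x hx z)
    refine ⟨(fun x : E3 => x + z • unitVec 2) ⁻¹' s, ?_, ?_⟩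
    · have hc : Tendsto (fun x : E3 => x + z • unitVec 2) (𝓝[P] x) (𝓝[P] (x + z • unitVec 2)) := by
        refine tendsto_nhdsWithin_of_tendsto_nhds_of_eventually_within _ ?_ ?_
        · exact (Continuous.tendsto (by fun_prop) x).mono_left nhdsWithin_le_nhds
        · filter_upwards [self_mem_nhdsWithin] with y hy
          exact hs y hy z
      exact hc hsn
    · exact ((measurePreserving_add_right (volume : Measure E3)
        (z • unitVec 2)).integrableOn_comp_preimage hemb).2 hsi
  refine ⟨hloc h.1, hloc h.2.1, fun φ hφ => ?_⟩
  have hφ' := isTest_shift hs hφ (-z)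
  have h1 := h.2.2 _ hφ'
  have h2 : ∀ x, fderiv ℝ (fun x => φ (x + (-z) • unitVec 2)) x (unitVec j) =
      fderiv ℝ φ (x + (-z) • unitVec 2) (unitVec j) := fun x => by
    rw [fderiv_comp_add_right]
  simp_rw [h2] at h1
  have e1 := hmp.integral_comp hemb fun x => fderiv ℝ φ (x + (-z) • unitVec 2) (unitVec j) • g x
  have e2 := hmp.integral_comp hemb fun x => φ (x + (-z) • unitVec 2) • d x
  have e3 : ∀ x : E3, x + z • unitVec 2 + (-z) • unitVec 2 = x := fun x => by module
  simp only [e3] at e1 e2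
  rw [e1, e2, h1]

/-- The shifted derivative is a weak derivative of the shifted function, which is the same function;
weak derivatives are unique. -/
lemma IsWeakPartial.periodic [CompleteSpace F] (hP : IsOpen P)
    (hs : ∀ x ∈ P, ∀ z : ℝ, x + z • unitVec 2 ∈ P)
    {j : Fin 3} {g d : E3 → F} (h : IsWeakPartial P j g d)
    (hper : ∀ᵐ x ∂(volume.restrict P), g (x + unitVec 2) = g x) :
    ∀ᵐ x ∂(volume.restrict P), d (x + unitVec 2) = d x := by
  have h1 := h.shift hs hP.measurableSet 1
  simp only [one_smul] at h1
  exact (h1.congr hper EventuallyEq.rfl).ae_eq hP h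

end WeakCalculus

end MaxwellCylinder

namespace MaxwellCylinder

/-! ### Coefficients -/

section Coefficients

variable {F G : Type} [NormedAddCommGroup F] [NormedSpace ℝ F] [NormedAddCommGroup G]
  [NormedSpace ℝ G] {P : Set E3} {ν : E3 → E3} {c : E3} {ρ D : ℝ}

lemma UniformLp.congr {m : Measure E3} {s : ℝ≥0∞} {f g : E3 → ℝ} (hf : UniformLp m s f)
    (hfg : f =ᵐ[m] g) : UniformLp m s g := by
  intro R
  obtain ⟨K, hK⟩ := hf R
  refine ⟨K, fun z => ?_⟩
  rw [← eLpNorm_congr_ae (ae_restrict_of_ae hfg)]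
  exact hK z

lemma UniformLp.mul_bound {m : Measure E3} {s : ℝ≥0∞} {f b : E3 → ℝ} (hf : UniformLp m s f)
    {M : NNReal} (hb : ∀ᵐ x ∂m, ‖b x‖ ≤ M) : UniformLp m s fun x => b x * f x := by
  intro R
  obtain ⟨K, hK⟩ := hf R
  refine ⟨M * K, fun z => ?_⟩
  have := eLpNorm_le_nnreal_smul_eLpNorm_of_ae_le_mul (f := fun x => b x * f x) (g := f) (c := M)
    (μ := m.restrict (Metric.ball (z • unitVec 2) R)) (by
      filter_upwards [ae_restrict_of_ae hb] with x hx
      rw [nnnorm_mul]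
      gcongr
      exact hx) s
  refine this.trans ?_
  rw [ENNReal.smul_def, smul_eq_mul]
  push_cast
  gcongr
  exact hK z

lemma UniformLp.add {m : Measure E3} {s : ℝ≥0∞} (hs : 1 ≤ s) {f g : E3 → ℝ} (hf : UniformLp m s f)
    (hg : UniformLp m s g) (mf : AEStronglyMeasurable f m) (mg : AEStronglyMeasurable g m) :
    UniformLp m s fun x => f x + g x := by
  intro R
  obtain ⟨K, hK⟩ := hf R
  obtain ⟨K', hK'⟩ := hg R
  refine ⟨K + K', fun z => ?_⟩
  push_cast
  exact (eLpNorm_add_le mf.restrict mg.restrict hs).trans (add_le_add (hK z) (hK' z))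

lemma UniformLp.memLpLoc {m : Measure E3} {s : ℝ≥0∞} {f : E3 → ℝ} (hf : UniformLp m s f)
    (mf : AEStronglyMeasurable f m) : MemLpLoc m s f := by
  intro R
  obtain ⟨K, hK⟩ := hf R
  refine ⟨mf.restrict, (le_trans ?_ (hK 0)).trans_lt ENNReal.coe_lt_top⟩
  rw [zero_smul]

lemma UniformLp.sqrt_abs {m : Measure E3} {s r : ℝ≥0∞} (hrs : r * ENNReal.ofReal (1 / 2) = s)
    {f : E3 → ℝ} (hf : UniformLp m s f) : UniformLp m r fun x => √|f x| := by
  intro R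
  obtain ⟨K, hK⟩ := hf R
  refine ⟨K ^ (1 / 2 : ℝ), fun z => ?_⟩
  have h := eLpNorm_norm_rpow (μ := m.restrict (Metric.ball (z • unitVec 2) R)) (p := r) f
    (q := 1 / 2) (by norm_num)
  rw [hrs] at h
  simp_rw [Real.sqrt_eq_rpow, ← Real.norm_eq_abs]
  rw [h, ENNReal.coe_rpow_of_nonneg _ (by norm_num)]
  gcongr
  exact hK z

lemma holderTriple_three_six : ENNReal.HolderTriple 3 6 2 := ⟨by
  rw [← ENNReal.toReal_eq_toReal_iff' (by simp) (by simp), ENNReal.toReal_add (by simp) (by simp)]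
  norm_num [ENNReal.toReal_inv]⟩

lemma holderTriple_four_four : ENNReal.HolderTriple 4 4 2 := ⟨by
  rw [← ENNReal.toReal_eq_toReal_iff' (by simp) (by simp), ENNReal.toReal_add (by simp) (by simp)]
  norm_num [ENNReal.toReal_inv]⟩

lemma one_le_three_halves : (1 : ℝ≥0∞) ≤ 3 / 2 := by
  rw [ENNReal.le_div_iff_mul_le (by simp) (by simp)]; norm_num

lemma three_halves_ne_top : (3 / 2 : ℝ≥0∞) ≠ ⊤ := by finiteness

lemma mul_ofReal_half (n : ℕ) : (n : ℝ≥0∞) * ENNReal.ofReal (1 / 2) = n / 2 := by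
  rw [one_div, ENNReal.ofReal_inv_of_pos (by norm_num), ENNReal.ofReal_ofNat, div_eq_mul_inv]

lemma IsGaussCylinder.exists_hor_bound (h : IsGaussCylinder P ν c ρ D) :
    ∃ D', ∀ x ∈ closure P, |x 0| ≤ D' ∧ |x 1| ≤ D' := by
  refine ⟨D + |c 0| + |c 1|, fun x hx => ?_⟩
  have h1 := h.hor_le x hx
  have h2 : ∀ j, |x j| ≤ |x j - c j| + |c j| := fun j => by
    simpa using abs_add_le (x j - c j) (c j)
  constructor
  · linarith [h2 0, abs_nonneg (c 1)]
  · linarith [h2 1, abs_nonneg (c 0)]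

/-- The exponents are `1/3 + 1/6 = 1/2`, with `H¹` in `L₆`. On the boundary, in the next lemma, they
are `1/4 + 1/4 = 1/2`, with traces in `L₄`. -/
lemma IsGaussCylinder.weightedBound_of_uniform (h : IsGaussCylinder P ν c ρ D) {w : E3 → ℝ}
    (hwm : AEStronglyMeasurable w (volume.restrict P)) (hw : UniformLp (volume.restrict P) 3 w) :
    WeightedBound P (volume.restrict P) w 2 2 := by
  have := holderTriple_three_six
  obtain ⟨D', hD'⟩ := h.exists_hor_bound
  refine WeightedBound.of_uniformLp (r := 6) (s := 3) (D := D') ?_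
    (h.sobolevBound_six.weightedBound (by simp)) hwm hw
  filter_upwards [ae_restrict_mem h.isOpen.measurableSet] with x hx
  exact hD' x (subset_closure hx)

lemma IsGaussCylinder.weightedBound_surface_of_uniform (h : IsGaussCylinder P ν c ρ D) {w : E3 → ℝ}
    (hwm : AEStronglyMeasurable w (surfaceMeasure P)) (hw : UniformLp (surfaceMeasure P) 4 w) :
    WeightedBound P (surfaceMeasure P) w 2 2 := by
  have := holderTriple_four_four
  have := h.sigmaFinite
  obtain ⟨D', hD'⟩ := h.exists_hor_bound
  refine WeightedBound.of_uniformLp (r := 4) (s := 4) (D := D') ?_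
    (h.sobolevBound_surface_four.weightedBound (by simp)) hwm hw
  filter_upwards [ae_restrict_mem isClosed_frontier.measurableSet] with x hx
  exact hD' x (frontier_subset_closure hx)

lemma memLpLoc_iff {F : Type} [NormedAddCommGroup F] {p : ℝ≥0∞} {g : E3 → F} : MemLpLoc
    (volume.restrict P) p g ↔
    ∀ R : ℝ, MemLp g p (volume.restrict (P ∩ Metric.ball 0 R)) := by
  refine forall_congr' fun R => ?_
  rw [Measure.restrict_restrict Metric.isOpen_ball.measurableSet, inter_comm]

lemma MemLpLoc.congr {F : Type} [NormedAddCommGroup F] {m : Measure E3} {p : ℝ≥0∞} {f g : E3 → F}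
    (hf : MemLpLoc m p f)
    (hfg : f =ᵐ[m] g) : MemLpLoc m p g := fun R => (hf R).ae_eq (ae_restrict_of_ae hfg)

/-- The trace as a limit. -/
lemma SmoothApprox.tendsto_trace [CompleteSpace F] (h : IsGaussCylinder P ν c ρ D) {p s : ℝ≥0∞}
    (hp : 1 ≤ p) (hs1 : 1 ≤ s) {g T : E3 → F} {d : Fin 3 → E3 → F} {φ : ℕ → E3 → F}
    (hs : SmoothApprox P p g d φ) (hw : ∀ j, IsWeakPartial P j g (d j))
    (hT : TendstoLpLoc (surfaceMeasure P) s φ T) (hTm : AEStronglyMeasurable T (surfaceMeasure P)) :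
    trace P g =ᵐ[surfaceMeasure P] T := by
  have hfc := h.isFiniteMeasureOnCompacts
  refine HasTrace.trace_ae_eq h (hasTrace_iff.2 ⟨hTm, d, φ, hw, ?_, ?_⟩)
  · exact hs.mono_exponent hp (hw 0).1.aestronglyMeasurable fun j => (hw j).2.1.aestronglyMeasurable
  · exact hT.mono_exponent hs1 (fun n => (hs.contDiff n).continuous.aestronglyMeasurable) hTm

theorem IsGaussCylinder.exists_h1Approx [FiniteDimensional ℝ F] (h : IsGaussCylinder P ν c ρ D)
    {u : E3 → F} {d : Fin 3 → E3 → F} (hw : ∀ j, IsWeakPartial P j u (d j))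
    (hu : MemLp u 2 (volume.restrict P)) (hd : ∀ j, MemLp (d j) 2 (volume.restrict P)) :
    ∃ φ, H1Approx P u d (trace P u) φ := by
  have : CompleteSpace F := FiniteDimensional.complete ℝ F
  have hfc := h.isFiniteMeasureOnCompacts
  obtain ⟨φ₀, hφ₀⟩ := h.exists_smoothApprox (p := 2) (by simp) (by simp) hw
    (memLpLoc_of_memLp hu) fun j => memLpLoc_of_memLp (hd j)
  obtain ⟨φ, h1, h2, h3, h4⟩ := exists_tendsto_of_smoothApprox hφ₀ hu hd
  have hs : SmoothApprox P 2 u d φ := ⟨h1, tendstoLpLoc_of_tendsto h3, fun j =>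
    tendstoLpLoc_of_tendsto (φ := fun n x => fderiv ℝ (φ n) x (unitVec j)) (h4 j)⟩
  obtain ⟨T, hTm, hT⟩ := hs.exists_trace (r := 4) (by simp) (by simp)
    (h.sobolevBound_surface_four.weightedBound (by simp)) hu.1 fun j => (hd j).1
  have hT2 : TendstoLpLoc (surfaceMeasure P) 2 φ T := hT.mono_exponent
    (by norm_num) (fun n => (h1 n).continuous.aestronglyMeasurable) hTm
  have he := hs.tendsto_trace h (by simp) (by simp) hw hT2 hTm
  exact ⟨φ, h1, h2, hu, hd, hTm.congr he.symm, h3, h4,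
    hT2.congr (fun _ => EventuallyEq.rfl) he.symm⟩

/-- The properties of the coefficients that are used: `m` takes values in `[s, t]`, its derivatives
are uniformly locally in `L₃` and may be multiplied with two functions in `H¹`. -/
structure IsCoefficient (P : Set E3) (m : E3 → ℝ) (s t : ℝ) : Prop where
  pos : 0 < s
  mem_Icc : ∀ᵐ x ∂(volume.restrict P), m x ∈ Icc s t
  isWeakPartial : ∀ j, IsWeakPartial P j m (weakPartial P j m)
  isWeakPartial_two : ∀ j k, IsWeakPartial P k (weakPartial P j m)
    (weakPartial P k (weakPartial P j m))
  uniformLp : ∀ j, UniformLp (volume.restrict P) 3 (weakPartial P j m)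
  multiplier : ∀ j, Multiplier P (weakPartial P j m)
    (fun k => weakPartial P k (weakPartial P j m)) (trace P (weakPartial P j m))

/-- Each `∂_j m` is periodic and in `W¹_{3/2}` on bounded parts. By the Sobolev inequalities it is
uniformly locally in `L₃` with trace in `L₂`. The square roots of its derivatives are then in `L₃`
and that of its trace in `L₄`, which are exactly the classes admitted as weights for `H¹`. -/
theorem IsGaussCylinder.isCoefficient (h : IsGaussCylinder P ν c ρ D) {m : E3 → ℝ} {s t : ℝ}
    (hs : 0 < s) (hm : ∀ᵐ x ∂(volume.restrict P), m x ∈ Icc s t)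
    (hmW : MemPeriodicSobolev P (3 / 2) 2 m) : IsCoefficient P m s t := by
  have hfc := h.isFiniteMeasureOnCompacts
  have hPo := h.isOpen
  have hPm := h.isOpen.measurableSet
  obtain ⟨hper, -, hder⟩ := hmW
  have h1 : ∀ j, IsWeakPartial P j m (weakPartial P j m) := fun j => by
    obtain ⟨d, hd, -⟩ := hder j
    exact hd.isWeakPartial_weakPartial
  have h2 : ∀ j k, IsWeakPartial P k (weakPartial P j m) (weakPartial P k (weakPartial P j m)) :=
    fun j k => by
    obtain ⟨d, hd, -, hd'⟩ := hder j
    obtain ⟨d', hdd, -⟩ := hd' k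
    exact (hdd.congr (hd.weakPartial_ae_eq hPo).symm EventuallyEq.rfl).isWeakPartial_weakPartial
  have l1 : ∀ j, MemLpLoc (volume.restrict P) (3 / 2) (weakPartial P j m) := fun j => by
    obtain ⟨d, hd, hdl, -⟩ := hder j
    exact (memLpLoc_iff.2 hdl).congr (hd.weakPartial_ae_eq hPo).symm
  have l2 : ∀ j k, MemLpLoc (volume.restrict P) (3 / 2) (weakPartial P k (weakPartial P j m)) :=
    fun j k => by
    obtain ⟨d, hd, -, hd'⟩ := hder j
    obtain ⟨d', hdd, hdl⟩ := hd' k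
    refine (memLpLoc_iff.2 hdl).congr ?_
    exact ((hdd.congr (hd.weakPartial_ae_eq hPo).symm EventuallyEq.rfl).weakPartial_ae_eq hPo).symm
  have p1 : ∀ j, ∀ᵐ x ∂(volume.restrict P),
      weakPartial P j m (x + unitVec 2) = weakPartial P j m x :=
    fun j => (h1 j).periodic hPo h.shift hper
  have p2 := fun j k => (h2 j k).periodic hPo h.shift (p1 j)
  have u1 := fun j => (l1 j).uniformLp h.shift hPm (p1 j)
  have u2 := fun j k => (l2 j k).uniformLp h.shift hPm (p2 j k)
  have key : ∀ j, UniformLp (volume.restrict P) 3 (weakPartial P j m) ∧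
      UniformLp (surfaceMeasure P) 2 (trace P (weakPartial P j m)) ∧
      AEStronglyMeasurable (trace P (weakPartial P j m)) (surfaceMeasure P) ∧
      ∃ φ, SmoothApprox P 1 (weakPartial P j m) (fun k => weakPartial P k (weakPartial P j m)) φ ∧
        TendstoLpLoc (surfaceMeasure P) 1 φ (trace P (weakPartial P j m)) := by
    intro j
    have m1 := (l1 j).aestronglyMeasurable
    have m2 := fun k => (l2 j k).aestronglyMeasurable
    obtain ⟨φ, hφ⟩ := h.exists_smoothApprox one_le_three_halves three_halves_ne_top (h2 j) (l1 j)
      (l2 j)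
    have cφ : ∀ {μ : Measure E3} n, AEStronglyMeasurable (φ n) μ := fun n =>
      (hφ.contDiff n).continuous.aestronglyMeasurable
    have hp0 : (3 / 2 : ℝ≥0∞) ≠ 0 := (zero_lt_one.trans_le one_le_three_halves).ne'
    have hW3 := h.sobolevBound_three.weightedBound one_le_three_halves
    have hW2 := h.sobolevBound_surface_two.weightedBound one_le_three_halves
    obtain ⟨S, hSm, hS⟩ := hφ.exists_trace (r := 3) (by simp) one_le_three_halves hW3 m1 m2
    obtain ⟨T, hTm, hT⟩ := hφ.exists_trace (r := 2) (by simp) one_le_three_halves hW2 m1 m2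
    -- The limit in `L₃` is the derivative itself, since the same sequence converges to it in
    -- `L_{3/2}`.
    have hSe := hS.ae_eq (by simp) hp0 hφ.tendsto cφ hSm m1
    have hTe := hφ.tendsto_trace h one_le_three_halves (by simp) (h2 j) hT hTm
    have uS := hφ.uniformLp (by simp) one_le_three_halves hW3 m1 m2 hS hSm (u1 j) (u2 j)
    have uT := hφ.uniformLp (by simp) one_le_three_halves hW2 m1 m2 hT hTm (u1 j) (u2 j)
    exact ⟨uS.congr hSe, uT.congr hTe.symm, hTm.congr hTe.symm, φ,
      hφ.mono_exponent one_le_three_halves m1 m2,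
      (hT.mono_exponent (by simp) cφ hTm).congr (fun _ => EventuallyEq.rfl) hTe.symm⟩
  refine ⟨hs, hm, h1, h2, fun j => (key j).1, fun j => ?_⟩
  obtain ⟨k1, k2, k3, k4⟩ := key j
  refine ⟨k4, (l1 j).mono_exponent one_le_three_halves,
    fun k => (l2 j k).mono_exponent one_le_three_halves,
    (k2.memLpLoc k3).mono_exponent (by simp), h.weightedBound_of_uniform (l1 j).aestronglyMeasurable k1,
    fun k => h.weightedBound_of_uniform
      (aestronglyMeasurable_sqrt_abs (l2 j k).aestronglyMeasurable) ?_,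
    h.weightedBound_surface_of_uniform (aestronglyMeasurable_sqrt_abs k3) ?_⟩
  · exact (u2 j k).sqrt_abs (mul_ofReal_half 3)
  · refine k2.sqrt_abs ((mul_ofReal_half 4).trans ?_)
    push_cast
    rw [show (4 : ℝ≥0∞) = 2 * 2 by norm_num, ENNReal.mul_div_cancel_right (by simp) (by simp)]

lemma IsCoefficient.aestronglyMeasurable {m : E3 → ℝ} {s t : ℝ} (hm : IsCoefficient P m s t) :
    AEStronglyMeasurable m (volume.restrict P) := (hm.isWeakPartial 0).1.aestronglyMeasurable

lemma IsCoefficient.memLpLoc_partial {m : E3 → ℝ} {s t : ℝ} (hm : IsCoefficient P m s t)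
    (j : Fin 3) : MemLpLoc (volume.restrict P) 2 (weakPartial P j m) :=
  ((hm.uniformLp j).memLpLoc (hm.isWeakPartial j).2.1.aestronglyMeasurable).mono_exponent
    (by norm_num)

lemma norm_inv_le_of_mem_Icc {s t y : ℝ} (hs : 0 < s) (hy : y ∈ Icc s t) : ‖y⁻¹‖ ≤ s⁻¹ := by
  rw [norm_inv, Real.norm_of_nonneg (hs.le.trans hy.1)]
  exact inv_anti₀ hs hy.1

/-- The derivatives and the trace of `(εμ)⁻¹`. -/
theorem IsGaussCylinder.inv_mul (h : IsGaussCylinder P ν c ρ D) {ε μ : E3 → ℝ} {s t s' t' : ℝ}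
    (hε : IsCoefficient P ε s t) (hst : s ≤ t) (hμ : IsCoefficient P μ s' t') (hst' : s' ≤ t') :
    (∀ j, IsWeakPartial P j (fun x => (ε x * μ x)⁻¹) (weakPartial P j fun x => (ε x * μ x)⁻¹)) ∧
    (∀ j, UniformLp (volume.restrict P) 3 (weakPartial P j fun x => (ε x * μ x)⁻¹)) ∧
    (∃ φ, SmoothApprox P 2 (fun x => (ε x * μ x)⁻¹) (fun j => weakPartial P j fun x => (ε x * μ x)⁻¹)
        φ ∧ TendstoLpLoc (surfaceMeasure P) 2 φ (trace P fun x => (ε x * μ x)⁻¹)) ∧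
    (∀ᵐ x ∂surfaceMeasure P, ‖trace P (fun x => (ε x * μ x)⁻¹) x‖ ≤ s⁻¹ * s'⁻¹) ∧
    AEStronglyMeasurable (trace P fun x => (ε x * μ x)⁻¹) (surfaceMeasure P) := by
  have hfc := h.isFiniteMeasureOnCompacts
  set q : E3 → ℝ := fun x => (ε x * μ x)⁻¹ with hq
  have bε : ∀ᵐ x ∂(volume.restrict P), ‖(ε x)⁻¹‖ ≤ s⁻¹ := by
    filter_upwards [hε.mem_Icc] with x hx
    exact norm_inv_le_of_mem_Icc hε.pos hx
  have bμ : ∀ᵐ x ∂(volume.restrict P), ‖(μ x)⁻¹‖ ≤ s'⁻¹ := by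
    filter_upwards [hμ.mem_Icc] with x hx
    exact norm_inv_le_of_mem_Icc hμ.pos hx
  have wε := h.isWeakPartial_inv hε.isWeakPartial hε.pos hst hε.mem_Icc hε.memLpLoc_partial
  have wμ := h.isWeakPartial_inv hμ.isWeakPartial hμ.pos hst' hμ.mem_Icc hμ.memLpLoc_partial
  have mε : AEStronglyMeasurable (fun x => (ε x)⁻¹) (volume.restrict P) := (wε 0).1.aestronglyMeasurable
  have mμ : AEStronglyMeasurable (fun x => (μ x)⁻¹) (volume.restrict P) := (wμ 0).1.aestronglyMeasurable
  have sinv : ∀ {s : ℝ}, 0 < s → ((s⁻¹).toNNReal : ℝ) = s⁻¹ := fun hs =>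
    Real.coe_toNNReal _ (inv_pos.2 hs).le
  have sqb : ∀ {w : E3 → ℝ} {s : ℝ}, 0 < s → (∀ᵐ x ∂(volume.restrict P), ‖(w x)⁻¹‖ ≤ s⁻¹) →
      ∀ᵐ x ∂(volume.restrict P), ‖-(w x)⁻¹ ^ 2‖ ≤ ((s⁻¹).toNNReal ^ 2 : NNReal) := by
    intro w s hs hw
    filter_upwards [hw] with x hx
    rw [norm_neg, norm_pow, NNReal.coe_pow, sinv hs]
    gcongr
  have uε : ∀ j, UniformLp (volume.restrict P) 3 fun x => -(ε x)⁻¹ ^ 2 * weakPartial P j ε x :=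
    fun j => (hε.uniformLp j).mul_bound (sqb hε.pos bε)
  have uμ : ∀ j, UniformLp (volume.restrict P) 3 fun x => -(μ x)⁻¹ ^ 2 * weakPartial P j μ x :=
    fun j => (hμ.uniformLp j).mul_bound (sqb hμ.pos bμ)
  have lε := fun j => ((uε j).memLpLoc (wε j).2.1.aestronglyMeasurable).mono_exponent
    (p := 2) (by norm_num)
  have lμ := fun j => ((uμ j).memLpLoc (wμ j).2.1.aestronglyMeasurable).mono_exponent
    (p := 2) (by norm_num)
  have hw := h.isWeakPartial_bilin (ContinuousLinearMap.mul ℝ ℝ) wε wμ (memLpLoc_of_bound mε bε) lε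
    (memLpLoc_of_bound mμ bμ) lμ
  simp only [ContinuousLinearMap.mul_apply', ← mul_inv] at hw
  have hw1 : ∀ j, IsWeakPartial P j q (weakPartial P j q) := fun j => (hw j).isWeakPartial_weakPartial
  have hu : ∀ j, UniformLp (volume.restrict P) 3 (weakPartial P j q) := by
    intro j
    refine UniformLp.congr ?_ ((hw j).weakPartial_ae_eq h.isOpen).symm
    refine UniformLp.add (by simp) ((uμ j).mul_bound (M := (s⁻¹).toNNReal) ?_) ?_
      (mε.mul (wμ j).2.1.aestronglyMeasurable) ((wε j).2.1.aestronglyMeasurable.mul mμ)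
    · filter_upwards [bε] with x hx
      rwa [sinv hε.pos]
    · simp_rw [mul_comm _ (μ _)⁻¹]
      refine (uε j).mul_bound (M := (s'⁻¹).toNNReal) ?_
      filter_upwards [bμ] with x hx
      rwa [sinv hμ.pos]
  have hl : ∀ j, MemLpLoc (volume.restrict P) 2 (weakPartial P j q) := fun j =>
    ((hu j).memLpLoc (hw1 j).2.1.aestronglyMeasurable).mono_exponent (by norm_num)
  -- Approximations confined to this closed interval pass the bound on to the trace, which is their
  -- limit on the boundary.
  have hqI : ∀ᵐ x ∂(volume.restrict P), q x ∈ Icc (-(s⁻¹ * s'⁻¹)) (s⁻¹ * s'⁻¹) := by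
    filter_upwards [bε, bμ] with x hx hy
    refine abs_le.1 ?_
    rw [hq, ← Real.norm_eq_abs]
    dsimp only
    rw [mul_inv, norm_mul]
    exact mul_le_mul hx hy (norm_nonneg _) ((norm_nonneg _).trans hx)
  have hpos : 0 < s⁻¹ * s'⁻¹ := mul_pos (inv_pos.2 hε.pos) (inv_pos.2 hμ.pos)
  obtain ⟨φ, hφ, hφI⟩ := h.exists_smoothApprox_Icc (p := 2) (by simp) (by simp) hw1
    (by linarith) hqI hl
  obtain ⟨T, hTm, hT⟩ := hφ.exists_trace (r := 4) (by simp) (by simp)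
    (h.sobolevBound_surface_four.weightedBound (by simp)) (hw1 0).1.aestronglyMeasurable
    fun j => (hl j).aestronglyMeasurable
  have cφ : ∀ n, AEStronglyMeasurable (φ n) (surfaceMeasure P) := fun n =>
    (hφ.contDiff n).continuous.aestronglyMeasurable
  have hT2 : TendstoLpLoc (surfaceMeasure P) 2 φ T := hT.mono_exponent (by norm_num) cφ hTm
  have he := hφ.tendsto_trace h (by simp) (by simp) hw1 hT2 hTm
  refine ⟨hw1, hu, ⟨φ, hφ, hT2.congr (fun _ => EventuallyEq.rfl) he.symm⟩, ?_, hTm.congr he.symm⟩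
  filter_upwards [he, hT2.ae_mem two_ne_zero cφ hTm isClosed_Icc hφI] with x hx hxI
  rw [hx, Real.norm_eq_abs]
  exact abs_le.2 hxI

end Coefficients

end MaxwellCylinder

/-! ### Pointwise algebra of the integrands. -/

namespace MaxwellCylinder

/-- The curl in terms of the partial derivatives. -/
noncomputable def rotOf (d : Fin 3 → C3) : C3 := !₂[d 1 2 - d 2 1, d 2 0 - d 0 2, d 0 1 - d 1 0]

section Algebra

open ComplexConjugate

lemma herm_eq (a b : C3) : herm a b = ∑ j, a j * conj (b j) := by
  simp [herm, PiLp.inner_apply]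

variable (a b : Fin 3 → ℝ) (H : Fin 3 → Fin 3 → ℝ) (v f : C3) (dv df : Fin 3 → C3)

/-- Here `a = ∇μ` and `b = ∇q`. Multiplying out the two curls and using `μ (εμ)⁻¹ = ε⁻¹` leaves the
double sum, which is `-⟨[∇μ, v], rot(q f)⟩` in components. -/
lemma herm_rotOf_smul {e m : ℝ} (hm : m ≠ 0) :
    herm (rotOf dv) (m • cross (WithLp.toLp 2 fun j => (b j : ℂ)) f) =
      herm (rotOf fun j => m • dv j + a j • v) (rotOf fun j => (e * m)⁻¹ • df j + b j • f) -
      ((e⁻¹ : ℝ) : ℂ) * herm (rotOf dv) (rotOf df) +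
      ∑ k, ∑ j, (a k • (v j * conj (((e * m)⁻¹ • df j + b j • f) k)) -
        a j • (v k * conj (((e * m)⁻¹ • df j + b j • f) k))) := by
  have hm' : (m : ℂ) ≠ 0 := by exact_mod_cast hm
  have hmm : (m : ℂ) * (m : ℂ)⁻¹ = 1 := mul_inv_cancel₀ hm'
  simp only [herm_eq, rotOf, cross, cross_apply, Fin.sum_univ_three, PiLp.smul_apply, PiLp.add_apply,
    Complex.real_smul, map_add, map_sub, map_mul, map_inv₀, Complex.conj_ofReal, Complex.ofReal_inv, Complex.ofReal_mul,
    mul_inv, Fin.isValue, Matrix.cons_val, Matrix.cons_val_zero, Matrix.cons_val_one]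
  generalize (m : ℂ)⁻¹ = mi at *
  generalize (e : ℂ)⁻¹ = ei at *
  generalize (m : ℂ) = mm at *
  linear_combination (-ei * ((dv 1 2 - dv 2 1) * (conj (df 1 2) - conj (df 2 1)) +
   (dv 2 0 - dv 0 2) * (conj (df 2 0) - conj (df 0 2)) + (dv 0 1 - dv 1 0) * (conj (df 0 1) - conj (df 1 0)))) * hmm

/-- The constraint `μ div v + ⟨∇μ, v⟩ = 0` turns `-∂_kμ div v` into `μ⁻¹ ∂_kμ ∑_j ∂_jμ v_j`, the
source of the `μ⁻²` term of `W₀`. Symmetry of the Hessian matches the order of its indices. -/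
lemma herm_act {e m : ℝ} (hm : m ≠ 0) (hH : ∀ j k, H j k = H k j)
    (hdiv : ∑ j, (m • dv j + a j • v) j = 0) :
    ((e⁻¹ : ℝ) : ℂ) * herm (act (Matrix.of fun j k => (if j = k then m⁻¹ * ∑ i, H i i else 0) +
      m⁻¹ ^ 2 * a j * a k - m⁻¹ * H k j) v) f =
      ∑ k, ∑ j, (H j j • (v k * conj ((e * m)⁻¹ • f k)) - H k j • (v j * conj ((e * m)⁻¹ • f k))
        - a k • (dv j j * conj ((e * m)⁻¹ • f k))) := by
  have hm' : (m : ℂ) ≠ 0 := by exact_mod_cast hm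
  have hmm : (m : ℂ) * (m : ℂ)⁻¹ = 1 := mul_inv_cancel₀ hm'
  simp only [herm_eq, act, Fin.sum_univ_three, PiLp.smul_apply, PiLp.add_apply, Matrix.mulVec, dotProduct,
    Matrix.map_apply, Matrix.of_apply,
    Complex.real_smul, map_mul, map_inv₀, Complex.conj_ofReal, Complex.ofReal_inv, Complex.ofReal_mul,
    Complex.ofReal_add, Complex.ofReal_sub, Complex.ofReal_pow,
    mul_inv, Fin.isValue, Fin.reduceEq, if_true, if_false, Complex.ofReal_zero] at hdiv ⊢
  rw [hH 1 0, hH 2 0, hH 2 1]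
  generalize (m : ℂ)⁻¹ = mi at *
  generalize (e : ℂ)⁻¹ = ei at *
  generalize (m : ℂ) = mm at *
  linear_combination ei * mi ^ 2 * (a 0 * conj (f 0) + a 1 * conj (f 1) + a 2 * conj (f 2)) * hdiv
    - ei * mi * (a 0 * conj (f 0) + a 1 * conj (f 1) + a 2 * conj (f 2)) * (dv 0 0 + dv 1 1 + dv 2 2) * hmm

lemma sum_mul_herm {q : ℝ} : ∑ j, ((q * a j : ℝ) : ℂ) * herm (dv j) f =
    ∑ k, ∑ j, a j • (dv j k * conj (q • f k)) := by
  rw [Finset.sum_comm]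
  refine Finset.sum_congr rfl fun j _ => ?_
  rw [herm_eq, Finset.mul_sum]
  refine Finset.sum_congr rfl fun k _ => ?_
  simp only [Complex.real_smul, map_mul, Complex.conj_ofReal, Complex.ofReal_mul]
  ring

/-- Lagrange's identity `[A, V]·[F, n] = (A·F)(V·n) - (A·n)(V·F)`, with `F` conjugated. -/
lemma herm_cross_cross (A n : Fin 3 → ℝ) (V F : C3) {q : ℝ} :
    (q : ℂ) * herm (cross (WithLp.toLp 2 fun j => (A j : ℂ)) V)
      (cross F (WithLp.toLp 2 fun j => (n j : ℂ))) =
    ∑ k, ∑ j, (n j • A k • (V j * conj (q • F k)) - n j • A j • (V k * conj (q • F k))) := by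
  simp only [herm_eq, cross, cross_apply, Fin.sum_univ_three, Complex.real_smul, map_sub, map_mul,
    Complex.conj_ofReal, Fin.isValue, Matrix.cons_val, Matrix.cons_val_zero, Matrix.cons_val_one]
  ring

end Algebra

end MaxwellCylinder

namespace MaxwellCylinder

/-! ### Traces, divergence and products for fields of low regularity. -/

section Fields

variable {F G : Type} [NormedAddCommGroup F] [NormedSpace ℝ F] [NormedAddCommGroup G]
  [NormedSpace ℝ G] {P : Set E3} {ν : E3 → E3} {c : E3} {ρ D : ℝ}

lemma IsTest.fderiv_apply {φ : E3 → ℝ} (hφ : IsTest P φ) (e : E3) :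
    IsTest P fun x => fderiv ℝ φ x e := by
  refine ⟨(hφ.1.fderiv_right (m := ∞) (by simp)).clm_apply contDiff_const,
    hφ.2.1.fderiv_apply ℝ e, (closure_mono fun x hx => ?_).trans ((tsupport_fderiv_subset ℝ).trans hφ.2.2)⟩
  intro h0
  exact hx (by simp [h0])

lemma fderiv_fderiv_comm {φ : E3 → ℝ} (hφ : ContDiff ℝ ∞ φ) (e e' : E3) (x : E3) :
    fderiv ℝ (fun x => fderiv ℝ φ x e) x e' = fderiv ℝ (fun x => fderiv ℝ φ x e') x e := by
  have hd : DifferentiableAt ℝ (fderiv ℝ φ) x :=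
    (hφ.fderiv_right (m := ∞) (by simp)).differentiable (by simp) x
  have hs : IsSymmSndFDerivAt ℝ φ x := hφ.contDiffAt.isSymmSndFDerivAt
    (by rw [minSmoothness_of_isRCLikeNormedField]; exact WithTop.coe_le_coe.2 le_top)
  have key : ∀ e e' : E3, fderiv ℝ (fun x => fderiv ℝ φ x e) x e' = fderiv ℝ (fderiv ℝ φ) x e' e := by
    intro e e'
    rw [fderiv_clm_apply hd (differentiableAt_const _)]
    simp
  rw [key, key, hs.eq]

/-- Mixed weak derivatives commute. -/
lemma IsWeakPartial.weakPartial_comm [CompleteSpace F] (hP : IsOpen P) {j k : Fin 3}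
    {g gj gk gjk gkj : E3 → F} (hj : IsWeakPartial P j g gj) (hk : IsWeakPartial P k g gk)
    (hjk : IsWeakPartial P k gj gjk) (hkj : IsWeakPartial P j gk gkj) :
    gjk =ᵐ[volume.restrict P] gkj := by
  refine IsWeakPartial.ae_eq hP hjk ⟨hj.2.1, hkj.2.1, fun φ hφ => ?_⟩
  rw [← hkj.2.2 φ hφ]
  have h1 := hj.2.2 _ (hφ.fderiv_apply (unitVec k))
  have h2 := hk.2.2 _ (hφ.fderiv_apply (unitVec j))
  simp_rw [fderiv_fderiv_comm hφ.1 (unitVec k) (unitVec j)] at h1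
  exact neg_injective (h1.symm.trans h2)

lemma SmoothApprox.clm {p : ℝ≥0∞} {g : E3 → F} {d : Fin 3 → E3 → F} {φ : ℕ → E3 → F}
    (h : SmoothApprox P p g d φ) (L : F →L[ℝ] G) :
    SmoothApprox P p (fun x => L (g x)) (fun j x => L (d j x)) (fun n x => L (φ n x)) where
  contDiff n := L.contDiff.comp (h.contDiff n)
  tendsto := h.tendsto.clm L
  tendsto_fderiv j := by
    simp_rw [fun n x => fderiv_clm_comp L ((h.contDiff_one n).differentiable (by simp)) x]
    exact (h.tendsto_fderiv j).clm L

lemma SmoothApprox.add {p : ℝ≥0∞} (hp : 1 ≤ p) {g g' : E3 → F} {d d' : Fin 3 → E3 → F}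
    {φ φ' : ℕ → E3 → F} (h : SmoothApprox P p g d φ) (h' : SmoothApprox P p g' d' φ')
    (mg : MemLpLoc (volume.restrict P) p g) (md : ∀ j, MemLpLoc (volume.restrict P) p (d j))
    (mg' : MemLpLoc (volume.restrict P) p g') (md' : ∀ j, MemLpLoc (volume.restrict P) p (d' j)) :
    SmoothApprox P p (fun x => g x + g' x) (fun j x => d j x + d' j x)
      (fun n x => φ n x + φ' n x) where
  contDiff n := (h.contDiff n).add (h'.contDiff n)
  tendsto := h.tendsto.add hp h'.tendsto
    (fun n => (h.contDiff n).continuous.aestronglyMeasurable) mg.aestronglyMeasurable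
    (fun n => (h'.contDiff n).continuous.aestronglyMeasurable) mg'.aestronglyMeasurable
  tendsto_fderiv j := by
    have e : ∀ n x, fderiv ℝ (fun x => φ n x + φ' n x) x (unitVec j) =
        fderiv ℝ (φ n) x (unitVec j) + fderiv ℝ (φ' n) x (unitVec j) := fun n x => by
      rw [fderiv_fun_add ((h.contDiff_one n).differentiable (by simp) x)
        ((h'.contDiff_one n).differentiable (by simp) x)]
      rfl
    simp_rw [e]
    exact (h.tendsto_fderiv j).add hp (h'.tendsto_fderiv j)
      (fun n => (continuous_fderiv_apply (h.contDiff_one n) _).aestronglyMeasurable)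
      (md j).aestronglyMeasurable
      (fun n => (continuous_fderiv_apply (h'.contDiff_one n) _).aestronglyMeasurable)
      (md' j).aestronglyMeasurable

lemma MemLpLoc.clm {m : Measure E3} {p : ℝ≥0∞} {g : E3 → F} (h : MemLpLoc m p g) (L : F →L[ℝ] G) :
    MemLpLoc m p fun x => L (g x) := fun R => L.comp_memLp' (h R)

/-- A function approximated by smooth functions in `W¹_1` on bounded sets, along with its
boundary values. -/
structure HasApprox (P : Set E3) (g : E3 → F) (d : Fin 3 → E3 → F) (T : E3 → F) : Prop where
  exists_approx : ∃ φ, SmoothApprox P 1 g d φ ∧ TendstoLpLoc (surfaceMeasure P) 1 φ T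
  memLpLoc : MemLpLoc (volume.restrict P) 1 g
  memLpLoc_partial : ∀ j, MemLpLoc (volume.restrict P) 1 (d j)
  memLpLoc_trace : MemLpLoc (surfaceMeasure P) 1 T

lemma HasApprox.trace_ae_eq [CompleteSpace F] (h : IsGaussCylinder P ν c ρ D) {g T : E3 → F}
    {d : Fin 3 → E3 → F} (hg : HasApprox P g d T) : trace P g =ᵐ[surfaceMeasure P] T := by
  obtain ⟨φ, hφ, hT⟩ := hg.exists_approx
  exact hφ.tendsto_trace h le_rfl le_rfl
    (fun j => hφ.isWeakPartial h hg.memLpLoc hg.memLpLoc_partial j) hT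
    hg.memLpLoc_trace.aestronglyMeasurable

lemma HasApprox.clm {g T : E3 → F} {d : Fin 3 → E3 → F} (hg : HasApprox P g d T) (L : F →L[ℝ] G) :
    HasApprox P (fun x => L (g x)) (fun j x => L (d j x)) fun x => L (T x) := by
  obtain ⟨φ, hφ, hT⟩ := hg.exists_approx
  exact ⟨⟨_, hφ.clm L, hT.clm L⟩, hg.memLpLoc.clm L, fun j => (hg.memLpLoc_partial j).clm L,
    hg.memLpLoc_trace.clm L⟩

lemma HasApprox.add {g T g' T' : E3 → F} {d d' : Fin 3 → E3 → F} (hg : HasApprox P g d T)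
    (hg' : HasApprox P g' d' T') : HasApprox P (fun x => g x + g' x) (fun j x => d j x + d' j x)
      fun x => T x + T' x := by
  obtain ⟨φ, hφ, hT⟩ := hg.exists_approx
  obtain ⟨φ', hφ', hT'⟩ := hg'.exists_approx
  exact ⟨⟨_, hφ.add le_rfl hφ' hg.memLpLoc hg.memLpLoc_partial hg'.memLpLoc hg'.memLpLoc_partial,
    hT.add le_rfl hT' (fun n => (hφ.contDiff n).continuous.aestronglyMeasurable)
      hg.memLpLoc_trace.aestronglyMeasurable
      (fun n => (hφ'.contDiff n).continuous.aestronglyMeasurable)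
      hg'.memLpLoc_trace.aestronglyMeasurable⟩,
    hg.memLpLoc.add hg'.memLpLoc, fun j => (hg.memLpLoc_partial j).add (hg'.memLpLoc_partial j),
    hg.memLpLoc_trace.add hg'.memLpLoc_trace⟩

/-- The coordinate embedding `ℝ → ℂ³`. -/
noncomputable def coordEmb (k : Fin 3) : ℝ →L[ℝ] C3 :=
  ContinuousLinearMap.toSpanSingleton ℝ (EuclideanSpace.single k 1)

lemma toLp_eq_coordEmb (r : Fin 3 → ℝ) : (WithLp.toLp 2 fun k => (r k : ℂ) : C3) =
    coordEmb 0 (r 0) + coordEmb 1 (r 1) + coordEmb 2 (r 2) := by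
  ext i
  fin_cases i <;> simp [coordEmb]

/-- The trace of a gradient. -/
theorem IsCoefficient.trace_grad (h : IsGaussCylinder P ν c ρ D) {m : E3 → ℝ} {s t : ℝ}
    (hm : IsCoefficient P m s t) : trace P (grad P m) =ᵐ[surfaceMeasure P]
      fun x => WithLp.toLp 2 fun k => ((trace P (weakPartial P k m) x : ℝ) : ℂ) := by
  have ha : ∀ k, HasApprox P (weakPartial P k m) (fun j => weakPartial P j (weakPartial P k m))
      (trace P (weakPartial P k m)) := fun k =>
    ⟨(hm.multiplier k).exists_approx, (hm.multiplier k).memLpLoc,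
      (hm.multiplier k).memLpLoc_partial, (hm.multiplier k).memLpLoc_trace⟩
  have := (((ha 0).clm (coordEmb 0)).add ((ha 1).clm (coordEmb 1))).add ((ha 2).clm (coordEmb 2))
  have hg : grad P m = fun x => coordEmb 0 (weakPartial P 0 m x) + coordEmb 1 (weakPartial P 1 m x) +
      coordEmb 2 (weakPartial P 2 m x) := funext fun x =>
    toLp_eq_coordEmb fun k => weakPartial P k m x
  rw [hg]
  simp_rw [fun x => toLp_eq_coordEmb fun k => trace P (weakPartial P k m) x]
  exact this.trace_ae_eq h

/-- The divergence of a solenoidal field vanishes pointwise. -/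
theorem DivFree.sum_eq_zero (hP : IsOpen P) {a : E3 → C3} {d : Fin 3 → E3 → C3}
    (ha : DivFree P a) (hd : ∀ j, IsWeakPartial P j a (d j)) :
    ∀ᵐ x ∂(volume.restrict P), ∑ j, d j x j = 0 := by
  let L : Fin 3 → C3 →L[ℝ] ℂ := fun j => (EuclideanSpace.proj j : C3 →L[ℂ] ℂ).restrictScalars ℝ
  have hproj : ∀ {g : E3 → C3} j, LocallyIntegrableOn g P → LocallyIntegrableOn (fun x => g x j) P := by
    intro g j hg x hx
    obtain ⟨s, hs, hi⟩ := hg x hx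
    exact ⟨s, hs, (L j).integrable_comp hi⟩
  have hsum : LocallyIntegrableOn (fun x => ∑ j, d j x j) P := by
    simp_rw [Fin.sum_univ_three]
    exact ((hproj 0 (hd 0).2.1).add (hproj 1 (hd 1).2.1)).add (hproj 2 (hd 2).2.1)
  have key := hP.ae_eq_zero_of_integral_contDiff_smul_eq_zero (μ := volume)
    hsum fun φ hφ hφc hφP => ?_
  · rw [ae_restrict_iff' hP.measurableSet]
    exact key
  · have ht : IsTest P φ := ⟨hφ, hφc, hφP⟩
    have e1 : ∫ x, φ x • ∑ j, d j x j = ∫ x in P, φ x • ∑ j, d j x j := by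
      refine (setIntegral_eq_integral_of_forall_compl_eq_zero fun x hx => ?_).symm
      rw [image_eq_zero_of_notMem_tsupport fun hc => hx (hφP hc), zero_smul]
    have e2 : ∀ {ψ : E3 → ℝ} {g : E3 → C3} j, IsTest P ψ → LocallyIntegrableOn g P →
        ∫ x in P, ψ x • g x j = L j (∫ x in P, ψ x • g x) := fun j hψ hg => by
      rw [← (L j).integral_comp_comm (integrable_test_smul hψ hg)]
      rfl
    have h0 := ha φ ht
    simp_rw [← Complex.real_smul] at h0
    rw [integral_finsetSum _ fun j _ => integrable_test_smul (ht.fderiv_apply (unitVec j))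
      (hproj j (hd j).1)] at h0
    simp_rw [Finset.smul_sum] at e1 ⊢
    rw [e1, integral_finsetSum _ fun j _ => integrable_test_smul ht (hproj j (hd j).2.1),
      ← neg_eq_zero, ← Finset.sum_neg_distrib, ← h0]
    refine Finset.sum_congr rfl fun j _ => ?_
    rw [e2 j ht (hd j).2.1, e2 j (ht.fderiv_apply _) (hd j).1, (hd j).2.2 φ ht, map_neg]

lemma memLp_smul_of_bound {m : Measure E3} {p : ℝ≥0∞} {b : E3 → ℝ} (hbm : AEStronglyMeasurable b m)
    {K : ℝ} (hb : ∀ᵐ x ∂m, ‖b x‖ ≤ K) {g : E3 → F} (hg : MemLp g p m) :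
    MemLp (fun x => b x • g x) p m := by
  refine hg.of_le_mul (c := K) (hbm.smul hg.1) ?_
  filter_upwards [hb] with x hx
  rw [norm_smul]
  gcongr

/-- The derivatives of functions in `H¹` and their approximation. -/
theorem MemH1.exists_approx [FiniteDimensional ℝ F] (h : IsGaussCylinder P ν c ρ D) {u : E3 → F}
    (hu : MemH1 P u) : (∀ j, IsWeakPartial P j u (weakPartial P j u)) ∧
      ∃ φ, H1Approx P u (fun j => weakPartial P j u) (trace P u) φ := by
  have : CompleteSpace F := FiniteDimensional.complete ℝ F
  have hw : ∀ j, IsWeakPartial P j u (weakPartial P j u) := fun j => by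
    obtain ⟨d, hd, -⟩ := hu.2 j
    exact hd.isWeakPartial_weakPartial
  refine ⟨hw, h.exists_h1Approx hw hu.1 fun j => ?_⟩
  obtain ⟨d, hd, hdl⟩ := hu.2 j
  exact MemLp.ae_eq (hd.weakPartial_ae_eq h.isOpen).symm hdl

/-- Products with bounded functions the derivatives of which are uniformly locally in `L₃`. -/
theorem H1Approx.smul [FiniteDimensional ℝ F] (h : IsGaussCylinder P ν c ρ D) {b : E3 → ℝ} {K : ℝ}
    (hb : ∀ᵐ x ∂(volume.restrict P), ‖b x‖ ≤ K) {db : Fin 3 → E3 → ℝ}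
    (wb : ∀ j, IsWeakPartial P j b (db j)) (ub : ∀ j, UniformLp (volume.restrict P) 3 (db j))
    {u T : E3 → F} {d : Fin 3 → E3 → F} {φ : ℕ → E3 → F} (hu : H1Approx P u d T φ)
    (wu : ∀ j, IsWeakPartial P j u (d j)) :
    MemLp (fun x => b x • u x) 2 (volume.restrict P) ∧
      (∀ j, IsWeakPartial P j (fun x => b x • u x) fun x => b x • d j x + db j x • u x) ∧
      ∀ j, MemLp (fun x => b x • d j x + db j x • u x) 2 (volume.restrict P) := by
  have : CompleteSpace F := FiniteDimensional.complete ℝ F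
  have bm : AEStronglyMeasurable b (volume.restrict P) := (wb 0).1.aestronglyMeasurable
  have dbm : ∀ j, AEStronglyMeasurable (db j) (volume.restrict P) := fun j =>
    (wb j).2.1.aestronglyMeasurable
  refine ⟨memLp_smul_of_bound bm hb hu.memLp, fun j => ?_, fun j => ?_⟩
  · exact h.isWeakPartial_bilin (ContinuousLinearMap.lsmul ℝ ℝ) wb wu (memLpLoc_of_bound bm hb)
      (fun j => ((ub j).memLpLoc (dbm j)).mono_exponent (by norm_num)) (memLpLoc_of_memLp hu.memLp)
      (fun j => memLpLoc_of_memLp (hu.memLp_partial j)) j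
  · exact (memLp_smul_of_bound bm hb (hu.memLp_partial j)).add
      ((h.weightedBound_of_uniform (dbm j) (ub j)).tendsto (dbm j) hu
        (tendstoLpLoc_of_tendsto hu.tendsto) hu.memLp.1).1

/-- The trace of a product. -/
theorem SmoothApprox.trace_smul [CompleteSpace F] (h : IsGaussCylinder P ν c ρ D) {b Tb : E3 → ℝ}
    {db : Fin 3 → E3 → ℝ} {γ : ℕ → E3 → ℝ} (hb : SmoothApprox P 2 b db γ)
    (hγ : TendstoLpLoc (surfaceMeasure P) 2 γ Tb) (mb : MemLpLoc (volume.restrict P) 2 b)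
    (mdb : ∀ j, MemLpLoc (volume.restrict P) 2 (db j)) (mT : MemLpLoc (surfaceMeasure P) 2 Tb)
    {u T : E3 → F} {d : Fin 3 → E3 → F} {φ : ℕ → E3 → F} (hu : H1Approx P u d T φ) :
    trace P (fun x => b x • u x) =ᵐ[surfaceMeasure P] fun x => Tb x • T x := by
  have hfc := h.isFiniteMeasureOnCompacts
  have mu := memLpLoc_of_memLp hu.memLp
  have mdu := fun j => memLpLoc_of_memLp (hu.memLp_partial j)
  have mTu : MemLpLoc (surfaceMeasure P) 2 T := hu.tendsto_trace.memLpLoc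
    (fun n => memLpLoc_of_continuous (hu.contDiff n).continuous) hu.aestronglyMeasurable_trace
  refine HasApprox.trace_ae_eq h ⟨⟨_, hb.bilin (ContinuousLinearMap.lsmul ℝ ℝ) hu.smoothApprox mb mdb
    mu mdu, hγ.bilin (ContinuousLinearMap.lsmul ℝ ℝ) le_rfl hu.tendsto_trace
      (fun n => (hb.contDiff n).continuous.aestronglyMeasurable) mT
      (fun n => (hu.contDiff n).continuous.aestronglyMeasurable) mTu⟩,
    mb.bilin (ContinuousLinearMap.lsmul ℝ ℝ) mu,
    fun j => mb.bilin_partial (ContinuousLinearMap.lsmul ℝ ℝ) mdb mu mdu j,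
    mT.bilin (ContinuousLinearMap.lsmul ℝ ℝ) mTu⟩

end Fields

end MaxwellCylinder

namespace MaxwellCylinder

/-! ### The integral identity. -/

section Identity

open ComplexConjugate

variable {P : Set E3} {c : E3} {ρ D : ℝ} {m : Measure E3}

lemma memLp_apply {p : ℝ≥0∞} {g : E3 → C3} (hg : MemLp g p m) (i : Fin 3) :
    MemLp (fun x => g x i) p m :=
  (EuclideanSpace.proj i : C3 →L[ℂ] ℂ).comp_memLp' hg

lemma memLp_rotOf_apply {p : ℝ≥0∞} {d : Fin 3 → E3 → C3} (hd : ∀ j, MemLp (d j) p m) (i : Fin 3) :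
    MemLp (fun x => rotOf (fun j => d j x) i) p m := by
  fin_cases i
  · exact (memLp_apply (hd 1) 2).sub (memLp_apply (hd 2) 1)
  · exact (memLp_apply (hd 2) 0).sub (memLp_apply (hd 0) 2)
  · exact (memLp_apply (hd 0) 1).sub (memLp_apply (hd 1) 0)

lemma rot_eq (a : E3 → C3) (x : E3) : rot P a x = rotOf fun j => weakPartial P j a x := rfl

lemma integrable_herm_rot {a b : E3 → C3} (ha : ∀ j, MemLp (weakPartial P j a) 2 m)
    (hb : ∀ j, MemLp (weakPartial P j b) 2 m) :
    Integrable (fun x => herm (rot P a x) (rot P b x)) m := by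
  simp_rw [herm_eq, rot_eq]
  exact integrable_finsetSum _ fun i _ =>
    (memLp_rotOf_apply ha i).integrable_mul (memLp_rotOf_apply hb i).star

lemma integrable_ofReal_mul {b : E3 → ℝ} (hbm : AEStronglyMeasurable b m) {K : ℝ}
    (hb : ∀ᵐ x ∂m, ‖b x‖ ≤ K) {g : E3 → ℂ} (hg : Integrable g m) :
    Integrable (fun x => (b x : ℂ) * g x) m := by
  refine hg.bdd_mul (c := K) (Complex.continuous_ofReal.comp_aestronglyMeasurable hbm) ?_
  filter_upwards [hb] with x hx
  rwa [Complex.norm_real]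

/-- The Gauss-Green formula for products of a derivative of a coefficient with components of
two fields. -/
lemma IsCoefficient.integral_eq (h : IsGaussCylinder P (outerNormal P) c ρ D) {μ : E3 → ℝ} {s t : ℝ}
    (hμ : IsCoefficient P μ s t) {u w Tu Tw : E3 → C3} {du dw : Fin 3 → E3 → C3}
    {φ γ : ℕ → E3 → C3} (hu : H1Approx P u du Tu φ) (hw : H1Approx P w dw Tw γ) (k l i j : Fin 3) :
    Integrable (fun x => weakPartial P k μ x • (du j x l * conj (w x i))) (volume.restrict P) ∧
    Integrable (fun x => weakPartial P k μ x • (u x l * conj (dw j x i))) (volume.restrict P) ∧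
    Integrable (fun x => weakPartial P j (weakPartial P k μ) x • (u x l * conj (w x i)))
      (volume.restrict P) ∧
    Integrable (fun x => outerNormal P x j • trace P (weakPartial P k μ) x •
      (Tu x l * conj (Tw x i))) (surfaceMeasure P) ∧
    (∫ x in P, weakPartial P k μ x • (du j x l * conj (w x i))) +
      (∫ x in P, weakPartial P k μ x • (u x l * conj (dw j x i))) +
      (∫ x in P, weakPartial P j (weakPartial P k μ) x • (u x l * conj (w x i))) =
      ∫ x, outerNormal P x j • trace P (weakPartial P k μ) x • (Tu x l * conj (Tw x i))
        ∂surfaceMeasure P :=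
  (hμ.multiplier k).integral_eq h
    (hu.clm ((EuclideanSpace.proj l : C3 →L[ℂ] ℂ).restrictScalars ℝ))
    (hw.clm ((Complex.conjCLE : ℂ →L[ℝ] ℂ).comp
      ((EuclideanSpace.proj i : C3 →L[ℂ] ℂ).restrictScalars ℝ))) j

/-- Summation of the Gauss-Green formulas. -/
lemma integral_identity_of_sums {m σ : Measure E3} {I₀ I₁ I₂ I₃ I₄ I₅ : E3 → ℂ}
    {p1 p2 p3 r1 r2 r3 pB rB : Fin 3 → Fin 3 → E3 → ℂ} (i0 : Integrable I₀ m) (i1 : Integrable I₁ m)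
    (kp : ∀ k j, Integrable (p1 k j) m ∧ Integrable (p2 k j) m ∧ Integrable (p3 k j) m ∧
      Integrable (pB k j) σ ∧ (∫ x, p1 k j x ∂m) + (∫ x, p2 k j x ∂m) + (∫ x, p3 k j x ∂m) =
        ∫ x, pB k j x ∂σ)
    (kr : ∀ k j, Integrable (r1 k j) m ∧ Integrable (r2 k j) m ∧ Integrable (r3 k j) m ∧
      Integrable (rB k j) σ ∧ (∫ x, r1 k j x ∂m) + (∫ x, r2 k j x ∂m) + (∫ x, r3 k j x ∂m) =
        ∫ x, rB k j x ∂σ)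
    (e2 : I₂ =ᵐ[m] fun x => I₁ x - I₀ x + ∑ k, ∑ j, (p2 k j x - r2 k j x))
    (e3 : I₃ =ᵐ[m] fun x => ∑ k, ∑ j, (r3 k j x - p3 k j x - p1 k j x))
    (e4 : I₄ = fun x => ∑ k, ∑ j, r1 k j x)
    (e5 : I₅ =ᵐ[σ] fun x => ∑ k, ∑ j, (pB k j x - rB k j x)) :
    (Integrable I₀ m ∧ Integrable I₁ m ∧ Integrable I₂ m ∧ Integrable I₃ m ∧ Integrable I₄ m ∧
      Integrable I₅ σ) ∧
    ∫ x, I₀ x ∂m = (∫ x, I₁ x ∂m) - (∫ x, I₂ x ∂m) + (∫ x, I₃ x ∂m) + (∫ x, I₄ x ∂m) +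
      ∫ x, I₅ x ∂σ := by
  have i10 : Integrable (fun x => I₁ x - I₀ x) m := i1.sub i0
  have i2' : ∀ k j, Integrable (fun x => p2 k j x - r2 k j x) m := fun k j =>
    (kp k j).2.1.sub (kr k j).2.1
  have i22 : Integrable (fun x => ∑ k, ∑ j, (p2 k j x - r2 k j x)) m :=
    integrable_finsetSum _ fun k _ => integrable_finsetSum _ fun j _ => i2' k j
  have i3' : ∀ k j, Integrable (fun x => r3 k j x - p3 k j x - p1 k j x) m := fun k j => ((kr k j).2.2.1.sub (kp k j).2.2.1).sub (kp k j).1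
  have i5' : ∀ k j, Integrable (fun x => pB k j x - rB k j x) σ := fun k j => (kp k j).2.2.2.1.sub (kr k j).2.2.2.1
  have i2 : Integrable I₂ m := (i10.add i22).congr e2.symm
  have i3 : Integrable I₃ m := (integrable_finsetSum _ fun k _ => integrable_finsetSum _ fun j _ =>
    i3' k j).congr e3.symm
  have i4 : Integrable I₄ m := by
    rw [e4]
    exact integrable_finsetSum _ fun k _ => integrable_finsetSum _ fun j _ => (kr k j).1
  have i5 : Integrable I₅ σ := (integrable_finsetSum _ fun k _ =>
    integrable_finsetSum _ fun j _ => i5' k j).congr e5.symm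
  refine ⟨⟨i0, i1, i2, i3, i4, i5⟩, ?_⟩
  have s2 : ∫ x, I₂ x ∂m = (∫ x, I₁ x ∂m) - (∫ x, I₀ x ∂m) +
      ∑ k, ∑ j, ((∫ x, p2 k j x ∂m) - ∫ x, r2 k j x ∂m) := by
    rw [integral_congr_ae e2, integral_add i10 i22, integral_sub i1 i0,
      integral_finsetSum _ fun k _ => integrable_finsetSum _ fun j _ => i2' k j]
    congr 1
    refine Finset.sum_congr rfl fun k _ => ?_
    rw [integral_finsetSum _ fun j _ => i2' k j]
    exact Finset.sum_congr rfl fun j _ => integral_sub (kp k j).2.1 (kr k j).2.1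
  have s3 : ∫ x, I₃ x ∂m = ∑ k, ∑ j, ((∫ x, r3 k j x ∂m) - (∫ x, p3 k j x ∂m) -
      ∫ x, p1 k j x ∂m) := by
    rw [integral_congr_ae e3, integral_finsetSum _ fun k _ => integrable_finsetSum _ fun j _ => i3' k j]
    refine Finset.sum_congr rfl fun k _ => ?_
    rw [integral_finsetSum _ fun j _ => i3' k j]
    refine Finset.sum_congr rfl fun j _ => ?_
    rw [← integral_sub (kr k j).2.2.1 (kp k j).2.2.1]
    exact integral_sub ((kr k j).2.2.1.sub (kp k j).2.2.1) (kp k j).1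
  have s4 : ∫ x, I₄ x ∂m = ∑ k, ∑ j, ∫ x, r1 k j x ∂m := by
    rw [e4, integral_finsetSum _ fun k _ => integrable_finsetSum _ fun j _ => (kr k j).1]
    exact Finset.sum_congr rfl fun k _ => integral_finsetSum _ fun j _ => (kr k j).1
  have s5 : ∫ x, I₅ x ∂σ = ∑ k, ∑ j,
      ((∫ x, pB k j x ∂σ) - ∫ x, rB k j x ∂σ) := by
    rw [integral_congr_ae e5, integral_finsetSum _ fun k _ => integrable_finsetSum _ fun j _ => i5' k j]
    refine Finset.sum_congr rfl fun k _ => ?_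
    rw [integral_finsetSum _ fun j _ => i5' k j]
    exact Finset.sum_congr rfl fun j _ => integral_sub (kp k j).2.2.2.1 (kr k j).2.2.2.1
  have total : ∑ k, ∑ j, ((∫ x, r3 k j x ∂m) - (∫ x, p3 k j x ∂m) - ∫ x, p1 k j x ∂m) +
      ∑ k, ∑ j, (∫ x, r1 k j x ∂m) + ∑ k, ∑ j,
      ((∫ x, pB k j x ∂σ) - ∫ x, rB k j x ∂σ) =
      ∑ k, ∑ j, ((∫ x, p2 k j x ∂m) - ∫ x, r2 k j x ∂m) := by
    simp_rw [← Finset.sum_add_distrib]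
    refine Finset.sum_congr rfl fun k _ => Finset.sum_congr rfl fun j _ => ?_
    rw [← (kp k j).2.2.2.2, ← (kr k j).2.2.2.2]
    ring
  rw [s2, s3, s4, s5]
  linear_combination -total

/-- The gradients of `μ` and `q` are uniformly locally in `L₃` and so multiply `H¹` into `L₂`; hence
`μ v` and `q f` have weak derivatives in `L₂`, which settles `I₀` and `I₁`. The other integrands are
sums of terms of Gauss-Green formulas for `∂μ`, `v` and `q f`. -/
theorem IsGaussCylinder.integral_rot_eq (h : IsGaussCylinder P (outerNormal P) c ρ D)
    {ε μ : E3 → ℝ} {s t s' t' : ℝ} (hε : IsCoefficient P ε s t) (hst : s ≤ t)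
    (hμ : IsCoefficient P μ s' t') (hst' : s' ≤ t') {v f : E3 → C3} (hv : MemH1 P v)
    (hf : MemH1 P f) (hdiv : DivFree P fun x => μ x • v x) :
    let ν : E3 → C3 := fun x => toC3 (outerNormal P x)
    let q : E3 → ℝ := fun x => (ε x * μ x)⁻¹
    let I₀ : E3 → ℂ := fun x => ((ε x)⁻¹ : ℝ) * herm (rot P v x) (rot P f x)
    let I₁ : E3 → ℂ := fun x =>
      herm (rot P (fun y => μ y • v y) x) (rot P (fun y => q y • f y) x)
    let I₂ : E3 → ℂ := fun x => herm (rot P v x) (μ x • cross (grad P q x) (f x))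
    let I₃ : E3 → ℂ := fun x => ((ε x)⁻¹ : ℝ) * herm (act (W0 P μ x) (v x)) (f x)
    let I₄ : E3 → ℂ := fun x =>
      ∑ j, ((q x * weakPartial P j μ x : ℝ) : ℂ) * herm (weakPartial P j v x) (f x)
    let I₅ : E3 → ℂ := fun x =>
      ((trace P q x : ℝ) : ℂ) *
        herm (cross (trace P (grad P μ) x) (trace P v x)) (cross (trace P f x) (ν x))
    (IntegrableOn I₀ P ∧ IntegrableOn I₁ P ∧ IntegrableOn I₂ P ∧ IntegrableOn I₃ P ∧
      IntegrableOn I₄ P ∧ Integrable I₅ (surfaceMeasure P)) ∧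
    ∫ x in P, I₀ x = (∫ x in P, I₁ x) - (∫ x in P, I₂ x) + (∫ x in P, I₃ x)
      + (∫ x in P, I₄ x) + ∫ x, I₅ x ∂(surfaceMeasure P) := by
  intro ν q I₀ I₁ I₂ I₃ I₄ I₅
  have hfc := h.isFiniteMeasureOnCompacts
  have hPo := h.isOpen
  obtain ⟨wv, φ, hφ⟩ := MemH1.exists_approx h hv
  obtain ⟨wf, γ, hγ⟩ := MemH1.exists_approx h hf
  obtain ⟨wq, uq, ⟨ψ, hψ, hψT⟩, bTq, mTq⟩ := h.inv_mul hε hst hμ hst'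
  have bε : ∀ᵐ x ∂(volume.restrict P), ‖(ε x)⁻¹‖ ≤ s⁻¹ := by
    filter_upwards [hε.mem_Icc] with x hx
    exact norm_inv_le_of_mem_Icc hε.pos hx
  have bq : ∀ᵐ x ∂(volume.restrict P), ‖q x‖ ≤ s⁻¹ * s'⁻¹ := by
    filter_upwards [bε, hμ.mem_Icc] with x hx hy
    simp only [q]
    rw [mul_inv, norm_mul]
    exact mul_le_mul hx (norm_inv_le_of_mem_Icc hμ.pos hy) (norm_nonneg _)
      ((norm_nonneg _).trans hx)
  have mq : AEStronglyMeasurable q (volume.restrict P) := (wq 0).1.aestronglyMeasurable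
  have lq := memLpLoc_of_bound (p := 2) mq bq
  have ldq : ∀ j, MemLpLoc (volume.restrict P) 2 (weakPartial P j q) := fun j =>
    ((uq j).memLpLoc (wq j).2.1.aestronglyMeasurable).mono_exponent (by norm_num)
  obtain ⟨mg, wg, mdg⟩ := hγ.smul h bq wq uq wf
  obtain ⟨η, hη⟩ := h.exists_h1Approx wg mg mdg
  have tg := hψ.trace_smul h hψT lq ldq (memLpLoc_of_bound mTq bTq) hγ
  obtain ⟨-, wμv, mdμv⟩ := hφ.smul h (hμ.mem_Icc.mono fun x hx => norm_le_of_mem_Icc hx)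
    hμ.isWeakPartial hμ.uniformLp wv
  have hdiv0 := DivFree.sum_eq_zero hPo hdiv wμv
  have eμ := fun j => (wμv j).weakPartial_ae_eq hPo
  have eg := fun j => (wg j).weakPartial_ae_eq hPo
  have hH : ∀ᵐ x ∂(volume.restrict P), ∀ j k, weakPartial P k (weakPartial P j μ) x =
      weakPartial P j (weakPartial P k μ) x := by
    refine ae_all_iff.2 fun j => ae_all_iff.2 fun k => ?_
    exact IsWeakPartial.weakPartial_comm hPo (hμ.isWeakPartial j) (hμ.isWeakPartial k)
      (hμ.isWeakPartial_two j k) (hμ.isWeakPartial_two k j)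
  have key := hμ.integral_eq h hφ hη
  have i0 : IntegrableOn I₀ P := integrable_ofReal_mul
    hε.aestronglyMeasurable.aemeasurable.inv.aestronglyMeasurable bε
    (integrable_herm_rot hφ.memLp_partial hγ.memLp_partial)
  have m1 : ∀ j, MemLp (weakPartial P j fun y => μ y • v y) 2 (volume.restrict P) := fun j =>
    (mdμv j).ae_eq (eμ j).symm
  have m2 : ∀ j, MemLp (weakPartial P j fun y => q y • f y) 2 (volume.restrict P) := fun j =>
    (mdg j).ae_eq (eg j).symm
  have i1 : IntegrableOn I₁ P := integrable_herm_rot m1 m2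
  -- The `p` terms are the Gauss-Green formula in direction `j` for `∂_kμ v_j` times the conjugate
  -- of `(q f)_k`, the `r` terms the one for `∂_jμ v_k` times the same factor. Summed, `p2 - r2` is
  -- `-⟨[∇μ, v], rot(q f)⟩`, `r3 - p3 - p1` is `I₃`, `r1` is `I₄` and `pB - rB` is `I₅`.
  refine integral_identity_of_sums
    (p1 := fun k j x => weakPartial P k μ x • (weakPartial P j v x j * conj ((q x • f x) k)))
    (p2 := fun k j x => weakPartial P k μ x •
      (v x j * conj ((q x • weakPartial P j f x + weakPartial P j q x • f x) k)))
    (p3 := fun k j x => weakPartial P j (weakPartial P k μ) x • (v x j * conj ((q x • f x) k)))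
    (r1 := fun k j x => weakPartial P j μ x • (weakPartial P j v x k * conj ((q x • f x) k)))
    (r2 := fun k j x => weakPartial P j μ x •
      (v x k * conj ((q x • weakPartial P j f x + weakPartial P j q x • f x) k)))
    (r3 := fun k j x => weakPartial P j (weakPartial P j μ) x • (v x k * conj ((q x • f x) k)))
    (pB := fun k j x => outerNormal P x j • trace P (weakPartial P k μ) x •
      (trace P v x j * conj (trace P (fun x => q x • f x) x k)))
    (rB := fun k j x => outerNormal P x j • trace P (weakPartial P j μ) x •
      (trace P v x k * conj (trace P (fun x => q x • f x) x k)))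
    i0 i1 (fun k j => key k j k j) (fun k j => key j k k j) ?_ ?_ ?_ ?_
  · filter_upwards [ae_all_iff.2 eμ, ae_all_iff.2 eg, hμ.mem_Icc] with x h1 h2 h3
    have h1' : rot P (fun y => μ y • v y) x =
        rotOf fun j => μ x • weakPartial P j v x + weakPartial P j μ x • v x := by
      simp_rw [← h1]; rfl
    have h2' : rot P (fun y => q y • f y) x =
        rotOf fun j => (ε x * μ x)⁻¹ • weakPartial P j f x + weakPartial P j q x • f x := by
      have h4 : ∀ j, weakPartial P j (fun y => q y • f y) x =
        (ε x * μ x)⁻¹ • weakPartial P j f x + weakPartial P j q x • f x := h2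
      simp_rw [← h4]; rfl
    have h5 := herm_rotOf_smul (fun j => weakPartial P j μ x) (fun j => weakPartial P j q x) (v x) (f x)
      (fun j => weakPartial P j v x) (fun j => weakPartial P j f x) (e := ε x)
      (hμ.pos.trans_le h3.1).ne'
    rw [← h1', ← h2'] at h5
    exact h5
  · filter_upwards [hdiv0, hH, hμ.mem_Icc] with x h1 h2 h3
    exact herm_act _ (fun k j => weakPartial P j (weakPartial P k μ) x) _ _ _
      (hμ.pos.trans_le h3.1).ne' h2 h1
  · exact funext fun x => sum_mul_herm _ _ _
  · filter_upwards [tg, hμ.trace_grad h] with x h1 h2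
    have h5 := herm_cross_cross (fun k => trace P (weakPartial P k μ) x) (outerNormal P x) (trace P v x)
      (trace P f x) (q := trace P q x)
    rw [← h2] at h5
    have h1' : ∀ k, trace P (fun x => q x • f x) x k = trace P q x • trace P f x k := fun k => by
      rw [h1]; rfl
    simp_rw [← h1'] at h5
    exact h5

end Identity

end MaxwellCylinder

theorem theoremt31
    (U : Set E2) (hUo : IsOpen U) (hUb : Bornology.IsBounded U) (hUc : Convex ℝ U)
    (hU2 : HasPiecewiseC2Boundary U)
    (ε μ : E3 → ℝ) (ε₀ ε₁ μ₀ μ₁ : ℝ) (hε₀ : 0 < ε₀) (hμ₀ : 0 < μ₀)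
    (hε : ∀ᵐ x ∂(volume.restrict (straightCylinder U)), ε₀ ≤ ε x ∧ ε x ≤ ε₁)
    (hμ : ∀ᵐ x ∂(volume.restrict (straightCylinder U)), μ₀ ≤ μ x ∧ μ x ≤ μ₁)
    (hεW : MemPeriodicSobolev (straightCylinder U) (3 / 2) 2 ε)
    (hμW : MemPeriodicSobolev (straightCylinder U) (3 / 2) 2 μ)
    (v f : E3 → C3) (hv : MemH1 (straightCylinder U) v) (hf : MemH1 (straightCylinder U) f)
    (hdiv : DivFree (straightCylinder U) (fun x => μ x • v x)) :
    let P : Set E3 := straightCylinder U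
    let ν : E3 → C3 := fun x => toC3 (outerNormal P x)
    -- the function `(εμ)⁻¹`
    let q : E3 → ℝ := fun x => (ε x * μ x)⁻¹
    -- the integrands, in the order of the identity
    let I₀ : E3 → ℂ := fun x => ((ε x)⁻¹ : ℝ) * herm (rot P v x) (rot P f x)
    let I₁ : E3 → ℂ := fun x =>
      herm (rot P (fun y => μ y • v y) x) (rot P (fun y => q y • f y) x)
    let I₂ : E3 → ℂ := fun x => herm (rot P v x) (μ x • cross (grad P q x) (f x))
    let I₃ : E3 → ℂ := fun x => ((ε x)⁻¹ : ℝ) * herm (act (W0 P μ x) (v x)) (f x)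
    let I₄ : E3 → ℂ := fun x =>
      ∑ j, ((q x * weakPartial P j μ x : ℝ) : ℂ) * herm (weakPartial P j v x) (f x)
    let I₅ : E3 → ℂ := fun x =>
      ((trace P q x : ℝ) : ℂ) *
        herm (cross (trace P (grad P μ) x) (trace P v x)) (cross (trace P f x) (ν x))
    -- all integrals converge absolutely, and the identity holds
    (IntegrableOn I₀ P ∧ IntegrableOn I₁ P ∧ IntegrableOn I₂ P ∧ IntegrableOn I₃ P ∧
      IntegrableOn I₄ P ∧ Integrable I₅ (surfaceMeasure P)) ∧
    ∫ x in P, I₀ x = (∫ x in P, I₁ x) - (∫ x in P, I₂ x) + (∫ x in P, I₃ x)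
      + (∫ x in P, I₄ x) + ∫ x, I₅ x ∂(surfaceMeasure P) := by
  obtain ⟨L, γ, S, hcurve⟩ := hU2.exists_curve
  obtain ⟨c, ρ, D, h⟩ := hcurve.isGaussCylinder hUo hUc hUb
  -- With the maximum as upper end the interval is nonempty by construction, whatever the order of
  -- `ε₀` and `ε₁`.
  have hεc := h.isCoefficient (t := max ε₀ ε₁) hε₀
    (hε.mono fun x hx => ⟨hx.1, hx.2.trans (le_max_right _ _)⟩) hεW
  have hμc := h.isCoefficient (t := max μ₀ μ₁) hμ₀
    (hμ.mono fun x hx => ⟨hx.1, hx.2.trans (le_max_right _ _)⟩) hμW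
  exact h.integral_rot_eq hεc (le_max_left _ _) hμc (le_max_left _ _) hv hf hdiv
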